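/- **Setting.** Let $K\ge 2$, $d\ge 1$, $\mathcal G\in\{\mathcal O(d),\mathcal{SO}(d)\}$ and $n=Km$. Let $\mathcal H$ be the set of matrices $\bm H\in\{0,1\}^{n\times K}$ with row sums $1$ and column sums $m$. Let $\mathcal F$, respectively $\mathcal E$, be the set of $n\times K$ block matrices $\bm V$ with $d\times d$ blocks $\bm V_{ij}=\bm H_{ij}\bm R_i$, where $\bm H\in\mathcal H$ and all $\bm R_i\in\mathcal O(d)$, respectively all $\bm R_i\in\mathcal G$. Let $\mathcal P_K(\mathcal G)$ be the group of matrices $\mathrm{bdiag}(\bm U_1,\dots,\bm U_K)(\bm P\otimes\bm I_d)$ with $\bm U_k\in\mathcal G$ and $\bm P$ a $K\times K$ permutation matrix. Let $\mu(\bm X)_{ij}=\|\bm X_{ij}\|_*$ be the blockwise nuclear norm. Fix a ground truth $\bm V^*\in\mathcal E$ with blocks $\bm R_i^*$ and clustering function $C^*:[n]\to[K]$, and put $\epsilon_{\mathcal G}(\bm V)=\min_{\bm Q\in\mathcal P_K(\mathcal G)}\|\bm V-\bm V^*\bm Q\|_F$; $\epsilon_{\mathcal O(d)}$ is the same with $\mathcal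 O(d)$ in place of $\mathcal G$. The model $\mathrm{SGBM}(n,p,q,K,d,\mathcal G)$ generates the symmetric $n\times n$ block matrix $\bm A$ with $\bm A_{ii}=\bm I_d$ and, for $i<j$, $\bm A_{ji}=\bm A_{ij}^\top$ and $$\bm A_{ij}=w_{ij}\bm R_i^*\bm R_j^{*\top}\ \text{ if } C^*(i)=C^*(j),\qquad \bm A_{ij}=u_{ij}\bm R_{ij}\ \text{ if } C^*(i)\ne C^*(j),$$ with all $w_{ij}\sim\mathrm{Bern}(p)$, $u_{ij}\sim\mathrm{Bern}(q)$ and $\bm R_{ij}\sim\mathrm{Unif}(\mathcal G)$ (Haar) independent. The generalized power method (GPM), on input $\bm A$, $\bm V^0\in\mathcal F$ and $T$, computes $\bm V^{t+1}\in\arg\min_{\bm W\in\mathcal F}\|\bm W-\bm A\bm V^t\|_F$ for $t<T$, with ties broken arbitrarily. If $\mathcal G=\mathcal{SO}(d)$ it finally rounds $\bm V^T$ blockwise to $\mathcal E$: each block $\bm X$ is replaced by $\det(\bm X)\bm X$ if $d$ is odd, and by $\bm X$ with its last column multiplied by $\det(\bm X)$ if $d$ is even. Time is the number of steps of a real random access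 machine: unit cost for arithmetic, comparisons and memory access, cost $k^3$ for the projection of a matrix of fixed size $k\times k$ onto $\mathcal O(k)$, and $\bm A$ given as the list of its nonzero blocks. **Theorem.** There is a program, depending only on $K$, $d$ and $\mathcal G$, that implements GPM (on every block matrix $\bm A$, every $\bm V^0\in\mathcal F$ and every $T$ it halts with an output of GPM), such that the following holds. For all $0<a\le b$ there are constants $\gamma,C_1,C_2>0$ and $N$ such that for all $\alpha,\beta,\chi\in[a,b]$, all $n=Km\ge N$ and every ground truth $\bm V^*\in\mathcal E$, if $\bm A$ is generated by $\mathrm{SGBM}(n,p,q,K,d,\mathcal G)$ with $p=\frac{\alpha\log n}{n}$ and $q=\frac{\beta\log n}{n}$, then with probability at least $1-n^{-\gamma}$ the matrix $\bm A$ has the following property. Suppose that (i) $\mu(\bm A\bm V^*)_{iC^*(i)}-\mu(\bm A\bm V^*)_{ij}\ge\chi mp>0$ for all $i$ and all $j\ne C^*(i)$; (ii) $\mu(\bm A\bm V^*)_{iC^*(i)}\ge\frac{\sqrt{2K\beta}}{\alpha}mp$ for all $i$. Then for every $\bm V^0\in\mathcal F$ that satisfies (iii) $\epsilon_{\mathcal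 O(d)}(\bm V^0)\le\frac{\sqrt m}{\rho}$ for some $\rho>2\sqrt2\sqrt{\frac{d^2}{\chi^2}+\frac{\alpha^2}{2K\beta}}$, and every $0<\tau\le\sqrt n$, with $T=\lceil C_1\log\frac n\tau\rceil$: every output $\bm V^T$ of GPM on $\bm A,\bm V^0,T$ lies in $\mathcal E$ and satisfies $\epsilon_{\mathcal G}(\bm V^T)\le\tau$, and the program takes at most $C_2\,n\log n\,\log\frac n\tau$ steps. -/

import Mathlib

open MeasureTheory

noncomputable section

namespace SGBM

/-! ### Matrices, the groups `O(d)` and `SO(d)`, and projections -/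

/-- Real matrices of `r × c` blocks of size `d × d`. -/
abbrev BlockMatrix (r c d : ℕ) : Type := Matrix (Fin r × Fin d) (Fin c × Fin d) ℝ

/-- The `(i, j)`-th `d × d` block. -/
def block {r c d : ℕ} (X : BlockMatrix r c d) (i : Fin r) (j : Fin c) :
    Matrix (Fin d) (Fin d) ℝ :=
  Matrix.of fun a b => X (i, a) (j, b)

/-- The Frobenius norm. -/
def frob {ι κ : Type*} [Fintype ι] [Fintype κ] (X : Matrix ι κ ℝ) : ℝ :=
  Real.sqrt (∑ i, ∑ j, X i j ^ 2)

/-- The nuclear norm of a square matrix: the sum of its singular values. -/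
def nuclearNorm {d : ℕ} (X : Matrix (Fin d) (Fin d) ℝ) : ℝ :=
  ∑ k ∈ Finset.range d, (Matrix.toEuclideanLin X).singularValues k

/-- The blockwise nuclear norm `μ`. -/
def blockNuclear {r c d : ℕ} (X : BlockMatrix r c d) : Matrix (Fin r) (Fin c) ℝ :=
  Matrix.of fun i j => nuclearNorm (block X i j)

/-- `W` is a nearest point to `X` in `S` for the Frobenius distance. -/
def IsNearest {ι κ : Type*} [Fintype ι] [Fintype κ] (S : Set (Matrix ι κ ℝ))
    (X W : Matrix ι κ ℝ) : Prop :=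
  W ∈ S ∧ ∀ W' ∈ S, frob (W - X) ≤ frob (W' - X)

/-- The two groups `O(d)` and `SO(d)`. -/
inductive GroupKind
  | orthogonal
  | rotation

/-- `O(d)`, or `SO(d)` as the subgroup of `O(d)` of the matrices of determinant one. -/
def GroupKind.subgroup (G : GroupKind) (d : ℕ) :
    Subgroup (Matrix.orthogonalGroup (Fin d) ℝ) :=
  match G with
  | .orthogonal => ⊤
  | .rotation =>
    { carrier := {Q | (Q : Matrix (Fin d) (Fin d) ℝ).det = 1}
      mul_mem' := by
        intro x y hx hy
        simp only [Set.mem_ofPred_eq] at hx hy ⊢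
        simp [hx, hy]
      one_mem' := by simp
      inv_mem' := by
        intro x hx
        simp only [Set.mem_ofPred_eq] at hx ⊢
        have h : ((x⁻¹ : Matrix.orthogonalGroup (Fin d) ℝ) :
            Matrix (Fin d) (Fin d) ℝ) = (x : Matrix (Fin d) (Fin d) ℝ).transpose := rfl
        rw [h, Matrix.det_transpose, hx] }

/-- The group as a set of matrices. -/
def GroupKind.carrier (G : GroupKind) (d : ℕ) : Set (Matrix (Fin d) (Fin d) ℝ) :=
  {Q | ∃ g : G.subgroup d, Q = ((g : Matrix.orthogonalGroup (Fin d) ℝ) : Matrix _ _ ℝ)}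

theorem isCompact_orthogonal (d : ℕ) :
    IsCompact (Matrix.orthogonalGroup (Fin d) ℝ : Set (Matrix (Fin d) (Fin d) ℝ)) := by
  have hsub : (Matrix.orthogonalGroup (Fin d) ℝ : Set (Matrix (Fin d) (Fin d) ℝ)) ⊆
      Set.pi Set.univ (fun _ => Set.pi Set.univ fun _ => Set.Icc (-1 : ℝ) 1) := by
    intro Q hQ i _ j _
    have h := (Matrix.mem_orthogonalGroup_iff (Fin d) ℝ).1 hQ
    have h1 : ∑ k, Q i k * Q i k = 1 := by
      have := congrFun (congrFun h i) i
      simpa [Matrix.mul_apply, Matrix.transpose_apply] using this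
    have h2 : Q i j * Q i j ≤ 1 := by
      rw [← h1]
      exact Finset.single_le_sum (f := fun k => Q i k * Q i k)
        (fun k _ => mul_self_nonneg _) (Finset.mem_univ j)
    exact ⟨by nlinarith, by nlinarith⟩
  have hclosed : IsClosed (Matrix.orthogonalGroup (Fin d) ℝ :
      Set (Matrix (Fin d) (Fin d) ℝ)) := by
    have : (Matrix.orthogonalGroup (Fin d) ℝ : Set (Matrix (Fin d) (Fin d) ℝ)) =
        {Q | Q * Q.transpose = 1} := by
      ext Q
      exact Matrix.mem_orthogonalGroup_iff (Fin d) ℝ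
    rw [this]
    exact isClosed_eq (by fun_prop) continuous_const
  exact IsCompact.of_isClosed_subset
    (isCompact_univ_pi fun _ => isCompact_univ_pi fun _ => isCompact_Icc) hclosed hsub

theorem exists_isNearest_orthogonal {d : ℕ} (X : Matrix (Fin d) (Fin d) ℝ) :
    ∃ Q, IsNearest (GroupKind.orthogonal.carrier d) X Q := by
  have hset : GroupKind.orthogonal.carrier d =
      (Matrix.orthogonalGroup (Fin d) ℝ : Set (Matrix (Fin d) (Fin d) ℝ)) := by
    ext Q
    constructor
    · rintro ⟨g, rfl⟩
      exact g.1.2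
    · intro hQ
      exact ⟨⟨⟨Q, hQ⟩, Subgroup.mem_top _⟩, rfl⟩
  obtain ⟨Q, hQ, h⟩ := (isCompact_orthogonal d).exists_isMinOn
    ⟨1, Submonoid.one_mem _⟩
    (f := fun Q : Matrix (Fin d) (Fin d) ℝ => frob (Q - X))
    (by unfold frob; simp only [Matrix.sub_apply]; fun_prop)
  exact ⟨Q, by rw [hset]; exact hQ, fun W' hW' => h (by rw [hset] at hW'; exact hW')⟩

/-- The projection onto `O(d)` (one fixed minimizer where there are several). -/
def nearestOrthogonal {d : ℕ} (X : Matrix (Fin d) (Fin d) ℝ) : Matrix (Fin d) (Fin d) ℝ :=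
  (exists_isNearest_orthogonal X).choose

/-! ### Clusterings, feasible sets and estimation error -/

/-- All `K` clusters of the clustering function `C` have the size `m`. -/
def Balanced {n K : ℕ} (m : ℕ) (C : Fin n → Fin K) : Prop :=
  ∀ k, (Finset.univ.filter fun i => C i = k).card = m

/-- The block matrix `(1_{1×K} ⊗ R) ⊙ (H ⊗ 1_{d×d})`, where `H` is the clustering matrix of `C`:
the only nonzero block in block row `i` is `R i`, in block column `C i`. -/
def assemble {n K d : ℕ} (C : Fin n → Fin K) (R : Fin n → Matrix (Fin d) (Fin d) ℝ) :
    BlockMatrix n K d :=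
  Matrix.of fun x y => if C x.1 = y.1 then R x.1 x.2 y.2 else 0

/-- The feasible set of the joint problem over `G`: all `assemble C R` with `C` balanced and all
`R i` in `G`. For `SO(d)` and `O(d)` these are the sets `𝓔` and `𝓕`. -/
def feasible (G : GroupKind) (n K d m : ℕ) : Set (BlockMatrix n K d) :=
  {V | ∃ (C : Fin n → Fin K) (R : Fin n → Matrix (Fin d) (Fin d) ℝ),
    Balanced m C ∧ (∀ i, R i ∈ G.carrier d) ∧ V = assemble C R}

/-- The group `𝓟_K(G)` of the matrices `bdiag(U) (P ⊗ I_d)`, with `U ∈ G^K` and `P` a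
permutation matrix of size `K`. -/
def permGroup (G : GroupKind) (K d : ℕ) : Set (BlockMatrix K K d) :=
  {Q | ∃ (U : Fin K → Matrix (Fin d) (Fin d) ℝ) (s : Equiv.Perm (Fin K)),
    (∀ k, U k ∈ G.carrier d) ∧
    Q = assemble id U *
      Matrix.kroneckerMap (fun x y => x * y) (s.permMatrix ℝ) (1 : Matrix (Fin d) (Fin d) ℝ)}

/-- The estimation error `ε_G(V)` of `V` with respect to the ground truth `Vstar`. -/
def estError (G : GroupKind) {n K d : ℕ} (Vstar V : BlockMatrix n K d) : ℝ :=
  sInf {r | ∃ Q ∈ permGroup G K d, r = frob (V - Vstar * Q)}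

/-- `A` preserves `V`, whose clustering function is `C`, by `δ`-separation. -/
def Separates {n K d : ℕ} (A : BlockMatrix n n d) (V : BlockMatrix n K d) (C : Fin n → Fin K)
    (δ : ℝ) : Prop :=
  0 < δ ∧ ∀ (i : Fin n) (j : Fin K), j ≠ C i →
    δ ≤ blockNuclear (A * V) i (C i) - blockNuclear (A * V) i j

/-! ### The generalized power method -/

/-- Rounding of a `d × d` block with determinant `±1` to determinant one (and of the zero block to
zero): the block is multiplied by its determinant if `d` is odd. If `d` is even, that would not
change the determinant, and only the last column is multiplied by it. -/
def roundBlock {d : ℕ} (X : Matrix (Fin d) (Fin d) ℝ) : Matrix (Fin d) (Fin d) ℝ :=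
  if Odd d then X.det • X
  else Matrix.of fun a b => if (b : ℕ) + 1 = d then X.det * X a b else X a b

/-- The last step of the method: blockwise rounding for `SO(d)`, nothing for `O(d)`. -/
def finish (G : GroupKind) {n K d : ℕ} (V : BlockMatrix n K d) : BlockMatrix n K d :=
  match G with
  | .orthogonal => V
  | .rotation => Matrix.of fun x y => roundBlock (block V x.1 y.1) x.2 y.2

/-- `W` is a possible output of the generalized power method on the input `A`, `V0` after `T`
iterations `V (t + 1) ∈ argmin_{W ∈ 𝓕} ‖W - A V t‖_F`; ties are broken arbitrarily. -/
def IsGPMOutput (G : GroupKind) {n K d : ℕ} (m : ℕ) (A : BlockMatrix n n d)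
    (V0 : BlockMatrix n K d) (T : ℕ) (W : BlockMatrix n K d) : Prop :=
  ∃ V : ℕ → BlockMatrix n K d, V 0 = V0 ∧
    (∀ t < T, IsNearest (feasible .orthogonal n K d m) (A * V t) (V (t + 1))) ∧
    W = finish G (V T)

/-! ### The random model -/

instance instMeasurableSpaceSquare (d : ℕ) : MeasurableSpace (Matrix (Fin d) (Fin d) ℝ) :=
  inferInstanceAs (MeasurableSpace (Fin d → Fin d → ℝ))

instance instBorelSpaceSquare (d : ℕ) : BorelSpace (Matrix (Fin d) (Fin d) ℝ) :=
  inferInstanceAs (BorelSpace (Fin d → Fin d → ℝ))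

instance instCompactOrthogonal (d : ℕ) : CompactSpace (Matrix.orthogonalGroup (Fin d) ℝ) :=
  isCompact_iff_compactSpace.1 (isCompact_orthogonal d)

instance instCompactSubgroup (G : GroupKind) (d : ℕ) : CompactSpace (G.subgroup d) := by
  refine isCompact_iff_compactSpace.1 (IsClosed.isCompact ?_)
  cases G with
  | orthogonal => exact isClosed_univ
  | rotation =>
    exact isClosed_eq (f := fun Q : Matrix.orthogonalGroup (Fin d) ℝ =>
      (Q : Matrix (Fin d) (Fin d) ℝ).det) (by fun_prop) continuous_const

/-- The uniform distribution on `G`: its Haar measure of total mass one. -/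
def unif (G : GroupKind) (d : ℕ) : Measure (G.subgroup d) :=
  Measure.haarMeasure ⊤

/-- Bernoulli distribution; `true` has probability `p` (used with `p` in `[0, 1]`). -/
def bern (p : ℝ) : Measure Bool :=
  ProbabilityTheory.bernoulliMeasure true false (Set.projIcc 0 1 zero_le_one p)

/-- The sample space: an edge indicator and a group element for each pair of nodes. Only the
pairs `(i, j)` with `i < j` are used by `observation`. -/
abbrev Sample (G : GroupKind) (n d : ℕ) : Type :=
  Fin n × Fin n → Bool × G.subgroup d

/-- The law of the sample: everything is independent, the group elements are uniform, and edges
have probability `p` inside the clusters of `C` and `q` between them. -/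
def sampleLaw (G : GroupKind) {n K : ℕ} (d : ℕ) (C : Fin n → Fin K) (p q : ℝ) :
    Measure (Sample G n d) :=
  Measure.pi fun e => (bern (if C e.1 = C e.2 then p else q)).prod (unif G d)

/-- The `(i, j)`-th block, `i < j`, of the observation matrix. -/
def observedBlock {G : GroupKind} {n K d : ℕ} (C : Fin n → Fin K)
    (R : Fin n → Matrix (Fin d) (Fin d) ℝ) (ω : Sample G n d) (i j : Fin n) :
    Matrix (Fin d) (Fin d) ℝ :=
  if (ω (i, j)).1 = true then
    if C i = C j then R i * (R j).transpose
    else (((ω (i, j)).2 : Matrix.orthogonalGroup (Fin d) ℝ) : Matrix (Fin d) (Fin d) ℝ)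
  else 0

/-- The observation matrix of the stochastic group block model with clustering function `C` and
group elements `R`: symmetric, with identity blocks on the diagonal. -/
def observation {G : GroupKind} {n K d : ℕ} (C : Fin n → Fin K)
    (R : Fin n → Matrix (Fin d) (Fin d) ℝ) (ω : Sample G n d) : BlockMatrix n n d :=
  Matrix.of fun x y =>
    if x.1 < y.1 then observedBlock C R ω x.1 y.1 x.2 y.2
    else if y.1 < x.1 then observedBlock C R ω y.1 x.1 y.2 x.2
    else (1 : Matrix (Fin d) (Fin d) ℝ) x.2 y.2

/-! ### A real random access machine with a step count

Programs are structured. They work on finitely many named scalars and arrays of natural numbers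
(indices) and arrays of reals. Every arithmetic operation, comparison and memory access costs one
step; a projection of a matrix of fixed size `k × k` onto `O(k)` costs `k ^ 3` steps besides the
computation of the addresses. -/

/-- Expressions for indices. -/
inductive WExp
  | lit (c : ℕ)
  | var (x : ℕ)
  | arr (a : ℕ) (i : WExp)
  | add (e f : WExp)
  | sub (e f : WExp)
  | half (e : WExp)

/-- Expressions for reals. -/
inductive RExp
  | lit (q : ℚ)
  | arr (a : ℕ) (i : WExp)
  | add (e f : RExp)
  | sub (e f : RExp)
  | mul (e f : RExp)
  | div (e f : RExp)

/-- Comparisons. -/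
inductive BExp
  | wlt (e f : WExp)
  | rle (e f : RExp)

/-- Programs. `proj k a i b j` projects the `k × k` matrix that is stored row by row from position
`i` of the real array `a` on, and stores the result from position `j` of the real array `b` on. -/
inductive Cmd
  | skip
  | setVar (x : ℕ) (e : WExp)
  | setIdx (a : ℕ) (i e : WExp)
  | setReal (a : ℕ) (i : WExp) (e : RExp)
  | proj (k a : ℕ) (i : WExp) (b : ℕ) (j : WExp)
  | seq (c₁ c₂ : Cmd)
  | ite (b : BExp) (c₁ c₂ : Cmd)
  | loop (b : BExp) (c : Cmd)

/-- Memory contents: scalars, index arrays and real arrays. -/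
structure Memory where
  var : ℕ → ℕ
  idx : ℕ → ℕ → ℕ
  real : ℕ → ℕ → ℝ

def WExp.eval (s : Memory) : WExp → ℕ
  | .lit c => c
  | .var x => s.var x
  | .arr a i => s.idx a (i.eval s)
  | .add e f => e.eval s + f.eval s
  | .sub e f => e.eval s - f.eval s
  | .half e => e.eval s / 2

def WExp.cost : WExp → ℕ
  | .lit _ => 1
  | .var _ => 1
  | .arr _ i => i.cost + 1
  | .add e f => e.cost + f.cost + 1
  | .sub e f => e.cost + f.cost + 1
  | .half e => e.cost + 1

def RExp.eval (s : Memory) : RExp → ℝ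
  | .lit q => (q : ℝ)
  | .arr a i => s.real a (i.eval s)
  | .add e f => e.eval s + f.eval s
  | .sub e f => e.eval s - f.eval s
  | .mul e f => e.eval s * f.eval s
  | .div e f => e.eval s / f.eval s

def RExp.cost : RExp → ℕ
  | .lit _ => 1
  | .arr _ i => i.cost + 1
  | .add e f => e.cost + f.cost + 1
  | .sub e f => e.cost + f.cost + 1
  | .mul e f => e.cost + f.cost + 1
  | .div e f => e.cost + f.cost + 1

def BExp.holds (s : Memory) : BExp → Prop
  | .wlt e f => e.eval s < f.eval s
  | .rle e f => e.eval s ≤ f.eval s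

def BExp.cost : BExp → ℕ
  | .wlt e f => e.cost + f.cost + 1
  | .rle e f => e.cost + f.cost + 1

/-- The `k × k` matrix stored row by row from position `i` of the real array `a` on. -/
def Memory.readSquare (s : Memory) (k a i : ℕ) : Matrix (Fin k) (Fin k) ℝ :=
  Matrix.of fun u v => s.real a (i + (u * k + v))

/-- Write the `k × k` matrix `X` row by row from position `j` of the real array `b` on. -/
def Memory.writeSquare (s : Memory) (k b j : ℕ) (X : Matrix (Fin k) (Fin k) ℝ) : Memory :=
  { s with
    real := fun b' p =>
      if h : b' = b ∧ j ≤ p ∧ p - j < k * k then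
        X ⟨(p - j) / k, Nat.div_lt_of_lt_mul h.2.2⟩
          ⟨(p - j) % k, Nat.mod_lt _ (Nat.pos_of_ne_zero (by rintro rfl; simp at h))⟩
      else s.real b' p }

/-- `Exec c s t s'`: started in `s`, the program `c` halts in `s'` after `t` steps. -/
inductive Exec : Cmd → Memory → ℕ → Memory → Prop
  | skip (s : Memory) : Exec .skip s 1 s
  | setVar (s : Memory) (x : ℕ) (e : WExp) :
      Exec (.setVar x e) s (e.cost + 1) { s with var := Function.update s.var x (e.eval s) }
  | setIdx (s : Memory) (a : ℕ) (i e : WExp) :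
      Exec (.setIdx a i e) s (i.cost + e.cost + 1)
        { s with
          idx := Function.update s.idx a (Function.update (s.idx a) (i.eval s) (e.eval s)) }
  | setReal (s : Memory) (a : ℕ) (i : WExp) (e : RExp) :
      Exec (.setReal a i e) s (i.cost + e.cost + 1)
        { s with
          real := Function.update s.real a (Function.update (s.real a) (i.eval s) (e.eval s)) }
  | proj (s : Memory) (k a : ℕ) (i : WExp) (b : ℕ) (j : WExp) :
      Exec (.proj k a i b j) s (i.cost + j.cost + k ^ 3 + 1)
        (s.writeSquare k b (j.eval s) (nearestOrthogonal (s.readSquare k a (i.eval s))))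
  | seq {c₁ c₂ : Cmd} {s s' s'' : Memory} {t t' : ℕ} (h₁ : Exec c₁ s t s')
      (h₂ : Exec c₂ s' t' s'') : Exec (.seq c₁ c₂) s (t + t') s''
  | iteTrue {b : BExp} {c₁ c₂ : Cmd} {s s' : Memory} {t : ℕ} (hb : b.holds s)
      (h : Exec c₁ s t s') : Exec (.ite b c₁ c₂) s (b.cost + t) s'
  | iteFalse {b : BExp} {c₁ c₂ : Cmd} {s s' : Memory} {t : ℕ} (hb : ¬ b.holds s)
      (h : Exec c₂ s t s') : Exec (.ite b c₁ c₂) s (b.cost + t) s'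
  | loopFalse {b : BExp} {c : Cmd} {s : Memory} (hb : ¬ b.holds s) :
      Exec (.loop b c) s b.cost s
  | loopTrue {b : BExp} {c : Cmd} {s s' s'' : Memory} {t t' : ℕ} (hb : b.holds s)
      (h : Exec c s t s') (h' : Exec (.loop b c) s' t' s'') :
      Exec (.loop b c) s (b.cost + t + t') s''

/-- The real array `1` holds the matrix `V` row by row. -/
def Holds {n K d : ℕ} (s : Memory) (V : BlockMatrix n K d) : Prop :=
  ∀ (i : Fin n) (a : Fin d) (k : Fin K) (b : Fin d),
    s.real 1 ((i * d + a) * (K * d) + (k * d + b)) = V (i, a) (k, b)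

/-- `L` lists the positions of the nonzero blocks of `A`, each once, in any order. -/
def IsSupport {n d : ℕ} (A : BlockMatrix n n d) (L : List (Fin n × Fin n)) : Prop :=
  L.Nodup ∧ ∀ i j, (i, j) ∈ L ↔ block A i j ≠ 0

/-- The memory holds an input of the method. The sparse matrix `A` is given by the list `L` of its
nonzero blocks: row indices in the index array `0`, column indices in the index array `1`, the
blocks themselves one after another in the real array `0`. All other cells are arbitrary. -/
def IsInput {n K d : ℕ} (s : Memory) (m T : ℕ) (A : BlockMatrix n n d)
    (L : List (Fin n × Fin n)) (V0 : BlockMatrix n K d) : Prop :=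
  s.var 0 = n ∧ s.var 1 = m ∧ s.var 2 = T ∧ s.var 3 = L.length ∧
  (∀ (e : ℕ) (h : e < L.length), s.idx 0 e = (L[e]).1 ∧ s.idx 1 e = (L[e]).2 ∧
    ∀ a b : Fin d, s.real 0 (e * (d * d) + (a * d + b)) = block A (L[e]).1 (L[e]).2 a b) ∧
  Holds s V0

/-- The program `c` is an implementation of the generalized power method: on all inputs it halts
with an output of the method in the real array `1`. -/
def ImplementsGPM (G : GroupKind) (K d : ℕ) (c : Cmd) : Prop :=
  ∀ (n m : ℕ), n = K * m → 0 < m →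
    ∀ (A : BlockMatrix n n d) (L : List (Fin n × Fin n)), IsSupport A L →
    ∀ V0 ∈ feasible .orthogonal n K d m, ∀ (T : ℕ) (s : Memory), IsInput s m T A L V0 →
      ∃ (t : ℕ) (s' : Memory) (W : BlockMatrix n K d),
        Exec c s t s' ∧ IsGPMOutput G m A V0 T W ∧ Holds s' W

end SGBM

end

/-! Chance enters only through two events that fail with probability at most `n ^ (-1/2)` in total
(`exists_typical`): the observation differs from its blockwise mean `Ab` by a matrix `D` of operator
norm at most `κ = η log n` with a small constant `η`, and it has `O(n log n)` edges. On these events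
the rest is deterministic, hence uniform in the initial point and in `τ`.

Contraction (`GoodObservation.step`). Given an iterate `V`, rotate the relabelled ground truth
cluster by cluster until it is closest to `V`; call this the target and put `E = V - target`. Then
`A V = A target + Ab E + D E`. The first term prefers the right cluster in every row by the gap `g =
χ m p`, and its right block is a nonnegative multiple of the target block. The mean term is only
quadratic in `E`, because the rotations are optimal; in the right block it is symmetric relative to
the target, so it does not turn the polar factor. The noise term is linear in `E`, with the small
constant `κ`. A nearest feasible point consists of a balanced assignment that maximizes the sum of
nuclear norms, and of polar factors of the chosen blocks. Correctly assigned rows are controlled by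
the stability of the polar factor (`frob_sub_one_le`), the others by the gap, since an optimal
assignment cannot lose in total against the target (`ip_nearest_sub_target_le`). The new error is at
most `4 d κ ‖E‖ / g ≤ ‖E‖ / 2`, so `O(log (n / τ))` iterations suffice. Rounding to `SO(d)` costs a
factor `√d` (`finish_spec`), because orthogonal matrices of different determinants have distance at
least two.

Noise (`measure_noise_le`). The trace of the power `2 k ≈ 2 log n` is expanded over closed walks.
Only walks that use each edge at least twice have nonzero mean, and one with `v` vertices has weight
at most `P ^ (v - 1)`, where `n P = O(log n)`. Grouping walks by the pattern of their coincidences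
compares them, up to a factor `n`, with unweighted walks in only `r = O(log n)` vertices
(`sum_repeating_le`). Those are counted by a moment of a dense `r × r` random matrix whose norm is
bounded with a net (`card_repeating_le`). The result, `k ^ k` times an exponential in `log n`, is
beaten by `(η log n) ^ (2 k)`.

Program (`exists_program`). An iteration is a sparse product, `K n` projections of constant size,
and a balanced assignment problem. The nodes are inserted one at a time at their best cluster with
respect to prices of the clusters. An overfull cluster is relieved along a chain of moves without
loss, which is found by raising prices (`denote_grow`, `run_walkBack`). Tournament trees, one for
each pair of clusters, hold the best moves, so an insertion costs `O(log n)`. All balanced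
assignments pay the same total price, so the final one is optimal (`HoldsAssign.optimal`). -/

noncomputable section

namespace SGBM

/-! ### The Frobenius inner product -/

/-- The Frobenius inner product. -/
def ip {ι κ : Type*} [Fintype ι] [Fintype κ] (X Y : Matrix ι κ ℝ) : ℝ :=
  ∑ i, ∑ j, X i j * Y i j

section ip
variable {ι κ : Type*} [Fintype ι] [Fintype κ]

theorem ip_comm (X Y : Matrix ι κ ℝ) : ip X Y = ip Y X := by
  simp only [ip, mul_comm]

theorem ip_add_left (X Y Z : Matrix ι κ ℝ) : ip (X + Y) Z = ip X Z + ip Y Z := by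
  simp only [ip, Matrix.add_apply, add_mul, Finset.sum_add_distrib]

theorem ip_add_right (X Y Z : Matrix ι κ ℝ) : ip X (Y + Z) = ip X Y + ip X Z := by
  simp only [ip, Matrix.add_apply, mul_add, Finset.sum_add_distrib]

theorem ip_smul_left (c : ℝ) (X Y : Matrix ι κ ℝ) : ip (c • X) Y = c * ip X Y := by
  simp only [ip, Matrix.smul_apply, smul_eq_mul, mul_assoc, Finset.mul_sum]

theorem ip_smul_right (c : ℝ) (X Y : Matrix ι κ ℝ) : ip X (c • Y) = c * ip X Y := by
  rw [ip_comm, ip_smul_left, ip_comm]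

theorem ip_neg_left (X Y : Matrix ι κ ℝ) : ip (-X) Y = -ip X Y := by
  simp only [ip, Matrix.neg_apply, neg_mul, Finset.sum_neg_distrib]

theorem ip_neg_right (X Y : Matrix ι κ ℝ) : ip X (-Y) = -ip X Y := by
  rw [ip_comm, ip_neg_left, ip_comm]

theorem ip_sub_left (X Y Z : Matrix ι κ ℝ) : ip (X - Y) Z = ip X Z - ip Y Z := by
  rw [sub_eq_add_neg, ip_add_left, ip_neg_left, sub_eq_add_neg]

theorem ip_sub_right (X Y Z : Matrix ι κ ℝ) : ip X (Y - Z) = ip X Y - ip X Z := by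
  rw [ip_comm, ip_sub_left, ip_comm Y, ip_comm Z]

theorem ip_zero_left (X : Matrix ι κ ℝ) : ip 0 X = 0 := by simp [ip]

theorem ip_zero_right (X : Matrix ι κ ℝ) : ip X 0 = 0 := by simp [ip]

theorem ip_sum_left {s : Type*} (t : Finset s) (f : s → Matrix ι κ ℝ) (Y : Matrix ι κ ℝ) :
    ip (∑ k ∈ t, f k) Y = ∑ k ∈ t, ip (f k) Y := by
  classical
  induction t using Finset.induction_on with
  | empty => simp [ip_zero_left]
  | insert a t ha ih => rw [Finset.sum_insert ha, Finset.sum_insert ha, ip_add_left, ih]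

theorem ip_sum_right {s : Type*} (t : Finset s) (f : s → Matrix ι κ ℝ) (Y : Matrix ι κ ℝ) :
    ip Y (∑ k ∈ t, f k) = ∑ k ∈ t, ip Y (f k) := by
  rw [ip_comm, ip_sum_left]
  exact Finset.sum_congr rfl fun _ _ => ip_comm _ _

theorem ip_eq_trace (X Y : Matrix ι κ ℝ) : ip X Y = (X.transpose * Y).trace := by
  simp only [ip, Matrix.trace, Matrix.diag, Matrix.mul_apply, Matrix.transpose_apply]
  exact Finset.sum_comm

theorem ip_transpose (X Y : Matrix ι κ ℝ) : ip X.transpose Y.transpose = ip X Y := by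
  simp only [ip, Matrix.transpose_apply]
  exact Finset.sum_comm

theorem ip_mul_left {μ : Type*} [Fintype μ] (X : Matrix ι μ ℝ) (Y : Matrix μ κ ℝ)
    (Z : Matrix ι κ ℝ) : ip (X * Y) Z = ip Y (X.transpose * Z) := by
  rw [ip_eq_trace, ip_eq_trace, Matrix.transpose_mul, Matrix.mul_assoc]

theorem ip_mul_right {μ : Type*} [Fintype μ] (X : Matrix ι μ ℝ) (Y : Matrix μ κ ℝ)
    (Z : Matrix ι κ ℝ) : ip (X * Y) Z = ip X (Z * Y.transpose) := by
  rw [← ip_transpose, Matrix.transpose_mul, ip_mul_left, ← ip_transpose X, Matrix.transpose_mul,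
    Matrix.transpose_transpose]

theorem ip_self_nonneg (X : Matrix ι κ ℝ) : 0 ≤ ip X X :=
  Finset.sum_nonneg fun _ _ => Finset.sum_nonneg fun _ _ => mul_self_nonneg _

theorem frob_eq_sqrt_ip (X : Matrix ι κ ℝ) : frob X = Real.sqrt (ip X X) := by
  simp only [frob, ip, sq]

theorem frob_nonneg (X : Matrix ι κ ℝ) : 0 ≤ frob X := Real.sqrt_nonneg _

theorem frob_sq (X : Matrix ι κ ℝ) : frob X ^ 2 = ip X X := by
  rw [frob_eq_sqrt_ip, Real.sq_sqrt (ip_self_nonneg X)]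

theorem ip_le_frob_mul_frob (X Y : Matrix ι κ ℝ) : ip X Y ≤ frob X * frob Y := by
  have h : ip X Y ^ 2 ≤ ip X X * ip Y Y := by
    simp only [ip, ← Fintype.sum_prod_type']
    have := Finset.sum_mul_sq_le_sq_mul_sq (Finset.univ : Finset (ι × κ))
      (fun x => X x.1 x.2) (fun x => Y x.1 x.2)
    simpa [sq] using this
  rw [frob_eq_sqrt_ip, frob_eq_sqrt_ip, ← Real.sqrt_mul (ip_self_nonneg X)]
  exact Real.le_sqrt_of_sq_le h

theorem frob_add_le (X Y : Matrix ι κ ℝ) : frob (X + Y) ≤ frob X + frob Y := by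
  refine abs_le_of_sq_le_sq' ?_ (add_nonneg (frob_nonneg X) (frob_nonneg Y)) |>.2
  rw [frob_sq, ip_add_left, ip_add_right, ip_add_right, add_sq, frob_sq, frob_sq, ip_comm Y X]
  linarith [ip_le_frob_mul_frob X Y]

theorem frob_neg (X : Matrix ι κ ℝ) : frob (-X) = frob X := by
  rw [frob_eq_sqrt_ip, ip_neg_left, ip_neg_right, neg_neg, ← frob_eq_sqrt_ip]

theorem frob_sub_sq (X Y : Matrix ι κ ℝ) :
    frob (X - Y) ^ 2 = ip X X + ip Y Y - 2 * ip X Y := by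
  rw [frob_sq, ip_sub_left, ip_sub_right, ip_sub_right, ip_comm Y X]; ring

theorem frob_le_frob_iff (X Y : Matrix ι κ ℝ) : frob X ≤ frob Y ↔ ip X X ≤ ip Y Y := by
  rw [frob_eq_sqrt_ip, frob_eq_sqrt_ip, Real.sqrt_le_sqrt_iff (ip_self_nonneg Y)]

end ip

/-! ### Orthogonal matrices -/

variable {d : ℕ}

/-- The set of orthogonal matrices. -/
abbrev Orth (d : ℕ) : Set (Matrix (Fin d) (Fin d) ℝ) := GroupKind.orthogonal.carrier d

theorem mem_orth_iff {Q : Matrix (Fin d) (Fin d) ℝ} : Q ∈ Orth d ↔ Q * Q.transpose = 1 := by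
  rw [← Matrix.mem_orthogonalGroup_iff]
  constructor
  · rintro ⟨g, rfl⟩
    exact g.1.2
  · intro hQ
    exact ⟨⟨⟨Q, hQ⟩, Subgroup.mem_top _⟩, rfl⟩

theorem orth_mul_transpose {Q : Matrix (Fin d) (Fin d) ℝ} (h : Q ∈ Orth d) :
    Q * Q.transpose = 1 := mem_orth_iff.1 h

theorem orth_transpose_mul {Q : Matrix (Fin d) (Fin d) ℝ} (h : Q ∈ Orth d) :
    Q.transpose * Q = 1 := mul_eq_one_comm.1 (mem_orth_iff.1 h)

theorem orth_one : (1 : Matrix (Fin d) (Fin d) ℝ) ∈ Orth d := by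
  rw [mem_orth_iff]; simp

theorem orth_mul {P Q : Matrix (Fin d) (Fin d) ℝ} (hP : P ∈ Orth d) (hQ : Q ∈ Orth d) :
    P * Q ∈ Orth d := by
  rw [mem_orth_iff, Matrix.transpose_mul, Matrix.mul_assoc, ← Matrix.mul_assoc Q,
    orth_mul_transpose hQ, Matrix.one_mul, orth_mul_transpose hP]

theorem orth_transpose {Q : Matrix (Fin d) (Fin d) ℝ} (h : Q ∈ Orth d) : Q.transpose ∈ Orth d := by
  rw [mem_orth_iff, Matrix.transpose_transpose, orth_transpose_mul h]

theorem orth_neg {Q : Matrix (Fin d) (Fin d) ℝ} (h : Q ∈ Orth d) : -Q ∈ Orth d := by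
  rw [mem_orth_iff, Matrix.transpose_neg, neg_mul_neg, orth_mul_transpose h]

theorem ip_orth_self {Q : Matrix (Fin d) (Fin d) ℝ} (h : Q ∈ Orth d) : ip Q Q = d := by
  rw [ip_eq_trace, orth_transpose_mul h]; simp

theorem ip_one_left (Y : Matrix (Fin d) (Fin d) ℝ) : ip 1 Y = Y.trace := by
  rw [ip_eq_trace]; simp

theorem ip_mul_orth_left {Q : Matrix (Fin d) (Fin d) ℝ} (h : Q ∈ Orth d)
    (X Y : Matrix (Fin d) (Fin d) ℝ) : ip (Q * X) (Q * Y) = ip X Y := by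
  rw [ip_mul_left, ← Matrix.mul_assoc, orth_transpose_mul h, Matrix.one_mul]

theorem ip_mul_orth_right {Q : Matrix (Fin d) (Fin d) ℝ} (h : Q ∈ Orth d)
    (X Y : Matrix (Fin d) (Fin d) ℝ) : ip (X * Q) (Y * Q) = ip X Y := by
  rw [ip_mul_right, Matrix.mul_assoc, orth_mul_transpose h, Matrix.mul_one]

theorem orth_det_sq {Q : Matrix (Fin d) (Fin d) ℝ} (h : Q ∈ Orth d) : Q.det * Q.det = 1 := by
  have := congrArg Matrix.det (orth_mul_transpose h)
  rwa [Matrix.det_mul, Matrix.det_transpose, Matrix.det_one] at this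

theorem carrier_subset_orth (G : GroupKind) : G.carrier d ⊆ Orth d := by
  rintro Q ⟨g, rfl⟩
  exact ⟨⟨g.1, Subgroup.mem_top _⟩, rfl⟩

theorem mem_rotation_iff {Q : Matrix (Fin d) (Fin d) ℝ} :
    Q ∈ GroupKind.rotation.carrier d ↔ Q ∈ Orth d ∧ Q.det = 1 := by
  constructor
  · rintro ⟨g, rfl⟩
    exact ⟨carrier_subset_orth .rotation ⟨g, rfl⟩, g.2⟩
  · rintro ⟨⟨g, rfl⟩, h⟩
    exact ⟨⟨g.1, h⟩, rfl⟩

/-- The reflection in the hyperplane orthogonal to the unit vector `v`. -/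
def reflection (v : Fin d → ℝ) : Matrix (Fin d) (Fin d) ℝ := 1 - (2 : ℝ) • Matrix.vecMulVec v v

theorem reflection_mem {v : Fin d → ℝ} (hv : v ⬝ᵥ v = 1) : reflection v ∈ Orth d := by
  rw [mem_orth_iff]
  have ht : (reflection v).transpose = reflection v := by
    simp [reflection, Matrix.transpose_sub, Matrix.transpose_smul, Matrix.transpose_vecMulVec]
  have hvv : Matrix.vecMulVec v v * Matrix.vecMulVec v v = Matrix.vecMulVec v v := by
    rw [Matrix.vecMulVec_mul_vecMulVec, hv]; simp
  rw [ht, reflection, sub_mul, mul_sub, mul_sub, Matrix.one_mul, Matrix.mul_one, Matrix.one_mul,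
    Matrix.smul_mul, Matrix.mul_smul, hvv]
  module

theorem ip_vecMulVec (u v : Fin d → ℝ) (Y : Matrix (Fin d) (Fin d) ℝ) :
    ip (Matrix.vecMulVec u v) Y = u ⬝ᵥ Y.mulVec v := by
  simp only [ip, Matrix.vecMulVec_apply, dotProduct, Matrix.mulVec, Finset.mul_sum]
  refine Finset.sum_congr rfl fun i _ => Finset.sum_congr rfl fun j _ => by ring

theorem ip_reflection (v : Fin d → ℝ) (Y : Matrix (Fin d) (Fin d) ℝ) :
    ip (reflection v) Y = Y.trace - 2 * (v ⬝ᵥ Y.mulVec v) := by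
  rw [reflection, ip_sub_left, ip_smul_left, ip_one_left, ip_vecMulVec]

theorem ip_reflection_mul (u v : Fin d → ℝ) (Y : Matrix (Fin d) (Fin d) ℝ) :
    ip (reflection u * reflection v) Y = Y.trace - 2 * (u ⬝ᵥ Y.mulVec u) -
      2 * (v ⬝ᵥ Y.mulVec v) + 4 * (u ⬝ᵥ v) * (u ⬝ᵥ Y.mulVec v) := by
  rw [reflection, reflection, sub_mul, mul_sub, mul_sub, Matrix.one_mul, Matrix.mul_one,
    Matrix.one_mul, Matrix.smul_mul, Matrix.mul_smul, Matrix.vecMulVec_mul_vecMulVec]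
  simp only [ip_sub_left, ip_smul_left, ip_one_left, ip_vecMulVec, Matrix.vecMulVec_smul]
  ring

/-- A unit vector in the direction of a nonzero vector. -/
theorem exists_unit {v : Fin d → ℝ} (hv : v ≠ 0) :
    ∃ (c : ℝ) (w : Fin d → ℝ), w ⬝ᵥ w = 1 ∧ v = c • w := by
  have h0 : 0 < v ⬝ᵥ v := by
    rcases (dotProduct_self_star_nonneg v).lt_or_eq with h | h
    · simpa using h
    · exact absurd (dotProduct_self_eq_zero.1 (by simpa using h.symm)) hv
  have hs := Real.sqrt_pos.2 h0
  refine ⟨Real.sqrt (v ⬝ᵥ v), (Real.sqrt (v ⬝ᵥ v))⁻¹ • v, ?_, ?_⟩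
  · rw [smul_dotProduct, dotProduct_smul, smul_eq_mul, smul_eq_mul]
    nth_rewrite 3 [← Real.mul_self_sqrt h0.le]
    field_simp
  · rw [smul_smul, mul_inv_cancel₀ hs.ne', one_smul]

/-- The reflection in a unit vector `w` lowers the trace pairing by twice the quadratic form of `Y`
at `w`; by maximality this cannot be a gain. -/
theorem posSemidef_of_trace_max {Y : Matrix (Fin d) (Fin d) ℝ}
    (h : ∀ U ∈ Orth d, ip U Y ≤ Y.trace) (v : Fin d → ℝ) : 0 ≤ v ⬝ᵥ Y.mulVec v := by
  by_cases hv : v = 0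
  · simp [hv]
  obtain ⟨c, w, hw, rfl⟩ := exists_unit hv
  have := h _ (reflection_mem hw)
  rw [ip_reflection] at this
  rw [smul_dotProduct, Matrix.mulVec_smul, dotProduct_smul, smul_eq_mul, smul_eq_mul, ← mul_assoc]
  exact mul_nonneg (mul_self_nonneg c) (by linarith)

/-- Products of two reflections are tested. For two nearly equal vectors the antisymmetric part of
`Y` enters to first order in their difference and everything else to second order, so it vanishes.
-/
theorem symm_of_trace_max {Y : Matrix (Fin d) (Fin d) ℝ}
    (h : ∀ U ∈ Orth d, ip U Y ≤ Y.trace) : Y.transpose = Y := by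
  have key : ∀ u v : Fin d → ℝ, 2 * (u ⬝ᵥ v) * (u ⬝ᵥ Y.mulVec v) ≤
      (v ⬝ᵥ v) * (u ⬝ᵥ Y.mulVec u) + (u ⬝ᵥ u) * (v ⬝ᵥ Y.mulVec v) := by
    intro u v
    by_cases hu : u = 0
    · simp [hu]
    by_cases hv : v = 0
    · simp [hv]
    obtain ⟨a, w, hw, rfl⟩ := exists_unit hu
    obtain ⟨b, z, hz, rfl⟩ := exists_unit hv
    have := h _ (orth_mul (reflection_mem hw) (reflection_mem hz))
    rw [ip_reflection_mul] at this
    simp only [smul_dotProduct, Matrix.mulVec_smul, dotProduct_smul, smul_eq_mul, hw, hz]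
    nlinarith [mul_nonneg (mul_self_nonneg a) (mul_self_nonneg b)]
  ext i j
  rw [Matrix.transpose_apply]
  by_cases hij : i = j
  · rw [hij]
  set v : Fin d → ℝ := Pi.single i 1
  set w : Fin d → ℝ := Pi.single j 1
  have e1 : v ⬝ᵥ v = 1 := by simp [v]
  have e2 : v ⬝ᵥ w = 0 := by simp [v, w, hij]
  have e3 : w ⬝ᵥ v = 0 := by rw [dotProduct_comm]; exact e2
  have e4 : w ⬝ᵥ w = 1 := by simp [w]
  have e5 : v ⬝ᵥ Y.mulVec w = Y i j := by simp [v, w]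
  have e6 : w ⬝ᵥ Y.mulVec v = Y j i := by simp [v, w]
  -- `key` for `v + t w` and `v`: the terms of order zero cancel.
  have hq : ∀ t : ℝ, 0 ≤ t * (Y i j - Y j i) +
      t ^ 2 * (w ⬝ᵥ Y.mulVec w + v ⬝ᵥ Y.mulVec v) := by
    intro t
    have := key (v + t • w) v
    simp only [add_dotProduct, dotProduct_add, smul_dotProduct, Matrix.mulVec_add,
      Matrix.mulVec_smul, dotProduct_smul, smul_eq_mul, e1, e2, e3, e4, e5, e6] at this
    linarith
  by_contra hne
  set a := Y i j - Y j i with ha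
  set c := w ⬝ᵥ Y.mulVec w + v ⬝ᵥ Y.mulVec v
  have ha0 : a ≠ 0 := fun h0 => hne (by rw [ha] at h0; linarith)
  -- A value of `t` so small, and of such a sign, that the negative linear term outweighs the
  -- quadratic one.
  have := hq (-a / (2 * (|c| + 1)))
  have hp : 0 < |c| + 1 := by positivity
  have e : -a / (2 * (|c| + 1)) * a + (-a / (2 * (|c| + 1))) ^ 2 * c =
      -(a ^ 2 / (4 * (|c| + 1) ^ 2)) * (2 * (|c| + 1) - c) := by
    field_simp; ring
  rw [e] at this
  have h2 : 0 < a ^ 2 / (4 * (|c| + 1) ^ 2) := by positivity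
  have h3 : 0 < 2 * (|c| + 1) - c := by linarith [le_abs_self c]
  nlinarith [mul_pos h2 h3]

/-! ### The nuclear norm -/

theorem nearestOrthogonal_mem (X : Matrix (Fin d) (Fin d) ℝ) : nearestOrthogonal X ∈ Orth d :=
  (exists_isNearest_orthogonal X).choose_spec.1

/-- All orthogonal matrices have the same Frobenius norm, so nearest means largest inner product. -/
theorem ip_le_ip_nearestOrthogonal (X : Matrix (Fin d) (Fin d) ℝ) {U : Matrix (Fin d) (Fin d) ℝ}
    (hU : U ∈ Orth d) : ip U X ≤ ip (nearestOrthogonal X) X := by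
  have h : frob (nearestOrthogonal X - X) ≤ frob (U - X) :=
    (exists_isNearest_orthogonal X).choose_spec.2 U hU
  have h2 := pow_le_pow_left₀ (frob_nonneg _) h 2
  have h3 := nearestOrthogonal_mem X
  rw [frob_sub_sq, frob_sub_sq, ip_orth_self hU, ip_orth_self h3] at h2
  linarith

theorem ip_le_trace_of_max {X Q : Matrix (Fin d) (Fin d) ℝ} (hQ : Q ∈ Orth d)
    (h : ∀ U ∈ Orth d, ip U X ≤ ip Q X) (U : Matrix (Fin d) (Fin d) ℝ) (hU : U ∈ Orth d) :
    ip U (Q.transpose * X) ≤ (Q.transpose * X).trace := by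
  rw [← ip_mul_left, ← ip_eq_trace]
  exact h _ (orth_mul hQ hU)

/-- The positive square root of `S` acts on each eigenvector of `S` as the root of the eigenvalue,
so the sum is the trace of `Y` in that basis. -/
theorem sum_sqrt_eigenvalues_eq_trace {E : Type*} [NormedAddCommGroup E] [InnerProductSpace ℝ E]
    [FiniteDimensional ℝ E] {n : ℕ} (hn : Module.finrank ℝ E = n) {S Y : E →ₗ[ℝ] E}
    (hS : S.IsSymmetric) (hY : Y.IsSymmetric) (hpos : ∀ x, 0 ≤ inner ℝ x (Y x))
    (h : Y ∘ₗ Y = S) : ∑ i, Real.sqrt (hS.eigenvalues hn i) = LinearMap.trace ℝ E Y := by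
  rw [LinearMap.trace_eq_sum_inner Y (hS.eigenvectorBasis hn)]
  refine Finset.sum_congr rfl fun i _ => ?_
  set b := hS.eigenvectorBasis hn i
  set σ := Real.sqrt (hS.eigenvalues hn i)
  have hb1 : inner ℝ b b = (1 : ℝ) := by
    rw [real_inner_self_eq_norm_sq, (hS.eigenvectorBasis hn).norm_eq_one]; norm_num
  have hSb : S b = (hS.eigenvalues hn i) • b := hS.apply_eigenvectorBasis hn i
  have hYY : Y (Y b) = (hS.eigenvalues hn i) • b := by rw [← hSb, ← h]; rfl
  have hl : 0 ≤ hS.eigenvalues hn i := by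
    have : inner ℝ (Y b) (Y b) = hS.eigenvalues hn i := by
      rw [hY b (Y b), hYY, inner_smul_right, hb1, mul_one]
    rw [← this]; exact real_inner_self_nonneg
  have hσ : σ * σ = hS.eigenvalues hn i := Real.mul_self_sqrt hl
  have hz : Y b = σ • b := by
    -- From `Y² b = σ² b` it follows that `Y z = -σ z`; positivity of `Y` then forces `z = 0` or `σ
    -- = 0`.
    set z := Y b - σ • b with hzdef
    have h1 : Y z = -(σ • z) := by
      rw [hzdef, map_sub, hYY, map_smul, ← hσ]; module
    have h2 : inner ℝ z z * σ = 0 := by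
      have h3 := hpos z
      rw [h1, inner_neg_right, inner_smul_right] at h3
      have h4 : 0 ≤ σ * inner ℝ z z := mul_nonneg (Real.sqrt_nonneg _) real_inner_self_nonneg
      linarith
    rcases mul_eq_zero.1 h2 with h3 | h3
    · exact sub_eq_zero.1 (inner_self_eq_zero.1 h3)
    · have h5 : inner ℝ (Y b) (Y b) = (0 : ℝ) := by
        rw [hY b (Y b), hYY, inner_smul_right, hb1, mul_one, ← hσ, h3, mul_zero]
      rw [inner_self_eq_zero.1 h5, h3, zero_smul]
  rw [hz, inner_smul_right, hb1, mul_one]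

/-- For a maximizer `Q`, the matrix `Qᵀ X` is symmetric and positive semidefinite with square `Xᵀ
X`, so its trace is the sum of the singular values. The resulting variational formula is the only
access to the nuclear norm below. -/
theorem nuclearNorm_eq_ip (X : Matrix (Fin d) (Fin d) ℝ) :
    nuclearNorm X = ip (nearestOrthogonal X) X := by
  set Q := nearestOrthogonal X
  have hQ : Q ∈ Orth d := nearestOrthogonal_mem X
  have hmax := ip_le_trace_of_max hQ fun U hU => ip_le_ip_nearestOrthogonal X hU
  have hsym := symm_of_trace_max hmax
  have hpsd := posSemidef_of_trace_max hmax
  set Y := Q.transpose * X with hYdef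
  have hfr : Module.finrank ℝ (EuclideanSpace ℝ (Fin d)) = d := by simp
  have hYY : Y * Y = X.transpose * X := by
    nth_rewrite 1 [← hsym]
    rw [hYdef, Matrix.transpose_mul, Matrix.transpose_transpose, Matrix.mul_assoc,
      ← Matrix.mul_assoc Q, orth_mul_transpose hQ, Matrix.one_mul]
  have hinner : ∀ x y : EuclideanSpace ℝ (Fin d), ∀ M : Matrix (Fin d) (Fin d) ℝ,
      inner ℝ x (Matrix.toEuclideanLin M y) = x.ofLp ⬝ᵥ M.mulVec y.ofLp := by
    intro x y M
    rw [EuclideanSpace.inner_eq_star_dotProduct]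
    simp [dotProduct_comm]
  have hcomp : (Matrix.toEuclideanLin Y) ∘ₗ (Matrix.toEuclideanLin Y) =
      LinearMap.adjoint (Matrix.toEuclideanLin X) ∘ₗ Matrix.toEuclideanLin X := by
    rw [← Matrix.toEuclideanLin_conjTranspose_eq_adjoint, Matrix.conjTranspose_eq_transpose_of_trivial]
    ext v i
    simp only [LinearMap.comp_apply, Matrix.toLpLin_apply, Matrix.mulVec_mulVec, hYY]
  have hsY : (Matrix.toEuclideanLin Y).IsSymmetric := by
    intro x y
    rw [real_inner_comm, hinner, hinner, ← Matrix.dotProduct_transpose_mulVec, hsym,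
      dotProduct_comm]
  have := sum_sqrt_eigenvalues_eq_trace hfr
    (Matrix.toEuclideanLin X).isSymmetric_adjoint_comp_self hsY
    (fun x => by rw [hinner]; exact hpsd _) hcomp
  rw [nuclearNorm, Finset.sum_range]
  simp only [LinearMap.singularValues_fin _ hfr]
  rw [this, ip_eq_trace]
  change _ = Y.trace
  rw [← Matrix.trace_toLin_eq Y (EuclideanSpace.basisFun (Fin d) ℝ).toBasis]
  rfl

variable {d : ℕ}

theorem ip_le_nuclearNorm {U : Matrix (Fin d) (Fin d) ℝ} (hU : U ∈ Orth d)
    (X : Matrix (Fin d) (Fin d) ℝ) : ip U X ≤ nuclearNorm X := by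
  rw [nuclearNorm_eq_ip]; exact ip_le_ip_nearestOrthogonal X hU

theorem nuclearNorm_le {X : Matrix (Fin d) (Fin d) ℝ} {c : ℝ} (h : ∀ U ∈ Orth d, ip U X ≤ c) :
    nuclearNorm X ≤ c := by
  rw [nuclearNorm_eq_ip]; exact h _ (nearestOrthogonal_mem X)

theorem nuclearNorm_nonneg (X : Matrix (Fin d) (Fin d) ℝ) : 0 ≤ nuclearNorm X :=
  Finset.sum_nonneg fun _ _ => LinearMap.singularValues_nonneg _ _

theorem nuclearNorm_zero : nuclearNorm (0 : Matrix (Fin d) (Fin d) ℝ) = 0 := by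
  rw [nuclearNorm_eq_ip, ip_zero_right]

theorem nuclearNorm_add_le (X Y : Matrix (Fin d) (Fin d) ℝ) :
    nuclearNorm (X + Y) ≤ nuclearNorm X + nuclearNorm Y :=
  nuclearNorm_le fun U hU => by
    rw [ip_add_right]; exact add_le_add (ip_le_nuclearNorm hU X) (ip_le_nuclearNorm hU Y)

theorem nuclearNorm_neg (X : Matrix (Fin d) (Fin d) ℝ) : nuclearNorm (-X) = nuclearNorm X := by
  have h : ∀ Y : Matrix (Fin d) (Fin d) ℝ, nuclearNorm (-Y) ≤ nuclearNorm Y := fun Y =>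
    nuclearNorm_le fun U hU => by
      rw [ip_neg_right, ← ip_neg_left]; exact ip_le_nuclearNorm (orth_neg hU) Y
  exact le_antisymm (h X) (by simpa using h (-X))

theorem nuclearNorm_le_add (X Y : Matrix (Fin d) (Fin d) ℝ) :
    nuclearNorm X ≤ nuclearNorm (X + Y) + nuclearNorm Y := by
  have := nuclearNorm_add_le (X + Y) (-Y)
  rwa [add_neg_cancel_right, nuclearNorm_neg] at this

theorem nuclearNorm_smul_le {c : ℝ} (hc : 0 ≤ c) (X : Matrix (Fin d) (Fin d) ℝ) :
    nuclearNorm (c • X) ≤ c * nuclearNorm X :=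
  nuclearNorm_le fun U hU => by
    rw [ip_smul_right]; exact mul_le_mul_of_nonneg_left (ip_le_nuclearNorm hU X) hc

theorem nuclearNorm_sum_le {s : Type*} (t : Finset s) (f : s → Matrix (Fin d) (Fin d) ℝ) :
    nuclearNorm (∑ k ∈ t, f k) ≤ ∑ k ∈ t, nuclearNorm (f k) :=
  nuclearNorm_le fun U hU => by
    rw [ip_sum_right]; exact Finset.sum_le_sum fun k _ => ip_le_nuclearNorm hU _

theorem nuclearNorm_orth_mul {Q : Matrix (Fin d) (Fin d) ℝ} (hQ : Q ∈ Orth d)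
    (X : Matrix (Fin d) (Fin d) ℝ) : nuclearNorm (Q * X) = nuclearNorm X := by
  have h : ∀ (P Y : Matrix (Fin d) (Fin d) ℝ), P ∈ Orth d → nuclearNorm (P * Y) ≤ nuclearNorm Y :=
    fun P Y hP => nuclearNorm_le fun U hU => by
      rw [ip_comm, ip_mul_left, ip_comm]
      exact ip_le_nuclearNorm (orth_mul (orth_transpose hP) hU) Y
  refine le_antisymm (h Q X hQ) ?_
  have := h Q.transpose (Q * X) (orth_transpose hQ)
  rwa [← Matrix.mul_assoc, orth_transpose_mul hQ, Matrix.one_mul] at this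

theorem nuclearNorm_mul_orth {Q : Matrix (Fin d) (Fin d) ℝ} (hQ : Q ∈ Orth d)
    (X : Matrix (Fin d) (Fin d) ℝ) : nuclearNorm (X * Q) = nuclearNorm X := by
  have h : ∀ (P Y : Matrix (Fin d) (Fin d) ℝ), P ∈ Orth d → nuclearNorm (Y * P) ≤ nuclearNorm Y :=
    fun P Y hP => nuclearNorm_le fun U hU => by
      rw [ip_comm, ip_mul_right, ip_comm]
      exact ip_le_nuclearNorm (orth_mul hU (orth_transpose hP)) Y
  refine le_antisymm (h Q X hQ) ?_
  have := h Q.transpose (X * Q) (orth_transpose hQ)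
  rwa [Matrix.mul_assoc, orth_mul_transpose hQ, Matrix.mul_one] at this

theorem frob_orth {Q : Matrix (Fin d) (Fin d) ℝ} (hQ : Q ∈ Orth d) :
    frob Q = Real.sqrt d := by
  rw [frob_eq_sqrt_ip, ip_orth_self hQ]

theorem nuclearNorm_le_sqrt_mul_frob (X : Matrix (Fin d) (Fin d) ℝ) :
    nuclearNorm X ≤ Real.sqrt d * frob X :=
  nuclearNorm_le fun U hU => by
    rw [← frob_orth hU]; exact ip_le_frob_mul_frob U X

theorem nuclearNorm_orth {Q : Matrix (Fin d) (Fin d) ℝ} (hQ : Q ∈ Orth d) :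
    nuclearNorm Q = d := by
  refine le_antisymm ?_ ?_
  · refine (nuclearNorm_le_sqrt_mul_frob Q).trans ?_
    rw [frob_orth hQ, Real.mul_self_sqrt (Nat.cast_nonneg d)]
  · rw [← ip_orth_self hQ]; exact ip_le_nuclearNorm hQ Q

theorem nuclearNorm_smul_orth {c : ℝ} (hc : 0 ≤ c) {Q : Matrix (Fin d) (Fin d) ℝ}
    (hQ : Q ∈ Orth d) : nuclearNorm (c • Q) = c * d := by
  refine le_antisymm ?_ ?_
  · rw [← nuclearNorm_orth hQ]; exact nuclearNorm_smul_le hc Q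
  · rw [← ip_orth_self hQ, ← ip_smul_right]; exact ip_le_nuclearNorm hQ _

/-- The nuclear norm dominates the pairings with a reflection and with `-1`; in their sum the trace
cancels and only the quadratic form remains. -/
theorem neg_nuclearNorm_mul_le (X : Matrix (Fin d) (Fin d) ℝ) (x : Fin d → ℝ) :
    -(nuclearNorm X * (x ⬝ᵥ x)) ≤ x ⬝ᵥ X.mulVec x := by
  by_cases hx : x = 0
  · simp [hx]
  obtain ⟨c, w, hw, rfl⟩ := exists_unit hx
  have h1 := ip_le_nuclearNorm (reflection_mem hw) X
  have h2 := ip_le_nuclearNorm (orth_neg orth_one) X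
  rw [ip_reflection] at h1
  rw [ip_neg_left, ip_one_left] at h2
  simp only [smul_dotProduct, Matrix.mulVec_smul, dotProduct_smul, smul_eq_mul, hw]
  nlinarith [mul_self_nonneg c]

/-! ### Stability of the polar factor -/

theorem ip_mul_self_ge {X : Matrix (Fin d) (Fin d) ℝ} {δ : ℝ}
    (hpos : ∀ x : Fin d → ℝ, δ * (x ⬝ᵥ x) ≤ x ⬝ᵥ X.mulVec x) (Z : Matrix (Fin d) (Fin d) ℝ) :
    δ * ip Z Z ≤ ip Z (X * Z) := by
  have h1 : ip Z Z = ∑ j, (fun i => Z i j) ⬝ᵥ (fun i => Z i j) := by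
    simp only [ip, dotProduct]; exact Finset.sum_comm
  have h2 : ip Z (X * Z) = ∑ j, (fun i => Z i j) ⬝ᵥ X.mulVec (fun i => Z i j) := by
    simp only [ip, dotProduct, Matrix.mul_apply, Matrix.mulVec]; exact Finset.sum_comm
  rw [h1, h2, Finset.mul_sum]
  exact Finset.sum_le_sum fun j _ => hpos _

/-- For symmetric `X`, the loss from replacing `1` by an orthogonal `W` is a quadratic form in `1 -
W`. This turns optimality, which is linear in `W`, into control of a distance. -/
theorem ip_one_sub_eq {X W : Matrix (Fin d) (Fin d) ℝ} (hX : X.transpose = X) (hW : W ∈ Orth d) :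
    ip (1 - W) (X * (1 - W)) = 2 * ip (1 - W) X := by
  have h1 : ip W (X * W) = ip 1 X := by
    rw [ip_comm, ip_mul_right, orth_mul_transpose hW, ip_comm]
  have h2 : ip 1 (X * W) = ip W X := by
    rw [ip_comm, ip_mul_left, Matrix.mul_one, hX]
  rw [mul_sub, Matrix.mul_one, ip_sub_right, ip_sub_left 1 W (X * W), h1, h2, ip_sub_left]
  ring

/-- If `X` is symmetric and at least `δ`, then the polar factor of `X + N` is close to one. -/
theorem frob_sub_one_le {X N W : Matrix (Fin d) (Fin d) ℝ} {δ : ℝ}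
    (hX : X.transpose = X) (hpos : ∀ x : Fin d → ℝ, δ * (x ⬝ᵥ x) ≤ x ⬝ᵥ X.mulVec x)
    (hW : W ∈ Orth d) (hmax : ip 1 (X + N) ≤ ip W (X + N)) :
    δ * frob (W - 1) ≤ 2 * frob N := by
  have h1 := ip_mul_self_ge hpos (1 - W)
  rw [ip_one_sub_eq hX hW] at h1
  have h2 : ip (1 - W) X ≤ ip (W - 1) N := by
    rw [ip_add_right, ip_add_right] at hmax
    rw [ip_sub_left, ip_sub_left]; linarith
  have h3 := ip_le_frob_mul_frob (W - 1) N
  have h4 : ip (1 - W) (1 - W) = frob (W - 1) ^ 2 := by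
    rw [← frob_sq, ← neg_sub, frob_neg]
  rw [h4] at h1
  -- A quadratic lower bound meets a linear upper bound in the distance; one factor cancels unless
  -- the distance is zero.
  rcases (frob_nonneg (W - 1)).eq_or_lt with h | h
  · rw [← h]; linarith [frob_nonneg N, mul_zero δ]
  · have : δ * frob (W - 1) * frob (W - 1) ≤ 2 * frob N * frob (W - 1) := by nlinarith
    exact le_of_mul_le_mul_right this h

/-! ### Assembled block matrices -/

section assemble
variable {n K m : ℕ}

theorem block_assemble (C : Fin n → Fin K) (R : Fin n → Matrix (Fin d) (Fin d) ℝ) (i : Fin n)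
    (k : Fin K) : block (assemble C R) i k = if C i = k then R i else 0 := by
  ext a b
  by_cases h : C i = k <;> simp [block, assemble, h]

theorem block_mul {r s c : ℕ} (A : BlockMatrix r s d) (V : BlockMatrix s c d) (i : Fin r)
    (k : Fin c) : block (A * V) i k = ∑ j, block A i j * block V j k := by
  ext a b
  simp only [block, Matrix.of_apply, Matrix.mul_apply, Matrix.sum_apply]
  exact Fintype.sum_prod_type _

theorem block_sub {r c : ℕ} (X Y : BlockMatrix r c d) (i : Fin r) (k : Fin c) :
    block (X - Y) i k = block X i k - block Y i k := rfl

theorem block_ext {r c : ℕ} {X Y : BlockMatrix r c d} (h : ∀ i k, block X i k = block Y i k) :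
    X = Y := by
  ext ⟨i, a⟩ ⟨k, b⟩
  exact congrFun (congrFun (h i k) a) b

theorem ip_eq_sum_block {r c : ℕ} (X Y : BlockMatrix r c d) :
    ip X Y = ∑ i, ∑ k, ip (block X i k) (block Y i k) := by
  simp only [ip, block, Matrix.of_apply, Fintype.sum_prod_type]
  refine Finset.sum_congr rfl fun i _ => ?_
  exact Finset.sum_comm

theorem ip_assemble_left (C : Fin n → Fin K) (R : Fin n → Matrix (Fin d) (Fin d) ℝ)
    (X : BlockMatrix n K d) : ip (assemble C R) X = ∑ i, ip (R i) (block X i (C i)) := by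
  rw [ip_eq_sum_block]
  refine Finset.sum_congr rfl fun i _ => ?_
  rw [Finset.sum_eq_single (C i)]
  · rw [block_assemble, if_pos rfl]
  · intro k _ hk
    rw [block_assemble, if_neg (Ne.symm hk), ip_zero_left]
  · intro h; exact absurd (Finset.mem_univ _) h

theorem ip_assemble_self (C : Fin n → Fin K) {R : Fin n → Matrix (Fin d) (Fin d) ℝ}
    (hR : ∀ i, R i ∈ Orth d) : ip (assemble C R) (assemble C R) = n * d := by
  rw [ip_assemble_left]
  simp [block_assemble, ip_orth_self (hR _)]

/-- All feasible points have the squared norm `n d`. Hence distances compare like inner products,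
and these split over the rows. -/
theorem frob_assemble_sub_le_iff {C C' : Fin n → Fin K} {R R' : Fin n → Matrix (Fin d) (Fin d) ℝ}
    (hR : ∀ i, R i ∈ Orth d) (hR' : ∀ i, R' i ∈ Orth d) (X : BlockMatrix n K d) :
    frob (assemble C R - X) ≤ frob (assemble C' R' - X) ↔
      ∑ i, ip (R' i) (block X i (C' i)) ≤ ∑ i, ip (R i) (block X i (C i)) := by
  rw [← abs_of_nonneg (frob_nonneg (assemble C R - X)),
    ← abs_of_nonneg (frob_nonneg (assemble C' R' - X)), ← sq_le_sq, frob_sub_sq, frob_sub_sq,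
    ip_assemble_self C hR, ip_assemble_self C' hR', ip_assemble_left, ip_assemble_left]
  constructor <;> intro h <;> linarith

/-- A nearest point of the feasible set has an optimal assignment and polar factors as blocks. -/
theorem isNearest_feasible_spec {X W : BlockMatrix n K d}
    (h : IsNearest (feasible .orthogonal n K d m) X W) :
    ∃ (C : Fin n → Fin K) (R : Fin n → Matrix (Fin d) (Fin d) ℝ),
      Balanced m C ∧ (∀ i, R i ∈ Orth d) ∧ W = assemble C R ∧
      (∀ i, ∀ U ∈ Orth d, ip U (block X i (C i)) ≤ ip (R i) (block X i (C i))) ∧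
      ∀ C' : Fin n → Fin K, Balanced m C' →
        ∑ i, nuclearNorm (block X i (C' i)) ≤ ∑ i, nuclearNorm (block X i (C i)) := by
  obtain ⟨⟨C, R, hC, hR, rfl⟩, hmin⟩ := h
  have key : ∀ (C' : Fin n → Fin K) (R' : Fin n → Matrix (Fin d) (Fin d) ℝ), Balanced m C' →
      (∀ i, R' i ∈ Orth d) →
      ∑ i, ip (R' i) (block X i (C' i)) ≤ ∑ i, ip (R i) (block X i (C i)) := by
    intro C' R' hC' hR'
    exact (frob_assemble_sub_le_iff hR hR' X).1 (hmin _ ⟨C', R', hC', hR', rfl⟩)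
  refine ⟨C, R, hC, hR, rfl, ?_, ?_⟩
  · intro i U hU
    have h := key C (Function.update R i U) hC (by
      intro j
      by_cases hj : j = i
      · subst hj; simpa using hU
      · rw [Function.update_of_ne hj]; exact hR j)
    rw [← Finset.add_sum_erase _ _ (Finset.mem_univ i),
      ← Finset.add_sum_erase (f := fun i => ip (R i) (block X i (C i))) _ (Finset.mem_univ i),
      Function.update_self] at h
    have h2 : ∑ x ∈ Finset.univ.erase i, ip (Function.update R i U x) (block X x (C x)) =
        ∑ x ∈ Finset.univ.erase i, ip (R x) (block X x (C x)) :=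
      Finset.sum_congr rfl fun j hj => by
        rw [Function.update_of_ne (Finset.ne_of_mem_erase hj)]
    rw [h2] at h
    exact le_of_add_le_add_right h
  · intro C' hC'
    have h := key C' (fun i => nearestOrthogonal (block X i (C' i))) hC'
      fun i => nearestOrthogonal_mem _
    simp only [← nuclearNorm_eq_ip] at h
    exact h.trans (Finset.sum_le_sum fun i _ => ip_le_nuclearNorm (hR i) _)

/-- The converse of `isNearest_feasible_spec`: what the program computes is a legitimate next
iterate. -/
theorem isNearest_assemble {X : BlockMatrix n K d} {C : Fin n → Fin K} (hC : Balanced m C)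
    (hopt : ∀ C' : Fin n → Fin K, Balanced m C' →
      ∑ i, nuclearNorm (block X i (C' i)) ≤ ∑ i, nuclearNorm (block X i (C i))) :
    IsNearest (feasible .orthogonal n K d m) X
      (assemble C fun i => nearestOrthogonal (block X i (C i))) := by
  refine ⟨⟨C, _, hC, fun i => nearestOrthogonal_mem _, rfl⟩, ?_⟩
  rintro _ ⟨C', R', hC', hR', rfl⟩
  rw [frob_assemble_sub_le_iff (fun i => nearestOrthogonal_mem _) hR']
  simp only [← nuclearNorm_eq_ip]
  exact (Finset.sum_le_sum fun i _ => ip_le_nuclearNorm (hR' i) _).trans (hopt C' hC')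

end assemble

variable {n K m d : ℕ}

/-! ### Distance of assembled matrices -/

/-- The contribution of row `i` to the squared distance of two assembled matrices. -/
def rowDist (C C' : Fin n → Fin K) (R R' : Fin n → Matrix (Fin d) (Fin d) ℝ) (i : Fin n) : ℝ :=
  if C i = C' i then ip (R i - R' i) (R i - R' i) else 2 * d

theorem rowDist_nonneg (C C' : Fin n → Fin K) (R R' : Fin n → Matrix (Fin d) (Fin d) ℝ)
    (i : Fin n) : 0 ≤ rowDist C C' R R' i := by
  unfold rowDist
  split_ifs
  · exact ip_self_nonneg _
  · positivity

theorem ip_assemble_sub_self {C C' : Fin n → Fin K} {R R' : Fin n → Matrix (Fin d) (Fin d) ℝ}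
    (hR : ∀ i, R i ∈ Orth d) (hR' : ∀ i, R' i ∈ Orth d) :
    ip (assemble C R - assemble C' R') (assemble C R - assemble C' R') =
      ∑ i, rowDist C C' R R' i := by
  rw [ip_sub_left, ip_sub_right, ip_sub_right, ip_comm (assemble C' R') (assemble C R),
    ip_assemble_left, ip_assemble_left, ip_assemble_left, ← Finset.sum_sub_distrib,
    ← Finset.sum_sub_distrib, ← Finset.sum_sub_distrib]
  refine Finset.sum_congr rfl fun i _ => ?_
  rw [block_assemble, block_assemble, block_assemble, if_pos rfl, if_pos rfl, rowDist]
  by_cases h : C i = C' i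
  · rw [if_pos h, if_pos h.symm, ip_sub_left, ip_sub_right, ip_sub_right, ip_comm (R' i) (R i)]
  · rw [if_neg h, if_neg (Ne.symm h), ip_zero_right, ip_orth_self (hR i), ip_orth_self (hR' i)]
    ring

/-- The error of a nearest feasible point to `Y + N + F`, where `Y` prefers the target with the
gap `g` and `N` is small and does not rotate the target. -/
theorem ip_nearest_sub_target_le {X Y N F W : BlockMatrix n K d} {Ct : Fin n → Fin K}
    {S : Fin n → Matrix (Fin d) (Fin d) ℝ} {δ : Fin n → ℝ} {g : ℝ} (hd : 1 ≤ d) (hg : 0 < g)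
    (hX : X = Y + N + F) (hCt : Balanced m Ct) (hS : ∀ i, S i ∈ Orth d)
    (hgap : ∀ i k, k ≠ Ct i →
      g ≤ nuclearNorm (block Y i (Ct i)) - nuclearNorm (block Y i k))
    (hdiag : ∀ i, block Y i (Ct i) = δ i • S i) (hδ : ∀ i, g ≤ δ i * d)
    (hN : ∀ i k, nuclearNorm (block N i k) ≤ g / (4 * d))
    (hsym : ∀ i, ((S i).transpose * block N i (Ct i)).transpose =
      (S i).transpose * block N i (Ct i))
    (hW : IsNearest (feasible .orthogonal n K d m) X W) :
    g ^ 2 * ip (W - assemble Ct S) (W - assemble Ct S) ≤ 16 * d ^ 2 * ip F F := by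
  obtain ⟨C, R, hC, hR, rfl, hloc, hglob⟩ := isNearest_feasible_spec hW
  have hd' : (1 : ℝ) ≤ d := by exact_mod_cast hd
  have hd0 : (0 : ℝ) < d := by linarith
  have hXb : ∀ i k, block X i k = block Y i k + block N i k + block F i k := by
    intro i k; rw [hX]; rfl
  -- The loss of row `i` against the target cluster. It is zero on correct rows, and optimality of
  -- the assignment makes the total nonpositive.
  set t : Fin n → ℝ := fun i =>
    nuclearNorm (block X i (Ct i)) - nuclearNorm (block X i (C i)) with ht
  set φ : Fin n → ℝ := fun i => ∑ k, ip (block F i k) (block F i k) with hφ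
  have hφ1 : ∀ i k, ip (block F i k) (block F i k) ≤ φ i := fun i k =>
    Finset.single_le_sum (f := fun k => ip (block F i k) (block F i k))
      (fun k _ => ip_self_nonneg _) (Finset.mem_univ k)
  have hφ2 : ∀ i k l, k ≠ l →
      ip (block F i k) (block F i k) + ip (block F i l) (block F i l) ≤ φ i := by
    intro i k l hkl
    rw [← Finset.sum_pair (f := fun k => ip (block F i k) (block F i k)) hkl]
    exact Finset.sum_le_sum_of_subset_of_nonneg (Finset.subset_univ _)
      fun k _ _ => ip_self_nonneg _
  have htsum : ∑ i, t i ≤ 0 := by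
    rw [ht, Finset.sum_sub_distrib]; linarith [hglob Ct hCt]
  -- The row estimate may contain a multiple of `t i`, because this drops out on summation.
  have hrow : ∀ i, g ^ 2 * rowDist C Ct R S i ≤ 16 * d ^ 2 * φ i + 8 * d * g * t i := by
    intro i
    by_cases hi : C i = Ct i
    · have ht0 : t i = 0 := by simp only [ht, hi, sub_self]
      rw [rowDist, if_pos hi, ht0, mul_zero, add_zero]
      set M := block N i (Ct i)
      set F' := block F i (Ct i)
      have hStS := orth_transpose_mul (hS i)
      have hXS : ((δ i • 1 + (S i).transpose * M : Matrix (Fin d) (Fin d) ℝ)).transpose =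
          δ i • 1 + (S i).transpose * M := by
        rw [Matrix.transpose_add, hsym i, Matrix.transpose_smul, Matrix.transpose_one]
      -- The multiple of the identity is at least `g / d`, and `N` consumes at most a quarter of it.
      have hpos : ∀ x : Fin d → ℝ, (3 / 4 * (g / d)) * (x ⬝ᵥ x) ≤
          x ⬝ᵥ (δ i • 1 + (S i).transpose * M : Matrix (Fin d) (Fin d) ℝ).mulVec x := by
        intro x
        rw [Matrix.add_mulVec, dotProduct_add, Matrix.smul_mulVec, Matrix.one_mulVec,
          dotProduct_smul, smul_eq_mul]
        have h1 := neg_nuclearNorm_mul_le ((S i).transpose * M) x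
        rw [nuclearNorm_orth_mul (orth_transpose (hS i))] at h1
        have h2 : g / d ≤ δ i := (div_le_iff₀ hd0).2 (hδ i)
        have h3 := hN i (Ct i)
        have h4 : g / (4 * d) = 1 / 4 * (g / d) := by field_simp
        rw [h4] at h3
        have h5 : 0 ≤ x ⬝ᵥ x := by
          simpa using dotProduct_self_star_nonneg x
        nlinarith
      have hmax := hloc i (S i) (hS i)
      rw [hi, hXb, hdiag] at hmax
      have e1 : (S i).transpose * (δ i • S i + M + F') =
          (δ i • 1 + (S i).transpose * M) + (S i).transpose * F' := by
        rw [mul_add, mul_add, Matrix.mul_smul, hStS]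
      have hmax2 : ip 1 ((δ i • 1 + (S i).transpose * M) + (S i).transpose * F') ≤
          ip ((S i).transpose * R i)
            ((δ i • 1 + (S i).transpose * M) + (S i).transpose * F') := by
        rw [← e1, ip_mul_orth_left (orth_transpose (hS i)), ← ip_mul_left, Matrix.mul_one]
        exact hmax
      have h := frob_sub_one_le hXS hpos (orth_mul (orth_transpose (hS i)) (hR i)) hmax2
      have e2 : frob ((S i).transpose * R i - 1) ^ 2 = ip (R i - S i) (R i - S i) := by
        rw [← hStS, ← mul_sub, frob_sq, ip_mul_orth_left (orth_transpose (hS i))]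
      have e3 : frob ((S i).transpose * F') ^ 2 = ip F' F' := by
        rw [frob_sq, ip_mul_orth_left (orth_transpose (hS i))]
      have h2 := pow_le_pow_left₀ (mul_nonneg (by positivity) (frob_nonneg _)) h 2
      rw [mul_pow, mul_pow 2, e2, e3] at h2
      have h3 := hφ1 i (Ct i)
      have e4 : (3 / 4 * (g / d)) ^ 2 * ip (R i - S i) (R i - S i) =
          9 / 16 * (g ^ 2 * ip (R i - S i) (R i - S i)) / d ^ 2 := by
        field_simp; ring
      rw [e4, div_le_iff₀ (by positivity)] at h2
      have h5 : ip F' F' * (d : ℝ) ^ 2 ≤ φ i * (d : ℝ) ^ 2 :=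
        mul_le_mul_of_nonneg_right h3 (by positivity)
      have h6 : 0 ≤ φ i * (d : ℝ) ^ 2 := (mul_nonneg (ip_self_nonneg _) (by positivity)).trans h5
      linarith
    · rw [rowDist, if_neg hi]
      have h1 := hgap i (C i) hi
      have h2 : nuclearNorm (block Y i (Ct i)) ≤
          nuclearNorm (block X i (Ct i)) + nuclearNorm (block N i (Ct i)) +
            nuclearNorm (block F i (Ct i)) := by
        rw [hXb, add_assoc, add_assoc]
        refine (nuclearNorm_le_add _ (block N i (Ct i) + block F i (Ct i))).trans ?_
        exact add_le_add le_rfl (nuclearNorm_add_le _ _)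
      have h3 : nuclearNorm (block X i (C i)) ≤
          nuclearNorm (block Y i (C i)) + nuclearNorm (block N i (C i)) +
            nuclearNorm (block F i (C i)) := by
        rw [hXb]
        refine (nuclearNorm_add_le _ _).trans ?_
        exact add_le_add (nuclearNorm_add_le _ _) le_rfl
      have h4 := hN i (C i)
      have h5 := hN i (Ct i)
      have h6 : g / (4 * d) ≤ g / 4 := by
        apply div_le_div_of_nonneg_left hg.le (by norm_num); linarith
      have h7 := nuclearNorm_le_sqrt_mul_frob (block F i (Ct i))
      have h8 := nuclearNorm_le_sqrt_mul_frob (block F i (C i))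
      have h9 := hφ2 i (Ct i) (C i) (Ne.symm hi)
      rw [← frob_sq, ← frob_sq] at h9
      set f1 := frob (block F i (Ct i))
      set f2 := frob (block F i (C i))
      have hs : Real.sqrt d ^ 2 = d := Real.sq_sqrt hd0.le
      set r := Real.sqrt d
      -- From `g x ≤ g² / 4 + x²`, where two different blocks of the same row share `φ i`.
      have h10 : g * (r * f1 + r * f2) ≤ g ^ 2 / 4 + 2 * d * φ i := by
        have : (r * f1 + r * f2) ^ 2 ≤ 2 * d * φ i := by
          have : (r * f1 + r * f2) ^ 2 = d * (f1 + f2) ^ 2 := by rw [← hs]; ring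
          rw [this]
          nlinarith [sq_nonneg (f1 - f2)]
        nlinarith [sq_nonneg (g / 2 - (r * f1 + r * f2))]
      -- The two blocks of `N` use up at most `g / 4` each of the gap `g`.
      have h11 : g / 2 - (r * f1 + r * f2) ≤ t i := by simp only [ht]; linarith
      have h12 : g * (g / 2 - (r * f1 + r * f2)) ≤ g * t i := mul_le_mul_of_nonneg_left h11 hg.le
      have h13 : g ^ 2 / 4 ≤ 2 * d * φ i + g * t i := by nlinarith
      have h14 := mul_le_mul_of_nonneg_left h13 (show (0 : ℝ) ≤ 8 * d by positivity)
      nlinarith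
  rw [ip_assemble_sub_self hR hS, Finset.mul_sum]
  have hF : ip F F = ∑ i, φ i := ip_eq_sum_block F F
  calc ∑ i, g ^ 2 * rowDist C Ct R S i ≤ ∑ i, (16 * d ^ 2 * φ i + 8 * d * g * t i) :=
        Finset.sum_le_sum fun i _ => hrow i
    _ = 16 * d ^ 2 * ip F F + 8 * d * g * ∑ i, t i := by
        rw [Finset.sum_add_distrib, ← Finset.mul_sum, ← Finset.mul_sum, hF]
    _ ≤ 16 * d ^ 2 * ip F F := by
        have : 0 ≤ 8 * (d : ℝ) * g := by positivity
        nlinarith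

/-! ### The mean part of the perturbation -/

theorem ip_le_trace_of_posSemidef {P O : Matrix (Fin d) (Fin d) ℝ} (hP : P.transpose = P)
    (hpos : ∀ x : Fin d → ℝ, 0 ≤ x ⬝ᵥ P.mulVec x) (hO : O ∈ Orth d) : ip O P ≤ P.trace := by
  have h1 := ip_mul_self_ge (δ := 0) (fun x => by rw [zero_mul]; exact hpos x) (1 - O)
  rw [zero_mul, ip_one_sub_eq hP hO, ip_sub_left, ip_one_left] at h1
  linarith

theorem dotProduct_orth_mulVec_le {O : Matrix (Fin d) (Fin d) ℝ} (hO : O ∈ Orth d)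
    (x : Fin d → ℝ) : x ⬝ᵥ O.mulVec x ≤ x ⬝ᵥ x := by
  have h1 : O.mulVec x ⬝ᵥ O.mulVec x = x ⬝ᵥ x := by
    rw [Matrix.dotProduct_mulVec, Matrix.vecMul_mulVec, orth_transpose_mul hO,
      Matrix.vecMul_one]
  have h2 : 0 ≤ (O.mulVec x - x) ⬝ᵥ (O.mulVec x - x) := by
    simpa using dotProduct_self_star_nonneg (O.mulVec x - x)
  rw [sub_dotProduct, dotProduct_sub, dotProduct_sub, h1, dotProduct_comm (O.mulVec x) x] at h2
  linarith

/-- The ground truth, relabelled by `s` and rotated by `U`. -/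
def target (Cs : Fin n → Fin K) (Rs : Fin n → Matrix (Fin d) (Fin d) ℝ)
    (s : Equiv.Perm (Fin K)) (U : Fin K → Matrix (Fin d) (Fin d) ℝ) : BlockMatrix n K d :=
  assemble (fun i => s (Cs i)) fun i => Rs i * U (Cs i)

/-- The correlation of `assemble C R` with the `l`-th true cluster, relabelled by `s`. -/
def corr (Cs C : Fin n → Fin K) (Rs R : Fin n → Matrix (Fin d) (Fin d) ℝ)
    (s : Equiv.Perm (Fin K)) (l : Fin K) : Matrix (Fin d) (Fin d) ℝ :=
  ∑ j with Cs j = l, if C j = s l then (Rs j).transpose * R j else 0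

/-- The rotations that align the true clusters best with `assemble C R`. -/
def align (Cs C : Fin n → Fin K) (Rs R : Fin n → Matrix (Fin d) (Fin d) ℝ)
    (s : Equiv.Perm (Fin K)) (l : Fin K) : Matrix (Fin d) (Fin d) ℝ :=
  nearestOrthogonal (corr Cs C Rs R s l)

section mean
variable {Cs C : Fin n → Fin K} {Rs R : Fin n → Matrix (Fin d) (Fin d) ℝ}
  {s : Equiv.Perm (Fin K)}

theorem align_mem (l : Fin K) : align Cs C Rs R s l ∈ Orth d := nearestOrthogonal_mem _

theorem sum_fiber (f : Fin n → ℝ) : ∑ l : Fin K, ∑ j with Cs j = l, f j = ∑ j, f j :=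
  Finset.sum_fiberwise _ _ _

theorem ip_target_eq (U : Fin K → Matrix (Fin d) (Fin d) ℝ) :
    ip (target Cs Rs s U) (assemble C R) = ∑ l, ip (U l) (corr Cs C Rs R s l) := by
  rw [target, ip_assemble_left, ← sum_fiber (Cs := Cs)]
  refine Finset.sum_congr rfl fun l _ => ?_
  rw [corr, ip_sum_right]
  refine Finset.sum_congr rfl fun j hj => ?_
  have hj' : Cs j = l := (Finset.mem_filter.1 hj).2
  rw [hj', block_assemble]
  split_ifs
  · rw [ip_mul_left]
  · rw [ip_zero_right, ip_zero_right]

/-- Realigning never increases the error, so every iteration may start from the best rotations. -/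
theorem ip_sub_target_align_le (hRs : ∀ i, Rs i ∈ Orth d)
    {U : Fin K → Matrix (Fin d) (Fin d) ℝ} (hU : ∀ k, U k ∈ Orth d) :
    ip (assemble C R - target Cs Rs s (align Cs C Rs R s))
        (assemble C R - target Cs Rs s (align Cs C Rs R s)) ≤
      ip (assemble C R - target Cs Rs s U) (assemble C R - target Cs Rs s U) := by
  have h : ∑ l, ip (U l) (corr Cs C Rs R s l) ≤
      ∑ l, ip (align Cs C Rs R s l) (corr Cs C Rs R s l) :=
    Finset.sum_le_sum fun l _ => ip_le_ip_nearestOrthogonal _ (hU l)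
  rw [← ip_target_eq, ← ip_target_eq] at h
  rw [← frob_sq, ← frob_sq, frob_sub_sq, frob_sub_sq,
    ip_comm (assemble C R) (target Cs Rs s U), ip_comm (assemble C R) (target Cs Rs s _)]
  have e1 : ∀ U' : Fin K → Matrix (Fin d) (Fin d) ℝ, (∀ k, U' k ∈ Orth d) →
      ip (target Cs Rs s U') (target Cs Rs s U') = n * d := fun U' hU' =>
    ip_assemble_self _ fun i => orth_mul (hRs i) (hU' _)
  rw [e1 _ hU, e1 _ align_mem]
  linarith

theorem symm_align (l : Fin K) :
    ((align Cs C Rs R s l).transpose * corr Cs C Rs R s l).transpose =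
      (align Cs C Rs R s l).transpose * corr Cs C Rs R s l :=
  symm_of_trace_max (ip_le_trace_of_max (align_mem l) fun _ hU => ip_le_ip_nearestOrthogonal _ hU)

/-- The correlation of the difference to the target with the `l`-th true cluster. -/
def diffCorr (Cs C : Fin n → Fin K) (Rs R : Fin n → Matrix (Fin d) (Fin d) ℝ)
    (s : Equiv.Perm (Fin K)) (l k : Fin K) : Matrix (Fin d) (Fin d) ℝ :=
  ∑ j with Cs j = l, (Rs j).transpose *
    block (assemble C R - target Cs Rs s (align Cs C Rs R s)) j k

theorem diffCorr_self (hCs : Balanced m Cs) (hRs : ∀ i, Rs i ∈ Orth d) (l : Fin K) :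
    diffCorr Cs C Rs R s l (s l) = corr Cs C Rs R s l - (m : ℝ) • align Cs C Rs R s l := by
  have h : (m : ℝ) • align Cs C Rs R s l = ∑ j with Cs j = l, align Cs C Rs R s l := by
    rw [Finset.sum_const, hCs l, Nat.cast_smul_eq_nsmul]
  rw [h, corr, ← Finset.sum_sub_distrib]
  refine Finset.sum_congr rfl fun j hj => ?_
  have hj' : Cs j = l := (Finset.mem_filter.1 hj).2
  rw [block_sub, target, block_assemble, block_assemble, hj', if_pos rfl, mul_sub,
    ← Matrix.mul_assoc, orth_transpose_mul (hRs j), Matrix.one_mul, mul_ite, Matrix.mul_zero]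

/-- Distance of row `j` to the aligned target. -/
abbrev alignDist (Cs C : Fin n → Fin K) (Rs R : Fin n → Matrix (Fin d) (Fin d) ℝ)
    (s : Equiv.Perm (Fin K)) (j : Fin n) : ℝ :=
  rowDist C (fun i => s (Cs i)) R (fun i => Rs i * align Cs C Rs R s (Cs i)) j

/-- The gain from first to second order. In the block of the right cluster, optimal alignment makes
`m - Uᵀ B` symmetric, and it is positive semidefinite because `B` sums at most `m` orthogonal
matrices; its nuclear norm is thus at most its trace, which is half the squared distance. In the
other blocks only misassigned rows contribute, each with nuclear norm `d`, half of the squared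
distance `2 d`. -/
theorem nuclearNorm_diffCorr_le (hCs : Balanced m Cs) (hRs : ∀ i, Rs i ∈ Orth d)
    (hR : ∀ i, R i ∈ Orth d) (l k : Fin K) :
    nuclearNorm (diffCorr Cs C Rs R s l k) ≤ 1 / 2 * ∑ j with Cs j = l, alignDist Cs C Rs R s j := by
  by_cases hk : k = s l
  · subst hk
    set U := align Cs C Rs R s l with hU
    set B := corr Cs C Rs R s l with hB
    have hUo : U ∈ Orth d := align_mem l
    set P : Matrix (Fin d) (Fin d) ℝ := (m : ℝ) • 1 - U.transpose * B with hP
    have hPs : P.transpose = P := by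
      rw [hP, Matrix.transpose_sub, symm_align, Matrix.transpose_smul, Matrix.transpose_one]
    have hpos : ∀ x : Fin d → ℝ, 0 ≤ x ⬝ᵥ P.mulVec x := by
      intro x
      rw [hP, Matrix.sub_mulVec, dotProduct_sub, Matrix.smul_mulVec, Matrix.one_mulVec,
        dotProduct_smul, smul_eq_mul]
      have e : x ⬝ᵥ (U.transpose * B).mulVec x = ∑ j with Cs j = l,
          x ⬝ᵥ (if C j = s l then U.transpose * ((Rs j).transpose * R j) else 0).mulVec x := by
        rw [hB, corr, Matrix.mul_sum, Matrix.sum_mulVec, dotProduct_sum]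
        refine Finset.sum_congr rfl fun j _ => ?_
        rw [mul_ite, Matrix.mul_zero]
      rw [e]
      have hx0 : 0 ≤ x ⬝ᵥ x := by simpa using dotProduct_self_star_nonneg x
      have : ∑ j with Cs j = l,
          x ⬝ᵥ (if C j = s l then U.transpose * ((Rs j).transpose * R j) else 0).mulVec x ≤
          ∑ j with Cs j = l, x ⬝ᵥ x := by
        refine Finset.sum_le_sum fun j _ => ?_
        split_ifs
        · exact dotProduct_orth_mulVec_le
            (orth_mul (orth_transpose hUo) (orth_mul (orth_transpose (hRs j)) (hR j))) x
        · simpa using hx0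
      rw [Finset.sum_const, hCs l, nsmul_eq_mul] at this
      linarith
    have htr : P.trace = m * d - ip U B := by
      rw [hP, Matrix.trace_sub, Matrix.trace_smul, Matrix.trace_one, ← ip_eq_trace]
      simp
    have hsum : P.trace = 1 / 2 * ∑ j with Cs j = l, alignDist Cs C Rs R s j := by
      have : (m : ℝ) * d = ∑ j with Cs j = l, (d : ℝ) := by
        rw [Finset.sum_const, hCs l, nsmul_eq_mul]
      rw [htr, this, hB, corr, ip_sum_right, ← Finset.sum_sub_distrib, Finset.mul_sum]
      refine Finset.sum_congr rfl fun j hj => ?_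
      have hj' : Cs j = l := (Finset.mem_filter.1 hj).2
      rw [alignDist, rowDist, hj']
      split_ifs with h
      · rw [← frob_sq, frob_sub_sq, ip_orth_self (hR j), ip_orth_self (orth_mul (hRs j) hUo),
          ip_comm (R j), ip_mul_left]
        ring
      · rw [ip_zero_right]; ring
    refine nuclearNorm_le fun O hO => ?_
    rw [diffCorr_self hCs hRs, ← hsum]
    have h1 := ip_le_trace_of_posSemidef hPs hpos (orth_neg (orth_mul (orth_transpose hUo) hO))
    have e : ip O (B - (m : ℝ) • U) = ip (-(U.transpose * O)) P := by
      rw [hP, ip_neg_left, ← ip_mul_orth_left (orth_transpose hUo), mul_sub, Matrix.mul_smul,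
        orth_transpose_mul hUo, ← ip_neg_right, neg_sub]
    exact e.trans_le h1
  · rw [Finset.mul_sum, diffCorr]
    refine (nuclearNorm_sum_le _ _).trans (Finset.sum_le_sum fun j hj => ?_)
    have hj' : Cs j = l := (Finset.mem_filter.1 hj).2
    rw [nuclearNorm_orth_mul (orth_transpose (hRs j)), block_sub, target, block_assemble,
      block_assemble, hj', if_neg (Ne.symm hk), sub_zero]
    split_ifs with h
    · rw [nuclearNorm_orth (hR j), alignDist, rowDist, hj', h, if_neg hk]; linarith
    · rw [nuclearNorm_zero]
      exact mul_nonneg (by norm_num) (rowDist_nonneg _ _ _ _ _)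

/-- The product of the mean with the difference to the target. -/
theorem block_mean_mul {Ab : BlockMatrix n n d} {c : Fin K → Fin K → ℝ}
    (hAb : ∀ i j, block Ab i j = c (Cs i) (Cs j) • (Rs i * (Rs j).transpose)) (i : Fin n)
    (k : Fin K) :
    block (Ab * (assemble C R - target Cs Rs s (align Cs C Rs R s))) i k =
      Rs i * ∑ l, c (Cs i) l • diffCorr Cs C Rs R s l k := by
  rw [block_mul, Matrix.mul_sum, ← Finset.sum_fiberwise (s := Finset.univ) (g := Cs)]
  refine Finset.sum_congr rfl fun l _ => ?_
  rw [diffCorr, Finset.smul_sum, Matrix.mul_sum]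
  refine Finset.sum_congr rfl fun j hj => ?_
  have hj' : Cs j = l := (Finset.mem_filter.1 hj).2
  rw [hAb, hj', Matrix.smul_mul, Matrix.mul_smul, Matrix.mul_assoc]

theorem nuclearNorm_block_mean_le (hCs : Balanced m Cs) (hRs : ∀ i, Rs i ∈ Orth d)
    (hR : ∀ i, R i ∈ Orth d) {Ab : BlockMatrix n n d} {c : Fin K → Fin K → ℝ} {c0 : ℝ}
    (hAb : ∀ i j, block Ab i j = c (Cs i) (Cs j) • (Rs i * (Rs j).transpose))
    (hc : ∀ k l, 0 ≤ c k l) (hc0 : ∀ k l, c k l ≤ c0) (i : Fin n) (k : Fin K) :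
    nuclearNorm (block (Ab * (assemble C R - target Cs Rs s (align Cs C Rs R s))) i k) ≤
      c0 / 2 * ip (assemble C R - target Cs Rs s (align Cs C Rs R s))
        (assemble C R - target Cs Rs s (align Cs C Rs R s)) := by
  rw [block_mean_mul hAb, nuclearNorm_orth_mul (hRs i), target,
    ip_assemble_sub_self hR fun i => orth_mul (hRs i) (align_mem _), ← sum_fiber (Cs := Cs),
    Finset.mul_sum]
  refine (nuclearNorm_sum_le _ _).trans (Finset.sum_le_sum fun l _ => ?_)
  refine (nuclearNorm_smul_le (hc _ _) _).trans ?_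
  have h1 := nuclearNorm_diffCorr_le (s := s) (C := C) hCs hRs hR l k
  have h2 : 0 ≤ ∑ j with Cs j = l, alignDist Cs C Rs R s j :=
    Finset.sum_nonneg fun j _ => rowDist_nonneg _ _ _ _ _
  calc c (Cs i) l * nuclearNorm (diffCorr Cs C Rs R s l k)
      ≤ c (Cs i) l * (1 / 2 * ∑ j with Cs j = l, alignDist Cs C Rs R s j) :=
        mul_le_mul_of_nonneg_left h1 (hc _ _)
    _ ≤ c0 * (1 / 2 * ∑ j with Cs j = l, alignDist Cs C Rs R s j) :=
        mul_le_mul_of_nonneg_right (hc0 _ _) (by positivity)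
    _ = _ := by ring

/-- If the mean vanishes between clusters, only the own cluster contributes, through a matrix that
alignment makes symmetric. Otherwise the blocks are `1 × 1` and symmetry is free. -/
theorem symm_block_mean (hCs : Balanced m Cs) (hRs : ∀ i, Rs i ∈ Orth d)
    {Ab : BlockMatrix n n d} {c : Fin K → Fin K → ℝ}
    (hAb : ∀ i j, block Ab i j = c (Cs i) (Cs j) • (Rs i * (Rs j).transpose))
    (hc : (∀ k l, k ≠ l → c k l = 0) ∨ d = 1) (i : Fin n) :
    ((Rs i * align Cs C Rs R s (Cs i)).transpose *
        block (Ab * (assemble C R - target Cs Rs s (align Cs C Rs R s))) i (s (Cs i))).transpose =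
      (Rs i * align Cs C Rs R s (Cs i)).transpose *
        block (Ab * (assemble C R - target Cs Rs s (align Cs C Rs R s))) i (s (Cs i)) := by
  rcases hc with hc | hc
  · rw [block_mean_mul hAb, Finset.sum_eq_single (Cs i), diffCorr_self hCs hRs,
      Matrix.transpose_mul (Rs i), Matrix.mul_assoc, ← Matrix.mul_assoc (Rs i).transpose,
      orth_transpose_mul (hRs i), Matrix.one_mul, Matrix.mul_smul, Matrix.transpose_smul, mul_sub,
      Matrix.transpose_sub, symm_align, Matrix.mul_smul, orth_transpose_mul (align_mem _),
      Matrix.transpose_smul, Matrix.transpose_one]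
    · intro l _ hl
      rw [hc _ _ (Ne.symm hl), zero_smul]
    · intro h; exact absurd (Finset.mem_univ _) h
  · subst hc
    ext a b
    rw [Subsingleton.elim a b]; rfl

end mean

variable {n K m d : ℕ}

section target
variable {Cs : Fin n → Fin K} {Rs : Fin n → Matrix (Fin d) (Fin d) ℝ}
  {s : Equiv.Perm (Fin K)} {U : Fin K → Matrix (Fin d) (Fin d) ℝ}

theorem block_mul_target (A : BlockMatrix n n d) (i : Fin n) (k : Fin K) :
    block (A * target Cs Rs s U) i k =
      block (A * assemble Cs Rs) i (s.symm k) * U (s.symm k) := by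
  rw [block_mul, block_mul, Matrix.sum_mul]
  refine Finset.sum_congr rfl fun j _ => ?_
  rw [target, block_assemble, block_assemble]
  by_cases h : Cs j = s.symm k
  · rw [if_pos h, if_pos (by rw [h, Equiv.apply_symm_apply]), h, Matrix.mul_assoc]
  · rw [if_neg h, if_neg (fun h' => h (by rw [← h', Equiv.symm_apply_apply])), Matrix.mul_zero,
      Matrix.zero_mul]

theorem balanced_comp_perm (hCs : Balanced m Cs) (s : Equiv.Perm (Fin K)) :
    Balanced m fun i => s (Cs i) := by
  intro k
  rw [← hCs (s.symm k)]
  congr 1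
  ext i
  simp [Equiv.eq_symm_apply]

/-- The orbit of the ground truth under `permGroup` is the family of targets, so `estError` is the
distance to the nearest target. -/
theorem assemble_mul_perm (U : Fin K → Matrix (Fin d) (Fin d) ℝ) (s : Equiv.Perm (Fin K)) :
    assemble Cs Rs * (assemble id U *
      Matrix.kroneckerMap (fun x y => x * y) (s.permMatrix ℝ) (1 : Matrix (Fin d) (Fin d) ℝ)) =
      target Cs Rs s U := by
  have hP : ∀ k l, block (Matrix.kroneckerMap (fun x y => x * y) (s.permMatrix ℝ)
      (1 : Matrix (Fin d) (Fin d) ℝ)) k l = if s k = l then 1 else 0 := by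
    intro k l
    ext a b
    by_cases h : s k = l <;>
      simp [block, Matrix.kroneckerMap_apply, Equiv.Perm.permMatrix, PEquiv.toMatrix_apply, h]
  refine block_ext fun i l => ?_
  rw [block_mul, Finset.sum_eq_single (Cs i), block_assemble, if_pos rfl, block_mul,
    Finset.sum_eq_single (Cs i), block_assemble, id, if_pos rfl, hP, target, block_assemble]
  · by_cases h : s (Cs i) = l <;> simp [h]
  · intro k _ hk
    rw [block_assemble, id, if_neg (Ne.symm hk), Matrix.zero_mul]
  · intro h; exact absurd (Finset.mem_univ _) h
  · intro k _ hk
    rw [block_assemble, if_neg (Ne.symm hk), Matrix.zero_mul]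
  · intro h; exact absurd (Finset.mem_univ _) h

theorem estError_le {G : GroupKind} (hU : ∀ k, U k ∈ G.carrier d) (V : BlockMatrix n K d) :
    estError G (assemble Cs Rs) V ≤ frob (V - target Cs Rs s U) := by
  refine csInf_le ⟨0, ?_⟩ ⟨_, ⟨U, s, hU, rfl⟩, by rw [assemble_mul_perm]⟩
  rintro _ ⟨Q, _, rfl⟩
  exact frob_nonneg _

theorem exists_target_of_estError_lt {G : GroupKind} {V : BlockMatrix n K d} {e : ℝ}
    (h : estError G (assemble Cs Rs) V < e) :
    ∃ (s : Equiv.Perm (Fin K)) (U : Fin K → Matrix (Fin d) (Fin d) ℝ),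
      (∀ k, U k ∈ G.carrier d) ∧ frob (V - target Cs Rs s U) < e := by
  have hne : {r | ∃ Q ∈ permGroup G K d, r = frob (V - assemble Cs Rs * Q)}.Nonempty := by
    refine ⟨_, _, ⟨fun _ => 1, 1, fun _ => ?_, rfl⟩, rfl⟩
    exact ⟨1, by simp⟩
  obtain ⟨_, ⟨_, ⟨U, s, hU, rfl⟩, rfl⟩, hr⟩ := exists_lt_of_csInf_lt hne h
  rw [assemble_mul_perm] at hr
  exact ⟨s, U, hU, hr⟩

end target

/-! ### Contraction of the iteration -/

/-- `A` splits into a mean that is constant on pairs of clusters and a noise of norm at most `κ`,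
and separates the ground truth by the gap `g`. -/
structure GoodObservation (A : BlockMatrix n n d) (m : ℕ) (Cs : Fin n → Fin K)
    (Rs : Fin n → Matrix (Fin d) (Fin d) ℝ) (p q κ g : ℝ) : Prop where
  balanced : Balanced m Cs
  orth : ∀ i, Rs i ∈ Orth d
  split : ∃ Ab D : BlockMatrix n n d, A = Ab + D ∧
    (∀ i j, block Ab i j =
      (if Cs i = Cs j then p else q) • (Rs i * (Rs j).transpose)) ∧
    ∀ X : BlockMatrix n K d, frob (D * X) ≤ κ * frob X
  mean_off : q = 0 ∨ d = 1
  p_nonneg : 0 ≤ p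
  q_nonneg : 0 ≤ q
  gap_pos : 0 < g
  gap : ∀ i k, k ≠ Cs i → g ≤ nuclearNorm (block (A * assemble Cs Rs) i (Cs i)) -
    nuclearNorm (block (A * assemble Cs Rs) i k)
  diag : ∃ δ : Fin n → ℝ, (∀ i, 0 ≤ δ i) ∧
    ∀ i, block (A * assemble Cs Rs) i (Cs i) = δ i • Rs i

section contraction
variable {A : BlockMatrix n n d} {Cs : Fin n → Fin K} {Rs : Fin n → Matrix (Fin d) (Fin d) ℝ}
  {p q κ g : ℝ}

/-- After realignment, `ip_nearest_sub_target_le` is applied to the gap part `A target`, the mean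
part, which is small and does not rotate the target, and the noise part. Only the last one enters
the new error. -/
theorem GoodObservation.step (h : GoodObservation A m Cs Rs p q κ g) (hK : 2 ≤ K) (hd : 1 ≤ d)
    {s : Equiv.Perm (Fin K)} {U : Fin K → Matrix (Fin d) (Fin d) ℝ} (hU : ∀ k, U k ∈ Orth d)
    {V W : BlockMatrix n K d} (hV : V ∈ feasible .orthogonal n K d m)
    (hW : IsNearest (feasible .orthogonal n K d m) (A * V) W)
    {e : ℝ} (he : frob (V - target Cs Rs s U) ≤ e)
    (hsmall : max p q / 2 * e ^ 2 ≤ g / (4 * d)) (hκ : 8 * d * κ ≤ g) :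
    ∃ U' : Fin K → Matrix (Fin d) (Fin d) ℝ, (∀ k, U' k ∈ Orth d) ∧
      frob (W - target Cs Rs s U') ≤ e / 2 := by
  obtain ⟨C, R, -, hR, rfl⟩ := hV
  obtain ⟨Ab, D, rfl, hAb, hD⟩ := h.split
  obtain ⟨δ, hδ0, hδ⟩ := h.diag
  have hg := h.gap_pos
  set U' := align Cs C Rs R s with hU'
  have hU'o : ∀ k, U' k ∈ Orth d := align_mem
  have he' : frob (assemble C R - target Cs Rs s U') ≤ e := by
    refine le_trans ?_ he
    rw [frob_le_frob_iff]
    exact ip_sub_target_align_le h.orth hU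
  set E := assemble C R - target Cs Rs s U' with hE
  have hE2 : ip E E ≤ e ^ 2 := by
    rw [← frob_sq]; exact pow_le_pow_left₀ (frob_nonneg _) he' 2
  set c : Fin K → Fin K → ℝ := fun k l => if k = l then p else q with hc
  have hc0 : ∀ k l, 0 ≤ c k l := by
    intro k l; simp only [hc]; split_ifs; exacts [h.p_nonneg, h.q_nonneg]
  have hcm : ∀ k l, c k l ≤ max p q := by
    intro k l; simp only [hc]; split_ifs; exacts [le_max_left _ _, le_max_right _ _]
  have hcoff : (∀ k l, k ≠ l → c k l = 0) ∨ d = 1 := by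
    rcases h.mean_off with hq | h1
    · left; intro k l hkl; simp only [hc, if_neg hkl, hq]
    · exact Or.inr h1
  have hsplit : (Ab + D) * assemble C R =
      (Ab + D) * target Cs Rs s U' + Ab * E + D * E := by
    rw [add_assoc, ← Matrix.add_mul, ← Matrix.mul_add, hE, add_sub_cancel]
  have hbound := ip_nearest_sub_target_le (Ct := fun i => s (Cs i))
    (S := fun i => Rs i * U' (Cs i)) (δ := δ) hd hg hsplit (balanced_comp_perm h.balanced s)
    (fun i => orth_mul (h.orth i) (hU'o _))
    (by
      intro i k hk
      rw [block_mul_target, block_mul_target, nuclearNorm_mul_orth (hU'o _),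
        nuclearNorm_mul_orth (hU'o _), Equiv.symm_apply_apply]
      exact h.gap i _ fun hk' => hk (by rw [← hk', Equiv.apply_symm_apply]))
    (by
      intro i
      rw [block_mul_target, Equiv.symm_apply_apply, hδ, Matrix.smul_mul])
    (by
      intro i
      have : Nontrivial (Fin K) := Fin.nontrivial_iff_two_le.2 hK
      obtain ⟨k, hk⟩ := exists_ne (Cs i)
      have h1 := h.gap i k hk
      rw [hδ, nuclearNorm_smul_orth (hδ0 i) (h.orth i)] at h1
      linarith [nuclearNorm_nonneg (block ((Ab + D) * assemble Cs Rs) i k)])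
    (by
      intro i k
      refine (nuclearNorm_block_mean_le h.balanced h.orth hR hAb hc0 hcm i k).trans ?_
      refine le_trans ?_ hsmall
      exact mul_le_mul_of_nonneg_left hE2
        (div_nonneg (h.p_nonneg.trans (le_max_left _ _)) (by norm_num)))
    (by
      intro i
      exact symm_block_mean h.balanced h.orth hAb hcoff i)
    hW
  refine ⟨U', hU'o, ?_⟩
  change g ^ 2 * ip (W - target Cs Rs s U') (W - target Cs Rs s U') ≤ _ at hbound
  rw [← frob_sq, ← frob_sq] at hbound
  have h1 := hD E
  have h0 := frob_nonneg E
  have h3 := frob_nonneg (W - target Cs Rs s U')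
  have h4 : 4 * d * frob (D * E) ≤ g / 2 * e := by
    calc 4 * d * frob (D * E) ≤ 4 * d * (κ * frob E) :=
          mul_le_mul_of_nonneg_left h1 (by positivity)
      _ = (4 * d * κ) * frob E := by ring
      _ ≤ (g / 2) * frob E := mul_le_mul_of_nonneg_right (by linarith) h0
      _ ≤ g / 2 * e := mul_le_mul_of_nonneg_left he' (by positivity)
  have h5 : (g * frob (W - target Cs Rs s U')) ^ 2 ≤ (g / 2 * e) ^ 2 := by
    calc (g * frob (W - target Cs Rs s U')) ^ 2 = g ^ 2 * frob (W - target Cs Rs s U') ^ 2 := by ring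
      _ ≤ (4 * d * frob (D * E)) ^ 2 := by refine hbound.trans_eq ?_; ring
      _ ≤ _ := pow_le_pow_left₀ (mul_nonneg (by positivity) (frob_nonneg _)) h4 2
  have h6 := abs_le_of_sq_le_sq' h5 (mul_nonneg (by positivity) (h0.trans he'))
  have h7 : g * frob (W - target Cs Rs s U') ≤ g * (e / 2) := by linarith [h6.2]
  exact le_of_mul_le_mul_left h7 hg

/-- The smallness condition persists as the error shrinks. The relabelling `s` stays the same
throughout; only the rotations change. -/
theorem GoodObservation.iterate (h : GoodObservation A m Cs Rs p q κ g) (hK : 2 ≤ K) (hd : 1 ≤ d)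
    {s : Equiv.Perm (Fin K)} {U : Fin K → Matrix (Fin d) (Fin d) ℝ} (hU : ∀ k, U k ∈ Orth d)
    {V : ℕ → BlockMatrix n K d} (hV : V 0 ∈ feasible .orthogonal n K d m) {T : ℕ}
    (hW : ∀ t < T, IsNearest (feasible .orthogonal n K d m) (A * V t) (V (t + 1)))
    {e : ℝ} (he : frob (V 0 - target Cs Rs s U) ≤ e)
    (hsmall : max p q / 2 * e ^ 2 ≤ g / (4 * d)) (hκ : 8 * d * κ ≤ g) :
    V T ∈ feasible .orthogonal n K d m ∧
    ∃ U' : Fin K → Matrix (Fin d) (Fin d) ℝ, (∀ k, U' k ∈ Orth d) ∧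
      frob (V T - target Cs Rs s U') ≤ e / 2 ^ T := by
  induction T with
  | zero => exact ⟨hV, U, hU, by simpa using he⟩
  | succ T ih =>
    obtain ⟨hVT, U₁, hU₁, he₁⟩ := ih fun t ht => hW t (ht.trans (Nat.lt_succ_self T))
    have hWT := hW T (Nat.lt_succ_self T)
    refine ⟨hWT.1, ?_⟩
    have he0 : 0 ≤ e := (frob_nonneg _).trans he
    have hle : (e / 2 ^ T) ^ 2 ≤ e ^ 2 :=
      pow_le_pow_left₀ (by positivity)
        (div_le_self he0 (one_le_pow₀ (by norm_num))) 2
    obtain ⟨U', hU', hb⟩ := h.step hK hd hU₁ hVT hWT he₁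
      ((mul_le_mul_of_nonneg_left hle
        (div_nonneg (h.p_nonneg.trans (le_max_left _ _)) (by norm_num))).trans hsmall) hκ
    refine ⟨U', hU', hb.trans_eq ?_⟩
    rw [pow_succ, div_div]

/-- The gap is at most about `d m (p - q)`. -/
theorem GoodObservation.gap_le (h : GoodObservation A m Cs Rs p q κ g) (hK : 2 ≤ K)
    (hn : 0 < n) : g ≤ d * (m * (p - q) + 2 * κ) := by
  obtain ⟨Ab, D, rfl, hAb, hD⟩ := h.split
  obtain ⟨δ, hδ0, hδ⟩ := h.diag
  have hK0 : 0 < K := by omega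
  -- A derangement of the clusters exists because `K ≥ 2`. The ground truth with clusters moved by
  -- `π` is a competitor that is wrong in every row.
  obtain ⟨π, hπ⟩ : ∃ π : Equiv.Perm (Fin K), ∀ k, π k ≠ k := by
    obtain ⟨K, rfl⟩ : ∃ K', K = K' + 2 := ⟨K - 2, by omega⟩
    refine ⟨finRotate _, fun k hk => ?_⟩
    rw [finRotate_apply] at hk
    simp at hk
  set Vs := assemble Cs Rs with hVs
  set Vx := assemble (fun i => π (Cs i)) Rs with hVx
  have hmean : ∀ i k, block (Ab * Vs) i k = (m * (if Cs i = k then p else q)) • Rs i := by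
    intro i k
    rw [block_mul, ← Finset.sum_fiberwise (s := Finset.univ) (g := Cs),
      Finset.sum_eq_single k]
    · have : ∀ j ∈ Finset.univ.filter (fun j => Cs j = k), block Ab i j * block Vs j k =
          (if Cs i = k then p else q) • Rs i := by
        intro j hj
        have hj' : Cs j = k := (Finset.mem_filter.1 hj).2
        rw [hAb, hVs, block_assemble, if_pos hj', hj', Matrix.smul_mul, Matrix.mul_assoc,
          orth_transpose_mul (h.orth j), Matrix.mul_one]
      rw [Finset.sum_congr rfl this, Finset.sum_const, h.balanced k, ← Nat.cast_smul_eq_nsmul ℝ,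
        smul_smul]
    · intro l _ hl
      refine Finset.sum_eq_zero fun j hj => ?_
      have hj' : Cs j = l := (Finset.mem_filter.1 hj).2
      rw [hVs, block_assemble, if_neg (by rw [hj']; exact hl), Matrix.mul_zero]
    · intro hk; exact absurd (Finset.mem_univ _) hk
  have h1 : ∀ i, g ≤ ip (Rs i) (block ((Ab + D) * Vs) i (Cs i)) -
      ip (Rs i) (block ((Ab + D) * Vs) i (π (Cs i))) := by
    intro i
    have e : nuclearNorm (block ((Ab + D) * Vs) i (Cs i)) =
        ip (Rs i) (block ((Ab + D) * Vs) i (Cs i)) := by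
      rw [hVs, hδ, nuclearNorm_smul_orth (hδ0 i) (h.orth i), ip_smul_right,
        ip_orth_self (h.orth i)]
    rw [← e]
    have := h.gap i _ (hπ (Cs i))
    linarith [ip_le_nuclearNorm (h.orth i) (block ((Ab + D) * Vs) i (π (Cs i)))]
  -- Summing the gaps over the rows leaves two bilinear forms in the noise, each at most `κ n d`; a
  -- single row would not allow the use of the operator norm.
  have h2 : (n : ℝ) * g ≤ ip Vs ((Ab + D) * Vs) - ip Vx ((Ab + D) * Vs) := by
    rw [hVx, ip_assemble_left, hVs, ip_assemble_left, ← Finset.sum_sub_distrib]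
    calc (n : ℝ) * g = ∑ _i : Fin n, g := by simp
      _ ≤ _ := Finset.sum_le_sum fun i _ => h1 i
  have h3 : ip Vs (Ab * Vs) = n * (m * p * d) := by
    nth_rewrite 1 [hVs]
    rw [ip_assemble_left]
    simp only [hmean, if_true, ip_smul_right, ip_orth_self (h.orth _)]
    simp
  have h4 : ip Vx (Ab * Vs) = n * (m * q * d) := by
    rw [hVx, ip_assemble_left]
    simp only [hmean, if_neg (Ne.symm (hπ _)), ip_smul_right, ip_orth_self (h.orth _)]
    simp
  have hnd : ∀ C : Fin n → Fin K, frob (assemble C Rs) * frob (assemble C Rs) = n * d := by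
    intro C
    rw [← sq, frob_sq, ip_assemble_self C h.orth]
  have hx : frob Vx = frob Vs := by
    rw [frob_eq_sqrt_ip, frob_eq_sqrt_ip, hVx, hVs, ip_assemble_self _ h.orth,
      ip_assemble_self _ h.orth]
  have h5 : frob Vs * frob (D * Vs) ≤ κ * (n * d) := by
    rw [← hnd Cs, ← hVs]
    calc frob Vs * frob (D * Vs) ≤ frob Vs * (κ * frob Vs) :=
          mul_le_mul_of_nonneg_left (hD Vs) (frob_nonneg _)
      _ = _ := by ring
  have h6 := ip_le_frob_mul_frob Vs (D * Vs)
  have h7 := ip_le_frob_mul_frob (-Vx) (D * Vs)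
  rw [frob_neg, ip_neg_left, hx] at h7
  rw [Matrix.add_mul, ip_add_right, ip_add_right, h3, h4] at h2
  have hn' : (0 : ℝ) < n := by exact_mod_cast hn
  have h8 : (n : ℝ) * g ≤ n * (d * (m * (p - q) + 2 * κ)) := by nlinarith
  exact le_of_mul_le_mul_left h8 hn'

end contraction

/-! ### Rounding to determinant one -/

/-- The factor on the right by which a block of determinant `t` is rounded. -/
def roundFactor (d : ℕ) (t : ℝ) : Matrix (Fin d) (Fin d) ℝ :=
  if Odd d then t • 1 else Matrix.diagonal fun b => if (b : ℕ) + 1 = d then t else 1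

theorem roundBlock_eq (X : Matrix (Fin d) (Fin d) ℝ) : roundBlock X = X * roundFactor d X.det := by
  unfold roundBlock roundFactor
  split_ifs with h
  · rw [Matrix.mul_smul, Matrix.mul_one]
  · ext a b
    rw [Matrix.mul_diagonal, Matrix.of_apply]
    split_ifs <;> ring

theorem roundFactor_mem {t : ℝ} (ht : t * t = 1) : roundFactor d t ∈ Orth d := by
  rw [mem_orth_iff]
  unfold roundFactor
  split_ifs with h
  · rw [Matrix.transpose_smul, Matrix.transpose_one, Matrix.smul_mul, Matrix.mul_smul, smul_smul,
      ht, Matrix.one_mul, one_smul]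
  · rw [Matrix.diagonal_transpose, Matrix.diagonal_mul_diagonal]
    rw [← Matrix.diagonal_one]
    congr 1
    ext b
    split_ifs <;> simp [ht]

theorem det_roundFactor (hd : 1 ≤ d) {t : ℝ} (ht : t * t = 1) : (roundFactor d t).det = t := by
  unfold roundFactor
  split_ifs with h
  · obtain ⟨k, hk⟩ := h
    rw [Matrix.det_smul, Matrix.det_one, mul_one, Fintype.card_fin, hk, pow_succ, pow_mul, sq, ht,
      one_pow, one_mul]
  · rw [Matrix.det_diagonal, Finset.prod_eq_single ⟨d - 1, by omega⟩]
    · rw [if_pos]; simp; omega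
    · intro b _ hb
      rw [if_neg]
      intro h'
      apply hb
      ext
      simp; omega
    · intro h'; exact absurd (Finset.mem_univ _) h'

theorem roundBlock_mem (hd : 1 ≤ d) {X : Matrix (Fin d) (Fin d) ℝ} (hX : X ∈ Orth d) :
    roundBlock X ∈ GroupKind.rotation.carrier d := by
  rw [mem_rotation_iff, roundBlock_eq]
  exact ⟨orth_mul hX (roundFactor_mem (orth_det_sq hX)), by
    rw [Matrix.det_mul, det_roundFactor hd (orth_det_sq hX), orth_det_sq hX]⟩

theorem roundBlock_zero : roundBlock (0 : Matrix (Fin d) (Fin d) ℝ) = 0 := by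
  rw [roundBlock_eq, Matrix.zero_mul]

/-- Rounding multiplies on the right by a matrix that depends only on the determinant, so it
commutes with rotations on the left, in particular with those of the ground truth. -/
theorem roundBlock_mul {P Q : Matrix (Fin d) (Fin d) ℝ} (hP : P.det = 1) :
    roundBlock (P * Q) = P * roundBlock Q := by
  rw [roundBlock_eq, roundBlock_eq, Matrix.det_mul, hP, one_mul, Matrix.mul_assoc]

/-- `Qᵀ P` has determinant `-1`, hence the eigenvalue `-1`. Pairing with the reflection in its
eigenvector bounds the trace by `d - 2`. -/
theorem four_le_ip_sub_of_det_ne {P Q : Matrix (Fin d) (Fin d) ℝ} (hP : P ∈ Orth d)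
    (hQ : Q ∈ Orth d) (h : P.det ≠ Q.det) : 4 ≤ ip (P - Q) (P - Q) := by
  set O := Q.transpose * P with hO
  have hOo : O ∈ Orth d := orth_mul (orth_transpose hQ) hP
  have hdet : O.det = -1 := by
    have h1 := orth_det_sq hP
    have h2 := orth_det_sq hQ
    rw [hO, Matrix.det_mul, Matrix.det_transpose]
    rcases mul_self_eq_one_iff.1 h1 with h3 | h3 <;> rcases mul_self_eq_one_iff.1 h2 with h4 | h4
    · exact absurd (h3.trans h4.symm) h
    · rw [h3, h4]; norm_num
    · rw [h3, h4]; norm_num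
    · exact absurd (h3.trans h4.symm) h
  have hdet0 : (O + 1).det = 0 := by
    -- Taking determinants, `det (O + 1)` equals its own negative.
    have e : O + 1 = O * (O + 1).transpose := by
      rw [Matrix.transpose_add, mul_add, orth_mul_transpose hOo, Matrix.transpose_one,
        Matrix.mul_one, add_comm]
    have := congrArg Matrix.det e
    rw [Matrix.det_mul, Matrix.det_transpose, hdet] at this
    linarith
  obtain ⟨v, hv, hOv⟩ := Matrix.exists_mulVec_eq_zero_iff.2 hdet0
  obtain ⟨c, w, hw, rfl⟩ := exists_unit hv
  have hc : c ≠ 0 := by rintro rfl; simp at hv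
  have hOw : O.mulVec w = -w := by
    rw [Matrix.mulVec_smul] at hOv
    have := (smul_eq_zero.1 hOv).resolve_left hc
    rw [Matrix.add_mulVec, Matrix.one_mulVec] at this
    exact eq_neg_of_add_eq_zero_left this
  have h1 := ip_le_nuclearNorm (reflection_mem hw) O
  rw [ip_reflection, nuclearNorm_orth hOo, hOw, dotProduct_neg, hw] at h1
  rw [← frob_sq, frob_sub_sq, ip_orth_self hP, ip_orth_self hQ, ip_comm, ip_eq_trace]
  linarith

theorem ip_sub_self_le_of_orth {P Q : Matrix (Fin d) (Fin d) ℝ} (hP : P ∈ Orth d)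
    (hQ : Q ∈ Orth d) : ip (P - Q) (P - Q) ≤ 4 * d := by
  have := ip_le_nuclearNorm (orth_neg hP) Q
  rw [nuclearNorm_orth hQ, ip_neg_left] at this
  rw [← frob_sq, frob_sub_sq, ip_orth_self hP, ip_orth_self hQ]
  linarith

/-- With equal determinants both are multiplied by the same orthogonal matrix. Otherwise the squared
distance is at least `4` before rounding, and at most `4 d` afterwards in any case. -/
theorem ip_roundBlock_sub_le {P Q : Matrix (Fin d) (Fin d) ℝ} (hd : 1 ≤ d) (hP : P ∈ Orth d)
    (hQ : Q ∈ Orth d) : ip (roundBlock P - roundBlock Q) (roundBlock P - roundBlock Q) ≤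
      d * ip (P - Q) (P - Q) := by
  have hd' : (1 : ℝ) ≤ d := by exact_mod_cast hd
  by_cases h : P.det = Q.det
  · rw [roundBlock_eq, roundBlock_eq, h, ← sub_mul,
      ip_mul_orth_right (roundFactor_mem (orth_det_sq hQ))]
    nlinarith [ip_self_nonneg (P - Q)]
  · have h1 := four_le_ip_sub_of_det_ne hP hQ h
    have h2 := ip_sub_self_le_of_orth (carrier_subset_orth _ (roundBlock_mem hd hP))
      (carrier_subset_orth _ (roundBlock_mem hd hQ))
    nlinarith

theorem finish_rotation_assemble (C : Fin n → Fin K) (R : Fin n → Matrix (Fin d) (Fin d) ℝ) :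
    finish .rotation (assemble C R) = assemble C fun i => roundBlock (R i) := by
  refine block_ext fun i k => ?_
  have : block (finish .rotation (assemble C R)) i k = roundBlock (block (assemble C R) i k) := rfl
  rw [this, block_assemble, block_assemble]
  split_ifs
  · rfl
  · exact roundBlock_zero

/-- The last step yields a point of the feasible set for `G` and costs at most the factor `√d`. -/
theorem finish_spec (G : GroupKind) (hd : 1 ≤ d) {Cs : Fin n → Fin K}
    {Rs : Fin n → Matrix (Fin d) (Fin d) ℝ} (hRs : ∀ i, Rs i ∈ G.carrier d)
    {s : Equiv.Perm (Fin K)} {U : Fin K → Matrix (Fin d) (Fin d) ℝ} (hU : ∀ k, U k ∈ Orth d)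
    {V : BlockMatrix n K d} (hV : V ∈ feasible .orthogonal n K d m) :
    finish G V ∈ feasible G n K d m ∧
      estError G (assemble Cs Rs) (finish G V) ≤ Real.sqrt d * frob (V - target Cs Rs s U) := by
  have hd' : (1 : ℝ) ≤ d := by exact_mod_cast hd
  cases G with
  | orthogonal =>
    refine ⟨hV, (estError_le (s := s) hU V).trans ?_⟩
    have : 1 ≤ Real.sqrt d := Real.one_le_sqrt.2 hd'
    nlinarith [frob_nonneg (V - target Cs Rs s U)]
  | rotation =>
    obtain ⟨C, R, hC, hR, rfl⟩ := hV
    have hR : ∀ i, R i ∈ Orth d := hR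
    rw [finish_rotation_assemble]
    refine ⟨⟨C, _, hC, fun i => roundBlock_mem hd (hR i), rfl⟩, ?_⟩
    refine (estError_le (s := s) (U := fun k => roundBlock (U k))
      (fun k => roundBlock_mem hd (hU k)) _).trans ?_
    rw [frob_eq_sqrt_ip, frob_eq_sqrt_ip, ← Real.sqrt_mul (by positivity)]
    apply Real.sqrt_le_sqrt
    have hRo : ∀ i, Rs i ∈ Orth d := fun i => carrier_subset_orth _ (hRs i)
    rw [target, target, ip_assemble_sub_self
      (fun i => carrier_subset_orth _ (roundBlock_mem hd (hR i)))
      (fun i => orth_mul (hRo i) (carrier_subset_orth _ (roundBlock_mem hd (hU _)))),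
      ip_assemble_sub_self hR (fun i => orth_mul (hRo i) (hU _)), Finset.mul_sum]
    refine Finset.sum_le_sum fun i _ => ?_
    unfold rowDist
    split_ifs with h
    · dsimp only
      rw [← roundBlock_mul (mem_rotation_iff.1 (hRs i)).2]
      exact ip_roundBlock_sub_le hd (hR i) (orth_mul (hRo i) (hU _))
    · nlinarith

/-! ### Traces of powers and closed walks -/

/-- The weight `f` of the endpoints is arbitrary so that the induction can absorb the first step of
the walk into it; the closing step of a cycle is a special weight. -/
theorem sum_paths {ι : Type*} [Fintype ι] [DecidableEq ι] (M : Matrix ι ι ℝ) (L : ℕ)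
    (f : ι → ι → ℝ) :
    ∑ w : Fin (L + 1) → ι, f (w 0) (w (Fin.last L)) *
      ∏ t : Fin L, M (w t.castSucc) (w t.succ) = ∑ x, ∑ y, f x y * (M ^ L) x y := by
  induction L generalizing f with
  | zero =>
    rw [← (Equiv.funUnique (Fin 1) ι).symm.sum_comp]
    refine Finset.sum_congr rfl fun x _ => ?_
    simp [Matrix.one_apply]
  | succ L ih =>
    rw [← (Fin.consEquiv fun _ : Fin (L + 2) => ι).sum_comp, Fintype.sum_prod_type,
      Finset.sum_comm]
    have h1 : ∀ w : Fin (L + 1) → ι, ∑ x, f ((Fin.consEquiv fun _ : Fin (L + 2) => ι) (x, w) 0)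
        ((Fin.consEquiv fun _ : Fin (L + 2) => ι) (x, w) (Fin.last (L + 1))) *
        ∏ t : Fin (L + 1), M ((Fin.consEquiv fun _ : Fin (L + 2) => ι) (x, w) t.castSucc)
          ((Fin.consEquiv fun _ : Fin (L + 2) => ι) (x, w) t.succ) =
        (fun x' y => ∑ x, f x y * M x x') (w 0) (w (Fin.last L)) *
          ∏ t : Fin L, M (w t.castSucc) (w t.succ) := by
      intro w
      rw [Finset.sum_mul]
      refine Finset.sum_congr rfl fun x _ => ?_
      rw [Fin.prod_univ_succ]
      simp only [Fin.consEquiv_apply, Fin.cons_zero, Fin.castSucc_zero, ← Fin.succ_last,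
        Fin.cons_succ, ← Fin.succ_castSucc]
      ring
    refine (Finset.sum_congr rfl fun w _ => h1 w).trans ((ih fun x' y => ∑ x, f x y * M x x').trans ?_)
    simp only [pow_succ', Matrix.mul_apply, Finset.sum_mul, Finset.mul_sum]
    have : ∀ y, ∑ x', ∑ x, f x y * M x x' * (M ^ L) x' y =
        ∑ x, ∑ x', f x y * (M x x' * (M ^ L) x' y) := by
      intro y
      rw [Finset.sum_comm]
      simp only [mul_assoc]
    calc _ = ∑ y, ∑ x', ∑ x, f x y * M x x' * (M ^ L) x' y := by rw [Finset.sum_comm]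
      _ = ∑ y, ∑ x, ∑ x', f x y * (M x x' * (M ^ L) x' y) :=
        Finset.sum_congr rfl fun y _ => this y
      _ = _ := Finset.sum_comm

theorem trace_pow_eq_sum_closed_walks {ι : Type*} [Fintype ι] [DecidableEq ι] (M : Matrix ι ι ℝ)
    (L : ℕ) : (M ^ (L + 1)).trace =
      ∑ w : Fin (L + 1) → ι, ∏ t : Fin (L + 1), M (w t) (w (t + 1)) := by
  have h := sum_paths M L fun x y => M y x
  have h2 : (M ^ (L + 1)).trace = ∑ x, ∑ y, M y x * (M ^ L) x y := by
    simp only [Matrix.trace, Matrix.diag, pow_succ, Matrix.mul_apply]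
    exact Finset.sum_congr rfl fun x _ => Finset.sum_congr rfl fun y _ => mul_comm _ _
  rw [h2, ← h]
  refine Finset.sum_congr rfl fun w _ => ?_
  rw [Fin.prod_univ_castSucc, mul_comm]
  congr 1
  · exact Finset.prod_congr rfl fun t _ => by rw [Fin.coeSucc_eq_succ]
  · rw [Fin.last_add_one]

/-! ### Products of independent factors -/

section independent
variable {κ ι S : Type*} [Fintype κ] [DecidableEq κ] [Fintype ι] [MeasurableSpace S]
  {μ : κ → Measure S} [∀ e, IsProbabilityMeasure (μ e)]

theorem integral_prod_eq (e : ι → κ) (g : ι → S → ℝ) :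
    ∫ ω, ∏ t, g t (ω (e t)) ∂Measure.pi μ = ∏ k, ∫ x, ∏ t with e t = k, g t x ∂μ k := by
  rw [← integral_fintype_prod_eq_prod]
  refine integral_congr_ae (Filter.Eventually.of_forall fun ω => ?_)
  simp only
  rw [← Finset.prod_fiberwise (s := Finset.univ) (g := e)]
  refine Finset.prod_congr rfl fun k _ => Finset.prod_congr rfl fun t ht => ?_
  rw [(Finset.mem_filter.1 ht).2]

open Classical in
-- Independence factors the mean over the edges. An edge used once contributes its mean, which is
-- zero. On an edge used several times, two factors are bounded by `b` and the others by one, so it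
-- contributes at most `P`.
theorem abs_integral_prod_le (e : ι → κ) (g : ι → S → ℝ) (b : κ → S → ℝ) {P : ℝ}
    (hb0 : ∀ k x, 0 ≤ b k x) (hb1 : ∀ k x, b k x ≤ 1) (hbm : ∀ k, Measurable (b k))
    (hg : ∀ t x, |g t x| ≤ b (e t) x) (hP : ∀ k, ∫ x, b k x ^ 2 ∂μ k ≤ P)
    (hmean : ∀ t, ∫ x, g t x ∂μ (e t) = 0) :
    |∫ ω, ∏ t, g t (ω (e t)) ∂Measure.pi μ| ≤
      if ∀ t, ∃ t', t' ≠ t ∧ e t' = e t then P ^ (Finset.univ.image e).card else 0 := by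
  rw [integral_prod_eq]
  split_ifs with h
  · rw [Finset.abs_prod]
    have h1 : ∀ k, |∫ x, ∏ t with e t = k, g t x ∂μ k| ≤
        if k ∈ Finset.univ.image e then P else 1 := by
      intro k
      split_ifs with hk
      · obtain ⟨t, -, rfl⟩ := Finset.mem_image.1 hk
        obtain ⟨t', ht', het'⟩ := h t
        refine le_trans ?_ (hP (e t))
        rw [← Real.norm_eq_abs]
        refine norm_integral_le_of_norm_le ?_ (Filter.Eventually.of_forall fun x => ?_)
        · refine (integrable_const (1 : ℝ)).mono' ((hbm _).pow_const 2).aestronglyMeasurable ?_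
          refine Filter.Eventually.of_forall fun x => ?_
          rw [Real.norm_eq_abs, abs_of_nonneg (sq_nonneg _)]
          exact pow_le_one₀ (hb0 _ _) (hb1 _ _)
        · rw [Real.norm_eq_abs, Finset.abs_prod]
          have hsub : ({t, t'} : Finset ι) ⊆ Finset.univ.filter (fun s => e s = e t) := by
            intro s hs
            rcases Finset.mem_insert.1 hs with rfl | hs
            · simp
            · rw [Finset.mem_singleton.1 hs]; simp [het']
          refine (Finset.prod_le_prod_of_subset_of_le_one hsub (fun _ _ => abs_nonneg _)
            fun s _ _ => (hg s x).trans (hb1 _ _)).trans ?_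
          rw [Finset.prod_pair (Ne.symm ht'), sq]
          exact mul_le_mul (hg t x) (het' ▸ hg t' x) (abs_nonneg _) (hb0 _ _)
      · have : (Finset.univ.filter fun t => e t = k) = ∅ := by
          rw [Finset.filter_eq_empty_iff]
          intro t _ ht
          exact hk (Finset.mem_image.2 ⟨t, Finset.mem_univ _, ht⟩)
        rw [this]
        simp
    refine (Finset.prod_le_prod (fun _ _ => abs_nonneg _) fun k _ => h1 k).trans_eq ?_
    rw [Finset.prod_ite, Finset.prod_const, Finset.prod_const_one, mul_one]
    congr 2
    ext k; simp
  · push Not at h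
    obtain ⟨t, ht⟩ := h
    have h0 : ∏ k, ∫ x, ∏ s with e s = k, g s x ∂μ k = 0 := by
      apply Finset.prod_eq_zero (Finset.mem_univ (e t))
      have : (Finset.univ.filter fun s => e s = e t) = {t} := by
        ext s
        simp only [Finset.mem_filter, Finset.mem_univ, true_and, Finset.mem_singleton]
        constructor
        · intro hs
          by_contra hne
          exact ht s hne hs
        · rintro rfl; rfl
      rw [this]
      simpa using hmean t
    rw [h0, abs_zero]

end independent

/-! ### Closed walks in which every edge is repeated -/

/-- The unordered pair `{a, b}` as an ordered one. -/
def edgePair {V : Type*} [LinearOrder V] (a b : V) : V × V := if a < b then (a, b) else (b, a)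

theorem edgePair_eq_iff {V : Type*} [LinearOrder V] {a b c e : V} :
    edgePair a b = edgePair c e ↔ (a = c ∧ b = e) ∨ (a = e ∧ b = c) := by
  unfold edgePair
  split_ifs <;> simp only [Prod.mk.injEq] <;> grind

/-- The steps `t` and `t'` of the closed walk `u` use the same edge. -/
def SameEdge {V : Type*} {L : ℕ} (u : Fin (L + 1) → V) (t' t : Fin (L + 1)) : Prop :=
  (u t' = u t ∧ u (t' + 1) = u (t + 1)) ∨ (u t' = u (t + 1) ∧ u (t' + 1) = u t)

/-- The closed walk `u` has no loops, and it uses each of its edges at least twice. -/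
def Repeating {V : Type*} {L : ℕ} (u : Fin (L + 1) → V) : Prop :=
  (∀ t, u t ≠ u (t + 1)) ∧ ∀ t, ∃ t', t' ≠ t ∧ SameEdge u t' t

open Classical in
-- Along a walk, each newly visited vertex is reached through a new edge; the start accounts for the
-- additional one.
theorem card_image_le_card_edges {V : Type*} [LinearOrder V] {L : ℕ} (u : Fin (L + 1) → V) :
    (Finset.univ.image u).card ≤
      (Finset.univ.image fun t => edgePair (u t) (u (t + 1))).card + 1 := by
  have key : ∀ s : ℕ, s ≤ L →
      ((Finset.univ.filter fun t : Fin (L + 1) => (t : ℕ) ≤ s).image u).card ≤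
      ((Finset.univ.filter fun t : Fin (L + 1) => (t : ℕ) < s).image
        fun t => edgePair (u t) (u (t + 1))).card + 1 := by
    intro s
    induction s with
    | zero =>
      intro _
      have : (Finset.univ.filter fun t : Fin (L + 1) => (t : ℕ) ≤ 0) = {0} := by
        ext t
        simp only [Finset.mem_filter, Finset.mem_univ, true_and, Finset.mem_singleton, Fin.ext_iff,
          Fin.val_zero, Nat.le_zero]
      rw [this]; simp
    | succ s ih =>
      intro hs
      have h := ih (by omega)
      set a : Fin (L + 1) := ⟨s, by omega⟩ with ha
      have ha1 : ((a + 1 : Fin (L + 1)) : ℕ) = s + 1 := by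
        rw [Fin.val_add_one_of_lt]; rw [Fin.lt_def]; simp [ha]; omega
      have e1 : (Finset.univ.filter fun t : Fin (L + 1) => (t : ℕ) ≤ s + 1) =
          insert (a + 1) (Finset.univ.filter fun t : Fin (L + 1) => (t : ℕ) ≤ s) := by
        ext t
        simp only [Finset.mem_filter, Finset.mem_univ, true_and, Finset.mem_insert, Fin.ext_iff, ha1]
        omega
      have e2 : (Finset.univ.filter fun t : Fin (L + 1) => (t : ℕ) < s + 1) =
          insert a (Finset.univ.filter fun t : Fin (L + 1) => (t : ℕ) < s) := by
        ext t
        simp only [Finset.mem_filter, Finset.mem_univ, true_and, Finset.mem_insert, Fin.ext_iff, ha]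
        omega
      rw [e1, e2, Finset.image_insert, Finset.image_insert]
      by_cases hmem : u (a + 1) ∈ (Finset.univ.filter fun t : Fin (L + 1) => (t : ℕ) ≤ s).image u
      · rw [Finset.insert_eq_of_mem hmem]
        refine h.trans (Nat.add_le_add_right (Finset.card_le_card (Finset.subset_insert _ _)) 1)
      · rw [Finset.card_insert_of_notMem hmem, Finset.card_insert_of_notMem]
        · omega
        -- If the edge had been used before, both of its ends would have been visited already.
        · intro hmem'
          obtain ⟨t, ht, hte⟩ := Finset.mem_image.1 hmem'
          have ht' : (t : ℕ) < s := (Finset.mem_filter.1 ht).2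
          have ht1 : ((t + 1 : Fin (L + 1)) : ℕ) = t + 1 := by
            rw [Fin.val_add_one_of_lt]; rw [Fin.lt_def]; simp; omega
          apply hmem
          rcases edgePair_eq_iff.1 hte with ⟨_, h2⟩ | ⟨h1, _⟩
          · exact Finset.mem_image.2 ⟨t + 1, by simp; omega, h2⟩
          · exact Finset.mem_image.2 ⟨t, by simp; omega, h1⟩
  have h := key L le_rfl
  have e1 : (Finset.univ.filter fun t : Fin (L + 1) => (t : ℕ) ≤ L) = Finset.univ := by
    ext t; simp; omega
  rw [e1] at h
  refine h.trans (Nat.add_le_add_right (Finset.card_le_card ?_) 1)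
  exact Finset.image_subset_image (Finset.subset_univ _)

open Classical in
theorem Repeating.two_mul_card_edges_le {V : Type*} [LinearOrder V] {L : ℕ} {u : Fin (L + 1) → V}
    (h : Repeating u) :
    2 * (Finset.univ.image fun t => edgePair (u t) (u (t + 1))).card ≤ L + 1 := by
  have := Finset.mul_card_image_le_card (s := (Finset.univ : Finset (Fin (L + 1))))
    (f := fun t => edgePair (u t) (u (t + 1))) (n := 2) ?_
  · simpa using this
  intro a ha
  obtain ⟨t, -, rfl⟩ := Finset.mem_image.1 ha
  obtain ⟨t', ht', hs⟩ := h.2 t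
  rw [← Finset.card_pair (Ne.symm ht')]
  refine Finset.card_le_card fun s hs' => ?_
  rw [Finset.mem_filter]
  refine ⟨Finset.mem_univ _, ?_⟩
  rcases Finset.mem_insert.1 hs' with rfl | hs'
  · rfl
  · rw [Finset.mem_singleton.1 hs']
    exact edgePair_eq_iff.2 hs

/-- Being repeating depends only on which times of the walk coincide. This allows a change of the
vertex set. -/
theorem repeating_congr {V V' : Type*} {L : ℕ} {u : Fin (L + 1) → V} {u' : Fin (L + 1) → V'}
    (h : ∀ s t, u s = u t ↔ u' s = u' t) : Repeating u ↔ Repeating u' := by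
  unfold Repeating SameEdge
  simp only [ne_eq, h]

/-! ### Counting functions with a given kernel -/

/-- A function with kernel `π` is the same as an injection of the quotient by `π`. -/
theorem card_ker_eq {α V : Type*} [Fintype α] [DecidableEq α] [Fintype V] (π : Setoid α)
    [DecidablePred fun u : α → V => Setoid.ker u = π] :
    (Finset.univ.filter fun u : α → V => Setoid.ker u = π).card =
      (Fintype.card V).descFactorial (Nat.card (Quotient π)) := by
  classical
  rw [Nat.card_eq_fintype_card, ← Fintype.card_embedding_eq, ← Fintype.card_subtype]
  refine Fintype.card_congr
    { toFun := fun u => ⟨Quotient.lift u.1 fun a b hab => ?_, ?_⟩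
      invFun := fun f => ⟨fun a => f (Quotient.mk π a), ?_⟩
      left_inv := ?_
      right_inv := ?_ }
  · have : (Setoid.ker u.1) a b := by rw [u.2]; exact hab
    exact this
  · intro x y
    refine Quotient.inductionOn₂ x y fun a b hab => Quotient.sound ?_
    have : (Setoid.ker u.1) a b := hab
    rw [u.2] at this
    exact this
  · ext a b
    simp only [Setoid.ker_def, f.injective.eq_iff]
    exact Quotient.eq
  · intro u; rfl
  · intro f
    ext x
    refine Quotient.inductionOn x fun a => rfl

theorem card_image_eq_card_quotient {α V : Type*} [Fintype α] [DecidableEq V] (u : α → V) :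
    (Finset.univ.image u).card = Nat.card (Quotient (Setoid.ker u)) := by
  rw [Nat.card_congr (Setoid.quotientKerEquivRange u), ← Set.toFinset_range, Set.toFinset_card,
    Nat.card_eq_fintype_card]

open Classical in
/-- The weighted number of repeating closed walks in `n` vertices is controlled by the number of
such walks in far fewer vertices. -/
theorem sum_repeating_le {n r L k : ℕ} {P : ℝ} (hP : 0 ≤ P) (hL : L + 1 = 2 * k)
    (hr : n * P + k + 1 ≤ r) :
    ∑ u : Fin (L + 1) → Fin n, (if Repeating u then P ^ ((Finset.univ.image u).card - 1) else 0) ≤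
      n * (Finset.univ.filter fun u : Fin (L + 1) → Fin r => Repeating u).card := by
  have : Finite (Setoid (Fin (L + 1))) :=
    Finite.of_injective (fun π : Setoid (Fin (L + 1)) => fun a b => π a b) fun π π' h => by
      ext a b; exact iff_of_eq (congrFun (congrFun h a) b)
  have : Fintype (Setoid (Fin (L + 1))) := Fintype.ofFinite _
  set mk : ∀ π : Setoid (Fin (L + 1)), Fin (L + 1) → Quotient π := fun π => Quotient.mk π
  have hker : ∀ {V : Type} (u : Fin (L + 1) → V) (π : Setoid (Fin (L + 1))), Setoid.ker u = π →
      (Repeating u ↔ Repeating (mk π)) := by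
    rintro V u _ rfl
    refine repeating_congr fun s t => ?_
    exact (@Quotient.eq _ (Setoid.ker u) s t).symm
  have hcard : ∀ {V : Type} [DecidableEq V] (u : Fin (L + 1) → V) (π : Setoid (Fin (L + 1))), Setoid.ker u = π →
      (Finset.univ.image u).card = Nat.card (Quotient π) := by
    rintro V _ u _ rfl
    exact card_image_eq_card_quotient u
  -- Walks are grouped by their pattern of coincidences. A pattern with `v` classes has a falling
  -- factorial of realizations, in `n` as well as in `r` vertices.
  have hl : ∑ u : Fin (L + 1) → Fin n,
      (if Repeating u then P ^ ((Finset.univ.image u).card - 1) else 0) =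
      ∑ π : Setoid (Fin (L + 1)), if Repeating (mk π) then
        (n.descFactorial (Nat.card (Quotient π)) : ℝ) * P ^ (Nat.card (Quotient π) - 1)
        else 0 := by
    rw [← Finset.sum_fiberwise (s := Finset.univ) (g := fun u : Fin (L + 1) → Fin n => Setoid.ker u)]
    refine Finset.sum_congr rfl fun π _ => ?_
    have h1 : ∀ u ∈ Finset.univ.filter (fun u : Fin (L + 1) → Fin n => Setoid.ker u = π),
        (if Repeating u then P ^ ((Finset.univ.image u).card - 1) else 0) =
        if Repeating (mk π) then P ^ (Nat.card (Quotient π) - 1) else 0 := by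
      intro u hu
      have hu' := (Finset.mem_filter.1 hu).2
      rw [hcard u π hu']
      simp only [hker u π hu']
    rw [Finset.sum_congr rfl h1, Finset.sum_const, card_ker_eq, Fintype.card_fin, nsmul_eq_mul,
      mul_ite, mul_zero]
  have hrr : ((Finset.univ.filter fun u : Fin (L + 1) → Fin r => Repeating u).card : ℝ) =
      ∑ π : Setoid (Fin (L + 1)), if Repeating (mk π) then
        (r.descFactorial (Nat.card (Quotient π)) : ℝ) else 0 := by
    rw [Finset.card_filter, Nat.cast_sum,
      ← Finset.sum_fiberwise (s := Finset.univ) (g := fun u : Fin (L + 1) → Fin r => Setoid.ker u)]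
    refine Finset.sum_congr rfl fun π _ => ?_
    have h1 : ∀ u ∈ Finset.univ.filter (fun u : Fin (L + 1) → Fin r => Setoid.ker u = π),
        ((if Repeating u then 1 else 0 : ℕ) : ℝ) =
        if Repeating (mk π) then (1 : ℝ) else 0 := by
      intro u hu
      have hu' := (Finset.mem_filter.1 hu).2
      simp only [hker u π hu', Nat.cast_ite, Nat.cast_one, Nat.cast_zero]
    rw [Finset.sum_congr rfl h1, Finset.sum_const, card_ker_eq, Fintype.card_fin, nsmul_eq_mul,
      mul_ite, mul_zero, mul_one]
  rw [hl, hrr, Finset.mul_sum]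
  refine Finset.sum_le_sum fun π _ => ?_
  split_ifs with hrep
  swap
  · rw [mul_zero]
  set v := Nat.card (Quotient π) with hv
  have hv1 : 1 ≤ v := (have : Nonempty (Quotient π) := ⟨mk π 0⟩; Nat.card_pos)
  -- A repeating walk of length `2 k` has at most `k` edges, hence at most `k + 1` vertices.
  have hvk : v ≤ k + 1 := by
    let e := Finite.equivFin (Quotient π)
    have hrep' : Repeating (fun t => e (mk π t)) :=
      (repeating_congr fun s t => by rw [e.injective.eq_iff]).1 hrep
    have h1 := hrep'.two_mul_card_edges_le
    have h2 := card_image_le_card_edges fun t => e (mk π t)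
    have h3 : (Finset.univ.image fun t => e (mk π t)).card = v := by
      rw [hv]
      refine hcard _ π ?_
      ext a b
      simp only [Setoid.ker_def, e.injective.eq_iff]
      exact Quotient.eq
    omega
  have h1 : (n.descFactorial v : ℝ) ≤ (n : ℝ) ^ v := by exact_mod_cast Nat.descFactorial_le_pow n v
  have hrk : k + 1 ≤ r := by
    have : (k : ℝ) + 1 ≤ r := by nlinarith [mul_nonneg (Nat.cast_nonneg (α := ℝ) n) hP]
    exact_mod_cast this
  have h2 : ((r - k : ℕ) : ℝ) ^ v ≤ r.descFactorial v := by
    have h3 := Nat.pow_sub_le_descFactorial r v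
    have h4 : (r - k) ^ v ≤ (r + 1 - v) ^ v := Nat.pow_le_pow_left (by omega) v
    exact_mod_cast h4.trans h3
  rw [Nat.cast_sub (by omega)] at h2
  have hQ1 : (1 : ℝ) ≤ r - k := by
    have : (k : ℝ) + 1 ≤ r := by exact_mod_cast hrk
    linarith
  clear_value v
  obtain ⟨w, rfl⟩ : ∃ w, v = w + 1 := ⟨v - 1, by omega⟩
  have hn0 : (0 : ℝ) ≤ n := Nat.cast_nonneg n
  -- One vertex pays the factor `n`. Each other one pays `n P ≤ r - k`, which is no more than any
  -- factor of the falling factorial of `r`.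
  calc (n.descFactorial (w + 1) : ℝ) * P ^ (w + 1 - 1) ≤ (n : ℝ) ^ (w + 1) * P ^ w :=
        mul_le_mul_of_nonneg_right h1 (pow_nonneg hP _)
    _ = n * (n * P) ^ w := by rw [pow_succ, mul_pow]; ring
    _ ≤ n * ((r : ℝ) - k) ^ w := by
        refine mul_le_mul_of_nonneg_left (pow_le_pow_left₀ (by positivity) (by linarith) _) hn0
    _ ≤ n * ((r : ℝ) - k) ^ (w + 1) :=
        mul_le_mul_of_nonneg_left (pow_le_pow_right₀ hQ1 (Nat.le_succ w)) hn0
    _ ≤ _ := mul_le_mul_of_nonneg_left h2 hn0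

/-! ### Moments of a random block matrix with independent centred entries -/

/-- Loops contribute nothing since diagonal blocks vanish. For the rest, a walk with `v` vertices
has at least `v - 1` edges, and `P ≤ 1`, so its weight is at most `P ^ (v - 1)`. -/
theorem abs_integral_trace_pow_le {n d r L k : ℕ} {S : Type*} [MeasurableSpace S]
    {μ : Fin n × Fin n → Measure S} [∀ e, IsProbabilityMeasure (μ e)]
    {F : Fin n × Fin d → Fin n × Fin d → S → ℝ} {b : Fin n × Fin n → S → ℝ} {P : ℝ}
    (hP0 : 0 ≤ P) (hP1 : P ≤ 1)
    (hb0 : ∀ e x, 0 ≤ b e x) (hb1 : ∀ e x, b e x ≤ 1) (hbm : ∀ e, Measurable (b e))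
    (hF : ∀ x y s, |F x y s| ≤ b (edgePair x.1 y.1) s) (hFm : ∀ x y, Measurable (F x y))
    (hF0 : ∀ x y, x.1 = y.1 → F x y = 0)
    (hmean : ∀ x y, ∫ s, F x y s ∂μ (edgePair x.1 y.1) = 0)
    (hP : ∀ e, ∫ s, b e s ^ 2 ∂μ e ≤ P)
    (hL : L + 1 = 2 * k) (hr : n * P + k + 1 ≤ r) :
    |∫ ω, (Matrix.trace ((Matrix.of fun x y => F x y (ω (edgePair x.1 y.1)) :
        Matrix (Fin n × Fin d) (Fin n × Fin d) ℝ) ^ (L + 1))) ∂Measure.pi μ| ≤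
      (d : ℝ) ^ (L + 1) * (n * Nat.card {u : Fin (L + 1) → Fin r | Repeating u}) := by
  classical
  simp only [trace_pow_eq_sum_closed_walks, Matrix.of_apply]
  have hintegrable : ∀ w : Fin (L + 1) → Fin n × Fin d, Integrable (fun ω : Fin n × Fin n → S =>
      ∏ t, F (w t) (w (t + 1)) (ω (edgePair (w t).1 (w (t + 1)).1))) (Measure.pi μ) := by
    intro w
    refine (integrable_const (1 : ℝ)).mono' ?_ (Filter.Eventually.of_forall fun ω => ?_)
    · exact (Finset.measurable_prod _ fun t _ =>
        (hFm _ _).comp (measurable_pi_apply _)).aestronglyMeasurable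
    · rw [Real.norm_eq_abs, Finset.abs_prod]
      exact Finset.prod_le_one (fun _ _ => abs_nonneg _) fun t _ => (hF _ _ _).trans (hb1 _ _)
  rw [integral_finsetSum _ fun w _ => hintegrable w]
  have hterm : ∀ w : Fin (L + 1) → Fin n × Fin d,
      |∫ ω, ∏ t, F (w t) (w (t + 1)) (ω (edgePair (w t).1 (w (t + 1)).1)) ∂Measure.pi μ| ≤
      if Repeating (fun t => (w t).1) then
        P ^ ((Finset.univ.image fun t => (w t).1).card - 1) else 0 := by
    intro w
    by_cases hloop : ∀ t, (w t).1 ≠ (w (t + 1)).1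
    · refine (abs_integral_prod_le (fun t => edgePair (w t).1 (w (t + 1)).1)
        (fun t => F (w t) (w (t + 1))) b hb0 hb1 hbm (fun t x => hF _ _ _) hP
        fun t => hmean _ _).trans ?_
      by_cases hrep : Repeating (fun t => (w t).1)
      · rw [if_pos hrep, if_pos]
        · refine pow_le_pow_of_le_one hP0 hP1 ?_
          have := card_image_le_card_edges fun t => (w t).1
          convert Nat.sub_le_of_le_add this using 2
        · intro t
          obtain ⟨t', h1, h2⟩ := hrep.2 t
          exact ⟨t', h1, edgePair_eq_iff.2 h2⟩
      · rw [if_neg hrep, if_neg]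
        intro h
        refine hrep ⟨hloop, fun t => ?_⟩
        obtain ⟨t', h1, h2⟩ := h t
        exact ⟨t', h1, edgePair_eq_iff.1 h2⟩
    · push Not at hloop
      obtain ⟨t, ht⟩ := hloop
      have h0 : ∀ ω : Fin n × Fin n → S,
          ∏ t, F (w t) (w (t + 1)) (ω (edgePair (w t).1 (w (t + 1)).1)) = 0 := by
        intro ω
        apply Finset.prod_eq_zero (Finset.mem_univ t)
        rw [hF0 _ _ ht]; rfl
      simp only [h0, integral_zero, abs_zero]
      split_ifs
      · exact pow_nonneg hP0 _
      · exact le_rfl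
  refine (Finset.abs_sum_le_sum_abs _ _).trans ((Finset.sum_le_sum fun w _ => hterm w).trans ?_)
  -- The positions inside the blocks are unconstrained and yield the factor `d ^ (L + 1)`; only the
  -- walk on the nodes matters.
  rw [← (Equiv.arrowProdEquivProdArrow (Fin (L + 1)) (fun _ => Fin n) (fun _ => Fin d)).symm.sum_comp,
    Fintype.sum_prod_type]
  simp only [Equiv.arrowProdEquivProdArrow_symm_apply]
  have hs := sum_repeating_le (n := n) (r := r) hP0 hL hr
  have hc : (Finset.univ.filter fun u : Fin (L + 1) → Fin r => Repeating u).card ≤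
      Nat.card {u : Fin (L + 1) → Fin r | Repeating u} := by
    rw [Nat.card_eq_fintype_card, Fintype.card_subtype]
    refine Finset.card_le_card fun u hu => ?_
    rw [Finset.mem_filter] at hu ⊢
    exact hu
  have hc' : ((Finset.univ.filter fun u : Fin (L + 1) → Fin r => Repeating u).card : ℝ) ≤
      Nat.card {u : Fin (L + 1) → Fin r | Repeating u} := by exact_mod_cast hc
  simp only [Finset.sum_const, Finset.card_univ, Fintype.card_pi, Fintype.card_fin,
    Finset.prod_const, nsmul_eq_mul, Nat.cast_pow, ← Finset.mul_sum]
  refine mul_le_mul_of_nonneg_left ?_ (by positivity)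
  refine le_trans (le_of_eq ?_) (hs.trans (mul_le_mul_of_nonneg_left hc' (Nat.cast_nonneg n)))
  refine Finset.sum_congr rfl fun u _ => ?_
  congr

/-! ### The comparison matrix -/

/-- A random variable with mean zero whose other moments are at least one. -/
def skewSign (x : Bool) : ℝ := if x then 2 else -(1 / 2)

theorem integral_bern (p : ℝ) (hp0 : 0 ≤ p) (hp1 : p ≤ 1) (f : Bool → ℝ) :
    ∫ x, f x ∂bern p = p * f true + (1 - p) * f false := by
  rw [bern, ProbabilityTheory.integral_bernoulliMeasure, Set.projIcc_of_mem zero_le_one ⟨hp0, hp1⟩]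
  simp

instance isProbabilityMeasure_bern (p : ℝ) : IsProbabilityMeasure (bern p) := by
  unfold bern; infer_instance

/-- With the values `2` and `-1/2` of probabilities `1/5` and `4/5`, the mean is zero and the
variance one, while odd moments from the third on do not vanish. A symmetric sign would lose the
walks with an edge used an odd number of times. -/
theorem integral_skewSign_pow (c : ℕ) :
    ∫ x, skewSign x ^ c ∂bern (1 / 5) = (2 ^ c + 4 * (-(1 / 2)) ^ c) / 5 := by
  rw [integral_bern _ (by norm_num) (by norm_num)]
  simp only [skewSign, if_true]
  norm_num
  ring

theorem integral_skewSign_pow_nonneg (c : ℕ) : 0 ≤ ∫ x, skewSign x ^ c ∂bern (1 / 5) := by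
  rw [integral_skewSign_pow]
  rcases c with _ | _ | c
  · norm_num
  · norm_num
  · have h1 : |(-(1 / 2) : ℝ) ^ (c + 2)| ≤ 1 / 4 := by
      rw [abs_pow, pow_add]
      have : |(-(1 / 2) : ℝ)| = 1 / 2 := by norm_num
      rw [this]
      have := pow_le_one₀ (n := c) (show (0 : ℝ) ≤ 1 / 2 by norm_num) (by norm_num)
      nlinarith
    have h2 : (4 : ℝ) ≤ 2 ^ (c + 2) := by
      rw [pow_add]; have := one_le_pow₀ (n := c) (show (1 : ℝ) ≤ 2 by norm_num); linarith
    have := abs_le.1 h1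
    linarith

theorem one_le_integral_skewSign_pow {c : ℕ} (hc : c ≠ 1) :
    1 ≤ ∫ x, skewSign x ^ c ∂bern (1 / 5) := by
  rw [integral_skewSign_pow]
  rcases c with _ | _ | _ | c
  · norm_num
  · exact absurd rfl hc
  · norm_num
  · have h1 : |(-(1 / 2) : ℝ) ^ (c + 3)| ≤ 1 / 8 := by
      rw [abs_pow, pow_add]
      have : |(-(1 / 2) : ℝ)| = 1 / 2 := by norm_num
      rw [this]
      have := pow_le_one₀ (n := c) (show (0 : ℝ) ≤ 1 / 2 by norm_num) (by norm_num)
      nlinarith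
    have h2 : (8 : ℝ) ≤ 2 ^ (c + 3) := by
      rw [pow_add]; have := one_le_pow₀ (n := c) (show (1 : ℝ) ≤ 2 by norm_num); linarith
    have := abs_le.1 h1
    linarith

/-- The comparison matrix: symmetric with zero diagonal and independent entries `skewSign`. -/
def skewMatrix {r : ℕ} (ω : Fin r × Fin r → Bool) : Matrix (Fin r) (Fin r) ℝ :=
  Matrix.of fun i j => if i = j then 0 else skewSign (ω (edgePair i j))

/-- The law of the independent signs. -/
abbrev skewLaw (r : ℕ) : Measure (Fin r × Fin r → Bool) := Measure.pi fun _ => bern (1 / 5)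

/-- In the expansion of the trace, a repeating walk has no edge of multiplicity one, so it
contributes at least one; all other walks contribute something nonnegative. -/
theorem card_repeating_le_integral {r L : ℕ} :
    (Nat.card {u : Fin (L + 1) → Fin r | Repeating u} : ℝ) ≤
      ∫ ω, (skewMatrix ω ^ (L + 1)).trace ∂skewLaw r := by
  classical
  simp only [trace_pow_eq_sum_closed_walks]
  rw [integral_finsetSum _ fun w _ => Integrable.of_finite, Nat.card_eq_fintype_card,
    Fintype.card_subtype, Finset.card_filter, Nat.cast_sum]
  refine Finset.sum_le_sum fun u _ => ?_
  by_cases hloop : ∀ t, u t ≠ u (t + 1)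
  · have e : ∀ ω : Fin r × Fin r → Bool, ∏ t, skewMatrix ω (u t) (u (t + 1)) =
        ∏ t, skewSign (ω (edgePair (u t) (u (t + 1)))) := by
      intro ω
      refine Finset.prod_congr rfl fun t _ => ?_
      rw [skewMatrix, Matrix.of_apply, if_neg (hloop t)]
    simp only [e]
    rw [integral_prod_eq (fun t => edgePair (u t) (u (t + 1))) fun _ => skewSign]
    simp only [Finset.prod_const]
    split_ifs with hrep
    · rw [Nat.cast_one]
      refine Finset.one_le_prod fun k _ => one_le_integral_skewSign_pow fun hk => ?_
      obtain ⟨t, ht⟩ := Finset.card_eq_one.1 hk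
      have hmem : t ∈ Finset.univ.filter (fun s => edgePair (u s) (u (s + 1)) = k) := by
        rw [ht]; exact Finset.mem_singleton_self t
      have htk : edgePair (u t) (u (t + 1)) = k := (Finset.mem_filter.1 hmem).2
      obtain ⟨t', h1, h2⟩ := hrep.2 t
      have : t' ∈ ({t} : Finset _) := by
        rw [← ht, Finset.mem_filter, ← htk]
        exact ⟨Finset.mem_univ _, edgePair_eq_iff.2 h2⟩
      exact h1 (Finset.mem_singleton.1 this)
    · rw [Nat.cast_zero]
      exact Finset.prod_nonneg fun k _ => integral_skewSign_pow_nonneg _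
  · have hrep : ¬ Repeating u := fun h => hloop h.1
    push Not at hloop
    obtain ⟨t, ht⟩ := hloop
    have h0 : ∀ ω : Fin r × Fin r → Bool, ∏ t, skewMatrix ω (u t) (u (t + 1)) = 0 := by
      intro ω
      apply Finset.prod_eq_zero (Finset.mem_univ t)
      rw [skewMatrix, Matrix.of_apply, if_pos ht]
    simp only [h0, integral_zero]
    rw [if_neg (by exact hrep)]
    simp

/-! ### Moments of the norm of the comparison matrix -/

/-- Hoeffding's lemma for an interval of length `5/2`: the exponent `25/32 t²` is rounded up to
`t²`. -/
theorem integral_exp_skewSign_le (t : ℝ) :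
    ∫ x, Real.exp (t * skewSign x) ∂bern (1 / 5) ≤ Real.exp (t ^ 2) := by
  have h := ProbabilityTheory.hasSubgaussianMGF_of_mem_Icc_of_integral_eq_zero
    (X := skewSign) (μ := bern (1 / 5)) (a := -(1 / 2)) (b := 2) (by fun_prop)
    (Filter.Eventually.of_forall fun x => by cases x <;> simp [skewSign] <;> norm_num)
    (by
      have := integral_skewSign_pow 1
      simp only [pow_one] at this
      rw [this]; norm_num)
  have h2 := h.mgf_le t
  rw [ProbabilityTheory.mgf] at h2
  refine h2.trans (Real.exp_le_exp.2 ?_)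
  have : (((‖(2 : ℝ) - -(1 / 2)‖₊ / 2) ^ 2 : NNReal) : ℝ) = 25 / 16 := by
    push_cast
    rw [Real.norm_eq_abs]
    norm_num [abs_of_pos]
  rw [this]
  nlinarith [sq_nonneg t]

theorem integral_exp_sum_skewSign_le {κ : Type*} [Fintype κ] (c : κ → ℝ) (t : ℝ) :
    ∫ ω, Real.exp (t * ∑ k, c k * skewSign (ω k)) ∂(Measure.pi fun _ : κ => bern (1 / 5)) ≤
      Real.exp (t ^ 2 * ∑ k, c k ^ 2) := by
  have e : ∀ ω : κ → Bool, Real.exp (t * ∑ k, c k * skewSign (ω k)) =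
      ∏ k, Real.exp ((t * c k) * skewSign (ω k)) := by
    intro ω
    rw [← Real.exp_sum, Finset.mul_sum]
    congr 1
    exact Finset.sum_congr rfl fun k _ => by ring
  simp only [e]
  rw [integral_fintype_prod_eq_prod (f := fun k x => Real.exp ((t * c k) * skewSign x)),
    Finset.mul_sum, Real.exp_sum]
  refine Finset.prod_le_prod (fun k _ => integral_nonneg fun x => (Real.exp_pos _).le) fun k _ => ?_
  refine (integral_exp_skewSign_le _).trans_eq ?_
  rw [mul_pow]

/-- Even powers are dominated by exponentials through one term of the series of `exp`, with the
parameter `t = √k`. Not optimal, but `k ^ k` with an exponential factor is all that is needed. -/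
theorem integral_pow_sum_skewSign_le {κ : Type*} [Fintype κ] (c : κ → ℝ) {V : ℝ}
    (hV : ∑ k, c k ^ 2 ≤ V) {k : ℕ} (hk : 1 ≤ k) :
    ∫ ω, (∑ i, c i * skewSign (ω i)) ^ (2 * k) ∂(Measure.pi fun _ : κ => bern (1 / 5)) ≤
      2 * 4 ^ k * k ^ k * Real.exp (k * V) := by
  set t := Real.sqrt k with ht
  have hk0 : (0 : ℝ) < k := by exact_mod_cast hk
  have ht2 : t ^ 2 = k := Real.sq_sqrt hk0.le
  have ht2k : t ^ (2 * k) = (k : ℝ) ^ k := by rw [pow_mul, ht2]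
  have hpt : ∀ x : ℝ, x ^ (2 * k) ≤ ((2 * k).factorial / (k : ℝ) ^ k) *
      (Real.exp (t * x) + Real.exp (-t * x)) := by
    intro x
    have h1 := Real.pow_div_factorial_le_exp (|t * x|) (abs_nonneg _) (2 * k)
    rw [Even.pow_abs (even_two_mul k), mul_pow, ht2k] at h1
    have h2 : Real.exp |t * x| ≤ Real.exp (t * x) + Real.exp (-t * x) := by
      rcases abs_cases (t * x) with ⟨h, _⟩ | ⟨h, _⟩ <;> rw [h]
      · linarith [Real.exp_pos (-t * x)]
      · rw [neg_mul]; linarith [Real.exp_pos (t * x)]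
    have hkk : (0 : ℝ) < (k : ℝ) ^ k := by positivity
    have hf : (0 : ℝ) < (2 * k).factorial := by exact_mod_cast Nat.factorial_pos _
    rw [div_mul_eq_mul_div, le_div_iff₀ hkk, mul_comm]
    rw [div_le_iff₀ hf] at h1
    calc (k : ℝ) ^ k * x ^ (2 * k) ≤ Real.exp |t * x| * (2 * k).factorial := h1
      _ ≤ _ := by rw [mul_comm]; exact mul_le_mul_of_nonneg_left h2 hf.le
  have hintegrable : ∀ f : (κ → Bool) → ℝ, Integrable f (Measure.pi fun _ : κ => bern (1 / 5)) :=
    fun f => Integrable.of_finite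
  have hexp : ∀ s : ℝ, s ^ 2 = k →
      ∫ ω, Real.exp (s * ∑ i, c i * skewSign (ω i)) ∂(Measure.pi fun _ : κ => bern (1 / 5)) ≤
        Real.exp (k * V) := by
    intro s hs
    refine (integral_exp_sum_skewSign_le c s).trans (Real.exp_le_exp.2 ?_)
    rw [hs]; exact mul_le_mul_of_nonneg_left hV hk0.le
  have hfac : ((2 * k).factorial : ℝ) / (k : ℝ) ^ k ≤ 4 ^ k * k ^ k := by
    rw [div_le_iff₀ (by positivity)]
    have : ((2 * k).factorial : ℝ) ≤ (2 * k : ℝ) ^ (2 * k) := by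
      exact_mod_cast Nat.factorial_le_pow (2 * k)
    refine this.trans_eq ?_
    rw [mul_pow, pow_mul, pow_mul (k : ℝ), sq (k : ℝ), mul_pow]; norm_num; ring
  calc _ ≤ ∫ ω, ((2 * k).factorial / (k : ℝ) ^ k) *
        (Real.exp (t * ∑ i, c i * skewSign (ω i)) + Real.exp (-t * ∑ i, c i * skewSign (ω i)))
        ∂(Measure.pi fun _ : κ => bern (1 / 5)) :=
        integral_mono (hintegrable _) (hintegrable _) fun ω => hpt _
    _ ≤ ((2 * k).factorial / (k : ℝ) ^ k) * (Real.exp (k * V) + Real.exp (k * V)) := by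
        rw [integral_const_mul, integral_add (hintegrable _) (hintegrable _)]
        refine mul_le_mul_of_nonneg_left (add_le_add (hexp t ht2) (hexp (-t) ?_)) (by positivity)
        rw [neg_sq, ht2]
    _ ≤ (4 ^ k * k ^ k) * (Real.exp (k * V) + Real.exp (k * V)) :=
        mul_le_mul_of_nonneg_right hfac (by positivity)
    _ = _ := by ring

theorem bilinear_skewMatrix {r : ℕ} (x y : Fin r → ℝ) (ω : Fin r × Fin r → Bool) :
    ∑ i, ∑ j, x i * skewMatrix ω i j * y j =
      ∑ e, (∑ p : Fin r × Fin r with edgePair p.1 p.2 = e,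
        if p.1 = p.2 then 0 else x p.1 * y p.2) * skewSign (ω e) := by
  rw [← Fintype.sum_prod_type' (fun i j => x i * skewMatrix ω i j * y j),
    ← Finset.sum_fiberwise (s := Finset.univ) (g := fun p : Fin r × Fin r => edgePair p.1 p.2)]
  refine Finset.sum_congr rfl fun e _ => ?_
  rw [Finset.sum_mul]
  refine Finset.sum_congr rfl fun p hp => ?_
  have hp' := (Finset.mem_filter.1 hp).2
  rw [skewMatrix, Matrix.of_apply, hp']
  split_ifs
  · simp
  · ring

/-- An unordered pair arises from at most two ordered ones, whence the factor two by Cauchy–Schwarz.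
-/
theorem sum_sq_coeff_le {r : ℕ} (x y : Fin r → ℝ) :
    ∑ e, (∑ p : Fin r × Fin r with edgePair p.1 p.2 = e,
      if p.1 = p.2 then 0 else x p.1 * y p.2) ^ 2 ≤ 2 * ((∑ i, x i ^ 2) * ∑ j, y j ^ 2) := by
  have h1 : ∀ e : Fin r × Fin r, (∑ p : Fin r × Fin r with edgePair p.1 p.2 = e,
      if p.1 = p.2 then 0 else x p.1 * y p.2) ^ 2 ≤
      2 * ∑ p : Fin r × Fin r with edgePair p.1 p.2 = e, x p.1 ^ 2 * y p.2 ^ 2 := by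
    intro e
    refine (sq_sum_le_card_mul_sum_sq).trans ?_
    have hc : (Finset.univ.filter fun p : Fin r × Fin r => edgePair p.1 p.2 = e).card ≤ 2 := by
      refine (Finset.card_le_card (t := {(e.1, e.2), (e.2, e.1)}) fun p hp => ?_).trans
        Finset.card_le_two
      have hp' := (Finset.mem_filter.1 hp).2
      rw [Finset.mem_insert, Finset.mem_singleton, ← hp', edgePair]
      split_ifs <;> simp
    have hc' : ((Finset.univ.filter fun p : Fin r × Fin r => edgePair p.1 p.2 = e).card : ℝ) ≤ 2 := by
      exact_mod_cast hc
    refine mul_le_mul hc' (Finset.sum_le_sum fun p _ => ?_)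
      (Finset.sum_nonneg fun p _ => sq_nonneg _) (by norm_num)
    split_ifs
    · rw [sq, mul_zero]; positivity
    · rw [mul_pow]
  refine (Finset.sum_le_sum fun e _ => h1 e).trans_eq ?_
  rw [← Finset.mul_sum, Finset.sum_fiberwise (s := Finset.univ)
    (g := fun p : Fin r × Fin r => edgePair p.1 p.2) (f := fun p => x p.1 ^ 2 * y p.2 ^ 2),
    Fintype.sum_prod_type, Finset.sum_mul_sum]

/-! ### A net of lattice points -/

/-- Integer vectors of length `r` with squared norm at most `7 r`. -/
def latticeNet (r : ℕ) : Finset (Fin r → ℤ) :=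
  (Fintype.piFinset fun _ => Finset.Icc (-(7 * r : ℤ)) (7 * r)).filter
    fun w => ∑ i, w i ^ 2 ≤ 7 * r

theorem mem_latticeNet {r : ℕ} {w : Fin r → ℤ} (h : ∑ i, w i ^ 2 ≤ 7 * r) : w ∈ latticeNet r := by
  rw [latticeNet, Finset.mem_filter, Fintype.mem_piFinset]
  refine ⟨fun i => ?_, h⟩
  have h1 : w i ^ 2 ≤ 7 * r :=
    (Finset.single_le_sum (f := fun i => w i ^ 2) (fun i _ => sq_nonneg _)
      (Finset.mem_univ i)).trans h
  have h2 : |w i| ≤ w i ^ 2 := by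
    rw [← sq_abs]
    rcases eq_or_ne (w i) 0 with h0 | h0
    · simp [h0]
    · have := Int.one_le_abs h0; nlinarith
  rw [Finset.mem_Icc]
  exact abs_le.1 (h2.trans h1)

theorem sum_half_pow_le (M : ℕ) :
    ∑ w ∈ Finset.Icc (-(M : ℤ)) M, (1 / 2 : ℝ) ^ w.natAbs ≤ 4 := by
  have hsub : Finset.Icc (-(M : ℤ)) M ⊆
      (Finset.range (M + 1)).image (fun j : ℕ => (j : ℤ)) ∪
        (Finset.range (M + 1)).image (fun j : ℕ => -(j : ℤ)) := by
    intro w hw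
    rw [Finset.mem_Icc] at hw
    rw [Finset.mem_union, Finset.mem_image, Finset.mem_image]
    rcases le_total 0 w with h | h
    · exact Or.inl ⟨w.natAbs, by rw [Finset.mem_range]; omega, by omega⟩
    · exact Or.inr ⟨w.natAbs, by rw [Finset.mem_range]; omega, by omega⟩
  have hgeo : ∑ j ∈ Finset.range (M + 1), (1 / 2 : ℝ) ^ j ≤ 2 := by
    have := sum_geometric_two_le (M + 1)
    simpa using this
  calc _ ≤ ∑ w ∈ (Finset.range (M + 1)).image (fun j : ℕ => (j : ℤ)) ∪
        (Finset.range (M + 1)).image (fun j : ℕ => -(j : ℤ)), (1 / 2 : ℝ) ^ w.natAbs :=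
        Finset.sum_le_sum_of_subset_of_nonneg hsub fun _ _ _ => by positivity
    _ ≤ ∑ w ∈ (Finset.range (M + 1)).image (fun j : ℕ => (j : ℤ)), (1 / 2 : ℝ) ^ w.natAbs +
        ∑ w ∈ (Finset.range (M + 1)).image (fun j : ℕ => -(j : ℤ)), (1 / 2 : ℝ) ^ w.natAbs := by
        rw [← Finset.sum_union_inter]
        have : 0 ≤ ∑ w ∈ (Finset.range (M + 1)).image (fun j : ℕ => (j : ℤ)) ∩
          (Finset.range (M + 1)).image (fun j : ℕ => -(j : ℤ)), (1 / 2 : ℝ) ^ w.natAbs :=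
          Finset.sum_nonneg fun _ _ => by positivity
        linarith
    _ ≤ 4 := by
        rw [Finset.sum_image (by intro a _ b _ h; simpa using h),
          Finset.sum_image (by intro a _ b _ h; simpa using h)]
        simp only [Int.natAbs_neg, Int.natAbs_natCast]
        linarith

/-- For integers the sum of absolute values is at most the sum of squares, hence at most `7 r`. So
the product weight `2 ^ (7 r) ∏ 2 ^ (-|w i|)` is at least one on the net, and its sum over the whole
box factors into `r` sums of at most `4`. -/
theorem card_latticeNet_le (r : ℕ) : ((latticeNet r).card : ℝ) ≤ 2 ^ (9 * r) := by
  have h1 : ∀ w ∈ latticeNet r, (1 : ℝ) ≤ 2 ^ (7 * r) * ∏ i, (1 / 2 : ℝ) ^ (w i).natAbs := by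
    intro w hw
    have hw2 := (Finset.mem_filter.1 hw).2
    have h2 : ∑ i, (w i).natAbs ≤ 7 * r := by
      have : (∑ i, (w i).natAbs : ℤ) ≤ ∑ i, w i ^ 2 := by
        refine Finset.sum_le_sum fun i _ => ?_
        rw [← Int.natAbs_sq]
        exact_mod_cast Nat.le_self_pow (by norm_num) _
      exact_mod_cast this.trans hw2
    rw [Finset.prod_pow_eq_pow_sum]
    calc (1 : ℝ) = 2 ^ (7 * r) * (1 / 2 : ℝ) ^ (7 * r) := by rw [← mul_pow]; norm_num
      _ ≤ _ := mul_le_mul_of_nonneg_left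
        (pow_le_pow_of_le_one (by norm_num) (by norm_num) h2) (by positivity)
  calc ((latticeNet r).card : ℝ) = ∑ w ∈ latticeNet r, (1 : ℝ) := by simp
    _ ≤ ∑ w ∈ latticeNet r, 2 ^ (7 * r) * ∏ i, (1 / 2 : ℝ) ^ (w i).natAbs :=
        Finset.sum_le_sum h1
    _ ≤ ∑ w ∈ Fintype.piFinset fun _ : Fin r => Finset.Icc (-(7 * r : ℤ)) (7 * r),
        2 ^ (7 * r) * ∏ i, (1 / 2 : ℝ) ^ (w i).natAbs :=
        Finset.sum_le_sum_of_subset_of_nonneg (Finset.filter_subset _ _)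
          fun _ _ _ => by positivity
    _ = 2 ^ (7 * r) * ∏ _i : Fin r, ∑ w ∈ Finset.Icc (-(7 * r : ℤ)) (7 * r),
        (1 / 2 : ℝ) ^ w.natAbs := by
        rw [← Finset.mul_sum, Finset.prod_univ_sum]
    _ ≤ 2 ^ (7 * r) * ∏ _i : Fin r, (4 : ℝ) := by
        refine mul_le_mul_of_nonneg_left (Finset.prod_le_prod (fun _ _ => Finset.sum_nonneg
          fun _ _ => by positivity) fun i _ => ?_) (by positivity)
        have := sum_half_pow_le (7 * r)
        push_cast at this
        exact this
    _ = 2 ^ (9 * r) := by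
        rw [Finset.prod_const, Finset.card_univ, Fintype.card_fin,
          show (4 : ℝ) = 2 ^ 2 by norm_num, ← pow_mul, ← pow_add]
        congr 1; ring

/-- The lattice point `w`, scaled to lie near the unit ball. -/
def netPoint {r : ℕ} (w : Fin r → ℤ) : EuclideanSpace ℝ (Fin r) :=
  WithLp.toLp 2 fun i => (w i : ℝ) / (2 * Real.sqrt r)

theorem norm_sq_netPoint {r : ℕ} (w : Fin r → ℤ) :
    ‖netPoint w‖ ^ 2 = (∑ i, (w i : ℝ) ^ 2) / (4 * r) := by
  have hr0 : (0 : ℝ) ≤ r := Nat.cast_nonneg r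
  rw [EuclideanSpace.norm_sq_eq, Finset.sum_div]
  refine Finset.sum_congr rfl fun i _ => ?_
  rw [netPoint, Real.norm_eq_abs, sq_abs, div_pow, mul_pow, Real.sq_sqrt hr0]
  norm_num

/-- Rounding to the grid of width `1 / (2 √r)` moves each coordinate by at most `1 / (4 √r)`. The
result has norm at most `5/4`, hence a lattice vector of squared norm at most `25/4 r ≤ 7 r`. -/
theorem exists_netPoint {r : ℕ} (hr : 1 ≤ r) {x : EuclideanSpace ℝ (Fin r)} (hx : ‖x‖ ≤ 1) :
    ∃ w ∈ latticeNet r, ‖x - netPoint w‖ ≤ 1 / 4 := by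
  have hr0 : (0 : ℝ) < r := by exact_mod_cast hr
  have hs : 0 < Real.sqrt r := Real.sqrt_pos.2 hr0
  set w : Fin r → ℤ := fun i => round (2 * Real.sqrt r * x i) with hw
  have hdist : ‖x - netPoint w‖ ^ 2 ≤ (1 / 4) ^ 2 := by
    rw [EuclideanSpace.norm_sq_eq]
    have : ∀ i, ‖(x - netPoint w) i‖ ^ 2 ≤ 1 / (16 * r) := by
      intro i
      have h1 := abs_sub_round (2 * Real.sqrt r * x i)
      have h2 : (x - netPoint w) i = (2 * Real.sqrt r * x i - w i) / (2 * Real.sqrt r) := by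
        rw [PiLp.sub_apply, netPoint]
        field_simp
      rw [h2, Real.norm_eq_abs, sq_abs, div_pow, mul_pow, Real.sq_sqrt hr0.le, div_le_div_iff₀
        (by positivity) (by positivity), ← sq_abs]
      have h3 : |2 * Real.sqrt r * x i - w i| ^ 2 ≤ (1 / 2) ^ 2 :=
        pow_le_pow_left₀ (abs_nonneg _) h1 2
      nlinarith
    calc _ ≤ ∑ _i : Fin r, 1 / (16 * (r : ℝ)) := Finset.sum_le_sum fun i _ => this i
      _ = (1 / 4) ^ 2 := by
        rw [Finset.sum_const, Finset.card_univ, Fintype.card_fin, nsmul_eq_mul]; field_simp; norm_num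
  have hdist' : ‖x - netPoint w‖ ≤ 1 / 4 := by
    exact (abs_le_of_sq_le_sq' hdist (by norm_num)).2
  refine ⟨w, mem_latticeNet ?_, hdist'⟩
  have h1 : ‖netPoint w‖ ≤ 5 / 4 := by
    have : netPoint w = x - (x - netPoint w) := by abel
    rw [this]
    exact (norm_sub_le _ _).trans (by linarith)
  have h2 : ‖netPoint w‖ ^ 2 ≤ (5 / 4) ^ 2 := pow_le_pow_left₀ (norm_nonneg _) h1 2
  rw [norm_sq_netPoint, div_le_iff₀ (by positivity)] at h2
  have h3 : (∑ i, (w i : ℝ) ^ 2) ≤ 7 * r := by nlinarith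
  exact_mod_cast h3

/-- Replacing two unit vectors by net points costs `1/4 + 5/4 · 1/4 = 9/16` of the norm; the
remaining `7/16` is controlled on the net. -/
theorem norm_le_of_net {r : ℕ} (hr : 1 ≤ r)
    (T : EuclideanSpace ℝ (Fin r) →L[ℝ] EuclideanSpace ℝ (Fin r)) {M : ℝ} (hM : 0 ≤ M)
    (h : ∀ w ∈ latticeNet r, ∀ w' ∈ latticeNet r, |inner ℝ (netPoint w) (T (netPoint w'))| ≤ M) :
    ‖T‖ ≤ 16 / 7 * M := by
  have key : ‖T‖ ≤ M + 9 / 16 * ‖T‖ := by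
    refine ContinuousLinearMap.opNorm_le_of_unit_norm (by positivity) fun x hx => ?_
    by_cases hTx : T x = 0
    · rw [hTx, norm_zero]; positivity
    set y := (‖T x‖)⁻¹ • T x with hy
    have hTx' : ‖T x‖ ≠ 0 := norm_ne_zero_iff.2 hTx
    have hy1 : ‖y‖ = 1 := by rw [hy, norm_smul, norm_inv, norm_norm, inv_mul_cancel₀ hTx']
    have hyx : inner ℝ y (T x) = ‖T x‖ := by
      rw [hy, inner_smul_left, real_inner_self_eq_norm_sq]
      simp only [conj_trivial]
      field_simp
    obtain ⟨w, hw, hwx⟩ := exists_netPoint hr hy1.le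
    obtain ⟨w', hw', hwx'⟩ := exists_netPoint hr hx.le
    set z := netPoint w
    set z' := netPoint w'
    have e : inner ℝ y (T x) = inner ℝ z (T z') + inner ℝ (y - z) (T x) + inner ℝ z (T (x - z')) := by
      rw [map_sub, inner_sub_left, inner_sub_right]; ring
    have hz : ‖z‖ ≤ 5 / 4 := by
      have : z = y - (y - z) := by abel
      rw [this]
      exact (norm_sub_le _ _).trans (by linarith)
    have h1 := h w hw w' hw'
    have h2 : inner ℝ (y - z) (T x) ≤ 1 / 4 * ‖T‖ := by
      refine (real_inner_le_norm _ _).trans ?_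
      have : ‖T x‖ ≤ ‖T‖ := by simpa [hx] using T.le_opNorm x
      exact mul_le_mul hwx this (norm_nonneg _) (by norm_num)
    have h3 : inner ℝ z (T (x - z')) ≤ 5 / 4 * (‖T‖ * (1 / 4)) := by
      refine (real_inner_le_norm _ _).trans ?_
      refine mul_le_mul hz ((T.le_opNorm _).trans ?_) (norm_nonneg _) (by norm_num)
      exact mul_le_mul_of_nonneg_left hwx' (norm_nonneg _)
    rw [← hyx, e]
    linarith [(abs_le.1 h1).2]
  linarith

/-! ### The number of repeating walks -/

theorem trace_pow_le_norm {r : ℕ} (Y : Matrix (Fin r) (Fin r) ℝ) (p : ℕ) :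
    (Y ^ p).trace ≤ r * ‖Matrix.toEuclideanCLM (𝕜 := ℝ) Y‖ ^ p := by
  have h : ∀ i, (Y ^ p) i i ≤ ‖Matrix.toEuclideanCLM (𝕜 := ℝ) Y‖ ^ p := by
    intro i
    set e : EuclideanSpace ℝ (Fin r) := EuclideanSpace.single i 1
    have he : ‖e‖ = 1 := by simp [e]
    have h1 : (Y ^ p) i i = inner ℝ e (Matrix.toEuclideanCLM (𝕜 := ℝ) (Y ^ p) e) := by
      rw [EuclideanSpace.inner_single_left, Matrix.ofLp_toEuclideanCLM]
      simp [e]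
    rw [h1, map_pow]
    refine (real_inner_le_norm _ _).trans ?_
    rw [he, one_mul]
    refine (ContinuousLinearMap.le_opNorm _ _).trans ?_
    rw [he, mul_one]
    rcases Nat.eq_zero_or_pos p with rfl | hp
    · rw [pow_zero, pow_zero]; exact ContinuousLinearMap.norm_id_le
    · exact norm_pow_le' _ hp
  calc (Y ^ p).trace ≤ ∑ _i : Fin r, ‖Matrix.toEuclideanCLM (𝕜 := ℝ) Y‖ ^ p :=
        Finset.sum_le_sum fun i _ => h i
    _ = _ := by simp

/-- The maximum over the net is replaced by the sum over its at most `2 ^ (18 r)` pairs, each with a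
moment bound. All constants to the power `k` are collected in `2 ^ 16`. -/
theorem card_repeating_le {r L k : ℕ} (hr : 1 ≤ r) (hk : 1 ≤ k) (hL : L + 1 = 2 * k) :
    (Nat.card {u : Fin (L + 1) → Fin r | Repeating u} : ℝ) ≤
      2 * r * 2 ^ (18 * r) * 2 ^ (16 * k) * k ^ k := by
  have hr0 : (0 : ℝ) < r := by exact_mod_cast hr
  have hintegrable : ∀ f : (Fin r × Fin r → Bool) → ℝ, Integrable f (skewLaw r) :=
    fun f => Integrable.of_finite
  obtain ⟨S, hS⟩ : ∃ S : (Fin r → ℤ) → (Fin r → ℤ) → (Fin r × Fin r → Bool) → ℝ,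
      ∀ w w' ω, S w w' ω =
        inner ℝ (netPoint w) (Matrix.toEuclideanCLM (𝕜 := ℝ) (skewMatrix ω) (netPoint w')) :=
    ⟨_, fun _ _ _ => rfl⟩
  have hSeq : ∀ w w' ω, S w w' ω = ∑ i, ∑ j, netPoint w i * skewMatrix ω i j * netPoint w' j := by
    intro w w' ω
    simp only [hS, EuclideanSpace.inner_eq_star_dotProduct, dotProduct, Matrix.toEuclideanCLM]
    refine Finset.sum_congr rfl fun i _ => ?_
    simp only [star_trivial, Pi.star_apply]
    change (∑ j, skewMatrix ω i j * netPoint w' j) * netPoint w i = _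
    rw [Finset.sum_mul]
    exact Finset.sum_congr rfl fun j _ => by ring
  have hpt : ∀ ω, ‖Matrix.toEuclideanCLM (𝕜 := ℝ) (skewMatrix ω)‖ ^ (2 * k) ≤
      (16 / 7) ^ (2 * k) * ∑ w ∈ latticeNet r, ∑ w' ∈ latticeNet r, S w w' ω ^ (2 * k) := by
    intro ω
    have hne : (latticeNet r ×ˢ latticeNet r).Nonempty :=
      ⟨(0, 0), Finset.mk_mem_product (mem_latticeNet (by simp)) (mem_latticeNet (by simp))⟩
    obtain ⟨q, hq, hmax⟩ := Finset.exists_max_image _ (fun q => |S q.1 q.2 ω|) hne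
    have h1 := norm_le_of_net hr (Matrix.toEuclideanCLM (𝕜 := ℝ) (skewMatrix ω))
      (abs_nonneg (S q.1 q.2 ω)) fun w hw w' hw' => by
        rw [← hS]
        exact hmax (w, w') (Finset.mk_mem_product hw hw')
    refine (pow_le_pow_left₀ (norm_nonneg _) h1 _).trans ?_
    rw [mul_pow, Even.pow_abs (even_two_mul k)]
    refine mul_le_mul_of_nonneg_left ?_ (by positivity)
    rw [← Finset.sum_product' (f := fun w w' => S w w' ω ^ (2 * k))]
    have h2 := Finset.single_le_sum (f := fun q : (Fin r → ℤ) × (Fin r → ℤ) =>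
      S q.1 q.2 ω ^ (2 * k)) (fun q _ => Even.pow_nonneg (even_two_mul k) _) hq
    exact h2
  have hmom : ∀ w ∈ latticeNet r, ∀ w' ∈ latticeNet r,
      ∫ ω, S w w' ω ^ (2 * k) ∂skewLaw r ≤ 2 * 4 ^ k * k ^ k * Real.exp (k * 7) := by
    intro w hw w' hw'
    simp only [hSeq, bilinear_skewMatrix]
    refine integral_pow_sum_skewSign_le _ ((sum_sq_coeff_le _ _).trans ?_) hk
    have hn : ∀ w ∈ latticeNet r, ∑ i, netPoint w i ^ 2 ≤ 7 / 4 := by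
      intro w hw
      have h1 := norm_sq_netPoint w
      rw [EuclideanSpace.norm_sq_eq] at h1
      simp only [Real.norm_eq_abs, sq_abs] at h1
      rw [h1, div_le_iff₀ (by positivity)]
      have h2 : (∑ i, (w i : ℝ) ^ 2) ≤ 7 * r := by exact_mod_cast (Finset.mem_filter.1 hw).2
      linarith
    have h1 := hn w hw
    have h2 := hn w' hw'
    have h3 : 0 ≤ ∑ i, netPoint w i ^ 2 := Finset.sum_nonneg fun _ _ => sq_nonneg _
    have h4 : 0 ≤ ∑ i, netPoint w' i ^ 2 := Finset.sum_nonneg fun _ _ => sq_nonneg _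
    -- Net points have squared norm at most `7/4`, so the variance is at most `2 (7/4)² = 49/8 ≤ 7`.
    nlinarith
  refine card_repeating_le_integral.trans ?_
  rw [hL]
  set Nc : ℝ := ((latticeNet r).card : ℝ)
  have hN : Nc ≤ 2 ^ (9 * r) := card_latticeNet_le r
  have hN0 : 0 ≤ Nc := Nat.cast_nonneg _
  calc ∫ ω, (skewMatrix ω ^ (2 * k)).trace ∂skewLaw r
      ≤ ∫ ω, r * ((16 / 7) ^ (2 * k) *
          ∑ w ∈ latticeNet r, ∑ w' ∈ latticeNet r, S w w' ω ^ (2 * k)) ∂skewLaw r :=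
        integral_mono (hintegrable _) (hintegrable _) fun ω => (trace_pow_le_norm _ _).trans
          (mul_le_mul_of_nonneg_left (hpt ω) hr0.le)
    _ = r * ((16 / 7) ^ (2 * k) *
          ∑ w ∈ latticeNet r, ∑ w' ∈ latticeNet r, ∫ ω, S w w' ω ^ (2 * k) ∂skewLaw r) := by
        rw [integral_const_mul, integral_const_mul, integral_finsetSum _ fun _ _ => hintegrable _]
        congr 2
        exact Finset.sum_congr rfl fun w _ => integral_finsetSum _ fun _ _ => hintegrable _
    _ ≤ r * ((16 / 7) ^ (2 * k) *
          ∑ w ∈ latticeNet r, ∑ w' ∈ latticeNet r, 2 * 4 ^ k * k ^ k * Real.exp (k * 7)) := by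
        gcongr with w hw w' hw'
        exact hmom w hw w' hw'
    _ = r * ((16 / 7) ^ (2 * k) * (Nc * Nc * (2 * 4 ^ k * k ^ k * Real.exp (k * 7)))) := by
        simp only [Finset.sum_const, nsmul_eq_mul, Nc]; ring
    _ ≤ r * (6 ^ k * (2 ^ (9 * r) * 2 ^ (9 * r) * (2 * 4 ^ k * k ^ k * 2187 ^ k))) := by
        have h1 : ((16 / 7 : ℝ)) ^ (2 * k) ≤ 6 ^ k := by
          rw [pow_mul]; exact pow_le_pow_left₀ (by norm_num) (by norm_num) k
        have h2 : Real.exp (k * 7) ≤ 2187 ^ k := by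
          rw [mul_comm, mul_comm (7 : ℝ), Real.exp_nat_mul]
          refine pow_le_pow_left₀ (Real.exp_pos _).le ?_ k
          have : Real.exp 7 = Real.exp 1 ^ 7 := by rw [← Real.exp_nat_mul]; norm_num
          rw [this]
          calc Real.exp 1 ^ 7 ≤ 3 ^ 7 :=
                pow_le_pow_left₀ (Real.exp_pos _).le (by linarith [Real.exp_one_lt_d9]) 7
            _ = 2187 := by norm_num
        gcongr
    _ = 2 * r * 2 ^ (18 * r) * 52488 ^ k * k ^ k := by
        rw [show (52488 : ℝ) = 6 * 4 * 2187 by norm_num, mul_pow, mul_pow,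
          show 18 * r = 9 * r + 9 * r by ring, pow_add]
        ring
    _ ≤ _ := by
        have : (52488 : ℝ) ^ k ≤ 2 ^ (16 * k) := by
          rw [pow_mul]; exact pow_le_pow_left₀ (by norm_num) (by norm_num) k
        gcongr

/-! ### From traces of powers to the operator norm -/

/-- The trace of an even power is a sum of even powers of the eigenvalues, so it bounds each of
them. -/
theorem sum_sq_mulVec_le_of_trace_pow_lt {ι : Type*} [Fintype ι] [DecidableEq ι]
    {M : Matrix ι ι ℝ} (hM : M.transpose = M) {k : ℕ} {t : ℝ}
    (h : (M ^ (2 * k)).trace < t ^ (2 * k)) (v : ι → ℝ) :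
    ∑ i, (M.mulVec v) i ^ 2 ≤ t ^ 2 * ∑ i, v i ^ 2 := by
  have hH : M.IsHermitian := by rw [Matrix.IsHermitian, Matrix.conjTranspose_eq_transpose_of_trivial, hM]
  have hsym := Matrix.isSymmetric_toEuclideanLin_iff.2 hH
  set T := Matrix.toEuclideanLin M with hT
  set b := hsym.eigenvectorBasis rfl with hb
  set ev := hsym.eigenvalues rfl with hev
  have hTb : ∀ i, T (b i) = ev i • b i := fun i => by
    have := hsym.apply_eigenvectorBasis rfl i
    exact this
  have hpow : ∀ (l : ℕ) i, (T ^ l) (b i) = ev i ^ l • b i := by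
    intro l i
    induction l with
    | zero => simp
    | succ l ih =>
      rw [pow_succ', Module.End.mul_apply, ih, map_smul, hTb, smul_smul, pow_succ]
  have htr : (M ^ (2 * k)).trace = ∑ i, ev i ^ (2 * k) := by
    have h1 : Matrix.toEuclideanLin (M ^ (2 * k)) = T ^ (2 * k) := by
      have : ∀ l, Matrix.toEuclideanLin (M ^ l) = T ^ l := by
        intro l
        induction l with
        | zero => ext; simp
        | succ l ih =>
          rw [pow_succ, pow_succ, ← ih]
          ext v i
          simp [hT, Matrix.toLpLin_apply]
      exact this _
    have h2 : LinearMap.trace ℝ _ (Matrix.toEuclideanLin (M ^ (2 * k))) = (M ^ (2 * k)).trace := by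
      rw [Matrix.toEuclideanLin_eq_toLin_orthonormal, Matrix.trace_toLin_eq]
    rw [← h2, h1, LinearMap.trace_eq_sum_inner _ b]
    refine Finset.sum_congr rfl fun i _ => ?_
    rw [hpow, inner_smul_right, real_inner_self_eq_norm_sq, b.norm_eq_one]
    simp
  have hle : ∀ i, ev i ^ 2 ≤ t ^ 2 := by
    intro i
    have h1 : ev i ^ (2 * k) ≤ (M ^ (2 * k)).trace := by
      rw [htr]
      exact Finset.single_le_sum (f := fun i => ev i ^ (2 * k))
        (fun j _ => Even.pow_nonneg (even_two_mul k) _) (Finset.mem_univ i)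
    have h2 := h1.trans_lt h
    rw [pow_mul, pow_mul] at h2
    exact (lt_of_pow_lt_pow_left₀ k (sq_nonneg t) h2).le
  set x : EuclideanSpace ℝ ι := WithLp.toLp 2 v with hx
  have e1 : ∑ i, (M.mulVec v) i ^ 2 = ‖T x‖ ^ 2 := by
    rw [EuclideanSpace.norm_sq_eq]
    simp [hT, hx, Matrix.toLpLin_apply]
  have e2 : ∑ i, v i ^ 2 = ‖x‖ ^ 2 := by
    rw [EuclideanSpace.norm_sq_eq]
    simp [hx]
  have hin : ∀ i, inner ℝ (b i) (T x) = ev i * inner ℝ (b i) x := by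
    intro i
    rw [← hsym, hTb, real_inner_smul_left]
  rw [e1, e2, ← b.sum_sq_norm_inner_right, ← b.sum_sq_norm_inner_right, Finset.mul_sum]
  refine Finset.sum_le_sum fun i _ => ?_
  rw [hin, norm_mul, mul_pow]
  refine mul_le_mul_of_nonneg_right ?_ (sq_nonneg _)
  rw [Real.norm_eq_abs, sq_abs]
  exact hle i

theorem frob_mul_le_of_mulVec_le {ι κ : Type*} [Fintype ι] [Fintype κ] [DecidableEq ι]
    {M : Matrix ι ι ℝ} {t : ℝ} (ht : 0 ≤ t)
    (h : ∀ v : ι → ℝ, ∑ i, (M.mulVec v) i ^ 2 ≤ t ^ 2 * ∑ i, v i ^ 2) (X : Matrix ι κ ℝ) :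
    frob (M * X) ≤ t * frob X := by
  unfold frob
  rw [← Real.sqrt_sq ht, ← Real.sqrt_mul (sq_nonneg t)]
  refine Real.sqrt_le_sqrt ?_
  rw [Finset.sum_comm, Finset.sum_comm (f := fun i j => X i j ^ 2), Finset.mul_sum]
  exact Finset.sum_le_sum fun j _ => h fun i => X i j

/-! ### Moments of the Haar measure -/

instance isProbabilityMeasure_unif (G : GroupKind) (d : ℕ) : IsProbabilityMeasure (unif G d) :=
  ⟨by simpa [unif] using Measure.haarMeasure_self (K₀ := (⊤ : TopologicalSpace.PositiveCompacts (G.subgroup d)))⟩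

instance isMulLeftInvariant_unif (G : GroupKind) (d : ℕ) : (unif G d).IsMulLeftInvariant := by
  unfold unif; infer_instance

/-- The entries of a group element. -/
def entry {G : GroupKind} {d : ℕ} (a b : Fin d) (g : G.subgroup d) : ℝ :=
  ((g : Matrix.orthogonalGroup (Fin d) ℝ) : Matrix (Fin d) (Fin d) ℝ) a b

theorem integral_entry_eq_zero_of_neg {G : GroupKind} {d : ℕ} {a b : Fin d} (h : G.subgroup d)
    (hh : ∀ g : G.subgroup d, entry a b (h * g) = -entry a b g) :
    ∫ g, entry a b g ∂unif G d = 0 := by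
  have h1 := integral_mul_left_eq_self (μ := unif G d) (fun g => entry a b g) h
  simp only [hh, integral_neg] at h1
  linarith

theorem integral_entry_orthogonal {d : ℕ} (a b : Fin d) :
    ∫ g, entry a b g ∂unif .orthogonal d = 0 := by
  refine integral_entry_eq_zero_of_neg (h := ⟨⟨-1, ?_⟩, Subgroup.mem_top _⟩) fun g => ?_
  · rw [Matrix.mem_orthogonalGroup_iff]; simp
  · simp [entry]

/-- Left multiplication by the diagonal matrix with `-1` at `a` and at one further place stays in
`SO(d)` and negates row `a`; the further place needs `d ≠ 1`. -/
theorem integral_entry_rotation {d : ℕ} (hd : d ≠ 1) (a b : Fin d) :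
    ∫ g, entry a b g ∂unif .rotation d = 0 := by
  obtain ⟨a', ha'⟩ : ∃ a' : Fin d, a' ≠ a := by
    have : Nontrivial (Fin d) := Fin.nontrivial_iff_two_le.2 (by have := a.pos; omega)
    exact exists_ne a
  set f : Fin d → ℝ := fun i => if i = a ∨ i = a' then -1 else 1 with hf
  have hQ : Matrix.diagonal f ∈ Matrix.orthogonalGroup (Fin d) ℝ := by
    rw [Matrix.mem_orthogonalGroup_iff]
    rw [Matrix.diagonal_transpose, Matrix.diagonal_mul_diagonal, ← Matrix.diagonal_one]
    congr 1
    funext i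
    simp only [hf]; split_ifs <;> norm_num
  have hdet : (Matrix.diagonal f).det = 1 := by
    rw [Matrix.det_diagonal]
    simp only [hf]
    rw [Finset.prod_ite, Finset.prod_const, Finset.prod_const_one, mul_one]
    have : (Finset.univ.filter fun i : Fin d => i = a ∨ i = a') = {a, a'} := by
      ext i; simp
    rw [this, Finset.card_pair ha'.symm]; norm_num
  refine integral_entry_eq_zero_of_neg (h := ⟨⟨Matrix.diagonal f, hQ⟩, hdet⟩) fun g => ?_
  simp [entry, Matrix.diagonal_mul, hf]

theorem abs_entry_le_one {d : ℕ} {Q : Matrix (Fin d) (Fin d) ℝ} (hQ : Q ∈ Orth d) (a b : Fin d) :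
    |Q a b| ≤ 1 := by
  have h := congrFun (congrFun (orth_mul_transpose hQ) a) a
  rw [Matrix.mul_apply, Matrix.one_apply_eq] at h
  have h2 : Q a b * Q a b ≤ 1 := by
    rw [← h]
    exact Finset.single_le_sum (f := fun k => Q a k * Q.transpose k a)
      (fun k _ => mul_self_nonneg _) (Finset.mem_univ b)
  exact abs_le.2 ⟨by nlinarith, by nlinarith⟩

theorem measurable_entry {G : GroupKind} {d : ℕ} (a b : Fin d) :
    Measurable (entry (G := G) a b) := by
  have h1 : Measurable fun g : G.subgroup d =>
      ((g : Matrix.orthogonalGroup (Fin d) ℝ) : Matrix (Fin d) (Fin d) ℝ) :=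
    measurable_subtype_coe.comp measurable_subtype_coe
  exact (measurable_pi_apply b).comp ((measurable_pi_apply a).comp h1)

/-! ### The tail of the operator norm of the noise -/

/-- Markov's inequality for the trace of the power `2 k`, which is nonnegative because it is the
squared Frobenius norm of the power `k`. -/
theorem measure_noise_le {n d r L k : ℕ} {S : Type*} [MeasurableSpace S]
    {μ : Fin n × Fin n → Measure S} [∀ e, IsProbabilityMeasure (μ e)]
    {F : Fin n × Fin d → Fin n × Fin d → S → ℝ} {b : Fin n × Fin n → S → ℝ} {P : ℝ}
    (hP0 : 0 ≤ P) (hP1 : P ≤ 1)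
    (hb0 : ∀ e x, 0 ≤ b e x) (hb1 : ∀ e x, b e x ≤ 1) (hbm : ∀ e, Measurable (b e))
    (hF : ∀ x y s, |F x y s| ≤ b (edgePair x.1 y.1) s) (hFm : ∀ x y, Measurable (F x y))
    (hF0 : ∀ x y, x.1 = y.1 → F x y = 0) (hsymm : ∀ x y, F x y = F y x)
    (hmean : ∀ x y, ∫ s, F x y s ∂μ (edgePair x.1 y.1) = 0)
    (hP : ∀ e, ∫ s, b e s ^ 2 ∂μ e ≤ P)
    (hL : L + 1 = 2 * k) (hr : n * P + k + 1 ≤ r) (hr1 : 1 ≤ r) (hk : 1 ≤ k) {t : ℝ} (ht : 0 < t) :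
    Measure.pi μ {ω | ¬ ∀ v : Fin n × Fin d → ℝ,
      ∑ i, ((Matrix.of fun x y => F x y (ω (edgePair x.1 y.1)) :
        Matrix (Fin n × Fin d) (Fin n × Fin d) ℝ).mulVec v) i ^ 2 ≤ t ^ 2 * ∑ i, v i ^ 2} ≤
      ENNReal.ofReal ((d : ℝ) ^ (2 * k) *
        (n * (2 * r * 2 ^ (18 * r) * 2 ^ (16 * k) * k ^ k)) / t ^ (2 * k)) := by
  classical
  set M : (Fin n × Fin n → S) → Matrix (Fin n × Fin d) (Fin n × Fin d) ℝ := fun ω =>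
    Matrix.of fun x y => F x y (ω (edgePair x.1 y.1)) with hM
  have hMt : ∀ ω, (M ω).transpose = M ω := by
    intro ω
    ext x y
    have : edgePair y.1 x.1 = edgePair x.1 y.1 := edgePair_eq_iff.2 (Or.inr ⟨rfl, rfl⟩)
    simp only [hM, Matrix.transpose_apply, Matrix.of_apply]
    rw [this, hsymm]
  set f : (Fin n × Fin n → S) → ℝ := fun ω => (M ω ^ (2 * k)).trace with hf
  have hf0 : ∀ ω, 0 ≤ f ω := by
    intro ω
    have : M ω ^ (2 * k) = (M ω ^ k).transpose * M ω ^ k := by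
      rw [Matrix.transpose_pow, hMt, ← pow_add, two_mul]
    simp only [hf]
    rw [this, ← ip_eq_trace]
    exact ip_self_nonneg _
  have hent : ∀ (l : ℕ) x y, Measurable (fun ω => (M ω ^ l) x y) ∧
      ∃ c : ℝ, ∀ ω, |(M ω ^ l) x y| ≤ c := by
    intro l
    induction l with
    | zero =>
      intro x y
      simp only [pow_zero]
      exact ⟨measurable_const, _, fun _ => le_rfl⟩
    | succ l ih =>
      intro x y
      have h1 : ∀ z, Measurable fun ω => M ω z y := fun z =>
        (hFm z y).comp (measurable_pi_apply _)
      simp only [pow_succ, Matrix.mul_apply]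
      refine ⟨Finset.measurable_sum _ fun z _ => ((ih x z).1).mul (h1 z), ?_⟩
      choose c hc using fun z => (ih x z).2
      refine ⟨∑ z, c z, fun ω => (Finset.abs_sum_le_sum_abs _ _).trans
        (Finset.sum_le_sum fun z _ => ?_)⟩
      rw [abs_mul]
      have h2 : |M ω z y| ≤ 1 := (hF z y _).trans (hb1 _ _)
      exact (mul_le_of_le_one_right (abs_nonneg _) h2).trans (hc z ω)
  have hfm : Measurable f := Finset.measurable_sum _ fun x _ => (hent _ x x).1
  have hfi : Integrable f (Measure.pi μ) := by
    choose c hc using fun x => (hent (2 * k) x x).2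
    refine (integrable_const (∑ x, c x)).mono' hfm.aestronglyMeasurable
      (Filter.Eventually.of_forall fun ω => ?_)
    exact (Finset.abs_sum_le_sum_abs _ _).trans (Finset.sum_le_sum fun x _ => hc x ω)
  have hintegrable : ∫ ω, f ω ∂Measure.pi μ ≤ (d : ℝ) ^ (2 * k) *
      (n * (2 * r * 2 ^ (18 * r) * 2 ^ (16 * k) * k ^ k)) := by
    have h1 := abs_integral_trace_pow_le hP0 hP1 hb0 hb1 hbm hF hFm hF0 hmean hP hL hr
    have h2 := h1.trans (mul_le_mul_of_nonneg_left (mul_le_mul_of_nonneg_left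
      (card_repeating_le hr1 hk hL) (Nat.cast_nonneg n)) (pow_nonneg (Nat.cast_nonneg d) _))
    rw [hL] at h2
    exact (le_abs_self _).trans h2
  have htk : 0 < t ^ (2 * k) := by positivity
  have hmark := mul_meas_ge_le_integral_of_nonneg (μ := Measure.pi μ)
    (Filter.Eventually.of_forall hf0) hfi (t ^ (2 * k))
  have hsub : {ω | ¬ ∀ v : Fin n × Fin d → ℝ, ∑ i, ((M ω).mulVec v) i ^ 2 ≤
      t ^ 2 * ∑ i, v i ^ 2} ⊆ {ω | t ^ (2 * k) ≤ f ω} := by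
    intro ω hω
    by_contra hlt
    exact hω (sum_sq_mulVec_le_of_trace_pow_lt (hMt ω) (not_le.1 hlt))
  refine (measure_mono hsub).trans ?_
  rw [← ENNReal.ofReal_toReal (measure_ne_top (Measure.pi μ) {ω | t ^ (2 * k) ≤ f ω})]
  refine ENNReal.ofReal_le_ofReal ?_
  rw [le_div_iff₀ htk, mul_comm]
  exact hmark.trans hintegrable

/-! ### The noise of the group block model -/

section model
variable {n K d : ℕ} (G : GroupKind)

/-- The coefficient of the mean of the observation between different clusters. -/
def offMean (G : GroupKind) (d : ℕ) (q : ℝ) : ℝ :=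
  match G with
  | .orthogonal => 0
  | .rotation => if d = 1 then q else 0

/-- Either the Haar measure has mean zero, or the group is `SO(1)` and trivial. In the latter case
edges between clusters carry the mean `q`, and `d = 1` replaces its vanishing later on. -/
theorem offMean_eq (q : ℝ) :
    (offMean G d q = 0 ∧ ∀ a b : Fin d, ∫ g, entry a b g ∂unif G d = 0) ∨
      (offMean G d q = q ∧ d = 1 ∧ ∀ Q ∈ G.carrier d, Q = 1) := by
  cases G with
  | orthogonal => exact Or.inl ⟨rfl, integral_entry_orthogonal⟩
  | rotation =>
    by_cases hd : d = 1
    · refine Or.inr ⟨by simp [offMean, hd], hd, ?_⟩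
      subst hd
      intro Q hQ
      have h := (mem_rotation_iff.1 hQ).2
      rw [Matrix.det_fin_one] at h
      ext a b
      rw [Subsingleton.elim a 0, Subsingleton.elim b 0, h]; simp
    · exact Or.inl ⟨by simp [offMean, hd], integral_entry_rotation hd⟩

theorem offMean_nonneg {q : ℝ} (hq : 0 ≤ q) : 0 ≤ offMean G d q := by
  rcases offMean_eq (d := d) G q with h | h <;> rw [h.1]; exact hq

theorem offMean_le {q : ℝ} (hq : 0 ≤ q) : offMean G d q ≤ q := by
  rcases offMean_eq (d := d) G q with h | h <;> rw [h.1]; exact hq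

/-- The mean of the off-diagonal blocks of the observation. -/
def meanMatrix (C : Fin n → Fin K) (R : Fin n → Matrix (Fin d) (Fin d) ℝ) (p q : ℝ) :
    BlockMatrix n n d :=
  Matrix.of fun x y => (if C x.1 = C y.1 then p else q) * (R x.1 * (R y.1).transpose) x.2 y.2

variable {G}

/-- Half of the centred entry of the observation above the diagonal. -/
def upperNoise (C : Fin n → Fin K) (R : Fin n → Matrix (Fin d) (Fin d) ℝ) (p q : ℝ)
    (x y : Fin n × Fin d) (s : Bool × G.subgroup d) : ℝ :=
  ((if s.1 = true then
      if C x.1 = C y.1 then (R x.1 * (R y.1).transpose) x.2 y.2 else entry x.2 y.2 s.2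
    else 0) - meanMatrix C R p q x y) / 2

/-- Half of the centred off-diagonal entry of the observation. -/
def noiseEntry (C : Fin n → Fin K) (R : Fin n → Matrix (Fin d) (Fin d) ℝ) (p q : ℝ)
    (x y : Fin n × Fin d) (s : Bool × G.subgroup d) : ℝ :=
  if x.1 < y.1 then upperNoise C R p q x y s
  else if y.1 < x.1 then upperNoise C R p q y x s else 0

theorem meanMatrix_symm (C : Fin n → Fin K) (R : Fin n → Matrix (Fin d) (Fin d) ℝ) (p q : ℝ)
    (x y : Fin n × Fin d) : meanMatrix C R p q x y = meanMatrix C R p q y x := by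
  have h : (R x.1 * (R y.1).transpose) x.2 y.2 = (R y.1 * (R x.1).transpose) y.2 x.2 := by
    rw [← Matrix.transpose_apply (R x.1 * (R y.1).transpose), Matrix.transpose_mul,
      Matrix.transpose_transpose]
  simp only [meanMatrix, Matrix.of_apply, h, eq_comm]

theorem noiseEntry_symm (C : Fin n → Fin K) (R : Fin n → Matrix (Fin d) (Fin d) ℝ) (p q : ℝ)
    (x y : Fin n × Fin d) :
    noiseEntry (G := G) C R p q x y = noiseEntry C R p q y x := by
  funext s
  unfold noiseEntry
  split_ifs with h1 h2
  · exact absurd h2 h1.asymm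
  all_goals rfl

/-- `meanMatrix` has `p` times the identity on the diagonal, which leaves `1 - p` there. The noise
entries are halved so that they are bounded by one, hence the factor two. -/
theorem observation_eq (C : Fin n → Fin K) {R : Fin n → Matrix (Fin d) (Fin d) ℝ}
    (hR : ∀ i, R i ∈ Orth d) (p q : ℝ) (ω : Sample G n d) :
    observation C R ω = meanMatrix C R p q + ((1 - p) • (1 : BlockMatrix n n d) +
      (2 : ℝ) • Matrix.of fun x y => noiseEntry C R p q x y (ω (edgePair x.1 y.1))) := by
  ext x y
  obtain ⟨i, a⟩ := x
  obtain ⟨j, b⟩ := y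
  simp only [observation, Matrix.of_apply, Matrix.add_apply, Matrix.smul_apply, smul_eq_mul]
  rcases lt_trichotomy i j with h | h | h
  · have h1 : (1 : BlockMatrix n n d) (i, a) (j, b) = 0 :=
      Matrix.one_apply_ne (by simp [h.ne])
    rw [if_pos h, h1, noiseEntry, if_pos h, edgePair, if_pos h, upperNoise, observedBlock]
    by_cases hw : (ω (i, j)).1 = true <;> by_cases hc : C i = C j <;> simp [hw, hc, entry] <;> ring
  · subst h
    rw [if_neg (lt_irrefl _), if_neg (lt_irrefl _), noiseEntry, if_neg (lt_irrefl _),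
      if_neg (lt_irrefl _), meanMatrix, Matrix.of_apply, if_pos rfl]
    have h1 : (1 : BlockMatrix n n d) (i, a) (i, b) = (1 : Matrix (Fin d) (Fin d) ℝ) a b := by
      simp [Matrix.one_apply]
    rw [h1]
    dsimp only
    rw [orth_mul_transpose (hR i)]
    ring
  · have h1 : (1 : BlockMatrix n n d) (i, a) (j, b) = 0 :=
      Matrix.one_apply_ne (by simp [h.ne'])
    rw [if_neg h.asymm, if_pos h, h1, noiseEntry, if_neg h.asymm, if_pos h, edgePair,
      if_neg h.asymm, upperNoise, observedBlock, meanMatrix_symm]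
    by_cases hw : (ω (j, i)).1 = true <;> by_cases hc : C j = C i <;> simp [hw, hc, entry] <;> ring

theorem abs_meanMatrix_le {C : Fin n → Fin K} {R : Fin n → Matrix (Fin d) (Fin d) ℝ}
    (hR : ∀ i, R i ∈ Orth d) {p q P : ℝ} (hp0 : 0 ≤ p) (hq0 : 0 ≤ q) (hp : p ≤ P) (hq : q ≤ P)
    (x y : Fin n × Fin d) : |meanMatrix C R p q x y| ≤ P := by
  have h1 := abs_entry_le_one (orth_mul (hR x.1) (orth_transpose (hR y.1))) x.2 y.2
  have h2 : |if C x.1 = C y.1 then p else q| ≤ P := by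
    split_ifs
    · rwa [abs_of_nonneg hp0]
    · rwa [abs_of_nonneg hq0]
  rw [meanMatrix, Matrix.of_apply, abs_mul]
  exact (mul_le_of_le_one_right (abs_nonneg _) h1).trans h2

/-- A bound on the noise: one on the edges, small elsewhere. -/
def noiseBound (P : ℝ) (s : Bool × G.subgroup d) : ℝ := if s.1 = true then 1 else P

theorem abs_upperNoise_le {C : Fin n → Fin K} {R : Fin n → Matrix (Fin d) (Fin d) ℝ}
    (hR : ∀ i, R i ∈ Orth d) {p q P : ℝ} (hp0 : 0 ≤ p) (hq0 : 0 ≤ q) (hp : p ≤ P) (hq : q ≤ P)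
    (hP1 : P ≤ 1) (x y : Fin n × Fin d) (s : Bool × G.subgroup d) :
    |upperNoise C R p q x y s| ≤ noiseBound P s := by
  have h0 : 0 ≤ P := hp0.trans hp
  have h1 := abs_meanMatrix_le (C := C) hR hp0 hq0 hp hq x y
  unfold upperNoise noiseBound
  rw [abs_div, abs_two]
  split_ifs with hs hc
  · have h2 := abs_entry_le_one (orth_mul (hR x.1) (orth_transpose (hR y.1))) x.2 y.2
    linarith [abs_sub ((R x.1 * (R y.1).transpose) x.2 y.2) (meanMatrix C R p q x y)]
  · have h2 : |entry x.2 y.2 s.2| ≤ 1 :=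
      abs_entry_le_one (carrier_subset_orth G ⟨s.2, rfl⟩) x.2 y.2
    linarith [abs_sub (entry x.2 y.2 s.2) (meanMatrix C R p q x y)]
  · rw [zero_sub, abs_neg]
    linarith

theorem abs_noiseEntry_le {C : Fin n → Fin K} {R : Fin n → Matrix (Fin d) (Fin d) ℝ}
    (hR : ∀ i, R i ∈ Orth d) {p q P : ℝ} (hp0 : 0 ≤ p) (hq0 : 0 ≤ q) (hp : p ≤ P) (hq : q ≤ P)
    (hP1 : P ≤ 1) (x y : Fin n × Fin d) (s : Bool × G.subgroup d) :
    |noiseEntry C R p q x y s| ≤ noiseBound P s := by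
  unfold noiseEntry
  split_ifs
  · exact abs_upperNoise_le hR hp0 hq0 hp hq hP1 x y s
  · exact abs_upperNoise_le hR hp0 hq0 hp hq hP1 y x s
  · rw [abs_zero, noiseBound]
    split_ifs
    exacts [zero_le_one, hp0.trans hp]

theorem measurable_upperNoise (C : Fin n → Fin K) (R : Fin n → Matrix (Fin d) (Fin d) ℝ) (p q : ℝ)
    (x y : Fin n × Fin d) : Measurable (upperNoise (G := G) C R p q x y) := by
  unfold upperNoise
  refine ((Measurable.ite (measurable_fst (measurableSet_singleton true)) ?_
    measurable_const).sub_const _).div_const _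
  by_cases hc : C x.1 = C y.1
  · simp only [if_pos hc]; exact measurable_const
  · simp only [if_neg hc]; exact (measurable_entry _ _).comp measurable_snd

theorem measurable_noiseEntry (C : Fin n → Fin K) (R : Fin n → Matrix (Fin d) (Fin d) ℝ) (p q : ℝ)
    (x y : Fin n × Fin d) : Measurable (noiseEntry (G := G) C R p q x y) := by
  unfold noiseEntry
  split_ifs
  exacts [measurable_upperNoise C R p q x y, measurable_upperNoise C R p q y x, measurable_const]

theorem integral_edge_mul {p : ℝ} (hp0 : 0 ≤ p) (hp1 : p ≤ 1) (h : G.subgroup d → ℝ) :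
    ∫ s : Bool × G.subgroup d, (if s.1 = true then h s.2 else 0) ∂(bern p).prod (unif G d) =
      p * ∫ g, h g ∂unif G d := by
  have e : ∀ s : Bool × G.subgroup d, (if s.1 = true then h s.2 else 0) =
      (if s.1 = true then 1 else 0) * h s.2 := fun s => by split_ifs <;> simp
  simp only [e]
  rw [integral_prod_mul (fun x : Bool => if x = true then (1 : ℝ) else 0) h,
    integral_bern p hp0 hp1]
  simp

theorem integral_upperNoise {C : Fin n → Fin K} {R : Fin n → Matrix (Fin d) (Fin d) ℝ}
    (hR : ∀ i, R i ∈ G.carrier d) {p q : ℝ} (hp0 : 0 ≤ p) (hp1 : p ≤ 1) (hq0 : 0 ≤ q)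
    (hq1 : q ≤ 1) (x y : Fin n × Fin d) :
    ∫ s, upperNoise (G := G) C R p (offMean G d q) x y s
      ∂(bern (if C x.1 = C y.1 then p else q)).prod (unif G d) = 0 := by
  have hO : ∀ i, R i ∈ Orth d := fun i => carrier_subset_orth G (hR i)
  set h : G.subgroup d → ℝ := fun g =>
    if C x.1 = C y.1 then (R x.1 * (R y.1).transpose) x.2 y.2 else entry x.2 y.2 g with hh
  have hm : Measurable h := by
    by_cases hc : C x.1 = C y.1
    · simp only [hh, if_pos hc]; exact measurable_const
    · simp only [hh, if_neg hc]; exact measurable_entry _ _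
  have hb : ∀ g, |h g| ≤ 1 := by
    intro g
    simp only [hh]
    split_ifs
    · exact abs_entry_le_one (orth_mul (hO x.1) (orth_transpose (hO y.1))) x.2 y.2
    · exact abs_entry_le_one (carrier_subset_orth G ⟨g, rfl⟩) x.2 y.2
  have hr0 : 0 ≤ (if C x.1 = C y.1 then p else q) := by split_ifs <;> assumption
  have hr1 : (if C x.1 = C y.1 then p else q) ≤ 1 := by split_ifs <;> assumption
  have hintegrable : Integrable (fun s : Bool × G.subgroup d => if s.1 = true then h s.2 else 0)
      ((bern (if C x.1 = C y.1 then p else q)).prod (unif G d)) := by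
    refine (integrable_const (1 : ℝ)).mono' ?_ (Filter.Eventually.of_forall fun s => ?_)
    · exact (Measurable.ite (measurable_fst (measurableSet_singleton true))
        (hm.comp measurable_snd) measurable_const).aestronglyMeasurable
    · split_ifs
      · exact hb _
      · simp
  have e : ∀ s, upperNoise (G := G) C R p (offMean G d q) x y s =
      ((if s.1 = true then h s.2 else 0) - meanMatrix C R p (offMean G d q) x y) / 2 := fun _ => rfl
  simp only [e]
  rw [integral_div, integral_sub hintegrable (integrable_const _), integral_edge_mul hr0 hr1]
  simp only [integral_const, probReal_univ, one_smul, hh, meanMatrix, Matrix.of_apply]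
  by_cases hc : C x.1 = C y.1
  · simp [hc]
  · simp only [if_neg hc]
    rcases offMean_eq (d := d) G q with ⟨h1, h2⟩ | ⟨h1, h2, h3⟩
    · rw [h1, h2]; simp
    · have h4 : ∀ g : G.subgroup d, entry x.2 y.2 g = (R x.1 * (R y.1).transpose) x.2 y.2 := by
        intro g
        rw [h3 _ (hR x.1), h3 _ (hR y.1), entry, h3 _ ⟨g, rfl⟩]; simp
      simp [h1, h4]

theorem integral_noiseEntry {C : Fin n → Fin K} {R : Fin n → Matrix (Fin d) (Fin d) ℝ}
    (hR : ∀ i, R i ∈ G.carrier d) {p q : ℝ} (hp0 : 0 ≤ p) (hp1 : p ≤ 1) (hq0 : 0 ≤ q)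
    (hq1 : q ≤ 1) (x y : Fin n × Fin d) :
    ∫ s, noiseEntry (G := G) C R p (offMean G d q) x y s
      ∂(bern (if C (edgePair x.1 y.1).1 = C (edgePair x.1 y.1).2 then p else q)).prod (unif G d)
      = 0 := by
  unfold noiseEntry edgePair
  by_cases h1 : x.1 < y.1
  · simp only [if_pos h1]
    exact integral_upperNoise hR hp0 hp1 hq0 hq1 x y
  · by_cases h2 : y.1 < x.1
    · simp only [if_neg h1, if_pos h2]
      exact integral_upperNoise hR hp0 hp1 hq0 hq1 y x
    · simp [if_neg h1, if_neg h2]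

/-- An edge contributes at most `P`, and a missing edge at most `P² ≤ P`. -/
theorem integral_noiseBound_sq_le {r P : ℝ} (hr0 : 0 ≤ r) (hr : r ≤ P) (hP1 : P ≤ 1) :
    ∫ s, noiseBound (G := G) (d := d) P s ^ 2 ∂(bern r).prod (unif G d) ≤ 2 * P := by
  have h1 := integral_fun_fst (μ := bern r) (ν := unif G d)
    (fun x : Bool => ((if x = true then 1 else P) ^ 2 : ℝ))
  have e : ∀ s : Bool × G.subgroup d, noiseBound P s ^ 2 =
    (fun x : Bool => ((if x = true then 1 else P) ^ 2 : ℝ)) s.1 := fun _ => rfl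
  simp only [e]
  rw [h1, integral_bern r hr0 (hr.trans hP1)]
  simp
  nlinarith

end model

/-! ### Typical observations -/

section typical
variable {n K d : ℕ} {G : GroupKind}

/-- The number of pairs with an edge. -/
def edgeCount (ω : Sample G n d) : ℕ := (Finset.univ.filter fun e => (ω e).1 = true).card

/-- Markov's inequality for `2 ^ edgeCount`, whose mean is a product over the `n²` pairs of factors
at most `1 + P ≤ exp P`. -/
theorem measure_edgeCount_le {C : Fin n → Fin K} {p q P : ℝ} (hp0 : 0 ≤ p) (hq0 : 0 ≤ q)
    (hp : p ≤ P) (hq : q ≤ P) (hP1 : P ≤ 1) (N : ℕ) :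
    sampleLaw G d C p q {ω | ¬ edgeCount ω < N} ≤
      ENNReal.ofReal (Real.exp (n ^ 2 * P) / 2 ^ N) := by
  set μ : Fin n × Fin n → Measure (Bool × G.subgroup d) := fun e =>
    (bern (if C e.1 = C e.2 then p else q)).prod (unif G d) with hμ
  have hlaw : sampleLaw G d C p q = Measure.pi μ := rfl
  rw [hlaw]
  set g : Bool × G.subgroup d → ℝ := fun s => if s.1 = true then 2 else 1 with hg
  have hgm : Measurable g :=
    Measurable.ite (measurable_fst (measurableSet_singleton true)) measurable_const measurable_const
  set f : Sample G n d → ℝ := fun ω => ∏ e, g (ω e) with hf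
  have hfe : ∀ ω, f ω = 2 ^ edgeCount ω := by
    intro ω
    simp only [hf, hg, edgeCount]
    rw [Finset.prod_ite, Finset.prod_const, Finset.prod_const_one, mul_one]
  have hg1 : ∀ s, 0 ≤ g s ∧ g s ≤ 2 := fun s => by simp only [hg]; split_ifs <;> norm_num
  have hf0 : ∀ ω, 0 ≤ f ω := fun ω => by rw [hfe]; positivity
  have hfi : Integrable f (Measure.pi μ) := by
    refine (integrable_const (∏ _e : Fin n × Fin n, (2 : ℝ))).mono' ?_
      (Filter.Eventually.of_forall fun ω => ?_)
    · exact (Finset.measurable_prod _ fun e _ =>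
        hgm.comp (measurable_pi_apply e)).aestronglyMeasurable
    · rw [Real.norm_eq_abs, abs_of_nonneg (hf0 ω)]
      exact Finset.prod_le_prod (fun e _ => (hg1 _).1) fun e _ => (hg1 _).2
  have hintegrable : ∫ ω, f ω ∂Measure.pi μ ≤ Real.exp (n ^ 2 * P) := by
    have h1 : ∀ e, ∫ s, g s ∂μ e ≤ Real.exp P := by
      intro e
      have h2 := integral_fun_fst (μ := bern (if C e.1 = C e.2 then p else q)) (ν := unif G d)
        (fun x : Bool => (if x = true then 2 else 1 : ℝ))
      have h3 : 0 ≤ (if C e.1 = C e.2 then p else q) := by split_ifs <;> assumption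
      have h4 : (if C e.1 = C e.2 then p else q) ≤ P := by split_ifs <;> assumption
      have h5 : ∫ s, g s ∂μ e = 1 + (if C e.1 = C e.2 then p else q) := by
        simp only [hg, hμ]
        rw [h2, integral_bern _ h3 (h4.trans hP1)]
        simp only [if_true, Bool.false_eq_true, if_false]
        rw [probReal_univ, one_smul]
        ring
      rw [h5]
      linarith [Real.add_one_le_exp P]
    simp only [hf]
    rw [integral_fintype_prod_eq_prod (fun _ => g)]
    calc ∏ e, ∫ s, g s ∂μ e ≤ ∏ _e : Fin n × Fin n, Real.exp P :=
          Finset.prod_le_prod (fun e _ => integral_nonneg fun s => (hg1 s).1) fun e _ => h1 e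
      _ = Real.exp (n ^ 2 * P) := by
          rw [Finset.prod_const, ← Real.exp_nat_mul]
          simp [sq]
  have hmark := mul_meas_ge_le_integral_of_nonneg (μ := Measure.pi μ)
    (Filter.Eventually.of_forall hf0) hfi (2 ^ N)
  have hsub : {ω : Sample G n d | ¬ edgeCount ω < N} ⊆ {ω | 2 ^ N ≤ f ω} := by
    intro ω hω
    rw [Set.mem_ofPred_eq, hfe]
    exact pow_le_pow_right₀ (by norm_num) (not_lt.1 hω)
  refine (measure_mono hsub).trans ?_
  rw [← ENNReal.ofReal_toReal (measure_ne_top (Measure.pi μ) {ω | 2 ^ N ≤ f ω})]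
  refine ENNReal.ofReal_le_ofReal ?_
  rw [le_div_iff₀ (by positivity), mul_comm]
  exact hmark.trans hintegrable

/-- Nonzero blocks are among the diagonal ones and the two orientations of each edge. -/
theorem support_length_le {C : Fin n → Fin K} {R : Fin n → Matrix (Fin d) (Fin d) ℝ}
    {ω : Sample G n d} {L : List (Fin n × Fin n)} (hL : IsSupport (observation C R ω) L) :
    L.length ≤ n + 2 * edgeCount ω := by
  set E := Finset.univ.filter fun e => (ω e).1 = true with hE
  have hsub : L.toFinset ⊆ (Finset.univ.image fun i : Fin n => (i, i)) ∪
      (E ∪ E.image Prod.swap) := by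
    rintro ⟨i, j⟩ h
    rw [List.mem_toFinset, hL.2] at h
    simp only [Finset.mem_union, Finset.mem_image, Finset.mem_univ, true_and, hE,
      Finset.mem_filter]
    by_contra hno
    push Not at hno
    refine h ?_
    ext a b
    rcases lt_trichotomy i j with hij | hij | hij
    · have : ¬ (ω (i, j)).1 = true := hno.2.1
      simp [block, observation, hij, observedBlock, this]
    · exact absurd (by rw [hij]) (hno.1 i)
    · have : ¬ (ω (j, i)).1 = true := fun h => hno.2.2 (j, i) h rfl
      simp [block, observation, hij, hij.asymm, observedBlock, this]
  rw [← List.toFinset_card_of_nodup hL.1]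
  refine (Finset.card_le_card hsub).trans ((Finset.card_union_le _ _).trans ?_)
  have h1 : (Finset.univ.image fun i : Fin n => (i, i)).card ≤ n :=
    Finset.card_image_le.trans (by simp)
  have h2 := Finset.card_union_le E (E.image Prod.swap)
  have h3 : (E.image Prod.swap).card ≤ E.card := Finset.card_image_le
  have h4 : E.card = edgeCount ω := rfl
  omega

/-- The deviation of `ω` from the mean has norm at most `κ`. -/
def SmallNoise (C : Fin n → Fin K) (R : Fin n → Matrix (Fin d) (Fin d) ℝ) (p q κ : ℝ)
    (ω : Sample G n d) : Prop :=
  ∀ X : BlockMatrix n K d, frob ((observation C R ω - meanMatrix C R p (offMean G d q)) * X) ≤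
    κ * frob X

theorem measure_smallNoise_le {C : Fin n → Fin K} {R : Fin n → Matrix (Fin d) (Fin d) ℝ}
    (hR : ∀ i, R i ∈ G.carrier d) {p q P : ℝ} (hp0 : 0 ≤ p) (hq0 : 0 ≤ q)
    (hp : p ≤ P) (hq : q ≤ P) (hP1 : 2 * P ≤ 1) {k r : ℕ} (hk : 1 ≤ k)
    (hr : n * (2 * P) + k + 1 ≤ r) {t : ℝ} (ht : 0 < t) :
    sampleLaw G d C p q {ω | ¬ SmallNoise C R p q (1 + 2 * t) ω} ≤
      ENNReal.ofReal ((d : ℝ) ^ (2 * k) *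
        (n * (2 * r * 2 ^ (18 * r) * 2 ^ (16 * k) * k ^ k)) / t ^ (2 * k)) := by
  have hO : ∀ i, R i ∈ Orth d := fun i => carrier_subset_orth G (hR i)
  have hP0 : 0 ≤ P := hp0.trans hp
  have hr1 : 1 ≤ r := by
    have : (1 : ℝ) ≤ r := by
      have : 0 ≤ n * (2 * P) := by positivity
      have : (0 : ℝ) ≤ k := Nat.cast_nonneg k
      linarith
    exact_mod_cast this
  have hoq := (offMean_le (d := d) G hq0).trans hq
  have h := measure_noise_le (μ := fun e : Fin n × Fin n =>
      (bern (if C e.1 = C e.2 then p else q)).prod (unif G d))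
    (F := noiseEntry (G := G) C R p (offMean G d q)) (b := fun _ => noiseBound P)
    (P := 2 * P) (L := 2 * k - 1) (by positivity) hP1
    (fun _ s => by unfold noiseBound; split_ifs <;> linarith)
    (fun _ s => by unfold noiseBound; split_ifs <;> linarith)
    (fun _ => Measurable.ite (measurable_fst (measurableSet_singleton true)) measurable_const
      measurable_const)
    (fun x y s => abs_noiseEntry_le hO hp0 (offMean_nonneg G hq0) hp hoq (by linarith) x y s)
    (fun x y => measurable_noiseEntry C R p _ x y)
    (fun x y hxy => by funext s; simp [noiseEntry, hxy])
    (fun x y => noiseEntry_symm C R p _ x y)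
    (fun x y => integral_noiseEntry hR hp0 (by linarith) hq0 (by linarith) x y)
    (fun e => integral_noiseBound_sq_le (by split_ifs <;> assumption)
      (by split_ifs <;> assumption) (by linarith))
    (by omega) hr hr1 hk ht
  refine (measure_mono ?_).trans h
  intro ω hω hall
  refine hω fun X => ?_
  rw [observation_eq C hO p (offMean G d q) ω, add_sub_cancel_left, Matrix.add_mul]
  refine (frob_add_le _ _).trans ?_
  have h1 := frob_mul_le_of_mulVec_le ht.le hall X
  have hs : ∀ (c : ℝ) (Y : BlockMatrix n K d), 0 ≤ c → frob (c • Y) = c * frob Y := by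
    intro c Y hc
    rw [frob_eq_sqrt_ip, ip_smul_left, ip_smul_right, ← mul_assoc, Real.sqrt_mul (by positivity),
      Real.sqrt_mul_self hc, ← frob_eq_sqrt_ip]
  rw [Matrix.smul_mul, Matrix.one_mul, Matrix.smul_mul, hs _ _ (by linarith), hs _ _ (by norm_num)]
  have h2 := frob_nonneg X
  nlinarith

end typical

/-- With `k` and `r` of the order of `log n`, the ratio `k ^ k / (η log n) ^ (2 k)` leaves a base of
order `1 / log n`. For large `n` this base is below `exp (-(18 B + 4))`, so its power absorbs `2 ^
(18 r)` and still provides `n ^ (-4)` against the prefactor `n ^ 3`. -/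
theorem trace_bound_le {d k r : ℕ} {η n B : ℝ} (hη : 0 < η) (hn0 : 0 < n)
    (hl1 : 1 ≤ Real.log n) (hB : 0 ≤ B)
    (hlc : d ^ 2 * 2 ^ 17 * 16 / η ^ 2 * Real.exp (18 * B + 4) ≤ Real.log n) (hnB : 2 * B ≤ n)
    (hkl : Real.log n ≤ k) (hku : (k : ℝ) ≤ 2 * Real.log n)
    (hru : (r : ℝ) ≤ B * Real.log n) :
    (d : ℝ) ^ (2 * k) * (n * (2 * r * 2 ^ (18 * r) * 2 ^ (16 * k) * k ^ k)) /
      (η * Real.log n / 4) ^ (2 * k) ≤ 1 / n := by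
  have hexp : Real.exp (Real.log n) = n := Real.exp_log hn0
  generalize Real.log n = l at *
  have e1 : (k : ℝ) ^ k ≤ (2 * l) ^ k := pow_le_pow_left₀ (Nat.cast_nonneg k) hku k
  have e2 : (d : ℝ) ^ (2 * k) * 2 ^ (16 * k) * (2 * l) ^ k / (η * l / 4) ^ (2 * k) =
      (d ^ 2 * 2 ^ 17 * 16 / η ^ 2 / l) ^ k := by
    rw [pow_mul, pow_mul, pow_mul, ← mul_pow, ← mul_pow, ← div_pow]
    congr 1
    field_simp; norm_num
  have e3 : (d ^ 2 * 2 ^ 17 * 16 / η ^ 2 / l) ^ k ≤ Real.exp (-((18 * B + 4) * l)) := by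
    have h1 : d ^ 2 * 2 ^ 17 * 16 / η ^ 2 / l ≤ Real.exp (-(18 * B + 4)) := by
      rw [Real.exp_neg, div_le_iff₀ (by linarith), ← div_eq_inv_mul, le_div_iff₀ (Real.exp_pos _)]
      exact hlc
    have hc0 : 0 ≤ d ^ 2 * 2 ^ 17 * 16 / η ^ 2 / l := by positivity
    refine (pow_le_pow_left₀ hc0 h1 k).trans ?_
    rw [← Real.exp_nat_mul]
    refine Real.exp_le_exp.2 ?_
    have hM0 : 0 ≤ 18 * B + 4 := by linarith
    nlinarith
  have e4 : (2 : ℝ) ^ (18 * r) ≤ Real.exp (18 * B * l) := by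
    have h1 : (2 : ℝ) ≤ Real.exp 1 := by linarith [Real.add_one_le_exp (1 : ℝ)]
    refine (pow_le_pow_left₀ (by norm_num) h1 _).trans ?_
    rw [← Real.exp_nat_mul]
    refine Real.exp_le_exp.2 ?_
    push_cast; linarith
  have e5 : 2 * (r : ℝ) ≤ n * n := by
    have h1 : l ≤ n := by
      rw [← hexp]; linarith [Real.add_one_le_exp l]
    nlinarith
  calc (d : ℝ) ^ (2 * k) * (n * (2 * r * 2 ^ (18 * r) * 2 ^ (16 * k) * k ^ k)) /
        (η * l / 4) ^ (2 * k)
      ≤ (d : ℝ) ^ (2 * k) * (n * (2 * r * 2 ^ (18 * r) * 2 ^ (16 * k) * (2 * l) ^ k)) /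
        (η * l / 4) ^ (2 * k) := by gcongr
    _ = n * (2 * r) * 2 ^ (18 * r) *
        ((d : ℝ) ^ (2 * k) * 2 ^ (16 * k) * (2 * l) ^ k / (η * l / 4) ^ (2 * k)) := by ring
    _ ≤ n * (n * n) * Real.exp (18 * B * l) * Real.exp (-((18 * B + 4) * l)) := by
        rw [e2]; gcongr
    _ ≤ 1 / n := ?_
  have h4 : Real.exp (18 * B * l) * Real.exp (-((18 * B + 4) * l)) = ((n : ℝ) ^ 4)⁻¹ := by
    rw [← Real.exp_add, ← hexp, ← Real.exp_nat_mul, ← Real.exp_neg]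
    congr 1
    push_cast; ring
  rw [mul_assoc, h4]
  refine le_of_eq ?_
  field_simp

/-- Since `2 ≥ exp (1/2)`, the exponent `z` beats the mean by `exp (n l) ≥ exp l = n`. -/
theorem edge_bound_le {hi n l P : ℝ} {z : ℕ} (hn : 1 ≤ n) (hl : 0 ≤ l)
    (hnP : n * P = hi * l) (hz : (2 * hi + 2) * (n * l) ≤ z) (hexp : Real.exp l = n) :
    Real.exp (n ^ 2 * P) / 2 ^ z ≤ 1 / n := by
  have h1 : Real.exp (1 / 2) ≤ 2 := by
    have := Real.exp_one_lt_d9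
    have h2 : Real.exp (1 / 2) ^ 2 = Real.exp 1 := by rw [← Real.exp_nat_mul]; norm_num
    nlinarith [Real.exp_pos (1 / 2)]
  have h2 : Real.exp ((hi + 1) * (n * l)) ≤ 2 ^ z := by
    refine le_trans ?_ (pow_le_pow_left₀ (Real.exp_pos _).le h1 z)
    rw [← Real.exp_nat_mul]
    exact Real.exp_le_exp.2 (by linarith)
  have h3 : (n : ℝ) ^ 2 * P = hi * (n * l) := by rw [sq, mul_assoc, hnP]; ring
  rw [h3, div_le_div_iff₀ (by positivity) (by linarith), one_mul]
  refine le_trans ?_ h2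
  nth_rewrite 2 [← hexp]
  rw [← Real.exp_add]
  refine Real.exp_le_exp.2 ?_
  nlinarith

/-- For large `n`, typical observations have few edges and a small deviation from the mean. -/
theorem exists_typical (d : ℕ) (G : GroupKind) {hi η : ℝ} (hhi : 0 < hi) (hη : 0 < η) :
    ∃ N : ℕ, 4 ≤ N ∧ ∀ n, N ≤ n → 2 * (hi * Real.log n / n) ≤ 1 ∧
      ∀ (K : ℕ) (C : Fin n → Fin K) (R : Fin n → Matrix (Fin d) (Fin d) ℝ),
      (∀ i, R i ∈ G.carrier d) → ∀ p q : ℝ, 0 ≤ p → 0 ≤ q → p ≤ hi * Real.log n / n →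
      q ≤ hi * Real.log n / n →
      sampleLaw G d C p q {ω | ¬ (SmallNoise C R p q (η * Real.log n) ω ∧
        (edgeCount ω : ℝ) < (2 * hi + 2) * (n * Real.log n) + 1)} ≤
      ENNReal.ofReal ((n : ℝ) ^ (-(1 / 2) : ℝ)) := by
  -- An upper bound for `r / log n`: `n (2 P)` gives `2 hi`, and `k` together with the rounding and
  -- the ones is at most `5 log n`.
  set B : ℝ := 2 * hi + 5 with hB
  set M : ℝ := 18 * B + 4 with hM
  set c : ℝ := d ^ 2 * 2 ^ 17 * 16 / η ^ 2 with hc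
  have hlog : Filter.Tendsto (fun n : ℕ => Real.log n) Filter.atTop Filter.atTop :=
    Real.tendsto_log_atTop.comp tendsto_natCast_atTop_atTop
  have hratio : Filter.Tendsto (fun n : ℕ => Real.log n / n) Filter.atTop (nhds 0) := by
    have := (Real.isLittleO_log_id_atTop.tendsto_div_nhds_zero).comp
      (tendsto_natCast_atTop_atTop (R := ℝ))
    exact this
  have hev : ∀ᶠ n : ℕ in Filter.atTop, 4 ≤ n ∧ 1 ≤ Real.log n ∧ 2 / η ≤ Real.log n ∧
      c * Real.exp M ≤ Real.log n ∧ 2 * B ≤ n ∧ Real.log n / n < 1 / (2 * hi) := by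
    filter_upwards [Filter.eventually_ge_atTop 4, hlog.eventually_ge_atTop 1,
      hlog.eventually_ge_atTop (2 / η), hlog.eventually_ge_atTop (c * Real.exp M),
      (tendsto_natCast_atTop_atTop (R := ℝ)).eventually_ge_atTop (2 * B),
      hratio.eventually_lt_const
        (show (0 : ℝ) < 1 / (2 * hi) by positivity)] with n h1 h2 h3 h4 h5 h6
    exact ⟨h1, h2, h3, h4, h5, h6⟩
  obtain ⟨N, hN⟩ := Filter.eventually_atTop.1 hev
  refine ⟨max N 4, le_max_right _ _, fun n hn => ?_⟩
  obtain ⟨hn4, hl1, hlη, hlc, hnB, hr1⟩ := hN n ((le_max_left _ _).trans hn)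
  set l := Real.log n with hl
  have hn0 : (0 : ℝ) < n := by exact_mod_cast (show 0 < n by omega)
  have hexp : Real.exp l = n := Real.exp_log hn0
  set P := hi * l / n with hP
  have hP1 : 2 * P ≤ 1 := by
    rw [lt_div_iff₀ (by positivity)] at hr1
    have : P = hi * (l / n) := by rw [hP, mul_div_assoc]
    rw [this]; linarith
  have hnP : n * P = hi * l := by rw [hP]; field_simp
  have hP0 : 0 ≤ P := by positivity
  refine ⟨hP1, fun K C R hR p q hp0 hq0 hp hq => ?_⟩
  set k := ⌈l⌉₊ with hk
  have hkl : l ≤ k := Nat.le_ceil l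
  have hku : (k : ℝ) ≤ 2 * l := by linarith [Nat.ceil_lt_add_one (show 0 ≤ l by linarith)]
  have hk1 : 1 ≤ k := Nat.one_le_ceil_iff.2 (by linarith)
  set r := ⌈n * (2 * P) + k + 1⌉₊ with hr
  have hrl : n * (2 * P) + k + 1 ≤ r := Nat.le_ceil _
  have hru : (r : ℝ) ≤ B * l := by
    have h1 : (r : ℝ) < n * (2 * P) + k + 1 + 1 := Nat.ceil_lt_add_one (by positivity)
    have h2 : n * (2 * P) = 2 * hi * l := by linarith
    rw [hB]; nlinarith
  have hr0 : (0 : ℝ) ≤ r := Nat.cast_nonneg r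
  have hB2 : 0 ≤ B := by rw [hB]; linarith
  have hη4 : 0 < η * l / 4 := by positivity
  have hnoise := measure_smallNoise_le (C := C) hR hp0 hq0 hp hq hP1 hk1 hrl hη4
  have hedge := measure_edgeCount_le (d := d) (G := G) (C := C) hp0 hq0 hp hq (by linarith)
    (⌈(2 * hi + 2) * (n * l)⌉₊)
  have hb1 := trace_bound_le (d := d) hη hn0 hl1 hB2 hlc hnB hkl hku hru
  have hb2 : Real.exp (n ^ 2 * P) / 2 ^ ⌈(2 * hi + 2) * (n * l)⌉₊ ≤ 1 / n :=
    edge_bound_le (by exact_mod_cast (show 1 ≤ n by omega)) (by linarith) hnP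
      (Nat.le_ceil _) hexp
  -- The trace bound is used at `η l / 4`; for `l ≥ 2 / η` there is room for the doubling and for
  -- the diagonal.
  have hsub : {ω : Sample G n d | ¬ (SmallNoise C R p q (η * l) ω ∧
      (edgeCount ω : ℝ) < (2 * hi + 2) * (n * l) + 1)} ⊆
      {ω | ¬ SmallNoise C R p q (1 + 2 * (η * l / 4)) ω} ∪
        {ω | ¬ edgeCount ω < ⌈(2 * hi + 2) * (n * l)⌉₊} := by
    intro ω hω
    by_contra hno
    simp only [Set.mem_union, Set.mem_ofPred_eq, not_or, not_not] at hno
    refine hω ⟨fun X => (hno.1 X).trans ?_, ?_⟩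
    · refine mul_le_mul_of_nonneg_right ?_ (frob_nonneg X)
      rw [div_le_iff₀ hη] at hlη
      linarith
    · have h1 : ((edgeCount ω : ℕ) : ℝ) < (⌈(2 * hi + 2) * (n * l)⌉₊ : ℕ) := by exact_mod_cast hno.2
      exact h1.trans (Nat.ceil_lt_add_one (by positivity))
  refine (measure_mono hsub).trans ((measure_union_le _ _).trans ((add_le_add hnoise hedge).trans ?_))
  rw [← ENNReal.ofReal_add (by positivity) (by positivity)]
  refine ENNReal.ofReal_le_ofReal ((add_le_add hb1 hb2).trans ?_)
  rw [Real.rpow_neg hn0.le, ← Real.sqrt_eq_rpow]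
  -- Two failures of probability `1 / n` fit into `1 / √n` from `n = 4` on.
  have h4 : (2 : ℝ) ≤ Real.sqrt n := by
    rw [show (2 : ℝ) = Real.sqrt 4 by rw [show (4 : ℝ) = 2 ^ 2 by norm_num]; simp]
    exact Real.sqrt_le_sqrt (by exact_mod_cast hn4)
  have h5 : Real.sqrt n * Real.sqrt n = n := Real.mul_self_sqrt hn0.le
  rw [← add_div, inv_eq_one_div, div_le_div_iff₀ hn0 (by linarith)]
  nlinarith

/-! ### Executions with a bound on the number of steps -/

namespace Memory

def putVar (s : Memory) (x v : ℕ) : Memory := { s with var := Function.update s.var x v }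

def putIdx (s : Memory) (a p v : ℕ) : Memory :=
  { s with idx := Function.update s.idx a (Function.update (s.idx a) p v) }

def putReal (s : Memory) (a p : ℕ) (v : ℝ) : Memory :=
  { s with real := Function.update s.real a (Function.update (s.real a) p v) }

variable (s : Memory)

@[simp] theorem putVar_idx (x v : ℕ) : (s.putVar x v).idx = s.idx := rfl
@[simp] theorem putVar_real (x v : ℕ) : (s.putVar x v).real = s.real := rfl
@[simp] theorem putIdx_var (a p v : ℕ) : (s.putIdx a p v).var = s.var := rfl
@[simp] theorem putIdx_real (a p v : ℕ) : (s.putIdx a p v).real = s.real := rfl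
@[simp] theorem putReal_var (a p : ℕ) (v : ℝ) : (s.putReal a p v).var = s.var := rfl
@[simp] theorem putReal_idx (a p : ℕ) (v : ℝ) : (s.putReal a p v).idx = s.idx := rfl

@[simp] theorem putVar_var (x v y : ℕ) : (s.putVar x v).var y = if y = x then v else s.var y := by
  simp [putVar, Function.update_apply]

@[simp] theorem putIdx_idx (a p v a' p' : ℕ) :
    (s.putIdx a p v).idx a' p' = if a' = a ∧ p' = p then v else s.idx a' p' := by
  by_cases h : a' = a
  · subst h; simp [putIdx, Function.update_apply]
  · simp [putIdx, h]

@[simp] theorem putReal_real (a p : ℕ) (v : ℝ) (a' p' : ℕ) :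
    (s.putReal a p v).real a' p' = if a' = a ∧ p' = p then v else s.real a' p' := by
  by_cases h : a' = a
  · subst h; simp [putReal, Function.update_apply]
  · simp [putReal, h]

theorem putIdx_idx_of_ne {a a' : ℕ} (h : a' ≠ a) (p v : ℕ) :
    (s.putIdx a p v).idx a' = s.idx a' := by simp [putIdx, h]

theorem putReal_real_of_ne {a a' : ℕ} (h : a' ≠ a) (p : ℕ) (v : ℝ) :
    (s.putReal a p v).real a' = s.real a' := by simp [putReal, h]

@[simp] theorem writeSquare_var (k b j : ℕ) (X : Matrix (Fin k) (Fin k) ℝ) :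
    (s.writeSquare k b j X).var = s.var := rfl

theorem writeSquare_real_of_ne {b b' : ℕ} (h : b' ≠ b) (k j : ℕ) (X : Matrix (Fin k) (Fin k) ℝ) :
    (s.writeSquare k b j X).real b' = s.real b' := by
  funext p; simp [writeSquare, h]

theorem writeSquare_real_of_not_mem (k b j p : ℕ) (X : Matrix (Fin k) (Fin k) ℝ)
    (h : p < j ∨ j + k * k ≤ p) : (s.writeSquare k b j X).real b p = s.real b p := by
  simp only [writeSquare]
  rw [dif_neg]
  rintro ⟨-, h1, h2⟩
  omega

theorem writeSquare_real (k b j : ℕ) (X : Matrix (Fin k) (Fin k) ℝ) (u v : Fin k) :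
    (s.writeSquare k b j X).real b (j + (u * k + v)) = X u v := by
  have hu := u.2
  have hv := v.2
  have h1 : (u : ℕ) * k + v < k * k := by nlinarith
  simp only [writeSquare]
  rw [dif_pos ⟨trivial, by omega, by omega⟩]
  congr 1
  · ext
    simp only [Nat.add_sub_cancel_left]
    rw [add_comm, Nat.add_mul_div_right _ _ (by omega), Nat.div_eq_of_lt hv, zero_add]
  · ext
    simp only [Nat.add_sub_cancel_left]
    rw [add_comm, Nat.add_mul_mod_self_right, Nat.mod_eq_of_lt hv]

end Memory

/-! ### Frame conditions, runs with step bounds, and rules for loops -/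

namespace Cmd

/-- The program writes no scalar `x`. -/
def KeepsVar (x : ℕ) : Cmd → Prop
  | setVar y _ => x ≠ y
  | seq c₁ c₂ => KeepsVar x c₁ ∧ KeepsVar x c₂
  | ite _ c₁ c₂ => KeepsVar x c₁ ∧ KeepsVar x c₂
  | loop _ c => KeepsVar x c
  | _ => True

/-- The program does not write into the index array `a`. -/
def KeepsIdx (a : ℕ) : Cmd → Prop
  | setIdx b _ _ => a ≠ b
  | seq c₁ c₂ => KeepsIdx a c₁ ∧ KeepsIdx a c₂
  | ite _ c₁ c₂ => KeepsIdx a c₁ ∧ KeepsIdx a c₂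
  | loop _ c => KeepsIdx a c
  | _ => True

/-- The program does not write into the real array `a`. -/
def KeepsReal (a : ℕ) : Cmd → Prop
  | setReal b _ _ => a ≠ b
  | proj _ _ _ b _ => a ≠ b
  | seq c₁ c₂ => KeepsReal a c₁ ∧ KeepsReal a c₂
  | ite _ c₁ c₂ => KeepsReal a c₁ ∧ KeepsReal a c₂
  | loop _ c => KeepsReal a c
  | _ => True

attribute [simp] KeepsVar KeepsIdx KeepsReal

/-- `s` and `s'` agree on everything that `c` does not write. -/
structure Same (c : Cmd) (s s' : Memory) : Prop where
  var : ∀ x, c.KeepsVar x → s'.var x = s.var x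
  idx : ∀ a, c.KeepsIdx a → s'.idx a = s.idx a
  real : ∀ a, c.KeepsReal a → s'.real a = s.real a

theorem Same.refl (c : Cmd) (s : Memory) : Same c s s := ⟨fun _ _ => rfl, fun _ _ => rfl, fun _ _ => rfl⟩

theorem Same.trans {c : Cmd} {s s' s'' : Memory} (h : Same c s s') (h' : Same c s' s'') :
    Same c s s'' :=
  ⟨fun x hx => (h'.var x hx).trans (h.var x hx), fun x hx => (h'.idx x hx).trans (h.idx x hx),
    fun x hx => (h'.real x hx).trans (h.real x hx)⟩

/-- The frame rule. What a program does not write is read off its syntax by `simp`, so later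
specifications mention only the cells that change. -/
theorem same_of_exec {c : Cmd} {s s' : Memory} {t : ℕ} (h : Exec c s t s') : Same c s s' := by
  induction h with
  | skip => exact Same.refl _ _
  | setVar s x e => exact ⟨fun y hy => Function.update_of_ne hy _ _, fun _ _ => rfl, fun _ _ => rfl⟩
  | setIdx s a i e =>
    exact ⟨fun _ _ => rfl, fun y hy => Function.update_of_ne hy _ _, fun _ _ => rfl⟩
  | setReal s a i e =>
    exact ⟨fun _ _ => rfl, fun _ _ => rfl, fun y hy => Function.update_of_ne hy _ _⟩
  | proj s k a i b j =>
    exact ⟨fun _ _ => rfl, fun _ _ => rfl, fun y hy => s.writeSquare_real_of_ne hy _ _ _⟩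
  | seq _ _ h₁ h₂ =>
    exact ⟨fun x hx => (h₂.var x hx.2).trans (h₁.var x hx.1),
      fun x hx => (h₂.idx x hx.2).trans (h₁.idx x hx.1),
      fun x hx => (h₂.real x hx.2).trans (h₁.real x hx.1)⟩
  | iteTrue _ _ h =>
    exact ⟨fun x hx => h.var x hx.1, fun x hx => h.idx x hx.1, fun x hx => h.real x hx.1⟩
  | iteFalse _ _ h =>
    exact ⟨fun x hx => h.var x hx.2, fun x hx => h.idx x hx.2, fun x hx => h.real x hx.2⟩
  | loopFalse => exact Same.refl _ _
  | loopTrue _ _ _ h hloop =>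
    exact Same.trans ⟨fun x hx => h.var x hx, fun x hx => h.idx x hx, fun x hx => h.real x hx⟩ hloop

/-- Started in `s`, the program halts after at most `b` steps, in a memory that satisfies `Q`. -/
def Run (c : Cmd) (s : Memory) (b : ℕ) (Q : Memory → Prop) : Prop :=
  ∃ t s', Exec c s t s' ∧ t ≤ b ∧ Q s'

theorem Run.mono {c : Cmd} {s : Memory} {b b' : ℕ} {Q Q' : Memory → Prop} (h : Run c s b Q)
    (hb : b ≤ b') (hQ : ∀ s', Same c s s' → Q s' → Q' s') : Run c s b' Q' := by
  obtain ⟨t, s', h1, h2, h3⟩ := h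
  exact ⟨t, s', h1, h2.trans hb, hQ s' (same_of_exec h1) h3⟩

theorem Run.seq {c₁ c₂ : Cmd} {s : Memory} {b₁ b₂ : ℕ} {Q Q' : Memory → Prop}
    (h₁ : Run c₁ s b₁ Q') (h₂ : ∀ s', Same c₁ s s' → Q' s' → Run c₂ s' b₂ Q) :
    Run (.seq c₁ c₂) s (b₁ + b₂) Q := by
  obtain ⟨t, s', h1, h2, h3⟩ := h₁
  obtain ⟨t', s'', h1', h2', h3'⟩ := h₂ s' (same_of_exec h1) h3
  exact ⟨_, _, .seq h1 h1', by omega, h3'⟩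

theorem Run.ite {b : BExp} {c₁ c₂ : Cmd} {s : Memory} {k : ℕ} {Q : Memory → Prop}
    (h₁ : b.holds s → Run c₁ s k Q) (h₂ : ¬ b.holds s → Run c₂ s k Q) :
    Run (.ite b c₁ c₂) s (b.cost + k) Q := by
  by_cases hb : b.holds s
  · obtain ⟨t, s', h1, h2, h3⟩ := h₁ hb
    exact ⟨_, _, .iteTrue hb h1, by omega, h3⟩
  · obtain ⟨t, s', h1, h2, h3⟩ := h₂ hb
    exact ⟨_, _, .iteFalse hb h1, by omega, h3⟩

/-- A program without loops. -/
def LoopFree : Cmd → Prop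
  | seq c₁ c₂ => LoopFree c₁ ∧ LoopFree c₂
  | ite _ c₁ c₂ => LoopFree c₁ ∧ LoopFree c₂
  | loop _ _ => False
  | _ => True

attribute [simp] LoopFree

open Classical in
/-- The effect of a program without loops. -/
def denote : Cmd → Memory → Memory
  | skip, s => s
  | setVar x e, s => s.putVar x (e.eval s)
  | setIdx a i e, s => s.putIdx a (i.eval s) (e.eval s)
  | setReal a i e, s => s.putReal a (i.eval s) (e.eval s)
  | proj k a i b j, s =>
    s.writeSquare k b (j.eval s) (nearestOrthogonal (s.readSquare k a (i.eval s)))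
  | seq c₁ c₂, s => c₂.denote (c₁.denote s)
  | ite b c₁ c₂, s => if b.holds s then c₁.denote s else c₂.denote s
  | loop _ _, s => s

/-- A bound on the number of steps of a program without loops. -/
def bound : Cmd → ℕ
  | skip => 1
  | setVar _ e => e.cost + 1
  | setIdx _ i e => i.cost + e.cost + 1
  | setReal _ i e => i.cost + e.cost + 1
  | proj k _ i _ j => i.cost + j.cost + k ^ 3 + 1
  | seq c₁ c₂ => c₁.bound + c₂.bound
  | ite b c₁ c₂ => b.cost + (c₁.bound + c₂.bound)
  | loop _ _ => 0

/-- `bound` adds up both branches of a conditional, so it does not depend on the memory: for fixed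
`K` and `d`, loop-free code takes constant time. -/
theorem exec_denote {c : Cmd} (hc : c.LoopFree) (s : Memory) :
    ∃ t, Exec c s t (c.denote s) ∧ t ≤ c.bound := by
  induction c generalizing s with
  | skip => exact ⟨_, .skip s, le_rfl⟩
  | setVar x e => exact ⟨_, .setVar s x e, le_rfl⟩
  | setIdx a i e => exact ⟨_, .setIdx s a i e, le_rfl⟩
  | setReal a i e => exact ⟨_, .setReal s a i e, le_rfl⟩
  | proj k a i b j => exact ⟨_, .proj s k a i b j, le_rfl⟩
  | seq c₁ c₂ h₁ h₂ =>
    obtain ⟨t, h1, h2⟩ := h₁ hc.1 s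
    obtain ⟨t', h1', h2'⟩ := h₂ hc.2 (c₁.denote s)
    exact ⟨_, .seq h1 h1', add_le_add h2 h2'⟩
  | ite b c₁ c₂ h₁ h₂ =>
    by_cases hb : b.holds s
    · obtain ⟨t, h1, h2⟩ := h₁ hc.1 s
      rw [denote, if_pos hb]
      exact ⟨_, .iteTrue hb h1, by rw [bound]; omega⟩
    · obtain ⟨t, h1, h2⟩ := h₂ hc.2 s
      rw [denote, if_neg hb]
      exact ⟨_, .iteFalse hb h1, by rw [bound]; omega⟩
  | loop b c h => exact hc.elim

theorem Run.of_denote {c : Cmd} (hc : c.LoopFree) {s : Memory} {Q : Memory → Prop}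
    (h : Q (c.denote s)) : Run c s c.bound Q := by
  obtain ⟨t, h1, h2⟩ := exec_denote hc s
  exact ⟨t, _, h1, h2, h⟩

theorem same_denote {c : Cmd} (hc : c.LoopFree) (s : Memory) : Same c s (c.denote s) := by
  obtain ⟨t, h1, -⟩ := exec_denote hc s
  exact same_of_exec h1

/-- `f 0`, …, `f (N - 1)`, one after another. -/
def seqN : ℕ → (ℕ → Cmd) → Cmd
  | 0, _ => skip
  | N + 1, f => seq (seqN N f) (f N)

@[simp] theorem keepsVar_seqN {x N : ℕ} {f : ℕ → Cmd} :
    (seqN N f).KeepsVar x ↔ ∀ i < N, (f i).KeepsVar x := by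
  induction N with
  | zero => simp [seqN]
  | succ N ih => simp only [seqN, KeepsVar, ih, Nat.forall_lt_succ_right]

@[simp] theorem keepsIdx_seqN {x N : ℕ} {f : ℕ → Cmd} :
    (seqN N f).KeepsIdx x ↔ ∀ i < N, (f i).KeepsIdx x := by
  induction N with
  | zero => simp [seqN]
  | succ N ih => simp only [seqN, KeepsIdx, ih, Nat.forall_lt_succ_right]

@[simp] theorem keepsReal_seqN {x N : ℕ} {f : ℕ → Cmd} :
    (seqN N f).KeepsReal x ↔ ∀ i < N, (f i).KeepsReal x := by
  induction N with
  | zero => simp [seqN]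
  | succ N ih => simp only [seqN, KeepsReal, ih, Nat.forall_lt_succ_right]

@[simp] theorem loopFree_seqN {N : ℕ} {f : ℕ → Cmd} :
    (seqN N f).LoopFree ↔ ∀ i < N, (f i).LoopFree := by
  induction N with
  | zero => simp [seqN]
  | succ N ih => simp only [seqN, LoopFree, ih, Nat.forall_lt_succ_right]

theorem Run.seqN {N b : ℕ} {f : ℕ → Cmd} {s : Memory} {I : ℕ → Memory → Prop} (h0 : I 0 s)
    (hstep : ∀ i < N, ∀ s', Cmd.Same (Cmd.seqN N f) s s' → I i s' → Run (f i) s' b (I (i + 1))) :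
    Run (Cmd.seqN N f) s (N * b + 1) (I N) := by
  have key : ∀ N' ≤ N, Run (Cmd.seqN N' f) s (N' * b + 1)
      (fun s' => Cmd.Same (Cmd.seqN N f) s s' ∧ I N' s') := by
    intro N'
    induction N' with
    | zero => exact fun _ => ⟨1, s, .skip s, by omega, Same.refl _ _, h0⟩
    | succ N' ih =>
      intro hN'
      refine Run.mono (Run.seq (ih (by omega)) fun s' _ h => ?_ ) (b := (N' * b + 1) + b)
        (Q := fun s' => Cmd.Same (Cmd.seqN N f) s s' ∧ I (N' + 1) s') (by rw [Nat.succ_mul]; omega)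
        fun _ _ h => h
      refine (hstep N' (by omega) s' h.1 h.2).mono le_rfl fun s'' hs h2 => ⟨h.1.trans ?_, h2⟩
      exact ⟨fun x hx => hs.var x (keepsVar_seqN.1 hx N' (by omega)),
        fun x hx => hs.idx x (keepsIdx_seqN.1 hx N' (by omega)),
        fun x hx => hs.real x (keepsReal_seqN.1 hx N' (by omega))⟩
  exact (key N le_rfl).mono le_rfl fun _ _ h => h.2

/-- A loop with the counter `x`, which runs from zero up to the value of `e`. -/
def forLoop (x : ℕ) (e : WExp) (c : Cmd) : Cmd :=
  seq (setVar x (.lit 0)) (loop (.wlt (.var x) e) (seq c (setVar x (.add (.var x) (.lit 1)))))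

attribute [simp] forLoop

/-- The invariant sees only the arrays, so incrementing the counter preserves it. The `e.cost + 6`
steps per round are the test, with `e.cost + 2`, and the increment, with `4`. -/
theorem Run.forLoop {x N b : ℕ} {e : WExp} {c : Cmd} {s : Memory}
    {I : ℕ → (ℕ → ℕ → ℕ) → (ℕ → ℕ → ℝ) → Prop} (hc : c.KeepsVar x)
    (he : ∀ s', Cmd.Same (Cmd.forLoop x e c) s s' → e.eval s' = N) (h0 : I 0 s.idx s.real)
    (hstep : ∀ i < N, ∀ s', Cmd.Same (Cmd.forLoop x e c) s s' → s'.var x = i →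
      I i s'.idx s'.real → Run c s' b fun s'' => I (i + 1) s''.idx s''.real) :
    Run (Cmd.forLoop x e c) s (N * (b + e.cost + 6) + (e.cost + 4))
      fun s' => I N s'.idx s'.real := by
  set F := Cmd.forLoop x e c with hF
  have key : ∀ k i s', i + k = N → Cmd.Same F s s' → s'.var x = i → I i s'.idx s'.real →
      Run (.loop (.wlt (.var x) e) (.seq c (.setVar x (.add (.var x) (.lit 1))))) s'
        (k * (b + e.cost + 6) + (e.cost + 2)) fun s'' => I N s''.idx s''.real := by
    intro k
    induction k with
    | zero =>
      intro i s' hi hs hx hI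
      refine ⟨_, s', .loopFalse ?_, ?_, ?_⟩
      · simp only [BExp.holds, WExp.eval, he s' hs, hx]; omega
      · simp only [BExp.cost, WExp.cost]; omega
      · have : i = N := by omega
        subst this; exact hI
    | succ k ih =>
      intro i s' hi hs hx hI
      obtain ⟨t, s₁, h1, h2, h3⟩ := hstep i (by omega) s' hs hx hI
      have hs₁ := same_of_exec h1
      have hx₁ : s₁.var x = i := (hs₁.var x hc).trans hx
      obtain ⟨s₂, hs₂def⟩ : ∃ s₂, s₂ = s₁.putVar x (s₁.var x + 1) := ⟨_, rfl⟩
      have h4 : Exec (.seq c (.setVar x (.add (.var x) (.lit 1)))) s' (t + 4) s₂ :=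
        hs₂def ▸ Exec.seq h1 (.setVar s₁ x (.add (.var x) (.lit 1)))
      have hs₂ := same_of_exec h4
      have hx₂ : s₂.var x = i + 1 := by simp [hs₂def, hx₁]
      replace h3 : I (i + 1) s₂.idx s₂.real := by rw [hs₂def]; exact h3
      have hsF : Cmd.Same F s s₂ := hs.trans
        ⟨fun y hy => hs₂.var y hy.2, fun y hy => hs₂.idx y hy.2, fun y hy => hs₂.real y hy.2⟩
      obtain ⟨t', s₃, h5, h6, h7⟩ := ih (i + 1) s₂ (by omega) hsF hx₂ h3
      refine ⟨_, s₃, .loopTrue ?_ h4 h5, ?_, h7⟩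
      · simp only [BExp.holds, WExp.eval, he s' hs, hx]; omega
      · simp only [BExp.cost, WExp.cost]
        rw [Nat.succ_mul]
        omega
  refine Run.mono (Run.seq (c₁ := .setVar x (.lit 0)) (b₁ := 2)
    (Q' := fun s' => s'.var x = 0 ∧ s'.idx = s.idx ∧ s'.real = s.real)
    ⟨_, _, .setVar s x (.lit 0), by simp [WExp.cost], by simp [WExp.eval]⟩
    fun s' hs h => key N 0 s' (by omega) ⟨fun y hy => hs.var y hy.1, fun y hy => hs.idx y hy.1,
      fun y hy => hs.real y hy.1⟩ h.1 (by rw [h.2.1, h.2.2]; exact h0))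
    (by omega) fun _ _ h => h

/-- Consecutive assignments to distinct cells of an index array. -/
theorem denote_scatterIdx {f : ℕ → Cmd} {N a : ℕ} {A F : ℕ → ℕ} {s : Memory}
    (hA : ∀ q < N, ∀ q' < N, A q = A q' → q = q')
    (h : ∀ q < N, ∀ s' : Memory, s'.var = s.var → s'.real = s.real →
      (∀ a', a' ≠ a → s'.idx a' = s.idx a') →
      (∀ p, (∀ q' < q, p ≠ A q') → s'.idx a p = s.idx a p) →
      (f q).denote s' = s'.putIdx a (A q) (F q)) :
    ((seqN N f).denote s).var = s.var ∧ ((seqN N f).denote s).real = s.real ∧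
      (∀ a', a' ≠ a → ((seqN N f).denote s).idx a' = s.idx a') ∧
      (∀ p, (∀ q < N, p ≠ A q) → ((seqN N f).denote s).idx a p = s.idx a p) ∧
      ∀ q < N, ((seqN N f).denote s).idx a (A q) = F q := by
  induction N with
  | zero => simp [seqN, denote]
  | succ N ih =>
    obtain ⟨h1, h2, h3, h4, h5⟩ := ih (fun q hq q' hq' => hA q (by omega) q' (by omega))
      (fun q hq => h q (by omega))
    rw [seqN, denote, h N (by omega) _ h1 h2 h3 h4]
    refine ⟨h1, h2, fun a' ha' => ?_, fun p hp => ?_, fun q hq => ?_⟩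
    · rw [Memory.putIdx_idx_of_ne _ ha', h3 a' ha']
    · rw [Memory.putIdx_idx, if_neg fun hh => hp N (by omega) hh.2,
        h4 p fun q hq => hp q (by omega)]
    · rw [Memory.putIdx_idx]
      by_cases hqN : q = N
      · subst hqN; simp
      · rw [if_neg fun hh => hqN (hA q hq N (by omega) hh.2), h5 q (by omega)]

/-- Consecutive assignments to distinct cells of a real array. -/
theorem denote_scatterReal {f : ℕ → Cmd} {N a : ℕ} {A : ℕ → ℕ} {F : ℕ → ℝ} {s : Memory}
    (hA : ∀ q < N, ∀ q' < N, A q = A q' → q = q')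
    (h : ∀ q < N, ∀ s' : Memory, s'.var = s.var → s'.idx = s.idx →
      (∀ a', a' ≠ a → s'.real a' = s.real a') →
      (∀ p, (∀ q' < q, p ≠ A q') → s'.real a p = s.real a p) →
      (f q).denote s' = s'.putReal a (A q) (F q)) :
    ((seqN N f).denote s).var = s.var ∧ ((seqN N f).denote s).idx = s.idx ∧
      (∀ a', a' ≠ a → ((seqN N f).denote s).real a' = s.real a') ∧
      (∀ p, (∀ q < N, p ≠ A q) → ((seqN N f).denote s).real a p = s.real a p) ∧
      ∀ q < N, ((seqN N f).denote s).real a (A q) = F q := by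
  induction N with
  | zero => simp [seqN, denote]
  | succ N ih =>
    obtain ⟨h1, h2, h3, h4, h5⟩ := ih (fun q hq q' hq' => hA q (by omega) q' (by omega))
      (fun q hq => h q (by omega))
    rw [seqN, denote, h N (by omega) _ h1 h2 h3 h4]
    refine ⟨h1, h2, fun a' ha' => ?_, fun p hp => ?_, fun q hq => ?_⟩
    · rw [Memory.putReal_real_of_ne _ ha', h3 a' ha']
    · rw [Memory.putReal_real, if_neg fun hh => hp N (by omega) hh.2,
        h4 p fun q hq => hp q (by omega)]
    · rw [Memory.putReal_real]
      by_cases hqN : q = N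
      · subst hqN; simp
      · rw [if_neg fun hh => hqN (hA q hq N (by omega) hh.2), h5 q (by omega)]

end Cmd

/-! ### Derived expressions -/

/-- The product of an index with a constant. -/
def WExp.mulLit : ℕ → WExp → WExp
  | 0, _ => .lit 0
  | c + 1, e => .add (mulLit c e) e

@[simp] theorem WExp.eval_mulLit (s : Memory) (c : ℕ) (e : WExp) :
    (WExp.mulLit c e).eval s = c * e.eval s := by
  induction c with
  | zero => simp [mulLit, eval]
  | succ c ih => simp [mulLit, eval, ih, Nat.succ_mul]

/-- The sum of `f 0`, …, `f (N - 1)`. -/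
def RExp.sum : ℕ → (ℕ → RExp) → RExp
  | 0, _ => .lit 0
  | N + 1, f => .add (RExp.sum N f) (f N)

@[simp] theorem RExp.eval_sum (s : Memory) (N : ℕ) (f : ℕ → RExp) :
    (RExp.sum N f).eval s = ∑ i ∈ Finset.range N, (f i).eval s := by
  induction N with
  | zero => simp [RExp.sum, eval]
  | succ N ih => rw [RExp.sum, eval, ih, Finset.sum_range_succ]

attribute [simp] WExp.eval RExp.eval BExp.holds

/-! ### The product with the current iterate, and the projections of its blocks -/

/-- The unit in which the number of steps of an iteration is measured. -/
def workload (n len : ℕ) : ℕ := n * (Nat.log 2 n + 1) + len + 1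

theorem le_workload (n len : ℕ) : n ≤ workload n len := by
  unfold workload; nlinarith [Nat.zero_le (n * Nat.log 2 n)]

theorem len_le_workload (n len : ℕ) : len ≤ workload n len := by unfold workload; omega

theorem one_le_workload (n len : ℕ) : 1 ≤ workload n len := by unfold workload; omega

theorem mul_add_inj {N i i' q q' : ℕ} (hq : q < N) (hq' : q' < N) (h : N * i + q = N * i' + q') :
    i = i' ∧ q = q' := by
  have h1 : (N * i + q) / N = i := by
    rw [Nat.mul_add_div (by omega), Nat.div_eq_of_lt hq, add_zero]
  have h2 : (N * i' + q') / N = i' := by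
    rw [Nat.mul_add_div (by omega), Nat.div_eq_of_lt hq', add_zero]
  have h3 : i = i' := by rw [← h1, h, h2]
  subst h3
  exact ⟨rfl, by omega⟩

/-- The position of an entry within a block row in which the blocks are stored one by one. -/
def blockPos (d : ℕ) (k a b : ℕ) : ℕ := k * (d * d) + (a * d + b)

theorem blockPos_lt {K d k a b : ℕ} (hk : k < K) (ha : a < d) (hb : b < d) :
    blockPos d k a b < K * (d * d) := by
  unfold blockPos
  have h1 : a * d + b < d * d := by nlinarith
  have h2 : (k + 1) * (d * d) ≤ K * (d * d) := Nat.mul_le_mul_right _ hk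
  linarith [Nat.succ_mul k (d * d)]

theorem blockPos_div {d k a b : ℕ} (ha : a < d) (hb : b < d) : blockPos d k a b / (d * d) = k := by
  have h1 : a * d + b < d * d := by nlinarith
  unfold blockPos
  rw [mul_comm k, Nat.mul_add_div (by omega), Nat.div_eq_of_lt h1, add_zero]

theorem blockPos_div_mod {d k a b : ℕ} (ha : a < d) (hb : b < d) :
    blockPos d k a b / d % d = a := by
  have : blockPos d k a b = d * (k * d + a) + b := by unfold blockPos; ring
  rw [this, Nat.mul_add_div (by omega), Nat.div_eq_of_lt hb, add_zero, add_comm,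
    Nat.add_mul_mod_self_right, Nat.mod_eq_of_lt ha]

theorem blockPos_mod {d k a b : ℕ} (hb : b < d) : blockPos d k a b % d = b := by
  have : blockPos d k a b = b + d * (k * d + a) := by unfold blockPos; ring
  rw [this, Nat.add_mul_mod_self_left, Nat.mod_eq_of_lt hb]

/-- The memory holds the size parameters and the matrix `A`, as in `IsInput`. -/
def HoldsMatrix {n d : ℕ} (s : Memory) (m T : ℕ) (A : BlockMatrix n n d)
    (L : List (Fin n × Fin n)) : Prop :=
  s.var 0 = n ∧ s.var 1 = m ∧ s.var 2 = T ∧ s.var 3 = L.length ∧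
  (∀ (e : ℕ) (h : e < L.length), s.idx 0 e = (L[e]).1 ∧ s.idx 1 e = (L[e]).2 ∧
    ∀ a b : Fin d, s.real 0 (e * (d * d) + (a * d + b)) = block A (L[e]).1 (L[e]).2 a b)

theorem HoldsMatrix.congr {n d : ℕ} {s s' : Memory} {m T : ℕ} {A : BlockMatrix n n d}
    {L : List (Fin n × Fin n)} (h : HoldsMatrix s m T A L) {c : Cmd} (hs : Cmd.Same c s s')
    (h0 : c.KeepsVar 0) (h1 : c.KeepsVar 1) (h2 : c.KeepsVar 2) (h3 : c.KeepsVar 3)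
    (h4 : c.KeepsIdx 0) (h5 : c.KeepsIdx 1) (h6 : c.KeepsReal 0) : HoldsMatrix s' m T A L := by
  unfold HoldsMatrix at *
  rw [hs.var 0 h0, hs.var 1 h1, hs.var 2 h2, hs.var 3 h3, hs.idx 0 h4, hs.idx 1 h5, hs.real 0 h6]
  exact h

namespace Cmd

/-- Set the real array `2` to zero. -/
def clearProduct (K d : ℕ) : Cmd :=
  forLoop 5 (.mulLit (K * (d * d)) (.var 0)) (setReal 2 (.var 5) (.lit 0))

/-- Add the contribution of the `5`-th nonzero block of `A` to the product. -/
def addBlock (K d : ℕ) : Cmd :=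
  seq (setVar 6 (.arr 0 (.var 5))) (seq (setVar 7 (.arr 1 (.var 5)))
    (seqN (K * (d * d)) fun q =>
      setReal 2 (.add (.mulLit (K * (d * d)) (.var 6)) (.lit q))
        (.add (.arr 2 (.add (.mulLit (K * (d * d)) (.var 6)) (.lit q)))
          (.sum d fun c => .mul
            (.arr 0 (.add (.mulLit (d * d) (.var 5)) (.lit (q / d % d * d + c))))
            (.arr 1 (.add (.mulLit (d * (K * d)) (.var 7))
              (.lit (c * (K * d) + (q / (d * d) * d + q % d)))))))))

/-- Multiply the matrix in the real array `1` by `A`; the product goes to the real array `2`. -/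
def multiply (K d : ℕ) : Cmd := seq (clearProduct K d) (forLoop 5 (.var 3) (addBlock K d))

/-- Project the blocks in the real array `2`; the projections go to the real array `3`, the nuclear
norms to the real array `4`. -/
def project (K d : ℕ) : Cmd :=
  forLoop 5 (.mulLit K (.var 0))
    (seq (proj d 2 (.mulLit (d * d) (.var 5)) 3 (.mulLit (d * d) (.var 5)))
      (setReal 4 (.add (.var 5) (.lit K)) (.sum d fun a => .sum d fun b => .mul
        (.arr 3 (.add (.mulLit (d * d) (.var 5)) (.lit (a * d + b))))
        (.arr 2 (.add (.mulLit (d * d) (.var 5)) (.lit (a * d + b)))))))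

attribute [simp] clearProduct addBlock multiply project

variable {n K d m T : ℕ} {A : BlockMatrix n n d} {L : List (Fin n × Fin n)} {V : BlockMatrix n K d}

theorem run_clearProduct (K d : ℕ) : ∃ B, ∀ n len (s : Memory), s.var 0 = n →
    Run (clearProduct K d) s (B * workload n len) fun s' =>
      ∀ p < K * (d * d) * n, s'.real 2 p = 0 := by
  obtain ⟨c, hc⟩ : ∃ c, c = (setReal 2 (.var 5) (.lit 0) : Cmd).bound +
    (WExp.mulLit (K * (d * d)) (.var 0)).cost + 6 := ⟨_, rfl⟩
  refine ⟨K * (d * d) * c + c, fun n len s hn => ?_⟩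
  refine Run.mono (Run.forLoop (N := K * (d * d) * n)
    (b := (setReal 2 (.var 5) (.lit 0) : Cmd).bound)
    (I := fun x _ real => ∀ p < x, real 2 p = 0) (by simp) (fun s' hs => ?_) (by simp)
    fun i hi s' hs hx hI => Run.of_denote (by simp) ?_) ?_ fun s' _ h => h
  · rw [WExp.eval_mulLit, WExp.eval, hs.var 0 (by simp), hn]
  · intro p hp
    simp only [denote, WExp.eval, RExp.eval, hx, Memory.putReal_real]
    split_ifs with h
    · simp
    · exact hI p (by grind)
  · rw [← hc]
    have h1 := le_workload n len
    have h2 := one_le_workload n len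
    rw [add_mul]
    refine add_le_add ?_ ?_
    · calc K * (d * d) * n * c = K * (d * d) * c * n := by ring
        _ ≤ _ := Nat.mul_le_mul_left _ h1
    · nlinarith

/-- Cell `q` of a block row encodes the block `q / (d * d)`, the row `q / d % d` and the column `q %
d`, as in `blockPos`. Each assignment reads only its own cell of the product, so the assignments do
not interfere. -/
theorem addBlock_spec {s : Memory} {e : ℕ} (he : s.var 5 = e) :
    (∀ i < K * (d * d), ((addBlock K d).denote s).real 2 (K * (d * d) * s.idx 0 e + i) =
      s.real 2 (K * (d * d) * s.idx 0 e + i) + ∑ c ∈ Finset.range d,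
        s.real 0 (d * d * e + (i / d % d * d + c)) *
          s.real 1 (d * (K * d) * s.idx 1 e + (c * (K * d) + (i / (d * d) * d + i % d)))) ∧
    ∀ p, (∀ i < K * (d * d), p ≠ K * (d * d) * s.idx 0 e + i) →
      ((addBlock K d).denote s).real 2 p = s.real 2 p := by
  have h := denote_scatterReal (N := K * (d * d)) (a := 2)
    (A := fun q => K * (d * d) * s.idx 0 e + q)
    (F := fun i => s.real 2 (K * (d * d) * s.idx 0 e + i) + ∑ c ∈ Finset.range d,
        s.real 0 (d * d * e + (i / d % d * d + c)) *
          s.real 1 (d * (K * d) * s.idx 1 e + (c * (K * d) + (i / (d * d) * d + i % d))))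
    (s := (s.putVar 6 (s.idx 0 e)).putVar 7 (s.idx 1 e))
    (f := fun q => setReal 2 (.add (.mulLit (K * (d * d)) (.var 6)) (.lit q))
        (.add (.arr 2 (.add (.mulLit (K * (d * d)) (.var 6)) (.lit q)))
          (.sum d fun c => .mul
            (.arr 0 (.add (.mulLit (d * d) (.var 5)) (.lit (q / d % d * d + c))))
            (.arr 1 (.add (.mulLit (d * (K * d)) (.var 7))
              (.lit (c * (K * d) + (q / (d * d) * d + q % d))))))))
    (fun q _ q' _ hqq => Nat.add_left_cancel hqq)
    (fun q hq s' hv hi hr hp => by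
      simp only [denote, WExp.eval, RExp.eval, WExp.eval_mulLit, RExp.eval_sum, hv, he,
        Memory.putVar_var]
      simp only [hr 0 (by norm_num), hr 1 (by norm_num), Memory.putVar_real]
      norm_num
      rw [hp _ fun q' hq' hh => by omega]
      rfl)
  have e1 : (addBlock K d).denote s = (seqN (K * (d * d)) fun q =>
      setReal 2 (.add (.mulLit (K * (d * d)) (.var 6)) (.lit q))
        (.add (.arr 2 (.add (.mulLit (K * (d * d)) (.var 6)) (.lit q)))
          (.sum d fun c => .mul
            (.arr 0 (.add (.mulLit (d * d) (.var 5)) (.lit (q / d % d * d + c))))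
            (.arr 1 (.add (.mulLit (d * (K * d)) (.var 7))
              (.lit (c * (K * d) + (q / (d * d) * d + q % d)))))))).denote
      ((s.putVar 6 (s.idx 0 e)).putVar 7 (s.idx 1 e)) := by
    simp only [addBlock, denote, WExp.eval, Memory.putVar_var, Memory.putVar_idx, he]
    norm_num
  rw [e1]
  exact ⟨h.2.2.2.2, h.2.2.2.1⟩

/-- The part of the product that comes from a block of `A`. -/
def contribution (A : BlockMatrix n n d) (V : BlockMatrix n K d) (i : Fin n) (k : Fin K)
    (a b : Fin d) (e : Fin n × Fin n) : ℝ :=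
  if e.1 = i then ∑ c, block A e.1 e.2 a c * V (e.2, c) (k, b) else 0

theorem sum_contribution (hL : IsSupport A L) (V : BlockMatrix n K d) (i : Fin n) (k : Fin K)
    (a b : Fin d) : (L.map (contribution A V i k a b)).sum = (A * V) (i, a) (k, b) := by
  rw [← List.sum_toFinset _ hL.1, Matrix.mul_apply, Fintype.sum_prod_type]
  have h1 : ∑ e ∈ L.toFinset, contribution A V i k a b e = ∑ e, contribution A V i k a b e := by
    refine Finset.sum_subset (Finset.subset_univ _) fun e _ he => ?_
    have h0 : block A e.1 e.2 = 0 := by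
      by_contra h
      exact he (List.mem_toFinset.2 ((hL.2 e.1 e.2).2 h))
    simp [contribution, h0]
  rw [h1, Fintype.sum_prod_type, Finset.sum_eq_single i]
  · simp [contribution, block]
  · intro j _ hj
    exact Finset.sum_eq_zero fun l _ => by simp [contribution, hj]
  · simp

theorem run_multiply (K d : ℕ) : ∃ B, ∀ (n m T : ℕ) (A : BlockMatrix n n d)
    (L : List (Fin n × Fin n)) (V : BlockMatrix n K d) (s : Memory), IsSupport A L →
    HoldsMatrix s m T A L → Holds s V →
    Run (multiply K d) s (B * workload n L.length) fun s' =>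
      ∀ (i : Fin n) (k : Fin K) (a b : Fin d),
        s'.real 2 (K * (d * d) * i + blockPos d k a b) = (A * V) (i, a) (k, b) := by
  obtain ⟨B₁, hB₁⟩ := run_clearProduct K d
  obtain ⟨c, hc⟩ : ∃ c, c = (addBlock K d).bound + (WExp.var 3).cost + 6 := ⟨_, rfl⟩
  refine ⟨B₁ + 2 * c, fun n m T A L V s hL hs hV => ?_⟩
  refine Run.mono (Run.seq (hB₁ n L.length s hs.1) fun s₁ hs₁ h₁ => Run.forLoop (N := L.length)
    (b := (addBlock K d).bound)
    (I := fun e _ real => ∀ (i : Fin n) (k : Fin K) (a b : Fin d),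
      real 2 (K * (d * d) * i + blockPos d k a b) =
        ((L.take e).map (contribution A V i k a b)).sum)
    (by simp) (fun s' hs' => ?_) (fun i k a b => ?_)
    fun e he s' hs' hx hI => Run.of_denote (by simp) ?_) ?_ fun s' _ h => ?_
  · rw [WExp.eval, hs'.var 3 (by simp), hs₁.var 3 (by simp), hs.2.2.2.1]
  · rw [h₁]
    · simp
    · have := blockPos_lt k.2 a.2 b.2
      calc _ < K * (d * d) * i + K * (d * d) := by omega
        _ = K * (d * d) * (i + 1) := by ring
        _ ≤ _ := Nat.mul_le_mul_left _ i.2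
  · have hM : HoldsMatrix s' m T A L := (hs.congr hs₁ (by simp) (by simp) (by simp) (by simp)
      (by simp) (by simp) (by simp)).congr hs' (by simp) (by simp) (by simp) (by simp)
      (by simp) (by simp) (by simp)
    have hV' : Holds s' V := by
      unfold Holds
      rw [hs'.real 1 (by simp), hs₁.real 1 (by simp)]
      exact hV
    obtain ⟨r1, r2⟩ := addBlock_spec (K := K) (d := d) hx
    obtain ⟨hrow, hcol, hblock⟩ := hM.2.2.2.2 e he
    rw [hrow] at r1 r2
    rw [hcol] at r1
    intro i k a b
    have hpos := blockPos_lt k.2 a.2 b.2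
    rw [List.take_succ_eq_append_getElem he, List.map_append, List.sum_append, ← hI i k a b]
    simp only [List.map_cons, List.map_nil, List.sum_cons, List.sum_nil, add_zero]
    by_cases hi : (L[e]).1 = i
    · rw [← hi, r1 _ hpos, hi, contribution, if_pos hi, Finset.sum_range]
      congr 1
      refine Finset.sum_congr rfl fun c _ => ?_
      rw [blockPos_div a.2 b.2, blockPos_div_mod a.2 b.2, blockPos_mod b.2, ← hblock,
        ← hV' (L[e]).2 c k b, mul_comm (d * d) e]
      congr 2
      ring
    · rw [contribution, if_neg hi, add_zero, r2]
      intro q hq h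
      exact hi (Fin.ext (mul_add_inj hpos hq h).1.symm)
  · have h1 := len_le_workload n L.length
    have h2 := one_le_workload n L.length
    rw [← hc, add_mul]
    have h3 : (WExp.var 3).cost + 4 ≤ c := by omega
    nlinarith
  · intro i k a b
    rw [h i k a b, List.take_length, sum_contribution hL]

/-- The nuclear norm is the pairing of a block with its projection, by `nuclearNorm_eq_ip`. The
norms of node `i` are stored in row `i + 1`, so that a tree entry `j + 1` addresses the row of node
`j` directly. -/
theorem run_project (K d : ℕ) : ∃ B, ∀ (n len : ℕ) (X : BlockMatrix n K d)
    (s : Memory), s.var 0 = n →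
    (∀ (i : Fin n) (k : Fin K) (a b : Fin d),
      s.real 2 (K * (d * d) * i + blockPos d k a b) = X (i, a) (k, b)) →
    Run (project K d) s (B * workload n len) fun s' =>
      ∀ (i : Fin n) (k : Fin K), (∀ a b : Fin d,
        s'.real 3 (K * (d * d) * i + blockPos d k a b) = nearestOrthogonal (block X i k) a b) ∧
        s'.real 4 ((i + 1) * K + k) = nuclearNorm (block X i k) := by
  set body : Cmd := (seq (proj d 2 (.mulLit (d * d) (.var 5)) 3 (.mulLit (d * d) (.var 5)))
      (setReal 4 (.add (.var 5) (.lit K)) (.sum d fun a => .sum d fun b => .mul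
        (.arr 3 (.add (.mulLit (d * d) (.var 5)) (.lit (a * d + b))))
        (.arr 2 (.add (.mulLit (d * d) (.var 5)) (.lit (a * d + b))))))) with hbody
  obtain ⟨c, hc⟩ : ∃ c, c = body.bound + (WExp.mulLit K (.var 0)).cost + 6 := ⟨_, rfl⟩
  refine ⟨K * c + c, fun n len X s hn hX => ?_⟩
  refine Run.mono (Run.forLoop (N := K * n) (b := body.bound)
    (I := fun x _ real => ∀ y < x,
      (∀ a b : Fin d, real 3 (d * d * y + (a * d + b)) =
        nearestOrthogonal (s.readSquare d 2 (d * d * y)) a b) ∧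
      real 4 (y + K) = nuclearNorm (s.readSquare d 2 (d * d * y)))
    (by simp) (fun s' hs => ?_) (by simp)
    fun x hxN s' hs hx hI => Run.of_denote (by simp) ?_) ?_ fun s' _ h => ?_
  · rw [WExp.eval_mulLit, WExp.eval, hs.var 0 (by simp), hn]
  · have h2 : s'.real 2 = s.real 2 := hs.real 2 (by simp)
    have hsq : s'.readSquare d 2 (d * d * x) = s.readSquare d 2 (d * d * x) := by
      unfold Memory.readSquare; rw [h2]
    obtain ⟨s₁, hs₁⟩ : ∃ s₁, s₁ = s'.writeSquare d 3 (d * d * x)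
      (nearestOrthogonal (s.readSquare d 2 (d * d * x))) := ⟨_, rfl⟩
    have hden : body.denote s' = s₁.putReal 4 (x + K)
        (∑ a ∈ Finset.range d, ∑ b ∈ Finset.range d, s₁.real 3 (d * d * x + (a * d + b)) *
          s₁.real 2 (d * d * x + (a * d + b))) := by
      simp only [hbody, denote, WExp.eval, RExp.eval, WExp.eval_mulLit, RExp.eval_sum,
        Memory.writeSquare_var, hx, hsq, hs₁]
    have h3 : ∀ a b : Fin d, s₁.real 3 (d * d * x + (a * d + b)) =
        nearestOrthogonal (s.readSquare d 2 (d * d * x)) a b := fun a b => by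
      rw [hs₁, Memory.writeSquare_real]
    have h4 : s₁.real 2 = s.real 2 := by
      rw [hs₁, Memory.writeSquare_real_of_ne _ (by norm_num), h2]
    have h5 : s₁.real 4 = s'.real 4 := by
      rw [hs₁, Memory.writeSquare_real_of_ne _ (by norm_num)]
    have hsum : (∑ a ∈ Finset.range d, ∑ b ∈ Finset.range d,
        s₁.real 3 (d * d * x + (a * d + b)) * s₁.real 2 (d * d * x + (a * d + b))) =
        nuclearNorm (s.readSquare d 2 (d * d * x)) := by
      rw [nuclearNorm_eq_ip, ip, Finset.sum_range]
      refine Finset.sum_congr rfl fun a _ => ?_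
      rw [Finset.sum_range]
      refine Finset.sum_congr rfl fun b _ => ?_
      rw [h3, h4]; rfl
    rw [hden, hsum]
    intro y hy
    rw [Memory.putReal_real_of_ne _ (by norm_num), Memory.putReal_real]
    by_cases hyx : y = x
    · subst hyx
      exact ⟨h3, by simp⟩
    · have hlt : y < x := by omega
      obtain ⟨i1, i2⟩ := hI y hlt
      refine ⟨fun a b => ?_, ?_⟩
      · rw [← i1 a b, hs₁, Memory.writeSquare_real_of_not_mem]
        left
        have : (a : ℕ) * d + b < d * d := by
          have := a.2; have := b.2; nlinarith
        calc _ < d * d * y + d * d := by omega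
          _ = d * d * (y + 1) := by ring
          _ ≤ _ := Nat.mul_le_mul_left _ hlt
      · rw [if_neg (by omega), h5, i2]
  · rw [← hc]
    have h1 := le_workload n len
    have h2 := one_le_workload n len
    have h3 : (WExp.mulLit K (.var 0)).cost + 4 ≤ c := by omega
    rw [add_mul]
    refine add_le_add ?_ ?_
    · calc K * n * c = K * c * n := by ring
        _ ≤ _ := Nat.mul_le_mul_left _ h1
    · nlinarith
  · intro i k
    have hy : K * i + k < K * n := by
      calc K * i + k < K * i + K := by have := k.2; omega
        _ = K * (i + 1) := by ring
        _ ≤ _ := Nat.mul_le_mul_left _ i.2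
    obtain ⟨h1, h2⟩ := h _ hy
    have hpos : ∀ a b, d * d * (K * i + k) + (a * d + b) = K * (d * d) * i + blockPos d k a b := by
      intro a b; unfold blockPos; ring
    have hsq : s.readSquare d 2 (d * d * (K * i + k)) = block X i k := by
      ext a b
      rw [Memory.readSquare, Matrix.of_apply, hpos, hX]; rfl
    rw [hsq] at h1 h2
    refine ⟨fun a b => by rw [← hpos, h1], ?_⟩
    rw [← h2]
    congr 1
    ring

end Cmd

/-! ### Tournament trees -/

/-- The better one of two entries; zero stands for no entry. -/
def pick (key : ℕ → ℝ) (x y : ℕ) : ℕ :=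
  if x = 0 then y else if y = 0 then x else if key y ≤ key x then x else y

theorem pick_eq_or (key : ℕ → ℝ) (x y : ℕ) : pick key x y = x ∨ pick key x y = y := by
  unfold pick; split_ifs <;> simp

theorem pick_spec_left (key : ℕ → ℝ) {x : ℕ} (y : ℕ) (hx : x ≠ 0) :
    pick key x y ≠ 0 ∧ key x ≤ key (pick key x y) := by
  unfold pick
  rw [if_neg hx]
  split_ifs with h1 h2
  · exact ⟨hx, le_rfl⟩
  · exact ⟨hx, le_rfl⟩
  · exact ⟨h1, (not_le.1 h2).le⟩

theorem pick_spec_right (key : ℕ → ℝ) (x : ℕ) {y : ℕ} (hy : y ≠ 0) :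
    pick key x y ≠ 0 ∧ key y ≤ key (pick key x y) := by
  unfold pick
  split_ifs with h1 h2
  · exact ⟨hy, le_rfl⟩
  · exact ⟨h1, h2⟩
  · exact ⟨hy, le_rfl⟩

section tournament
variable {n : ℕ} {t : ℕ → ℕ} {key : ℕ → ℝ} {p : ℕ → Prop} [DecidablePred p]

/-- The tree is laid out as a heap: the root is `1`, the children of `v` are `2 v` and `2 v + 1`,
and the leaves are `n, …, 2 n - 1`. The induction runs from the leaves up; its measure is `2 n - v`.
-/
theorem tree_mem (hleaf : ∀ j < n, t (n + j) = if p j then j + 1 else 0)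
    (hnode : ∀ v, 1 ≤ v → v < n → t v = pick key (t (2 * v)) (t (2 * v + 1))) :
    ∀ k v, v + k = 2 * n → 1 ≤ v → 1 ≤ k → t v = 0 ∨ ∃ j < n, p j ∧ t v = j + 1 := by
  intro k
  induction k using Nat.strong_induction_on with
  | _ k ih =>
    intro v hv hv1 hk1
    by_cases hvn : v < n
    · rw [hnode v hv1 hvn]
      rcases pick_eq_or key (t (2 * v)) (t (2 * v + 1)) with h | h <;> rw [h]
      · exact ih (2 * n - 2 * v) (by omega) _ (by omega) (by omega) (by omega)
      · exact ih (2 * n - (2 * v + 1)) (by omega) _ (by omega) (by omega) (by omega)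
    · obtain ⟨j, rfl⟩ : ∃ j, v = n + j := ⟨v - n, by omega⟩
      rw [hleaf j (by omega)]
      split_ifs with h
      · exact Or.inr ⟨j, by omega, h, rfl⟩
      · exact Or.inl rfl

/-- The key can only grow from a vertex `v` to its parent `v / 2`. -/
theorem tree_le_root (hnode : ∀ v, 1 ≤ v → v < n → t v = pick key (t (2 * v)) (t (2 * v + 1)))
    (v : ℕ) (hv1 : 1 ≤ v) (hv2 : v < 2 * n) (h : t v ≠ 0) : t 1 ≠ 0 ∧ key (t v) ≤ key (t 1) := by
  induction v using Nat.strong_induction_on with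
  | _ v ih =>
    by_cases h1 : v = 1
    · subst h1; exact ⟨h, le_rfl⟩
    have hn := hnode (v / 2) (by omega) (by omega)
    have hpar : t (v / 2) ≠ 0 ∧ key (t v) ≤ key (t (v / 2)) := by
      rw [hn]
      rcases Nat.even_or_odd' v with ⟨w, rfl | rfl⟩
      · have : 2 * w / 2 = w := by omega
        rw [this]; exact pick_spec_left key _ h
      · have : (2 * w + 1) / 2 = w := by omega
        rw [this]; exact pick_spec_right key _ h
    obtain ⟨i1, i2⟩ := ih (v / 2) (by omega) (by omega) (by omega) hpar.1
    exact ⟨i1, hpar.2.trans i2⟩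

theorem tree_root (hn : 1 ≤ n) (hleaf : ∀ j < n, t (n + j) = if p j then j + 1 else 0)
    (hnode : ∀ v, 1 ≤ v → v < n → t v = pick key (t (2 * v)) (t (2 * v + 1))) :
    (t 1 = 0 ∨ ∃ j < n, p j ∧ t 1 = j + 1) ∧
      ∀ j < n, p j → t 1 ≠ 0 ∧ key (j + 1) ≤ key (t 1) := by
  refine ⟨tree_mem hleaf hnode (2 * n - 1) 1 (by omega) le_rfl (by omega), fun j hj hp => ?_⟩
  have h := hleaf j hj
  rw [if_pos hp] at h
  have := tree_le_root hnode (n + j) (by omega) (by omega) (by omega)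
  rwa [h] at this

end tournament

/-- The gain of the move of a node from cluster `q / K` to cluster `q % K`; the node `j` is given
as `j + 1`. -/
def moveKey (K : ℕ) (real : ℕ → ℕ → ℝ) (q w : ℕ) : ℝ :=
  real 4 (K * w + q % K) - real 4 (K * w + q / K)

/-- For each pair `q` of clusters, the index array `3` holds a tournament tree of the nodes in the
first cluster, apart from the inner vertex `v`. -/
structure HoldsTrees (n K : ℕ) (idx : ℕ → ℕ → ℕ) (real : ℕ → ℕ → ℝ) (v : ℕ) : Prop where
  leaf : ∀ q < K * K, ∀ j < n,
    idx 3 (K * K * (n + j) + q) = if idx 2 j = q / K then j + 1 else 0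
  node : ∀ q < K * K, ∀ w, 1 ≤ w → w < n → w ≠ v → idx 3 (K * K * w + q) =
    pick (moveKey K real q) (idx 3 (K * K * (2 * w) + q)) (idx 3 (K * K * (2 * w + 1) + q))

theorem HoldsTrees.root {n K : ℕ} {idx : ℕ → ℕ → ℕ} {real : ℕ → ℕ → ℝ} (hn : 1 ≤ n)
    (h : HoldsTrees n K idx real 0) {q : ℕ} (hq : q < K * K) :
    (idx 3 (K * K + q) = 0 ∨ ∃ j < n, idx 2 j = q / K ∧ idx 3 (K * K + q) = j + 1) ∧
      ∀ j < n, idx 2 j = q / K → idx 3 (K * K + q) ≠ 0 ∧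
        moveKey K real q (j + 1) ≤ moveKey K real q (idx 3 (K * K + q)) := by
  have := tree_root (t := fun v => idx 3 (K * K * v + q)) (key := moveKey K real q)
    (p := fun j => idx 2 j = q / K) hn (h.leaf q hq) (fun v h1 h2 => h.node q hq v h1 h2 (by omega))
  simpa using this

/-! ### Updating the tournament trees along a path to the root -/

namespace Cmd

/-- The cell of pair `q` at the tree vertex `v`. -/
def treeCell (K : ℕ) (v : WExp) (q : ℕ) : WExp := .add (.mulLit (K * K) v) (.lit q)

/-- The gain of a move for the entry of a tree. -/
def keyExp (K q : ℕ) (w : WExp) : RExp :=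
  .sub (.arr 4 (.add (.mulLit K w) (.lit (q % K)))) (.arr 4 (.add (.mulLit K w) (.lit (q / K))))

/-- Recompute the entry of the tree `q` at the vertex in the scalar `14`. -/
def pickNode (K q : ℕ) : Cmd :=
  let l : WExp := .arr 3 (treeCell K (.add (.var 14) (.var 14)) q)
  let r : WExp := .arr 3 (treeCell K (.add (.add (.var 14) (.var 14)) (.lit 1)) q)
  ite (.wlt (.lit 0) l)
    (ite (.wlt (.lit 0) r)
      (ite (.rle (keyExp K q r) (keyExp K q l))
        (setIdx 3 (treeCell K (.var 14) q) l) (setIdx 3 (treeCell K (.var 14) q) r))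
      (setIdx 3 (treeCell K (.var 14) q) l))
    (setIdx 3 (treeCell K (.var 14) q) r)

/-- Set the leaves of the node in the scalar `9`. -/
def setLeaves (K : ℕ) : Cmd :=
  seq (seqN (K * K) fun q => setIdx 3 (treeCell K (.add (.var 0) (.var 9)) q) (.lit 0))
    (seqN K fun b => setIdx 3 (.add (.mulLit (K * K) (.add (.var 0) (.var 9)))
      (.add (.mulLit K (.arr 2 (.var 9))) (.lit b))) (.add (.var 9) (.lit 1)))

/-- Recompute the trees upwards from the vertex in the scalar `14`. -/
def climb (K : ℕ) : Cmd :=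
  loop (.wlt (.lit 0) (.var 14)) (seq (seqN (K * K) (pickNode K)) (setVar 14 (.half (.var 14))))

/-- Update the trees after a change of the cluster of the node in the scalar `9`. -/
def updateTrees (K : ℕ) : Cmd :=
  seq (setLeaves K) (seq (setVar 14 (.half (.add (.var 0) (.var 9)))) (climb K))

attribute [simp] pickNode setLeaves climb updateTrees

theorem eval_keyExp (K q : ℕ) (w : WExp) (s : Memory) :
    (keyExp K q w).eval s = moveKey K s.real q (w.eval s) := by
  simp [keyExp, moveKey]

theorem denote_pickNode (K q : ℕ) (s : Memory) :
    (pickNode K q).denote s = s.putIdx 3 (K * K * s.var 14 + q)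
      (pick (moveKey K s.real q) (s.idx 3 (K * K * (2 * s.var 14) + q))
        (s.idx 3 (K * K * (2 * s.var 14 + 1) + q))) := by
  simp only [pickNode, denote, treeCell, eval_keyExp, BExp.holds, WExp.eval,
    WExp.eval_mulLit, ← two_mul]
  generalize s.idx 3 (K * K * (2 * s.var 14) + q) = l
  generalize s.idx 3 (K * K * (2 * s.var 14 + 1) + q) = r
  unfold pick
  by_cases h1 : l = 0
  · simp [h1]
  · rw [if_pos (Nat.pos_of_ne_zero h1), if_neg h1]
    by_cases h2 : r = 0
    · simp [h2]
    · rw [if_pos (Nat.pos_of_ne_zero h2), if_neg h2]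
      by_cases h3 : moveKey K s.real q r ≤ moveKey K s.real q l
      · rw [if_pos h3, if_pos h3]
      · rw [if_neg h3, if_neg h3]

/-- Only the vertex `v` may violate the tree condition. Recomputing it moves the possible violation
to its parent; at `0` there is none left. -/
theorem run_climb (K : ℕ) : ∃ B, ∀ n v (s : Memory), s.var 14 = v → v < n →
    HoldsTrees n K s.idx s.real v →
    Run (climb K) s (B * (Nat.log 2 v + 1) + 3) fun s' => HoldsTrees n K s'.idx s'.real 0 := by
  set body : Cmd := seq (seqN (K * K) (pickNode K)) (setVar 14 (.half (.var 14))) with hbody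
  refine ⟨body.bound + 3, fun n v => ?_⟩
  induction v using Nat.strong_induction_on with
  | _ v ih =>
    intro s hv hvn hs
    by_cases hv0 : v = 0
    · subst hv0
      exact ⟨_, s, .loopFalse (by simp [hv]), by simp [BExp.cost, WExp.cost], hs⟩
    have hbf : body.LoopFree := by simp [hbody]
    obtain ⟨t, h1, h2⟩ := exec_denote hbf s
    obtain ⟨g1, g2, g3, g4, g5⟩ := denote_scatterIdx (f := pickNode K) (N := K * K) (a := 3)
      (A := fun q => K * K * v + q)
      (F := fun q => pick (moveKey K s.real q) (s.idx 3 (K * K * (2 * v) + q))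
        (s.idx 3 (K * K * (2 * v + 1) + q))) (s := s)
      (fun q _ q' _ h => Nat.add_left_cancel h)
      (fun q hq s' hv' hr _ hp => by
        rw [denote_pickNode, hr, hv', hv, hp, hp]
        · intro q' hq' h
          have := (mul_add_inj hq (hq'.trans hq) h).1
          omega
        · intro q' hq' h
          have := (mul_add_inj hq (hq'.trans hq) h).1
          omega)
    set s₁ := (seqN (K * K) (pickNode K)).denote s with hs₁
    have hden : body.denote s = s₁.putVar 14 (v / 2) := by
      simp only [hbody, denote, WExp.eval]
      rw [← hs₁, g1, hv]
    rw [hden] at h1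
    have g4' : ∀ w q, q < K * K → w ≠ v → s₁.idx 3 (K * K * w + q) = s.idx 3 (K * K * w + q) :=
      fun w q hq hw => g4 _ fun q' hq' h => hw (mul_add_inj hq hq' h).1
    have hinv : HoldsTrees n K (s₁.putVar 14 (v / 2)).idx (s₁.putVar 14 (v / 2)).real (v / 2) := by
      rw [Memory.putVar_idx, Memory.putVar_real, g2]
      refine ⟨fun q hq j hj => ?_, fun q hq w hw1 hwn hwv => ?_⟩
      · rw [g4' _ q hq (by omega), hs.leaf q hq j hj, g3 2 (by norm_num)]
      · rw [g4' (2 * w) q hq (by omega), g4' (2 * w + 1) q hq (by omega)]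
        by_cases hwv' : w = v
        · subst hwv'; exact g5 q hq
        · rw [g4' w q hq hwv', hs.node q hq w hw1 hwn hwv']
    obtain ⟨t', s', e1, e2, e3⟩ := ih (v / 2) (by omega) (s₁.putVar 14 (v / 2)) (by simp)
      (by omega) hinv
    refine ⟨_, s', .loopTrue (by simp [hv]; omega) h1 e1, ?_, e3⟩
    simp only [BExp.cost, WExp.cost]
    -- The logarithm does not drop from `1` to `0`, so the final test of the loop is counted
    -- directly.
    by_cases hv1 : v = 1
    · subst hv1
      have hfix : ∀ t'' s'', Exec (climb K) (s₁.putVar 14 (1 / 2)) t'' s'' → t'' ≤ 3 := by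
        intro t'' s'' h
        rcases h with _ | _ | _ | _ | _ | _ | _ | _ | ⟨hb⟩ | ⟨hb, _, _⟩
        · simp [BExp.cost, WExp.cost]
        · simp at hb
      have := hfix _ _ e1
      simp
      omega
    · have hlog : Nat.log 2 v = Nat.log 2 (v / 2) + 1 := Nat.log_of_one_lt_of_le (by norm_num) (by omega)
      rw [hlog]
      nlinarith

/-- A change of the cluster of `j` affects only the leaf `n + j` in each tree: the leaf is cleared
in all the trees and then filled in those `K` whose first cluster is the current one. Then the climb
starts at its parent. -/
theorem run_updateTrees (K : ℕ) : ∃ B, ∀ n j (s : Memory), s.var 0 = n → s.var 9 = j → j < n →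
    s.idx 2 j < K →
    (∀ q < K * K, ∀ j' < n, j' ≠ j →
      s.idx 3 (K * K * (n + j') + q) = if s.idx 2 j' = q / K then j' + 1 else 0) →
    (∀ q < K * K, ∀ w, 1 ≤ w → w < n → s.idx 3 (K * K * w + q) =
      pick (moveKey K s.real q) (s.idx 3 (K * K * (2 * w) + q))
        (s.idx 3 (K * K * (2 * w + 1) + q))) →
    Run (updateTrees K) s (B * (Nat.log 2 n + 1)) fun s' => HoldsTrees n K s'.idx s'.real 0 := by
  obtain ⟨B, hB⟩ := run_climb K
  obtain ⟨c, hc⟩ : ∃ c, c = (setLeaves K).bound +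
    (setVar 14 (.half (.add (.var 0) (.var 9)))).bound := ⟨_, rfl⟩
  refine ⟨B + 3 + c, fun n j s hn hj hjn hcur hleaf hnode => ?_⟩
  obtain ⟨f1, f2, f3, f4, f5⟩ := denote_scatterIdx
    (f := fun q => setIdx 3 (treeCell K (.add (.var 0) (.var 9)) q) (.lit 0)) (N := K * K) (a := 3)
    (A := fun q => K * K * (n + j) + q) (F := fun _ => 0) (s := s)
    (fun q _ q' _ h => Nat.add_left_cancel h)
    (fun q hq s' hv' _ _ _ => by
      simp only [denote, treeCell, WExp.eval, WExp.eval_mulLit, hv', hn, hj])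
  set s₁ := (seqN (K * K) fun q =>
    setIdx 3 (treeCell K (.add (.var 0) (.var 9)) q) (.lit 0)).denote s with hs₁
  obtain ⟨g1, g2, g3, g4, g5⟩ := denote_scatterIdx
    (f := fun b => setIdx 3 (.add (.mulLit (K * K) (.add (.var 0) (.var 9)))
      (.add (.mulLit K (.arr 2 (.var 9))) (.lit b))) (.add (.var 9) (.lit 1))) (N := K) (a := 3)
    (A := fun b => K * K * (n + j) + (K * s.idx 2 j + b)) (F := fun _ => j + 1) (s := s₁)
    (fun q _ q' _ h => by omega)
    (fun q hq s' hv' _ hi _ => by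
      simp only [denote, WExp.eval, WExp.eval_mulLit, hv', f1, hn, hj, hi 2 (by norm_num),
        f3 2 (by norm_num)])
  have hden : (setLeaves K).denote s = (seqN K fun b =>
    setIdx 3 (.add (.mulLit (K * K) (.add (.var 0) (.var 9)))
      (.add (.mulLit K (.arr 2 (.var 9))) (.lit b))) (.add (.var 9) (.lit 1))).denote s₁ := rfl
  rw [← hden] at g1 g2 g3 g4 g5
  set s₂ := (setLeaves K).denote s with hs₂
  have hlt : ∀ b < K, K * s.idx 2 j + b < K * K := by
    intro b hb
    calc K * s.idx 2 j + b < K * s.idx 2 j + K := by omega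
      _ = K * (s.idx 2 j + 1) := by ring
      _ ≤ _ := Nat.mul_le_mul_left _ hcur
  have hother : ∀ w q, q < K * K → w ≠ n + j →
      s₂.idx 3 (K * K * w + q) = s.idx 3 (K * K * w + q) := by
    intro w q hq hw
    rw [g4 _ fun b hb h => hw (mul_add_inj hq (hlt b hb) h).1,
      f4 _ fun b hb h => hw (mul_add_inj hq hb h).1]
  have hcur2 : s₂.idx 2 = s.idx 2 := by rw [g3 2 (by norm_num), f3 2 (by norm_num)]
  have hv2 : s₂.var = s.var := by rw [g1, f1]
  have hr2 : s₂.real = s.real := by rw [g2, f2]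
  have htree : HoldsTrees n K s₂.idx s₂.real ((n + j) / 2) := by
    refine ⟨fun q hq j' hj' => ?_, fun q hq w hw1 hwn hwv => ?_⟩
    · rw [hcur2]
      by_cases hjj : j' = j
      · subst hjj
        have hqe : q = K * (q / K) + q % K := (Nat.div_add_mod q K).symm
        have hK0 : 0 < K := by omega
        by_cases hc : s.idx 2 j' = q / K
        · rw [if_pos hc]
          have := g5 (q % K) (Nat.mod_lt _ hK0)
          rwa [hc, ← hqe] at this
        · rw [if_neg hc, g4, f5 q hq]
          intro b hb h
          have h' := Nat.add_left_cancel h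
          rw [hqe] at h'
          exact hc (mul_add_inj (Nat.mod_lt _ hK0) hb h').1.symm
      · rw [hother _ q hq (by omega), hleaf q hq j' hj' hjj]
    · rw [hother w q hq (by omega), hother (2 * w) q hq (by omega),
        hother (2 * w + 1) q hq (by omega), hr2, hnode q hq w hw1 hwn]
  refine Run.mono (Run.seq (b₁ := (setLeaves K).bound) (Q' := fun s' => s' = s₂)
    (Run.of_denote (by simp) rfl) fun s' _ h => Run.seq
      (b₁ := (setVar 14 (.half (.add (.var 0) (.var 9)))).bound)
      (Q' := fun s' => s' = s₂.putVar 14 ((n + j) / 2))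
      (Run.of_denote (by simp) (by simp [denote, h, hv2, hn, hj])) fun s'' _ h' =>
        hB n ((n + j) / 2) s'' (by simp [h']) (by omega) (by rw [h']; exact htree))
    ?_ fun _ _ h => h
  have hlog : Nat.log 2 ((n + j) / 2) ≤ Nat.log 2 n := Nat.log_mono_right (by omega)
  have h1 : B * (Nat.log 2 ((n + j) / 2) + 1) ≤ B * (Nat.log 2 n + 1) :=
    Nat.mul_le_mul_left _ (by omega)
  have h2 : c ≤ c * (Nat.log 2 n + 1) := Nat.le_mul_of_pos_right _ (by omega)
  have h3 : 3 ≤ 3 * (Nat.log 2 n + 1) := by omega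
  rw [add_mul, add_mul]
  omega

end Cmd

/-! ### Balanced assignments of maximal value -/

/-- The number of the nodes `j < n` with `f j = k`. -/
def clusterSize (n : ℕ) (f : ℕ → ℕ) (k : ℕ) : ℕ := ((Finset.range n).filter fun j => f j = k).card

theorem clusterSize_update {n u c : ℕ} {f : ℕ → ℕ} (hu : u < n) (hc : f u ≠ c) (k : ℕ) :
    clusterSize n (Function.update f u c) k =
      if k = c then clusterSize n f k + 1 else if k = f u then clusterSize n f k - 1
      else clusterSize n f k := by
  unfold clusterSize
  have hmem : u ∈ Finset.range n := Finset.mem_range.2 hu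
  by_cases h1 : k = c
  · subst h1
    rw [if_pos rfl]
    have : (Finset.range n).filter (fun j => Function.update f u k j = k) =
        insert u ((Finset.range n).filter fun j => f j = k) := by
      ext j
      by_cases hj : j = u
      · subst hj; simp [hmem]
      · simp [hj]
    rw [this, Finset.card_insert_of_notMem (by simp [hc])]
  · rw [if_neg h1]
    by_cases h2 : k = f u
    · rw [if_pos h2]
      have : (Finset.range n).filter (fun j => Function.update f u c j = k) =
          ((Finset.range n).filter fun j => f j = k).erase u := by
        ext j
        by_cases hj : j = u
        · subst hj; simp [Ne.symm h1]
        · simp [hj]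
      rw [this, Finset.card_erase_of_mem (by simp [hu, h2])]
    · rw [if_neg h2]
      congr 1
      ext j
      by_cases hj : j = u
      · subst hj; simp [Ne.symm h1, Ne.symm h2]
      · simp [hj]

theorem sum_clusterSize_le (n K : ℕ) (f : ℕ → ℕ) :
    ∑ k ∈ Finset.range K, clusterSize n f k ≤ n := by
  unfold clusterSize
  rw [← Finset.card_biUnion fun a _ b _ hab => Finset.disjoint_filter.2 fun j _ h1 h2 =>
    hab (h1 ▸ h2)]
  exact (Finset.card_le_card fun j hj => by
    obtain ⟨k, -, hk⟩ := Finset.mem_biUnion.1 hj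
    exact (Finset.mem_filter.1 hk).1).trans (by simp)

/-- The value of the cluster `k` for the node `j`, at the current prices. -/
def reducedValue (K : ℕ) (real : ℕ → ℕ → ℝ) (j k : ℕ) : ℝ := real 4 (K * (j + 1) + k) - real 5 k

/-- The first `N` nodes are assigned to clusters that are best for them at the current prices; the
sizes of the clusters and the trees are up to date. -/
structure HoldsAssign (n K : ℕ) (idx : ℕ → ℕ → ℕ) (real : ℕ → ℕ → ℝ) (N : ℕ) : Prop where
  cur_lt : ∀ j < N, idx 2 j < K
  cur_eq : ∀ j, N ≤ j → j < n → idx 2 j = K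
  size : ∀ k < K, idx 4 k = clusterSize n (idx 2) k
  best : ∀ j < N, ∀ k < K, reducedValue K real j k ≤ reducedValue K real j (idx 2 j)
  trees : HoldsTrees n K idx real 0

/-! ### The assignment program and its elementary moves -/

namespace Cmd

theorem denote_seqN {N : ℕ} {f : ℕ → Cmd} {s : Memory} {I : ℕ → Memory → Prop}
    (hf : ∀ i < N, (f i).LoopFree) (h0 : I 0 s)
    (hstep : ∀ i < N, ∀ s', Same (seqN N f) s s' → I i s' → I (i + 1) ((f i).denote s')) :
    I N ((seqN N f).denote s) := by
  have key : ∀ N' ≤ N, I N' ((seqN N' f).denote s) ∧ Same (seqN N f) s ((seqN N' f).denote s) := by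
    intro N'
    induction N' with
    | zero => exact fun _ => ⟨h0, Same.refl _ _⟩
    | succ N' ih =>
      intro hN'
      obtain ⟨i1, i2⟩ := ih (by omega)
      have hs := same_denote (hf N' (by omega)) ((seqN N' f).denote s)
      exact ⟨hstep N' (by omega) _ i2 i1, i2.trans
        ⟨fun x hx => hs.var x (keepsVar_seqN.1 hx N' (by omega)),
        fun x hx => hs.idx x (keepsIdx_seqN.1 hx N' (by omega)),
        fun x hx => hs.real x (keepsReal_seqN.1 hx N' (by omega))⟩⟩
  exact (key N le_rfl).1

/-- The value of a cluster for the node in the scalar `8`, at the current prices. -/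
def valueExp (K : ℕ) (k : WExp) : RExp :=
  .sub (.arr 4 (.add (.mulLit K (.add (.var 8) (.lit 1))) k)) (.arr 5 k)

theorem eval_valueExp (K : ℕ) (k : WExp) (s : Memory) :
    (valueExp K k).eval s = reducedValue K s.real (s.var 8) (k.eval s) := by
  simp [valueExp, reducedValue]

/-- Find the best cluster for the node in the scalar `8`. -/
def chooseBest (K : ℕ) : Cmd :=
  seq (setVar 7 (.lit 0)) (seqN K fun k =>
    ite (.rle (valueExp K (.var 7)) (valueExp K (.lit k))) (setVar 7 (.lit k)) skip)

/-- Move the node in the scalar `9` to the cluster in the scalar `7`. -/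
def moveNode (K : ℕ) : Cmd :=
  seq (seq (setIdx 4 (.arr 2 (.var 9)) (.sub (.arr 4 (.arr 2 (.var 9))) (.lit 1)))
    (seq (setIdx 4 (.var 7) (.add (.arr 4 (.var 7)) (.lit 1))) (setIdx 2 (.var 9) (.var 7))))
    (updateTrees K)

/-- The slack of the best move for the pair `q` of clusters. -/
def slackExp (K q : ℕ) : RExp :=
  .sub (.sub (.arr 5 (.lit (q % K))) (.arr 5 (.lit (q / K))))
    (keyExp K q (.arr 3 (.lit (K * K + q))))

/-- Record the best move for the pair `q`. -/
def recordMove (K q : ℕ) : Cmd :=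
  seq (setReal 6 (.lit 0) (slackExp K q)) (seq (setVar 12 (.lit (q % K)))
    (seq (setVar 13 (.arr 3 (.lit (K * K + q)))) (setVar 10 (.lit 1))))

/-- Compare the best move for the pair `q` with the recorded one. -/
def scanPair (K q : ℕ) : Cmd :=
  ite (.wlt (.lit 0) (.arr 5 (.lit (q / K))))
    (ite (.wlt (.lit 0) (.arr 5 (.lit (q % K)))) skip
      (ite (.wlt (.lit 0) (.arr 3 (.lit (K * K + q))))
        (ite (.wlt (.lit 0) (.var 10))
          (ite (.rle (.arr 6 (.lit 0)) (slackExp K q)) skip (recordMove K q))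
          (recordMove K q)) skip)) skip

/-- Find the best move out of the set of the clusters of positive rank. -/
def scanMoves (K : ℕ) : Cmd := seq (setVar 10 (.lit 0)) (seqN (K * K) (scanPair K))

/-- Raise the prices in the set until one more cluster can join it. -/
def growStep (K r : ℕ) : Cmd :=
  seq (scanMoves K) (seq
    (seqN K fun a => ite (.wlt (.lit 0) (.arr 5 (.lit a)))
      (setReal 5 (.lit a) (.add (.arr 5 (.lit a)) (.arr 6 (.lit 0)))) skip)
    (seq (setIdx 5 (.var 12) (.lit (r + 2)))
      (seq (setIdx 6 (.var 12) (.sub (.var 13) (.lit 1))) (setVar 7 (.var 12)))))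

/-- Grow the set from the cluster in the scalar `7` until it contains a cluster that is not full. -/
def grow (K : ℕ) : Cmd :=
  seq (seq (seqN K fun k => setIdx 5 (.lit k) (.lit 0)) (setIdx 5 (.var 7) (.lit 1)))
    (seqN K fun r => ite (.wlt (.arr 4 (.var 7)) (.var 1)) skip (growStep K r))

/-- Move nodes backwards along the recorded moves. -/
def walkBack (K : ℕ) : Cmd :=
  seqN K fun _ => ite (.wlt (.lit 1) (.arr 5 (.var 7)))
    (seq (seq (setVar 9 (.arr 6 (.var 7))) (setVar 10 (.arr 2 (.var 9))))
      (seq (moveNode K) (setVar 7 (.var 10)))) skip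

/-- Assign the node in the scalar `8`. -/
def insertNode (K : ℕ) : Cmd :=
  seq (seq (chooseBest K) (setVar 9 (.var 8))) (seq (moveNode K)
    (ite (.wlt (.var 1) (.arr 4 (.var 7))) (seq (grow K) (walkBack K)) skip))

/-- Start with no node assigned. -/
def initAssign (K : ℕ) : Cmd :=
  seq (forLoop 5 (.var 0) (setIdx 2 (.var 5) (.lit K)))
    (seq (forLoop 5 (.mulLit (2 * (K * K)) (.var 0)) (setIdx 3 (.var 5) (.lit 0)))
      (seq (seqN K fun k => setIdx 4 (.lit k) (.lit 0)) (seqN K fun k => setReal 5 (.lit k) (.lit 0))))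

/-- Find a balanced assignment of maximal value. -/
def assign (K : ℕ) : Cmd := seq (initAssign K) (forLoop 8 (.var 0) (insertNode K))

attribute [simp] chooseBest moveNode recordMove scanPair scanMoves growStep grow walkBack insertNode
  initAssign assign

theorem denote_chooseBest {K : ℕ} (hK : 0 < K) (s : Memory) :
    ((chooseBest K).denote s).var 7 < K ∧ ∀ k < K, reducedValue K s.real (s.var 8) k ≤
      reducedValue K s.real (s.var 8) (((chooseBest K).denote s).var 7) := by
  rw [chooseBest, denote]
  refine denote_seqN (I := fun i s' => s'.var 7 < K ∧ ∀ k < i, reducedValue K s.real (s.var 8) k ≤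
    reducedValue K s.real (s.var 8) (s'.var 7)) (by simp) (by simp [denote, hK])
    fun i hi s' hs ⟨h1, h2⟩ => ?_
  have h8 : s'.var 8 = s.var 8 := by rw [hs.var 8 (by simp)]; simp [denote]
  have hr : s'.real = s.real := by
    funext a; rw [hs.real a (by simp)]; simp [denote]
  simp only [denote, BExp.holds, eval_valueExp, h8, hr, WExp.eval]
  by_cases hc : reducedValue K s.real (s.var 8) (s'.var 7) ≤ reducedValue K s.real (s.var 8) i
  · rw [if_pos hc]
    refine ⟨by simpa using hi, fun k hk => ?_⟩
    rw [Memory.putVar_var, if_pos rfl]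
    rcases Nat.lt_succ_iff_lt_or_eq.1 hk with h | rfl
    exacts [(h2 k h).trans hc, le_rfl]
  · rw [if_neg hc]
    refine ⟨h1, fun k hk => ?_⟩
    rcases Nat.lt_succ_iff_lt_or_eq.1 hk with h | rfl
    exacts [h2 k h, (not_le.1 hc).le]

/-- This also covers the first assignment of a node: its old cluster is then the dummy `K`, whose
counter lies beyond the sizes and is never read as one. -/
theorem run_moveNode (K : ℕ) : ∃ B, ∀ n u c (s : Memory), s.var 0 = n → s.var 9 = u → u < n →
    s.var 7 = c → c < K → s.idx 2 u ≠ c → HoldsTrees n K s.idx s.real 0 →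
    (∀ k < K, s.idx 4 k = clusterSize n (s.idx 2) k) →
    Run (moveNode K) s (B * (Nat.log 2 n + 1)) fun s' =>
      s'.idx 2 = Function.update (s.idx 2) u c ∧ HoldsTrees n K s'.idx s'.real 0 ∧
      ∀ k < K, s'.idx 4 k = clusterSize n (s'.idx 2) k := by
  obtain ⟨B, hB⟩ := run_updateTrees K
  set pre : Cmd := seq (setIdx 4 (.arr 2 (.var 9)) (.sub (.arr 4 (.arr 2 (.var 9))) (.lit 1)))
    (seq (setIdx 4 (.var 7) (.add (.arr 4 (.var 7)) (.lit 1))) (setIdx 2 (.var 9) (.var 7))) with hpre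
  refine ⟨pre.bound + B, fun n u c s hn hu hun hc hcK hne hT hsize => ?_⟩
  have hcK' : c < K := hcK
  obtain ⟨s₁, hs₁⟩ : ∃ s₁, s₁ = ((s.putIdx 4 (s.idx 2 u) (s.idx 4 (s.idx 2 u) - 1)).putIdx 4 c
    (s.idx 4 c + 1)).putIdx 2 u c := ⟨_, rfl⟩
  have hden : pre.denote s = s₁ := by
    simp only [hpre, denote, WExp.eval, Memory.putIdx_var, hu, hc, hs₁, Memory.putIdx_idx]
    rw [if_neg (by simp [Ne.symm hne])]
  have e2 : s₁.idx 2 = Function.update (s.idx 2) u c := by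
    funext j
    rw [hs₁, Function.update_apply]
    simp
  have e3 : s₁.idx 3 = s.idx 3 := by
    rw [hs₁]
    simp only [Memory.putIdx_idx_of_ne _ (show (3 : ℕ) ≠ 2 by norm_num),
      Memory.putIdx_idx_of_ne _ (show (3 : ℕ) ≠ 4 by norm_num)]
  have er : s₁.real = s.real := by rw [hs₁]; rfl
  have ev : s₁.var = s.var := by rw [hs₁]; rfl
  have e4 : ∀ k < K, s₁.idx 4 k = clusterSize n (s₁.idx 2) k := by
    intro k hk
    rw [e2, clusterSize_update hun hne, ← hsize k hk, hs₁,
      Memory.putIdx_idx_of_ne _ (show (4 : ℕ) ≠ 2 by norm_num), Memory.putIdx_idx]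
    by_cases h1 : k = c
    · simp [h1]
    · rw [if_neg (by simp [h1]), if_neg h1, Memory.putIdx_idx]
      by_cases h2 : k = s.idx 2 u
      · simp [h2]
      · simp [h2]
  refine Run.mono (Run.seq (b₁ := pre.bound) (Q' := fun s' => s' = s₁)
    (Run.of_denote (by simp) hden) fun s' _ h =>
      (hB n u s' (by rw [h, ev, hn]) (by rw [h, ev, hu]) hun ?_ ?_ ?_).mono
        (Q' := fun s' => s'.idx 2 = Function.update (s.idx 2) u c ∧
          HoldsTrees n K s'.idx s'.real 0 ∧ ∀ k < K, s'.idx 4 k = clusterSize n (s'.idx 2) k)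
        le_rfl fun s'' hs'' h'' => ?_) ?_ fun _ _ h => h
  · rw [h, e2]; simpa using hcK
  · intro q hq j' hj' hjj
    rw [h, e2, e3, hT.leaf q hq j' hj', Function.update_of_ne hjj]
  · intro q hq w hw1 hwn
    rw [h, e3, er, hT.node q hq w hw1 hwn (by omega)]
  · refine ⟨by rw [hs''.idx 2 (by simp [treeCell]), h, e2], h'', fun k hk => ?_⟩
    rw [hs''.idx 4 (by simp [treeCell]), hs''.idx 2 (by simp [treeCell]), h, e4 k hk]
  · rw [add_mul]
    have := Nat.le_mul_of_pos_right pre.bound (show 0 < Nat.log 2 n + 1 by omega)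
    omega

end Cmd

/-- The keys involve the nuclear norms but not the prices: for a fixed pair of clusters, prices
shift all gains equally. So raising prices leaves the trees valid. -/
theorem HoldsTrees.congr {n K v : ℕ} {idx idx' : ℕ → ℕ → ℕ} {real real' : ℕ → ℕ → ℝ}
    (h : HoldsTrees n K idx real v) (h2 : idx' 2 = idx 2) (h3 : idx' 3 = idx 3)
    (h4 : real' 4 = real 4) : HoldsTrees n K idx' real' v := by
  have hk : ∀ q, moveKey K real' q = moveKey K real q := fun q => by
    funext w; unfold moveKey; rw [h4]
  refine ⟨fun q hq j hj => ?_, fun q hq w h5 h6 h7 => ?_⟩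
  · rw [h2, h3, h.leaf q hq j hj]
  · rw [h3, hk, h.node q hq w h5 h6 h7]

/-- The best move for the pair `q` leads out of the set of the clusters of positive rank. -/
def Candidate (K : ℕ) (idx : ℕ → ℕ → ℕ) (q : ℕ) : Prop :=
  0 < idx 5 (q / K) ∧ idx 5 (q % K) = 0 ∧ idx 3 (K * K + q) ≠ 0

/-- The slack of the best move for the pair `q` of clusters. -/
def slack (K : ℕ) (idx : ℕ → ℕ → ℕ) (real : ℕ → ℕ → ℝ) (q : ℕ) : ℝ :=
  real 5 (q % K) - real 5 (q / K) - moveKey K real q (idx 3 (K * K + q))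

theorem slack_congr {K : ℕ} {idx : ℕ → ℕ → ℕ} {real real' : ℕ → ℕ → ℝ} (h4 : real' 4 = real 4)
    (h5 : real' 5 = real 5) (q : ℕ) : slack K idx real' q = slack K idx real q := by
  unfold slack moveKey; rw [h4, h5]

theorem slack_eq {K u : ℕ} {idx : ℕ → ℕ → ℕ} {real : ℕ → ℕ → ℝ} {q : ℕ}
    (h : idx 3 (K * K + q) = u + 1) :
    slack K idx real q = reducedValue K real u (q / K) - reducedValue K real u (q % K) := by
  unfold slack moveKey reducedValue; rw [h]; ring

theorem div_lt_of_lt_sq {K q : ℕ} (hq : q < K * K) : q / K < K := Nat.div_lt_of_lt_mul hq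

theorem mod_lt_of_lt_sq {K q : ℕ} (hq : q < K * K) : q % K < K :=
  Nat.mod_lt _ (Nat.pos_of_ne_zero (by rintro rfl; simp at hq))

theorem exists_pair {K a b : ℕ} (ha : a < K) (hb : b < K) :
    ∃ q < K * K, q / K = a ∧ q % K = b := by
  refine ⟨K * a + b, ?_, ?_, ?_⟩
  · calc K * a + b < K * a + K := by omega
      _ = K * (a + 1) := by ring
      _ ≤ _ := Nat.mul_le_mul_left _ ha
  · rw [Nat.mul_add_div (by omega), Nat.div_eq_of_lt hb, add_zero]
  · rw [Nat.mul_add_mod, Nat.mod_eq_of_lt hb]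

/-! ### Raising prices and growing the set of reachable clusters -/

section pricing
variable {n K N : ℕ} {idx : ℕ → ℕ → ℕ} {real : ℕ → ℕ → ℝ}

theorem HoldsAssign.lt_of_cur_lt (h : HoldsAssign n K idx real N) {j : ℕ} (hj : j < n)
    (hc : idx 2 j < K) : j < N := by
  by_contra hN
  rw [h.cur_eq j (not_lt.1 hN) hj] at hc
  exact lt_irrefl _ hc

theorem HoldsAssign.exists_slack_eq (h : HoldsAssign n K idx real N) (hn : 1 ≤ n) {q : ℕ}
    (hq : q < K * K) (hc : Candidate K idx q) : ∃ u < n, idx 3 (K * K + q) = u + 1 ∧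
      idx 2 u = q / K ∧
      slack K idx real q = reducedValue K real u (q / K) - reducedValue K real u (q % K) := by
  rcases (h.trees.root hn hq).1 with h0 | ⟨u, hu, h1, h2⟩
  · exact absurd h0 hc.2.2
  · exact ⟨u, hu, h2, h1, slack_eq h2⟩

theorem HoldsAssign.slack_nonneg (h : HoldsAssign n K idx real N) (hn : 1 ≤ n) {q : ℕ}
    (hq : q < K * K) (hc : Candidate K idx q) : 0 ≤ slack K idx real q := by
  obtain ⟨u, hu, -, h2, h3⟩ := h.exists_slack_eq hn hq hc
  have := h.best u (h.lt_of_cur_lt hu (by rw [h2]; exact div_lt_of_lt_sq hq)) (q % K)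
    (mod_lt_of_lt_sq hq)
  rw [h2] at this
  rw [h3]; linarith

theorem HoldsAssign.candidate (h : HoldsAssign n K idx real N) (hn : 1 ≤ n) {q j : ℕ}
    (hq : q < K * K) (hj : j < n) (hcur : idx 2 j = q / K) (ha : 0 < idx 5 (q / K))
    (hb : idx 5 (q % K) = 0) : Candidate K idx q ∧
      slack K idx real q ≤ reducedValue K real j (q / K) - reducedValue K real j (q % K) := by
  obtain ⟨h1, h2⟩ := (h.trees.root hn hq).2 j hj hcur
  have hc : Candidate K idx q := ⟨ha, hb, h1⟩
  refine ⟨hc, ?_⟩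
  unfold slack reducedValue
  unfold moveKey at h2 ⊢
  linarith

/-- The invariant survives when the prices of the clusters of positive rank rise by the minimal
slack. -/
theorem HoldsAssign.raise (h : HoldsAssign n K idx real N) (hn : 1 ≤ n) (hN : N ≤ n) {q₀ : ℕ}
    (hq₀ : q₀ < K * K) (hc₀ : Candidate K idx q₀)
    (hmin : ∀ q < K * K, Candidate K idx q → slack K idx real q₀ ≤ slack K idx real q)
    {idx' : ℕ → ℕ → ℕ} {real' : ℕ → ℕ → ℝ} (h2 : idx' 2 = idx 2) (h3 : idx' 3 = idx 3)
    (h4 : idx' 4 = idx 4) (hr4 : real' 4 = real 4)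
    (hr5 : ∀ a < K, real' 5 a = real 5 a + if 0 < idx 5 a then slack K idx real q₀ else 0) :
    HoldsAssign n K idx' real' N := by
  refine ⟨fun j hj => ?_, fun j hj hjn => ?_, fun k hk => ?_, fun j hj k hk => ?_,
    h.trees.congr h2 h3 hr4⟩
  · rw [h2]; exact h.cur_lt j hj
  · rw [h2]; exact h.cur_eq j hj hjn
  · rw [h4, h2]; exact h.size k hk
  · have hcur := h.cur_lt j hj
    have hbest := h.best j hj k hk
    have h0 := h.slack_nonneg hn hq₀ hc₀
    rw [h2]
    unfold reducedValue at hbest ⊢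
    rw [hr4, hr5 k hk, hr5 _ hcur]
    -- Only a node inside the set can lose, and only against a cluster outside; its slack there is
    -- at least the amount of the raise.
    by_cases ha : 0 < idx 5 (idx 2 j)
    · rw [if_pos ha]
      by_cases hb : 0 < idx 5 k
      · rw [if_pos hb]; linarith
      · rw [if_neg hb]
        obtain ⟨q, hq, hqa, hqb⟩ := exists_pair hcur hk
        obtain ⟨c1, c2⟩ := h.candidate hn hq (hj.trans_le hN) hqa.symm (by rw [hqa]; exact ha)
          (by rw [hqb]; omega)
        have := hmin q hq c1
        rw [hqa, hqb] at c2
        unfold reducedValue at c2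
        linarith
    · rw [if_neg ha]
      split_ifs <;> linarith

/-- The set of the clusters of positive rank has been grown from `c₀` in `r` rounds; the last
cluster that joined is `c`. Every other one has a node that can move into it at no loss, from a
cluster of smaller rank. -/
structure Grown (n K m c₀ : ℕ) (idx : ℕ → ℕ → ℕ) (real : ℕ → ℕ → ℝ) (c r : ℕ) : Prop where
  rank_root : idx 5 c₀ = 1
  rank_le : ∀ b < K, idx 5 b ≤ r + 1
  eq_root : ∀ b < K, idx 5 b = 1 → b = c₀
  last_lt : c < K
  last_mem : 0 < idx 5 c
  tight : ∀ b < K, 1 < idx 5 b → idx 6 b < n ∧ idx 2 (idx 6 b) < K ∧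
    0 < idx 5 (idx 2 (idx 6 b)) ∧ idx 5 (idx 2 (idx 6 b)) < idx 5 b ∧
    reducedValue K real (idx 6 b) b = reducedValue K real (idx 6 b) (idx 2 (idx 6 b))
  full : ∀ b < K, 0 < idx 5 b → b ≠ c → m ≤ idx 4 b
  progress : idx 4 c < m ∨ r + 1 ≤ ((Finset.range K).filter fun b => 0 < idx 5 b).card

/-- If every cluster had joined, all would be full and `c₀` overfull, which needs more than `K m`
nodes. So some cluster is outside, and the nodes of the nonempty cluster `c₀` can move there. -/
theorem Grown.exists_candidate {m c₀ c r : ℕ} (hg : Grown n K m c₀ idx real c r)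
    (h : HoldsAssign n K idx real N) (hn : 1 ≤ n) (hnK : n = K * m) (hc₀ : c₀ < K)
    (hover : m < idx 4 c₀) (hc : m ≤ idx 4 c) : ∃ q < K * K, Candidate K idx q := by
  have hex : ∃ b < K, idx 5 b = 0 := by
    by_contra hno
    push Not at hno
    have h1 : ∀ b ∈ Finset.range K, m ≤ clusterSize n (idx 2) b := by
      intro b hb
      rw [Finset.mem_range] at hb
      rw [← h.size b hb]
      by_cases hbc : b = c
      · rw [hbc]; exact hc
      · exact hg.full b hb (Nat.pos_of_ne_zero (hno b hb)) hbc
    have h2 : ∑ _b ∈ Finset.range K, m < ∑ b ∈ Finset.range K, clusterSize n (idx 2) b :=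
      Finset.sum_lt_sum h1 ⟨c₀, Finset.mem_range.2 hc₀, by rw [← h.size c₀ hc₀]; exact hover⟩
    have h3 := sum_clusterSize_le n K (idx 2)
    rw [Finset.sum_const, Finset.card_range, smul_eq_mul] at h2
    omega
  obtain ⟨b, hb, hb0⟩ := hex
  obtain ⟨q, hq, hqa, hqb⟩ := exists_pair hc₀ hb
  have hne : 0 < clusterSize n (idx 2) c₀ := by rw [← h.size c₀ hc₀]; omega
  obtain ⟨j, hj⟩ := Finset.card_pos.1 hne
  rw [Finset.mem_filter, Finset.mem_range] at hj
  exact ⟨q, hq, (h.candidate hn hq hj.1 (by rw [hqa]; exact hj.2)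
    (by rw [hqa, hg.rank_root]; norm_num) (by rw [hqb]; exact hb0)).1⟩

/-- Raising by the minimal slack makes the chosen move lossless. Older moves stay lossless since
both of their clusters are inside and rise together. The new cluster gets a rank above all the
others, so recorded moves always come from a smaller rank. -/
theorem Grown.step {m c₀ c r q₀ : ℕ} (hg : Grown n K m c₀ idx real c r)
    (h : HoldsAssign n K idx real N) (hn : 1 ≤ n) (hc : m ≤ idx 4 c)
    (hq₀ : q₀ < K * K) (hcand : Candidate K idx q₀)
    {idx' : ℕ → ℕ → ℕ} {real' : ℕ → ℕ → ℝ} (h2 : idx' 2 = idx 2)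
    (h4 : idx' 4 = idx 4) (h5 : idx' 5 = Function.update (idx 5) (q₀ % K) (r + 2))
    (h6 : idx' 6 = Function.update (idx 6) (q₀ % K) (idx 3 (K * K + q₀) - 1))
    (hr4 : real' 4 = real 4)
    (hr5 : ∀ a < K, real' 5 a = real 5 a + if 0 < idx 5 a then slack K idx real q₀ else 0) :
    Grown n K m c₀ idx' real' (q₀ % K) (r + 1) := by
  obtain ⟨u, hu, e1, e2, e3⟩ := h.exists_slack_eq hn hq₀ hcand
  have hb := mod_lt_of_lt_sq hq₀
  have ha := div_lt_of_lt_sq hq₀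
  obtain ⟨c1, c2, c3⟩ := hcand
  have hold : ∀ a, 0 < idx 5 a → idx' 5 a = idx 5 a := by
    intro a ha'
    rw [h5, Function.update_of_ne]
    rintro rfl; omega
  have hnew : idx' 5 (q₀ % K) = r + 2 := by rw [h5, Function.update_self]
  have hcases : ∀ b, 0 < idx' 5 b → b = q₀ % K ∨ (b ≠ q₀ % K ∧ 0 < idx 5 b) := by
    intro b hb'
    by_cases hbq : b = q₀ % K
    · exact Or.inl hbq
    · rw [h5, Function.update_of_ne hbq] at hb'
      exact Or.inr ⟨hbq, hb'⟩
  refine ⟨?_, fun b hbK => ?_, fun b hbK hb1 => ?_, hb, by omega, fun b hbK hb1 => ?_,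
    fun b hbK hb1 hne => ?_, ?_⟩
  · rw [hold _ (by rw [hg.rank_root]; norm_num), hg.rank_root]
  · rw [h5]
    by_cases hbq : b = q₀ % K
    · rw [hbq, Function.update_self]
    · rw [Function.update_of_ne hbq]
      have := hg.rank_le b hbK; omega
  · rcases hcases b (by omega) with rfl | ⟨_, h1⟩
    · omega
    · exact hg.eq_root b hbK (by rw [← hold b h1, hb1])
  · rcases hcases b (by omega) with rfl | ⟨hbq, h1⟩
    · have h6' : idx' 6 (q₀ % K) = u := by rw [h6, Function.update_self, e1]; rfl
      rw [h6', h2, e2, hold _ c1, hnew]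
      refine ⟨hu, ha, c1, ?_, ?_⟩
      · have := hg.rank_le _ ha; omega
      · unfold reducedValue at e3 ⊢
        rw [hr4, hr5 _ hb, hr5 _ ha, if_pos c1, if_neg (by omega), e3]
        ring
    · rw [hold b h1] at hb1 ⊢
      obtain ⟨t1, t2, t3, t4, t5⟩ := hg.tight b hbK hb1
      rw [h6, Function.update_of_ne hbq, h2, hold _ t3]
      refine ⟨t1, t2, t3, t4, ?_⟩
      unfold reducedValue at t5 ⊢
      rw [hr4, hr5 _ hbK, hr5 _ t2, if_pos h1, if_pos t3]
      linarith
  · rcases hcases b hb1 with rfl | ⟨_, h1⟩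
    · exact absurd rfl hne
    · rw [h4]
      by_cases hbc : b = c
      · rw [hbc]; exact hc
      · exact hg.full b hbK h1 hbc
  · right
    rcases hg.progress with hp | hp
    · omega
    · have : ((Finset.range K).filter fun b => 0 < idx' 5 b) =
          insert (q₀ % K) ((Finset.range K).filter fun b => 0 < idx 5 b) := by
        ext b
        simp only [Finset.mem_filter, Finset.mem_range, Finset.mem_insert]
        constructor
        · rintro ⟨hbK, hb1⟩
          rcases hcases b hb1 with h1 | ⟨_, h1⟩
          exacts [Or.inl h1, Or.inr ⟨hbK, h1⟩]
        · rintro (rfl | ⟨hbK, hb1⟩)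
          · exact ⟨hb, by omega⟩
          · exact ⟨hbK, by rw [hold b hb1]; exact hb1⟩
      rw [this, Finset.card_insert_of_notMem (by simp [c2])]
      omega

end pricing

/-! ### Correctness and cost of an insertion -/

namespace Cmd

theorem eval_slackExp (K q : ℕ) (s : Memory) :
    (slackExp K q).eval s = slack K s.idx s.real q := by
  simp [slackExp, slack, eval_keyExp]

theorem denote_recordMove (K q : ℕ) (s : Memory) :
    (recordMove K q).denote s = (((s.putReal 6 0 (slack K s.idx s.real q)).putVar 12 (q % K)).putVar
      13 (s.idx 3 (K * K + q))).putVar 10 1 := by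
  simp [recordMove, denote, eval_slackExp]

/-- A running minimum over the candidates; the scalar `10` tells whether one has been recorded yet.
-/
theorem denote_scanMoves (K : ℕ) (s : Memory) (hex : ∃ q < K * K, Candidate K s.idx q) :
    ∃ q₀ < K * K, Candidate K s.idx q₀ ∧
      (∀ q < K * K, Candidate K s.idx q → slack K s.idx s.real q₀ ≤ slack K s.idx s.real q) ∧
      ((scanMoves K).denote s).real 6 0 = slack K s.idx s.real q₀ ∧
      ((scanMoves K).denote s).var 12 = q₀ % K ∧
      ((scanMoves K).denote s).var 13 = s.idx 3 (K * K + q₀) := by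
  have hI := denote_seqN (N := K * K) (f := scanPair K) (s := s.putVar 10 0)
    (I := fun i s' => (∀ q < i, Candidate K s.idx q →
        0 < s'.var 10 ∧ s'.real 6 0 ≤ slack K s.idx s.real q) ∧
      (0 < s'.var 10 → ∃ q₀ < i, Candidate K s.idx q₀ ∧
        s'.real 6 0 = slack K s.idx s.real q₀ ∧ s'.var 12 = q₀ % K ∧
        s'.var 13 = s.idx 3 (K * K + q₀))) (by simp) (by simp) ?_
  · obtain ⟨h1, h2⟩ := hI
    obtain ⟨q, hq, hc⟩ := hex
    obtain ⟨q₀, hq₀, hc₀, e1, e2, e3⟩ := h2 (h1 q hq hc).1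
    refine ⟨q₀, hq₀, hc₀, fun q' hq' hc' => ?_, e1, e2, e3⟩
    rw [← e1]
    exact (h1 q' hq' hc').2
  · intro i hi s' hs ⟨h1, h2⟩
    have hidx : s'.idx = s.idx := by
      funext a; rw [hs.idx a (by simp)]; rfl
    have hr4 : s'.real 4 = s.real 4 := by rw [hs.real 4 (by simp)]; rfl
    have hr5 : s'.real 5 = s.real 5 := by rw [hs.real 5 (by simp)]; rfl
    have hsl : ∀ q, slack K s'.idx s'.real q = slack K s.idx s.real q := fun q => by
      rw [hidx, slack_congr hr4 hr5]
    by_cases hc : Candidate K s.idx i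
    · have hcase : (scanPair K i).denote s' =
          if 0 < s'.var 10 ∧ s'.real 6 0 ≤ slack K s.idx s.real i then s'
          else (recordMove K i).denote s' := by
        obtain ⟨c1, c2, c3⟩ := hc
        simp only [scanPair, denote, BExp.holds, WExp.eval, RExp.eval, eval_slackExp, hidx]
        rw [if_pos c1, if_neg (by omega), if_pos (Nat.pos_of_ne_zero c3)]
        rw [← hidx, hsl, hidx]
        by_cases g1 : 0 < s'.var 10
        · by_cases g2 : s'.real 6 0 ≤ slack K s.idx s.real i
          · simp [g1, g2]
          · simp [g1, g2]
        · simp [g1]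
      rw [hcase]
      split_ifs with hg
      · refine ⟨fun q hq hcq => ?_, fun h => ?_⟩
        · rcases Nat.lt_succ_iff_lt_or_eq.1 hq with h | rfl
          exacts [h1 q h hcq, hg]
        · obtain ⟨q₀, hq₀, h3⟩ := h2 h
          exact ⟨q₀, by omega, h3⟩
      · rw [denote_recordMove, hsl, hidx]
        refine ⟨fun q hq hcq => ⟨by simp, ?_⟩, fun _ => ⟨i, by omega, hc, by simp, by simp, by simp⟩⟩
        rcases Nat.lt_succ_iff_lt_or_eq.1 hq with h | rfl
        · obtain ⟨h3, h4⟩ := h1 q h hcq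
          have : slack K s.idx s.real i < s'.real 6 0 := not_le.1 fun h => hg ⟨h3, h⟩
          simpa using this.le.trans h4
        · simp
    · have hcase : (scanPair K i).denote s' = s' := by
        simp only [scanPair, denote, BExp.holds, WExp.eval, hidx]
        by_cases g1 : 0 < s.idx 5 (i / K)
        · by_cases g2 : 0 < s.idx 5 (i % K)
          · simp [g1, g2]
          · have g3 : s.idx 3 (K * K + i) = 0 := by
              by_contra g3
              exact hc ⟨g1, by omega, g3⟩
            simp [g1, g2, g3]
        · simp [g1]
      rw [hcase]
      refine ⟨fun q hq hcq => ?_, fun h => ?_⟩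
      · rcases Nat.lt_succ_iff_lt_or_eq.1 hq with h | rfl
        exacts [h1 q h hcq, absurd hcq hc]
      · obtain ⟨q₀, hq₀, h3⟩ := h2 h
        exact ⟨q₀, by omega, h3⟩

theorem denote_growStep (K r : ℕ) (s : Memory) (hex : ∃ q < K * K, Candidate K s.idx q) :
    ∃ q₀ < K * K, Candidate K s.idx q₀ ∧
      (∀ q < K * K, Candidate K s.idx q → slack K s.idx s.real q₀ ≤ slack K s.idx s.real q) ∧
      ((growStep K r).denote s).var 7 = q₀ % K ∧
      (∀ a < K, ((growStep K r).denote s).real 5 a =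
        s.real 5 a + if 0 < s.idx 5 a then slack K s.idx s.real q₀ else 0) ∧
      ((growStep K r).denote s).idx 5 = Function.update (s.idx 5) (q₀ % K) (r + 2) ∧
      ((growStep K r).denote s).idx 6 =
        Function.update (s.idx 6) (q₀ % K) (s.idx 3 (K * K + q₀) - 1) := by
  obtain ⟨q₀, hq₀, hc₀, hmin, e1, e2, e3⟩ := denote_scanMoves K s hex
  have hs₁ := same_denote (c := scanMoves K) (by simp) s
  set s₁ := (scanMoves K).denote s with hs₁def
  have hidx : s₁.idx = s.idx := by funext a; rw [hs₁.idx a (by simp)]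
  have hr5 : s₁.real 5 = s.real 5 := hs₁.real 5 (by simp)
  set raise : Cmd := seqN K fun a => ite (.wlt (.lit 0) (.arr 5 (.lit a)))
      (setReal 5 (.lit a) (.add (.arr 5 (.lit a)) (.arr 6 (.lit 0)))) skip with hraise
  have hs₂ := same_denote (c := raise) (by simp [hraise]) s₁
  have hI := denote_seqN (N := K) (s := s₁)
    (f := fun a => ite (.wlt (.lit 0) (.arr 5 (.lit a)))
      (setReal 5 (.lit a) (.add (.arr 5 (.lit a)) (.arr 6 (.lit 0)))) skip)
    (I := fun i s' => ∀ a, s'.real 5 a =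
      s.real 5 a + if a < i ∧ 0 < s.idx 5 a then slack K s.idx s.real q₀ else 0)
    (by simp) (by simp [hr5]) (fun i hi s' hs' h a => by
      have h6 : s'.real 6 = s₁.real 6 := hs'.real 6 (by simp)
      have hi5 : s'.idx 5 = s.idx 5 := by rw [hs'.idx 5 (by simp), hidx]
      simp only [denote, BExp.holds, WExp.eval, RExp.eval, hi5, h6, e1]
      by_cases g : 0 < s.idx 5 i
      · rw [if_pos g, Memory.putReal_real]
        by_cases hai : a = i
        · subst hai
          rw [if_pos ⟨rfl, rfl⟩, h a, if_neg (by omega), if_pos ⟨by omega, g⟩]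
          ring
        · rw [if_neg (by simp [hai]), h a]
          congr 1
          refine if_congr ?_ rfl rfl
          omega
      · rw [if_neg g, h a]
        congr 1
        refine if_congr ?_ rfl rfl
        constructor
        · exact fun hh => ⟨by omega, hh.2⟩
        · rintro ⟨h1, h2⟩
          refine ⟨?_, h2⟩
          rcases Nat.lt_succ_iff_lt_or_eq.1 h1 with h3 | rfl
          exacts [h3, absurd h2 g])
  rw [← hraise] at hI
  set s₂ := raise.denote s₁ with hs₂def
  have hidx2 : s₂.idx = s.idx := by funext a; rw [hs₂.idx a (by simp [hraise]), hidx]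
  have hv : s₂.var = s₁.var := by funext a; rw [hs₂.var a (by simp [hraise])]
  have hden : (growStep K r).denote s = ((s₂.putIdx 5 (q₀ % K) (r + 2)).putIdx 6 (q₀ % K)
      (s.idx 3 (K * K + q₀) - 1)).putVar 7 (q₀ % K) := by
    rw [growStep, denote, ← hs₁def, denote, ← hraise, ← hs₂def]
    simp only [denote, WExp.eval, Memory.putIdx_var, hv, e2, e3]
  refine ⟨q₀, hq₀, hc₀, hmin, ?_, fun a ha => ?_, ?_, ?_⟩
  · rw [hden]; simp
  · rw [hden]
    simp only [Memory.putVar_real, Memory.putIdx_real]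
    rw [hI a]
    simp [ha]
  · rw [hden]
    funext p
    simp [Function.update_apply, hidx2]
  · rw [hden]
    funext p
    simp [Function.update_apply, hidx2]

/-- `K` rounds suffice: unless a cluster with room has joined, each round adds a cluster, which
would make `K + 1` of them in the end. -/
theorem denote_grow {K n m N c₀ : ℕ} {s : Memory} (hnK : n = K * m) (hn : 1 ≤ n) (hN : N ≤ n)
    (hm : s.var 1 = m) (hc : s.var 7 = c₀) (hcK : c₀ < K) (hover : m < s.idx 4 c₀)
    (h : HoldsAssign n K s.idx s.real N) :
    HoldsAssign n K ((grow K).denote s).idx ((grow K).denote s).real N ∧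
    Grown n K m c₀ ((grow K).denote s).idx ((grow K).denote s).real
      (((grow K).denote s).var 7) K ∧
    ((grow K).denote s).idx 4 (((grow K).denote s).var 7) < m := by
  have hinit := denote_scatterIdx (f := fun k => setIdx 5 (.lit k) (.lit 0)) (N := K) (a := 5)
    (A := fun q => q) (F := fun _ => 0) (s := s) (fun _ _ _ _ h => h) (fun _ _ _ _ _ _ _ => rfl)
  obtain ⟨i1, i2, i3, -, i5⟩ := hinit
  obtain ⟨s₁, hs₁⟩ : ∃ s₁, s₁ = (seq (seqN K fun k => setIdx 5 (.lit k) (.lit 0))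
    (setIdx 5 (.var 7) (.lit 1))).denote s := ⟨_, rfl⟩
  have hs₁' : s₁ = ((seqN K fun k => setIdx 5 (.lit k) (.lit 0)).denote s).putIdx 5 c₀ 1 := by
    rw [hs₁]; simp only [denote, WExp.eval, i1, hc]
  have hr : s₁.real = s.real := by rw [hs₁']; exact i2
  have hv : s₁.var = s.var := by rw [hs₁']; exact i1
  have hi : ∀ a, a ≠ 5 → s₁.idx a = s.idx a := fun a ha => by
    rw [hs₁', Memory.putIdx_idx_of_ne _ ha, i3 a ha]
  have hrank : ∀ b < K, s₁.idx 5 b = if b = c₀ then 1 else 0 := by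
    intro b hb
    rw [hs₁', Memory.putIdx_idx]
    by_cases hbc : b = c₀
    · simp [hbc]
    · simp [hbc, i5 b hb]
  have h₁ : HoldsAssign n K s₁.idx s₁.real N := by
    rw [hr]
    exact ⟨by rw [hi 2 (by norm_num)]; exact h.cur_lt, by rw [hi 2 (by norm_num)]; exact h.cur_eq,
      by rw [hi 2 (by norm_num), hi 4 (by norm_num)]; exact h.size,
      by rw [hi 2 (by norm_num)]; exact h.best,
      h.trees.congr (hi 2 (by norm_num)) (hi 3 (by norm_num)) rfl⟩
  have hg₁ : Grown n K m c₀ s₁.idx s₁.real c₀ 0 := by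
    refine ⟨by rw [hrank c₀ hcK, if_pos rfl], fun b hb => ?_, fun b hb hb1 => ?_, hcK,
      by rw [hrank c₀ hcK, if_pos rfl]; norm_num, fun b hb hb1 => ?_, fun b hb hb1 hne => ?_, ?_⟩
    · rw [hrank b hb]; split_ifs <;> omega
    · rw [hrank b hb] at hb1
      by_contra hne
      rw [if_neg hne] at hb1; omega
    · rw [hrank b hb] at hb1
      split_ifs at hb1 <;> omega
    · rw [hrank b hb, if_neg hne] at hb1
      omega
    · right
      refine Finset.card_pos.2 ⟨c₀, ?_⟩
      rw [Finset.mem_filter, Finset.mem_range, hrank c₀ hcK, if_pos rfl]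
      exact ⟨hcK, by norm_num⟩
  have hI := denote_seqN (N := K) (s := s₁)
    (f := fun r => ite (.wlt (.arr 4 (.var 7)) (.var 1)) skip (growStep K r))
    (I := fun r s' => HoldsAssign n K s'.idx s'.real N ∧
      Grown n K m c₀ s'.idx s'.real (s'.var 7) r) (by simp)
    ⟨h₁, by rw [hv, hc]; exact hg₁⟩ (fun r hrK s' hs' ⟨h2, h3⟩ => by
      have hm' : s'.var 1 = m := by rw [hs'.var 1 (by simp), hv, hm]
      have h4' : s'.idx 4 = s.idx 4 := by rw [hs'.idx 4 (by simp), hi 4 (by norm_num)]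
      simp only [denote, BExp.holds, WExp.eval, hm']
      by_cases hlt : s'.idx 4 (s'.var 7) < m
      · rw [if_pos hlt]
        exact ⟨h2, h3.rank_root, fun b hb => (h3.rank_le b hb).trans (by omega), h3.eq_root,
          h3.last_lt, h3.last_mem, h3.tight, h3.full, Or.inl hlt⟩
      · rw [if_neg hlt]
        have hex := h3.exists_candidate h2 hn hnK hcK (by rw [h4']; exact hover) (not_lt.1 hlt)
        obtain ⟨q₀, hq₀, hc₀, hmin, g1, g2, g3, g4⟩ := denote_growStep K r s' hex
        have hsame := same_denote (c := growStep K r) (by simp) s'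
        rw [g1]
        exact ⟨h2.raise hn hN hq₀ hc₀ hmin (hsame.idx 2 (by simp)) (hsame.idx 3 (by simp))
            (hsame.idx 4 (by simp)) (hsame.real 4 (by simp)) g2,
          h3.step h2 hn (not_lt.1 hlt) hq₀ hc₀ (hsame.idx 2 (by simp)) (hsame.idx 4 (by simp))
            g3 g4 (hsame.real 4 (by simp)) g2⟩)
  have hden : (grow K).denote s = (seqN K fun r =>
    ite (.wlt (.arr 4 (.var 7)) (.var 1)) skip (growStep K r)).denote s₁ := by
    rw [hs₁]; rfl
  rw [hden]
  refine ⟨hI.1, hI.2, ?_⟩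
  rcases hI.2.progress with hp | hp
  · exact hp
  · have := (Finset.card_filter_le (Finset.range K) fun b => 0 < ((seqN K fun r =>
      ite (.wlt (.arr 4 (.var 7)) (.var 1)) skip (growStep K r)).denote s₁).idx 5 b)
    rw [Finset.card_range] at this
    omega

/-- Moving the recorded node into the current cluster `c` fills its free place and frees one in the
cluster `p` it came from, of smaller rank. After at most `K` moves `p` is the root `c₀`, and the
surplus is gone. The moves are lossless, so every node stays in a best cluster. -/
theorem run_walkBack (K : ℕ) : ∃ B, ∀ {n m N c₀ : ℕ} {s : Memory}, s.var 0 = n →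
    HoldsAssign n K s.idx s.real N → Grown n K m c₀ s.idx s.real (s.var 7) K →
    s.idx 4 (s.var 7) < m → (∀ k < K, s.idx 4 k ≤ m + if k = c₀ then 1 else 0) →
    Run (walkBack K) s (B * (Nat.log 2 n + 1)) fun s' =>
      HoldsAssign n K s'.idx s'.real N ∧ ∀ k < K, s'.idx 4 k ≤ m := by
  obtain ⟨B, hB⟩ := run_moveNode K
  refine ⟨K * (B + 20) + 1, fun {n m N c₀ s} hn h hg hlt hsize => ?_⟩
  set L := Nat.log 2 n + 1 with hL
  have hL1 : 1 ≤ L := by omega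
  refine Run.mono (Run.seqN (b := B * L + 20)
    -- Until the root is reached, it may exceed `m` by one and the current cluster has room. Records
    -- need to remain valid only for ranks up to the current one, and the rank drops in every round.
    (I := fun i s' => HoldsAssign n K s'.idx s'.real N ∧ s'.var 7 < K ∧ 0 < s.idx 5 (s'.var 7) ∧
      (∀ k < K, s'.idx 4 k ≤ m + if k = c₀ ∧ s'.var 7 ≠ c₀ then 1 else 0) ∧
      (s'.var 7 ≠ c₀ → s'.idx 4 (s'.var 7) < m) ∧
      (∀ b < K, 1 < s.idx 5 b → s.idx 5 b ≤ s.idx 5 (s'.var 7) → s.idx 6 b < n ∧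
        s'.idx 2 (s.idx 6 b) < K ∧ 0 < s.idx 5 (s'.idx 2 (s.idx 6 b)) ∧
        s.idx 5 (s'.idx 2 (s.idx 6 b)) < s.idx 5 b ∧
        reducedValue K s.real (s.idx 6 b) b =
          reducedValue K s.real (s.idx 6 b) (s'.idx 2 (s.idx 6 b))) ∧
      (s.idx 5 (s'.var 7) + i ≤ K + 1 ∨ s'.var 7 = c₀)) ?_ ?_) ?_ ?_
  · refine ⟨h, hg.last_lt, hg.last_mem, fun k hk => ?_, fun _ => hlt,
      fun b hb hb1 _ => hg.tight b hb hb1, Or.inl (hg.rank_le _ hg.last_lt)⟩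
    by_cases hkc : k = c₀
    · by_cases hc : s.var 7 = c₀
      · rw [hc] at hlt; rw [hkc]; omega
      · simpa [hkc, hc] using hsize c₀ (hkc ▸ hk)
    · simpa [hkc] using hsize k hk
  · intro i hi s' hs ⟨h1, h2, h3, h4, h5, h6, h7⟩
    have e5 : s'.idx 5 = s.idx 5 := hs.idx 5 (by simp [treeCell])
    have e6 : s'.idx 6 = s.idx 6 := hs.idx 6 (by simp [treeCell])
    have er : s'.real = s.real := funext fun a => hs.real a (by simp [treeCell])
    have e0 : s'.var 0 = n := (hs.var 0 (by simp [treeCell])).trans hn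
    set c := s'.var 7 with hc
    refine Run.mono (Run.ite (k := B * L + 10) (fun hb => ?_) fun hb => ?_)
      (b := _) (by simp only [BExp.cost, WExp.cost]; omega) fun _ _ q => q
    · simp only [BExp.holds, WExp.eval, e5, ← hc] at hb
      obtain ⟨t1, t2, t3, t4, t5⟩ := h6 c h2 hb le_rfl
      set u := s.idx 6 c with hu
      set p := s'.idx 2 u with hp
      have hcc : c ≠ c₀ := fun hcc => by rw [hcc, hg.rank_root] at hb; omega
      have hpc : p ≠ c := fun hpc => by rw [hpc] at t4; omega
      have huN : u < N := h1.lt_of_cur_lt t1 t2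
      refine Run.mono (Run.seq (b₁ := 8) (Q' := fun s₁ => s₁ = (s'.putVar 9 u).putVar 10 p) ?_
        fun s₁ _ q₁ => Run.seq (hB n u c s₁ ?_ ?_ t1 ?_ h2 ?_ ?_ ?_) fun s₂ hs₂ q₂ =>
          Run.of_denote (by simp) (Q := fun s₃ => s₃.var 7 = p ∧
            s₃.idx 2 = Function.update (s'.idx 2) u c ∧ HoldsTrees n K s₃.idx s₃.real 0 ∧
            ∀ k < K, s₃.idx 4 k = clusterSize n (s₃.idx 2) k) ?_) ?_ ?_
      · exact (Run.of_denote (c := seq (setVar 9 (.arr 6 (.var 7))) (setVar 10 (.arr 2 (.var 9)))) (by simp)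
          (by simp [denote, e6, ← hc, ← hu, ← hp])).mono
          (by simp [bound, WExp.cost]) fun _ _ q => q
      · rw [q₁]; simpa using e0
      · rw [q₁]; simp
      · rw [q₁]; simpa using hc.symm
      · rw [q₁]; exact hpc
      · rw [q₁]; exact h1.trees
      · rw [q₁]; exact h1.size
      · have : s₂.var 10 = p := by rw [hs₂.var 10 (by simp [treeCell]), q₁]; simp
        rw [q₁] at q₂
        exact ⟨by simp [denote, this], by simpa [denote] using q₂⟩
      · simp only [bound, WExp.cost, ← hL]; omega
      · rintro s₃ hs₃ ⟨f1, f2, f3, f4⟩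
        have er₃ : s₃.real = s.real := by
          funext a; rw [hs₃.real a (by simp [treeCell]), er]
        have hcur : ∀ j < N, j ≠ u → s₃.idx 2 j = s'.idx 2 j := fun j _ hj => by
          rw [f2, Function.update_of_ne hj]
        have hcu : s₃.idx 2 u = c := by rw [f2, Function.update_self]
        have hold : ∀ k < K, s₃.idx 4 k =
            if k = c then s'.idx 4 k + 1 else if k = p then s'.idx 4 k - 1 else s'.idx 4 k := by
          intro k hk
          rw [f4 k hk, f2, clusterSize_update t1 hpc, ← h1.size k hk]
        rw [f1]
        refine ⟨⟨fun j hj => ?_, fun j hj hjn => ?_, f4, fun j hj k hk => ?_, f3⟩, t2, t3,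
          fun k hk => ?_, fun hne => ?_, fun b hb1 hb2 hb3 => ?_, Or.inl ?_⟩
        · by_cases hju : j = u
          · rw [hju, hcu]; exact h2
          · rw [hcur j hj hju]; exact h1.cur_lt j hj
        · rw [f2, Function.update_of_ne (by omega)]; exact h1.cur_eq j hj hjn
        · have := h1.best j hj k hk
          rw [er] at this
          rw [er₃]
          by_cases hju : j = u
          · subst hju; rw [hcu, t5]; exact this
          · rw [hcur j hj hju]; exact this
        · rw [hold k hk]
          have := h4 k hk
          by_cases hkc : k = c
          · have h5' := h5 hcc
            rw [if_pos hkc, hkc]; omega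
          · rw [if_neg hkc]
            by_cases hkp : k = p
            · rw [if_pos hkp]
              split_ifs at this ⊢ <;> omega
            · rw [if_neg hkp]
              by_cases hk0 : k = c₀
              · rw [if_pos ⟨hk0, by rw [← hk0]; exact Ne.symm hkp⟩]
                rwa [if_pos ⟨hk0, hcc⟩] at this
              · simpa [hk0] using this
        · rw [hold p t2, if_neg hpc, if_pos rfl]
          have := h4 p t2
          have h5' := h5 hcc
          rw [if_neg (by simp [hne])] at this
          omega
        · obtain ⟨g1, g2, g3, g4, g5⟩ := h6 b hb1 hb2 (by omega)
          -- The moved node came from `p`, so it cannot be on record for a cluster of rank at most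
          -- that of `p`.
          have hne : s.idx 6 b ≠ u := fun hh => by rw [hh, ← hp] at g4; omega
          rw [f2, Function.update_of_ne hne]
          exact ⟨g1, g2, g3, g4, g5⟩
        · rcases h7 with h7 | h7
          · omega
          · exact absurd h7 hcc
    · refine (Run.of_denote (c := skip) (by simp) ?_).mono (by simp [bound]) fun _ _ q => q
      simp only [BExp.holds, WExp.eval, e5, ← hc] at hb
      exact ⟨h1, h2, h3, h4, h5, h6, Or.inr (hg.eq_root c h2 (by omega))⟩
  · nlinarith
  · intro s' _ ⟨h1, h2, h3, h4, _, _, h7⟩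
    refine ⟨h1, fun k hk => ?_⟩
    have : s'.var 7 = c₀ := by
      rcases h7 with h7 | h7
      · exact hg.eq_root _ h2 (by omega)
      · exact h7
    simpa [this] using h4 k hk

theorem run_augment (K : ℕ) : ∃ B, ∀ {n m N c : ℕ} {s : Memory}, n = K * m → 1 ≤ n → N ≤ n →
    s.var 0 = n → s.var 1 = m → s.var 7 = c → c < K → HoldsAssign n K s.idx s.real N →
    (∀ k < K, s.idx 4 k ≤ m + if k = c then 1 else 0) →
    Run (ite (.wlt (.var 1) (.arr 4 (.var 7))) (seq (grow K) (walkBack K)) skip) s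
      (B * (Nat.log 2 n + 1)) fun s' =>
      HoldsAssign n K s'.idx s'.real N ∧ ∀ k < K, s'.idx 4 k ≤ m := by
  obtain ⟨B, hB⟩ := run_walkBack K
  refine ⟨(grow K).bound + 10 + B, fun {n m N c s} hnK hn1 hN hn hm h7 hc h hsize => ?_⟩
  refine Run.mono (Run.ite (k := (grow K).bound + 1 + B * (Nat.log 2 n + 1)) (fun hb => ?_)
    fun hb => ?_) ?_ fun _ _ q => q
  · simp only [BExp.holds, WExp.eval, hm, h7] at hb
    obtain ⟨g1, g2, g3⟩ := denote_grow hnK hn1 hN hm h7 hc hb h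
    have hs := same_denote (c := grow K) (by simp) s
    refine Run.mono (Run.seq (Run.of_denote (c := grow K) (by simp)
      (Q := fun s' => s' = (grow K).denote s) rfl) (b₂ := B * (Nat.log 2 n + 1)) fun s' _ hs' => ?_)
      (by omega) fun _ _ q => q
    subst hs'
    refine hB ((hs.var 0 (by simp)).trans hn) g1 g2 g3 fun k hk => ?_
    rw [hs.idx 4 (by simp)]; exact hsize k hk
  · simp only [BExp.holds, WExp.eval, hm, h7] at hb
    refine (Run.of_denote (c := skip) (by simp) ⟨h, fun k hk => ?_⟩).mono (by simp [bound]; omega)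
      fun _ _ q => q
    have := hsize k hk
    by_cases hkc : k = c
    · subst hkc; exact not_lt.1 hb
    · simpa [hkc, denote] using this
  · simp only [BExp.cost, WExp.cost, add_mul]
    have := Nat.le_mul_of_pos_right (grow K).bound (show 0 < Nat.log 2 n + 1 by omega)
    omega

/-- Putting the node into its best cluster keeps the price condition, and it overfills at most that
cluster, by one node; the augmentation repairs this. -/
theorem run_insertNode (K : ℕ) : ∃ B, ∀ {n m j : ℕ} {s : Memory}, n = K * m → j < n →
    s.var 0 = n → s.var 1 = m → s.var 8 = j → HoldsAssign n K s.idx s.real j →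
    (∀ k < K, s.idx 4 k ≤ m) → Run (insertNode K) s (B * (Nat.log 2 n + 1)) fun s' =>
      HoldsAssign n K s'.idx s'.real (j + 1) ∧ ∀ k < K, s'.idx 4 k ≤ m := by
  obtain ⟨B₁, hB₁⟩ := run_moveNode K
  obtain ⟨B₂, hB₂⟩ := run_augment K
  refine ⟨(chooseBest K).bound + 2 + (B₁ + B₂), fun {n m j s} hnK hj hn hm h8 h hsize => ?_⟩
  have hK : 0 < K := Nat.pos_of_ne_zero (by rintro rfl; omega)
  obtain ⟨hcK, hbest⟩ := denote_chooseBest hK s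
  have hs₁ := same_denote (c := chooseBest K) (by simp) s
  set c := ((chooseBest K).denote s).var 7 with hc
  rw [h8] at hbest
  have hjc : s.idx 2 j ≠ c := by rw [h.cur_eq j le_rfl hj]; exact hcK.ne'
  refine Run.mono (Run.seq (c₁ := seq (chooseBest K) (setVar 9 (.var 8)))
    (Q' := fun s₁ => s₁.var 0 = n ∧ s₁.var 1 = m ∧ s₁.var 9 = j ∧ s₁.var 7 = c ∧ s₁.idx = s.idx ∧
      s₁.real = s.real) (Run.of_denote (by simp) ?_) fun s₁ _ ⟨a0, a1, a9, a7, ai, ar⟩ => Run.seq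
        (hB₁ n j c s₁ a0 a9 hj a7 hcK ?_ ?_ ?_) fun s₂ hs₂ ⟨f1, f2, f3⟩ =>
          hB₂ (N := j + 1) hnK (by omega) hj ((hs₂.var 0 (by simp [treeCell])).trans a0)
            ((hs₂.var 1 (by simp [treeCell])).trans a1) ((hs₂.var 7 (by simp [treeCell])).trans a7)
            hcK ?_ ?_) ?_ fun _ _ q => q
  · refine ⟨?_, ?_, ?_, ?_, ?_, ?_⟩
    · simpa [denote] using (hs₁.var 0 (by simp)).trans hn
    · simpa [denote] using (hs₁.var 1 (by simp)).trans hm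
    · simpa [denote] using (hs₁.var 8 (by simp)).trans h8
    · simp only [denote, Memory.putVar_var]; simp [hc]
    · funext a; simpa [denote] using hs₁.idx a (by simp)
    · funext a; simpa [denote] using hs₁.real a (by simp)
  · rw [ai]; exact hjc
  · rw [ai, ar]; exact h.trees
  · rw [ai]; exact h.size
  · have er : s₂.real = s.real := by
      funext a; rw [hs₂.real a (by simp [treeCell]), ar]
    rw [ai] at f1
    have hcur : ∀ i, i ≠ j → s₂.idx 2 i = s.idx 2 i := fun i hi => by
      rw [f1, Function.update_of_ne hi]
    have hcj : s₂.idx 2 j = c := by rw [f1, Function.update_self]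
    refine ⟨fun i hi => ?_, fun i hi hin => ?_, f3, fun i hi k hk => ?_, f2⟩
    · by_cases hij : i = j
      · rw [hij, hcj]; exact hcK
      · rw [hcur i hij]; exact h.cur_lt i (by omega)
    · rw [hcur i (by omega)]; exact h.cur_eq i (by omega) hin
    · rw [er]
      by_cases hij : i = j
      · subst hij; rw [hcj]; exact hbest k hk
      · rw [hcur i hij]; exact h.best i (by omega) k hk
  · intro k hk
    rw [ai] at f1
    rw [f3 k hk, f1, clusterSize_update hj hjc, ← h.size k hk, h.cur_eq j le_rfl hj]
    have := hsize k hk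
    rw [if_neg hk.ne]
    split_ifs <;> omega
  · simp only [bound, WExp.cost, add_mul]
    have := Nat.le_mul_of_pos_right (chooseBest K).bound (show 0 < Nat.log 2 n + 1 by omega)
    omega

theorem run_initAssign (K : ℕ) : ∃ B, ∀ {n len : ℕ} {s : Memory}, s.var 0 = n →
    Run (initAssign K) s (B * workload n len) fun s' =>
      HoldsAssign n K s'.idx s'.real 0 ∧ ∀ k < K, s'.idx 4 k = 0 := by
  set e : WExp := .mulLit (2 * (K * K)) (.var 0) with he
  set f : ℕ → Cmd := fun k => setIdx 4 (.lit k) (.lit 0) with hf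
  set g : ℕ → Cmd := fun k => setReal 5 (.lit k) (.lit 0) with hg
  refine ⟨11 + 5 + (2 * (K * K) * (10 + e.cost) + (e.cost + 4)) +
    ((seqN K f).bound + (seqN K g).bound), fun {n len s} hn => ?_⟩
  refine Run.mono (Run.seq (Run.forLoop (N := n) (b := 4)
    (I := fun i idx _ => ∀ j < i, idx 2 j = K) (by simp) (fun s' hs => ?_) (by simp) ?_)
    fun s₁ hs₁ h₁ => Run.seq (Run.forLoop (N := 2 * (K * K) * n) (b := 4)
    (I := fun i idx _ => ∀ p < i, idx 3 p = 0) (by simp) (fun s' hs => ?_) (by simp) ?_)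
    fun s₂ hs₂ h₂ => Run.of_denote (c := seq (seqN K f) (seqN K g)) (by simp [hf, hg]) (Q := fun s' =>
      HoldsAssign n K s'.idx s'.real 0 ∧ ∀ k < K, s'.idx 4 k = 0) ?_) ?_ fun _ _ q => q
  · simpa using (hs.var 0 (by simp)).trans hn
  · intro i hi s' hs h5 hI
    refine (Run.of_denote (by simp) ?_).mono (by simp [bound, WExp.cost]) fun _ _ q => q
    intro j hj
    simp only [denote, WExp.eval, h5, Memory.putIdx_idx]
    rcases Nat.lt_succ_iff_lt_or_eq.1 hj with h | rfl
    · rw [if_neg (by omega)]; exact hI j h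
    · simp
  · have := ((hs.var 0 (by simp)).trans (hs₁.var 0 (by simp))).trans hn
    simp [this]
  · intro i hi s' hs h5 hI
    refine (Run.of_denote (by simp) ?_).mono (by simp [bound, WExp.cost]) fun _ _ q => q
    intro j hj
    simp only [denote, WExp.eval, h5, Memory.putIdx_idx]
    rcases Nat.lt_succ_iff_lt_or_eq.1 hj with h | rfl
    · rw [if_neg (by omega)]; exact hI j h
    · simp
  · have hs := same_denote (c := seq (seqN K f) (seqN K g)) (by simp [hf, hg]) s₂
    have hcell := (denote_scatterIdx (f := f) (N := K) (a := 4) (A := fun q => q)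
      (F := fun _ => 0) (s := s₂) (fun _ _ _ _ h => h) (fun _ _ _ _ _ _ _ => rfl)).2.2.2.2
    have h4 : ∀ k < K, ((seq (seqN K f) (seqN K g)).denote s₂).idx 4 k = 0 := by
      intro k hk
      rw [denote, (same_denote (c := seqN K g) (by simp [hg]) _).idx 4 (by simp [hg])]
      exact hcell k hk
    have h2 : ((seq (seqN K f) (seqN K g)).denote s₂).idx 2 = s₁.idx 2 :=
      (hs.idx 2 (by simp [hf, hg])).trans (hs₂.idx 2 (by simp))
    have h3 : ((seq (seqN K f) (seqN K g)).denote s₂).idx 3 = s₂.idx 3 :=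
      hs.idx 3 (by simp [hf, hg])
    have hz : ∀ p < 2 * n, ∀ q < K * K, s₂.idx 3 (K * K * p + q) = 0 := fun p hp q hq => by
      refine h₂ _ ?_
      calc K * K * p + q < K * K * p + K * K := by omega
        _ = K * K * (p + 1) := by ring
        _ ≤ K * K * (2 * n) := Nat.mul_le_mul_left _ hp
        _ = _ := by ring
    refine ⟨⟨fun j hj => absurd hj (by omega), fun j _ hj => by rw [h2]; exact h₁ j hj,
      fun k hk => ?_, fun j hj => absurd hj (by omega),
      ⟨fun q hq j hj => ?_, fun q hq w hw1 hwn _ => ?_⟩⟩, h4⟩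
    · rw [h4 k hk, h2, clusterSize, eq_comm, Finset.card_eq_zero, Finset.filter_eq_empty_iff]
      intro j hj
      rw [h₁ j (Finset.mem_range.1 hj)]
      exact hk.ne'
    · rw [h3, h2, hz _ (by omega) q hq, if_neg]
      rw [h₁ j hj]
      exact (div_lt_of_lt_sq hq).ne'
    · rw [h3, hz _ (by omega) q hq, hz _ (by omega) q hq, hz _ (by omega) q hq]
      simp [pick]
  · have h1 := one_le_workload n len
    have h2 := le_workload n len
    have h3 : (seq (seqN K f) (seqN K g)).bound = (seqN K f).bound + (seqN K g).bound := rfl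
    rw [h3]
    simp only [WExp.cost]
    generalize (seqN K f).bound + (seqN K g).bound = x
    generalize e.cost = y
    have h4 := Nat.mul_le_mul_left (2 * (K * K) * (10 + y)) h2
    have h5 := Nat.mul_le_mul_left (y + 4) h1
    have h6 := Nat.mul_le_mul_left x h1
    nlinarith

theorem run_assign (K : ℕ) : ∃ B, ∀ {n m len : ℕ} {s : Memory}, n = K * m →
    s.var 0 = n → s.var 1 = m → Run (assign K) s (B * workload n len) fun s' =>
      HoldsAssign n K s'.idx s'.real n ∧ ∀ k < K, s'.idx 4 k ≤ m := by
  obtain ⟨B₁, hB₁⟩ := run_initAssign K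
  obtain ⟨B₂, hB₂⟩ := run_insertNode K
  refine ⟨B₁ + B₂ + 12, fun {n m len s} hnK hn hm => ?_⟩
  refine Run.mono (Run.seq (hB₁ (len := len) hn) fun s₁ hs₁ ⟨h1, h2⟩ => Run.forLoop (N := n)
    (b := B₂ * (Nat.log 2 n + 1))
    (I := fun i idx real => HoldsAssign n K idx real i ∧ ∀ k < K, idx 4 k ≤ m)
    (by simp [treeCell]) (fun s' hs => ?_) ⟨h1, fun k hk => by rw [h2 k hk]; omega⟩ ?_) ?_
    fun _ _ q => q
  · exact ((hs.var 0 (by simp [treeCell])).trans (hs₁.var 0 (by simp))).trans hn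
  · intro i hi s' hs h8 ⟨h3, h4⟩
    exact hB₂ hnK hi (((hs.var 0 (by simp [treeCell])).trans (hs₁.var 0 (by simp))).trans hn)
      (((hs.var 1 (by simp [treeCell])).trans (hs₁.var 1 (by simp))).trans hm) h8 h3 h4
  · simp only [WExp.cost]
    have h1 := one_le_workload n len
    have h2 := le_workload n len
    have h3 : n * (Nat.log 2 n + 1) ≤ workload n len := by unfold workload; omega
    have h4 := Nat.mul_le_mul_left B₂ h3
    nlinarith

end Cmd

/-! ### Optimality of the final assignment -/

theorem sum_clusterSize {n K : ℕ} {f : ℕ → ℕ} (hf : ∀ j < n, f j < K) :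
    ∑ k ∈ Finset.range K, clusterSize n f k = n := by
  have := Finset.card_eq_sum_card_fiberwise (s := Finset.range n) (t := Finset.range K) (f := f)
    fun j hj => by simpa using hf j (by simpa using hj)
  rw [Finset.card_range] at this
  exact this.symm

theorem clusterSize_eq {n m K : ℕ} {f : ℕ → ℕ} (hnK : n = K * m) (hf : ∀ j < n, f j < K)
    (h : ∀ k < K, clusterSize n f k ≤ m) : ∀ k < K, clusterSize n f k = m := by
  have hs : ∑ k ∈ Finset.range K, clusterSize n f k = ∑ _k ∈ Finset.range K, m := by
    rw [sum_clusterSize hf, Finset.sum_const, Finset.card_range, smul_eq_mul, hnK]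
  intro k hk
  exact (Finset.sum_eq_sum_iff_of_le fun i hi => h i (Finset.mem_range.1 hi)).1 hs k
    (Finset.mem_range.2 hk)

/-- The total price is the same for all balanced assignments. This is the duality behind the method:
being best node by node at some prices implies being optimal. -/
theorem sum_price_of_balanced {n m K : ℕ} {C : Fin n → Fin K} (hC : Balanced m C)
    (price : Fin K → ℝ) : ∑ i, price (C i) = ∑ k, (m : ℝ) * price k := by
  rw [← Finset.sum_fiberwise (s := Finset.univ) (g := C)]
  refine Finset.sum_congr rfl fun k _ => ?_
  rw [Finset.sum_congr rfl fun i hi => by rw [(Finset.mem_filter.1 hi).2], Finset.sum_const, hC k,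
    nsmul_eq_mul]

/-- A full assignment that is balanced and best for all the nodes at some prices is optimal. -/
theorem HoldsAssign.optimal {n m K : ℕ} {idx : ℕ → ℕ → ℕ} {real : ℕ → ℕ → ℝ}
    (h : HoldsAssign n K idx real n) (hnK : n = K * m) (hsize : ∀ k < K, idx 4 k ≤ m) :
    Balanced m (fun i : Fin n => (⟨idx 2 i, h.cur_lt i i.2⟩ : Fin K)) ∧
    ∀ C' : Fin n → Fin K, Balanced m C' →
      ∑ i, real 4 (K * (i + 1) + C' i) ≤ ∑ i : Fin n, real 4 (K * (i + 1) + idx 2 i) := by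
  have hbal : Balanced m (fun i : Fin n => (⟨idx 2 i, h.cur_lt i i.2⟩ : Fin K)) := by
    intro k
    rw [← clusterSize_eq hnK h.cur_lt (fun k hk => (h.size k hk) ▸ hsize k hk) k k.2, clusterSize,
      Finset.card_filter, Finset.card_filter,
      ← Fin.sum_univ_eq_sum_range (fun j => if idx 2 j = (k : ℕ) then 1 else 0) n]
    exact Finset.sum_congr rfl fun i _ => if_congr Fin.ext_iff rfl rfl
  refine ⟨hbal, fun C' hC' => ?_⟩
  have h1 := sum_price_of_balanced hbal fun k => real 5 k
  have h2 := sum_price_of_balanced hC' fun k => real 5 k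
  have h3 := Finset.sum_le_sum fun (i : Fin n) (_ : i ∈ Finset.univ) =>
    h.best i i.2 (C' i) (C' i).2
  unfold reducedValue at h3
  rw [Finset.sum_sub_distrib, Finset.sum_sub_distrib, h2] at h3
  simp only at h1
  rw [h1] at h3
  linarith

/-! ### The program -/

/-- The determinant of a matrix of expressions. -/
def RExp.det : (d : ℕ) → (Fin d → Fin d → RExp) → RExp
  | 0, _ => .lit 1
  | d + 1, M => .sum (d + 1) fun j => .mul (.mul (.lit ((-1) ^ j)) (M 0 (Fin.ofNat (d + 1) j)))
      (RExp.det d fun a b => M a.succ ((Fin.ofNat (d + 1) j).succAbove b))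

theorem RExp.eval_det (s : Memory) (d : ℕ) (M : Fin d → Fin d → RExp) :
    (RExp.det d M).eval s = (Matrix.of fun a b => (M a b).eval s).det := by
  induction d with
  | zero => simp [RExp.det]
  | succ d ih =>
    rw [RExp.det, RExp.eval_sum, Matrix.det_succ_row_zero, Finset.sum_range]
    refine Finset.sum_congr rfl fun j _ => ?_
    have hj : Fin.ofNat (d + 1) (j : ℕ) = j := by ext; simp
    simp only [RExp.eval, ih, hj, Rat.cast_pow, Rat.cast_neg, Rat.cast_one, Matrix.of_apply]
    rfl

namespace Cmd

/-- The cells are written in increasing order. The values `E` must not depend on what the loop has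
already written, which the frame condition in `h` lets one check. -/
theorem run_rows {N a n : ℕ} {f : ℕ → Cmd} {E : ℕ → ℕ → ℝ} {s : Memory} (len : ℕ)
    (hf : ∀ q < N, (f q).LoopFree) (h5 : ∀ q < N, (f q).KeepsVar 5)
    (h0 : ∀ q < N, (f q).KeepsVar 0) (hn : s.var 0 = n)
    (h : ∀ i < n, ∀ q < N, ∀ s', Same (forLoop 5 (.var 0) (seqN N f)) s s' → s'.var 5 = i →
      (f q).denote s' = s'.putReal a (N * i + q) (E i q)) :
    Run (forLoop 5 (.var 0) (seqN N f)) s (((seqN N f).bound + 12) * workload n len) fun s' =>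
      ∀ i < n, ∀ q < N, s'.real a (N * i + q) = E i q := by
  refine Run.mono (Run.forLoop (N := n) (b := (seqN N f).bound)
    (I := fun x _ real => ∀ j q, q < N → N * j + q < N * x → real a (N * j + q) = E j q)
    (by simpa using h5) (fun s' hs => ?_) (by simp) fun i hi s' hs hs5 hI =>
      Run.of_denote (by simpa using hf) ?_) ?_ fun s' _ hI i hi q hq => hI i q hq ?_
  · exact (hs.var 0 (by simpa using h0)).trans hn
  · refine denote_seqN (I := fun x s₁ => ∀ j q, q < N → N * j + q < N * i + x →
      s₁.real a (N * j + q) = E j q) hf hI fun x hx s₁ hs₁ hI => ?_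
    rw [h i hi x hx s₁ (hs.trans ⟨fun y hy => hs₁.var y hy.2.1, fun y hy => hs₁.idx y hy.2.1,
      fun y hy => hs₁.real y hy.2.1⟩) ((hs₁.var 5 (by simpa using h5)).trans hs5)]
    intro j q hq hlt
    rw [Memory.putReal_real]
    by_cases hjq : N * j + q = N * i + x
    · obtain ⟨rfl, rfl⟩ := mul_add_inj hq hx hjq
      simp
    · rw [if_neg (by simp [hjq])]
      exact hI j q hq (by omega)
  · have h1 := one_le_workload n len
    have h2 := le_workload n len
    simp only [WExp.cost]
    nlinarith
  · calc N * i + q < N * i + N := by omega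
      _ = N * (i + 1) := by ring
      _ ≤ _ := Nat.mul_le_mul_left _ hi

end Cmd

theorem rowPos {K d k a b : ℕ} (ha : a < d) (hk : k < K) (hb : b < d) :
    a * (K * d) + (k * d + b) < d * (K * d) ∧
    (a * (K * d) + (k * d + b)) / (K * d) = a ∧
    (a * (K * d) + (k * d + b)) % (K * d) / d = k ∧
    (a * (K * d) + (k * d + b)) % (K * d) % d = b := by
  have h1 : k * d + b < K * d := by
    calc k * d + b < k * d + d := by omega
      _ = (k + 1) * d := by ring
      _ ≤ _ := Nat.mul_le_mul_right _ hk
  have h2 : (a * (K * d) + (k * d + b)) % (K * d) = k * d + b := by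
    rw [mul_comm a, Nat.mul_add_mod, Nat.mod_eq_of_lt h1]
  refine ⟨?_, ?_, ?_, ?_⟩
  · calc _ < a * (K * d) + K * d := by omega
      _ = (a + 1) * (K * d) := by ring
      _ ≤ _ := Nat.mul_le_mul_right _ ha
  · rw [mul_comm a, Nat.mul_add_div (by omega), Nat.div_eq_of_lt h1, add_zero]
  · rw [h2, mul_comm k, Nat.mul_add_div (by omega), Nat.div_eq_of_lt hb, add_zero]
  · rw [h2, mul_comm k, Nat.mul_add_mod, Nat.mod_eq_of_lt hb]

theorem holds_of_rows {n K d : ℕ} {s : Memory} {W : BlockMatrix n K d} {E : ℕ → ℕ → ℝ}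
    (h : ∀ i < n, ∀ q < d * (K * d), s.real 1 (d * (K * d) * i + q) = E i q)
    (hE : ∀ (i : Fin n) (a : Fin d) (k : Fin K) (b : Fin d),
      E i (a * (K * d) + (k * d + b)) = W (i, a) (k, b)) : Holds s W := by
  intro i a k b
  rw [← hE, ← h i i.2 _ (rowPos a.2 k.2 b.2).1]
  congr 1
  ring

theorem Holds.row {n K d : ℕ} {s : Memory} {V : BlockMatrix n K d} (h : Holds s V) (i : Fin n)
    (a : Fin d) (k : Fin K) (b : Fin d) :
    s.real 1 (d * (K * d) * i + (a * (K * d) + (k * d + b))) = V (i, a) (k, b) := by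
  rw [← h i a k b]
  congr 1
  ring

/-! ### One iteration and the final rounding as programs -/

namespace Cmd

/-- The cell number `q` of the block row in the scalar `5`. -/
def rowCell (K d q : ℕ) : WExp := .add (.mulLit (d * (K * d)) (.var 5)) (.lit q)

/-- The next iterate is made of the projections of the blocks of the assigned clusters. -/
def storeCell (K d q : ℕ) : Cmd :=
  ite (.wlt (.arr 2 (.var 5)) (.lit (q % (K * d) / d))) (setReal 1 (rowCell K d q) (.lit 0))
    (ite (.wlt (.lit (q % (K * d) / d)) (.arr 2 (.var 5))) (setReal 1 (rowCell K d q) (.lit 0))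
      (setReal 1 (rowCell K d q) (.arr 3 (.add (.mulLit (K * (d * d)) (.var 5))
        (.lit (blockPos d (q % (K * d) / d) (q / (K * d)) (q % (K * d) % d)))))))

/-- Store the next iterate. -/
def store (K d : ℕ) : Cmd := forLoop 5 (.var 0) (seqN (d * (K * d)) (storeCell K d))

/-- One iteration. -/
def iterate (K d : ℕ) : Cmd := seq (multiply K d) (seq (project K d) (seq (assign K) (store K d)))

/-- An entry of the rounded matrix. -/
def roundExp (K d q : ℕ) : RExp :=
  if Odd d ∨ q % (K * d) % d + 1 = d then
    .mul (.det d fun a b => .arr 1 (rowCell K d (a * (K * d) + (q % (K * d) / d * d + b))))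
      (.arr 1 (rowCell K d q))
  else .arr 1 (rowCell K d q)

/-- The last step of the method. -/
def round (G : GroupKind) (K d : ℕ) : Cmd :=
  match G with
  | .orthogonal => skip
  | .rotation =>
    seq (forLoop 5 (.var 0) (seqN (d * (K * d)) fun q => setReal 3 (rowCell K d q) (roundExp K d q)))
      (forLoop 5 (.var 0) (seqN (d * (K * d)) fun q =>
        setReal 1 (rowCell K d q) (.arr 3 (rowCell K d q))))

/-- The generalized power method. -/
def powerMethod (G : GroupKind) (K d : ℕ) : Cmd :=
  seq (forLoop 4 (.var 2) (iterate K d)) (round G K d)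

attribute [simp] storeCell store iterate

theorem run_store (K d : ℕ) : ∃ B, ∀ {n : ℕ} (len : ℕ) {W : BlockMatrix n K d} {s : Memory},
    s.var 0 = n → (∀ (i : Fin n) (a : Fin d) (k : Fin K) (b : Fin d), W (i, a) (k, b) =
      if s.idx 2 i = k then s.real 3 (K * (d * d) * i + blockPos d k a b) else 0) →
    Run (store K d) s (B * workload n len) fun s' => Holds s' W := by
  refine ⟨_, fun {n} len {W s} hn hW => (run_rows (a := 1) (n := n) (s := s)
    (f := storeCell K d) (E := fun i q => if s.idx 2 i = q % (K * d) / d then s.real 3 (K * (d * d) * i +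
      blockPos d (q % (K * d) / d) (q / (K * d)) (q % (K * d) % d)) else 0) len
    (by simp) (by simp) (by simp) hn fun i hi q hq s' hs h5 => ?_).mono le_rfl
    fun s' _ h => holds_of_rows h fun i a k b => ?_⟩
  · have e2 : s'.idx 2 = s.idx 2 := hs.idx 2 (by simp)
    have e3 : s'.real 3 = s.real 3 := hs.real 3 (by simp)
    simp only [storeCell, denote, BExp.holds, WExp.eval, RExp.eval, WExp.eval_mulLit, rowCell, h5,
      e2, e3, Rat.cast_zero]
    split_ifs with g1 g2 g3 g4 g5
    all_goals first | rfl | omega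
  · obtain ⟨-, h1, h2, h3⟩ := rowPos a.2 k.2 b.2
    simp only [h1, h2, h3]
    exact (hW i a k b).symm

/-- The rounded entries go to another array and are copied back afterwards, since each needs the
determinant of the block before rounding. -/
theorem run_round (G : GroupKind) (K d : ℕ) : ∃ B, ∀ {n : ℕ} (len : ℕ) {V : BlockMatrix n K d}
    {s : Memory}, s.var 0 = n → Holds s V →
    Run (round G K d) s (B * workload n len) fun s' => Holds s' (finish G V) := by
  cases G with
  | orthogonal =>
    refine ⟨1, fun {n} len {V s} hn hV => (Run.of_denote (c := skip) (by simp) ?_).mono ?_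
      fun _ _ q => q⟩
    · exact hV
    · have := one_le_workload n len
      simp only [bound]; omega
  | rotation =>
    refine ⟨_, fun {n} len {V s} hn hV => Run.mono (Run.seq (run_rows (a := 3) (n := n) (s := s)
      (f := fun q => setReal 3 (rowCell K d q) (roundExp K d q))
      (E := fun i q => if Odd d ∨ q % (K * d) % d + 1 = d then
        (Matrix.of fun (a b : Fin d) => s.real 1 (d * (K * d) * i +
          (a * (K * d) + (q % (K * d) / d * d + b)))).det * s.real 1 (d * (K * d) * i + q)
        else s.real 1 (d * (K * d) * i + q)) len (by simp) (by simp) (by simp) hn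
        fun i hi q hq s' hs h5 => ?_) fun s₁ hs₁ h₁ => (run_rows (a := 1) (n := n) (s := s₁)
        (f := fun q => setReal 1 (rowCell K d q) (.arr 3 (rowCell K d q)))
        (E := fun i q => s₁.real 3 (d * (K * d) * i + q)) len (by simp) (by simp) (by simp)
        ((hs₁.var 0 (by simp)).trans hn) fun i hi q hq s' hs h5 => ?_).mono le_rfl
        fun s' _ h => holds_of_rows h fun i a k b => ?_) (add_mul _ _ _).ge fun _ _ q => q⟩
    · have e1 : s'.real 1 = s.real 1 := hs.real 1 (by simp)
      simp only [denote, roundExp]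
      split_ifs with hc
      · simp [rowCell, RExp.eval_det, h5, e1]
      · simp [rowCell, h5, e1]
    · have e3 : s'.real 3 = s₁.real 3 := hs.real 3 (by simp)
      simp [denote, rowCell, h5, e3]
    · obtain ⟨h0, h1, h2, h3⟩ := rowPos a.2 k.2 b.2
      rw [h₁ i i.2 _ h0]
      simp only [h2, h3, hV.row]
      simp only [finish, Matrix.of_apply, roundBlock]
      have hblock : (Matrix.of fun a b => V (i, a) (k, b)) = block V i k := rfl
      rw [hblock]
      by_cases hd : Odd d
      · rw [if_pos (Or.inl hd), if_pos hd]; rfl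
      · by_cases hb : (b : ℕ) + 1 = d
        · rw [if_pos (Or.inr hb), if_neg hd, Matrix.of_apply, if_pos hb]; rfl
        · rw [if_neg (by tauto), if_neg hd, Matrix.of_apply, if_neg hb]; rfl

theorem run_iterate (K d : ℕ) : ∃ B, ∀ {n m T : ℕ} {A : BlockMatrix n n d}
    {L : List (Fin n × Fin n)} {V : BlockMatrix n K d} {s : Memory}, n = K * m → IsSupport A L →
    HoldsMatrix s m T A L → Holds s V →
    Run (iterate K d) s (B * workload n L.length) fun s' =>
      ∃ W, IsNearest (feasible .orthogonal n K d m) (A * V) W ∧ Holds s' W := by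
  obtain ⟨B₁, hB₁⟩ := run_multiply K d
  obtain ⟨B₂, hB₂⟩ := run_project K d
  obtain ⟨B₃, hB₃⟩ := run_assign K
  obtain ⟨B₄, hB₄⟩ := run_store K d
  refine ⟨B₁ + (B₂ + (B₃ + B₄)), fun {n m T A L V s} hnK hL hs hV => ?_⟩
  refine Run.mono (Run.seq (hB₁ n m T A L V s hL hs hV) fun s₁ hs₁ h₁ => Run.seq
    (hB₂ n L.length (A * V) s₁ ((hs₁.var 0 (by simp)).trans hs.1) h₁) fun s₂ hs₂ h₂ => Run.seq
    (hB₃ (len := L.length) hnK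
      (((hs₂.var 0 (by simp)).trans (hs₁.var 0 (by simp))).trans hs.1)
      (((hs₂.var 1 (by simp)).trans (hs₁.var 1 (by simp))).trans hs.2.1)) fun s₃ hs₃ ⟨h₃, h₃'⟩ => ?_)
    (by simp only [add_mul]; exact le_rfl) fun _ _ q => q
  obtain ⟨hbal, hopt⟩ := h₃.optimal hnK h₃'
  have e3 : s₃.real 3 = s₂.real 3 := hs₃.real 3 (by simp [treeCell])
  have e4 : s₃.real 4 = s₂.real 4 := hs₃.real 4 (by simp [treeCell])
  have hmu : ∀ (i : Fin n) (k : Fin K), s₃.real 4 (K * (i + 1) + k) =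
      nuclearNorm (block (A * V) i k) := fun i k => by
    rw [e4, ← (h₂ i k).2, mul_comm]
  refine (hB₄ L.length (W := assemble _ _) ?_ ?_).mono le_rfl fun s' _ h =>
    ⟨_, isNearest_assemble hbal fun C' hC' => ?_, h⟩
  · exact ((hs₃.var 0 (by simp [treeCell])).trans
      ((hs₂.var 0 (by simp)).trans (hs₁.var 0 (by simp)))).trans hs.1
  · intro i a k b
    rw [assemble, Matrix.of_apply, e3, (h₂ i k).1 a b]
    simp only [Fin.ext_iff]
    split_ifs with hk
    · have hk' : (⟨s₃.idx 2 i, h₃.cur_lt i i.2⟩ : Fin K) = k := Fin.ext hk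
      rw [hk']
    · rfl
  · have := hopt C' hC'
    simp only [hmu] at this
    refine this.trans (le_of_eq (Finset.sum_congr rfl fun i _ => ?_))
    exact hmu i ⟨s₃.idx 2 i, h₃.cur_lt i i.2⟩

end Cmd

/-- The generalized power method can be implemented in time of the order of the number of nonzero
blocks and of `n log n` per iteration. -/
theorem exists_program (K d : ℕ) (G : GroupKind) :
    ∃ (c : Cmd) (B : ℕ), ∀ n m : ℕ, n = K * m →
      ∀ (A : BlockMatrix n n d) (L : List (Fin n × Fin n)), IsSupport A L →
      ∀ (V0 : BlockMatrix n K d) (T : ℕ) (s : Memory), IsInput s m T A L V0 →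
      ∃ (t : ℕ) (s' : Memory) (W : BlockMatrix n K d),
        Exec c s t s' ∧ IsGPMOutput G m A V0 T W ∧ Holds s' W ∧
        t ≤ B * ((T + 1) * workload n L.length) := by
  obtain ⟨B₁, hB₁⟩ := Cmd.run_iterate K d
  obtain ⟨B₂, hB₂⟩ := Cmd.run_round G K d
  refine ⟨Cmd.powerMethod G K d, B₁ + B₂ + 12, fun n m hnK A L hL V0 T s hs => ?_⟩
  have hM : HoldsMatrix s m T A L := ⟨hs.1, hs.2.1, hs.2.2.1, hs.2.2.2.1, hs.2.2.2.2.1⟩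
  have hrun : Cmd.Run (Cmd.powerMethod G K d) s ((B₁ + B₂ + 12) * ((T + 1) * workload n L.length))
      fun s' => ∃ W, IsGPMOutput G m A V0 T W ∧ Holds s' W := by
    refine Cmd.Run.mono (Cmd.Run.seq (Cmd.Run.forLoop (N := T) (b := B₁ * workload n L.length)
      -- The history of iterates exists only in the invariant; each round extends it by one value.
      (I := fun t _ real => ∃ V : ℕ → BlockMatrix n K d, V 0 = V0 ∧
        (∀ t' < t, IsNearest (feasible .orthogonal n K d m) (A * V t') (V (t' + 1))) ∧
        ∀ (i : Fin n) (a : Fin d) (k : Fin K) (b : Fin d),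
          real 1 ((i * d + a) * (K * d) + (k * d + b)) = V t (i, a) (k, b))
      (by simp [Cmd.treeCell, Cmd.rowCell]) (fun s' hs' => ?_)
      ⟨fun _ => V0, rfl, by simp, hs.2.2.2.2.2⟩ ?_) fun s₁ hs₁ ⟨V, hV0, hV, hVT⟩ =>
      (hB₂ L.length (V := V T) ?_ hVT).mono le_rfl fun s' _ h => ⟨_, ⟨V, hV0, hV, rfl⟩, h⟩)
      ?_ fun _ _ q => q
    · exact (hs'.var 2 (by simp [Cmd.treeCell])).trans hM.2.2.1
    · rintro t ht s' hs' - ⟨V, hV0, hV, hVt⟩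
      refine (hB₁ hnK hL (hM.congr hs' (by simp [Cmd.treeCell]) (by simp [Cmd.treeCell])
        (by simp [Cmd.treeCell]) (by simp [Cmd.treeCell]) (by simp [Cmd.treeCell])
        (by simp [Cmd.treeCell]) (by simp [Cmd.treeCell])) hVt).mono le_rfl ?_
      rintro s'' - ⟨W, hW, hW'⟩
      refine ⟨Function.update V (t + 1) W, ?_, fun t' ht' => ?_, ?_⟩
      · rw [Function.update_of_ne (by omega), hV0]
      · rw [Function.update_of_ne (by omega)]
        by_cases htt : t' = t
        · subst htt; rw [Function.update_self]; exact hW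
        · rw [Function.update_of_ne (by omega)]; exact hV t' (by omega)
      · rw [Function.update_self]; exact hW'
    · exact (hs₁.var 0 (by simp [Cmd.treeCell])).trans hM.1
    · have h1 := one_le_workload n L.length
      simp only [WExp.cost]
      generalize workload n L.length = w at *
      have h2 := Nat.mul_le_mul_left T h1
      have h3 : 0 ≤ B₂ * (T * w) := Nat.zero_le _
      nlinarith
  obtain ⟨t, s', h1, h2, W, h3, h4⟩ := hrun
  exact ⟨t, s', W, h1, h3, h4, h2⟩

/-! ### Recovery from typical observations -/

/-- Blocks inside a cluster are `0` or `R i (R j)ᵀ`, without noise in the rotation. So the own block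
of the product is `R i` times a count of neighbours. -/
theorem exists_block_observation_mul {n K d : ℕ} {G : GroupKind} (C : Fin n → Fin K)
    {R : Fin n → Matrix (Fin d) (Fin d) ℝ} (hR : ∀ i, R i ∈ Orth d) (ω : Sample G n d) :
    ∃ δ : Fin n → ℝ, (∀ i, 0 ≤ δ i) ∧
      ∀ i, block (observation C R ω * assemble C R) i (C i) = δ i • R i := by
  have h : ∀ i j, C j = C i → ∃ c : ℝ, 0 ≤ c ∧
      block (observation C R ω) i j = c • (R i * (R j).transpose) := by
    intro i j hij
    rcases lt_trichotomy i j with h | h | h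
    · refine ⟨if (ω (i, j)).1 = true then 1 else 0, by split_ifs <;> norm_num, ?_⟩
      ext a b
      simp only [block, observation, Matrix.of_apply, if_pos h, observedBlock, hij]
      split_ifs <;> simp
    · subst h
      refine ⟨1, zero_le_one, ?_⟩
      rw [orth_mul_transpose (hR i), one_smul]
      ext a b
      simp [block, observation]
    · refine ⟨if (ω (j, i)).1 = true then 1 else 0, by split_ifs <;> norm_num, ?_⟩
      have ht : (R i * (R j).transpose) = (R j * (R i).transpose).transpose := by
        rw [Matrix.transpose_mul, Matrix.transpose_transpose]
      rw [ht]
      ext a b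
      simp only [block, observation, Matrix.of_apply, if_pos h, if_neg h.asymm, observedBlock, hij]
      split_ifs <;> simp [Matrix.mul_apply, mul_comm]
  choose c hc0 hc using h
  refine ⟨fun i => ∑ j, if hj : C j = C i then c i j hj else 0, fun i =>
    Finset.sum_nonneg fun j _ => by split_ifs with hj; exacts [hc0 i j hj, le_rfl], fun i => ?_⟩
  rw [block_mul, Finset.sum_smul]
  refine Finset.sum_congr rfl fun j _ => ?_
  rw [block_assemble]
  by_cases hj : C j = C i
  · rw [if_pos hj, dif_pos hj, hc i j hj, Matrix.smul_mul, Matrix.mul_assoc,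
      orth_transpose_mul (hR j), Matrix.mul_one]
  · rw [if_neg hj, dif_neg hj, Matrix.mul_zero, zero_smul]

theorem goodObservation {n K d m : ℕ} {G : GroupKind} {C : Fin n → Fin K}
    {R : Fin n → Matrix (Fin d) (Fin d) ℝ} (hC : Balanced m C) (hR : ∀ i, R i ∈ G.carrier d)
    {ω : Sample G n d} {p q κ g : ℝ} (hp : 0 ≤ p) (hq : 0 ≤ q)
    (hω : SmallNoise C R p q κ ω)
    (hsep : Separates (observation C R ω) (assemble C R) C g) :
    GoodObservation (observation C R ω) m C R p (offMean G d q) κ g where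
  balanced := hC
  orth i := carrier_subset_orth G (hR i)
  split := by
    refine ⟨meanMatrix C R p (offMean G d q), _, (add_sub_cancel _ _).symm, fun i j => ?_, hω⟩
    ext a b
    rfl
  mean_off := by
    rcases offMean_eq (d := d) G q with h | h
    exacts [Or.inl h.1, Or.inr h.2.1]
  p_nonneg := hp
  q_nonneg := offMean_nonneg G hq
  gap_pos := hsep.1
  gap := hsep.2
  diag := exists_block_observation_mul C (fun i => carrier_subset_orth G (hR i)) ω

/-- The existence of the gap already limits the parameters: `gap_le` yields `χ ≤ 1.1 d` and `q ≤ 1.1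
p`. With these, the initial radius meets the smallness condition of `iterate`. -/
theorem GoodObservation.output_spec {n K d m : ℕ} {G : GroupKind} {C : Fin n → Fin K}
    {R : Fin n → Matrix (Fin d) (Fin d) ℝ} {A : BlockMatrix n n d} {p q κ χ : ℝ} (hK : 2 ≤ K)
    (hd : 1 ≤ d) (hn : 0 < n) (hm : 0 < m)
    (h : GoodObservation A m C R p q κ (χ * m * p)) (hR : ∀ i, R i ∈ G.carrier d)
    (hχ : 0 < χ) (hp : 0 < p) (hκ1 : 8 * d * κ ≤ χ * m * p) (hκ2 : 20 * κ ≤ m * p)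
    {V₀ W : BlockMatrix n K d} (hV₀ : V₀ ∈ feasible .orthogonal n K d m)
    {ρ : ℝ} (hρ : 2 * Real.sqrt 2 * (d / χ) < ρ)
    (he : estError .orthogonal (assemble C R) V₀ ≤ Real.sqrt m / ρ) {T : ℕ}
    (hW : IsGPMOutput G m A V₀ T W) :
    W ∈ feasible G n K d m ∧ estError G (assemble C R) W ≤ Real.sqrt d * (Real.sqrt m / 2 ^ T) := by
  have hd0 : (0 : ℝ) < d := by exact_mod_cast hd
  have hm0 : (0 : ℝ) < m := by exact_mod_cast hm
  have hmp : 0 < m * p := mul_pos hm0 hp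
  have hgap := h.gap_le hK hn
  have hq0 := h.q_nonneg
  have hmq : 0 ≤ m * q := by positivity
  have hχd : χ ≤ 11 / 10 * d := by
    have h1 : χ * (m * p) ≤ (11 / 10 * d) * (m * p) := by
      have : d * (m * (p - q) + 2 * κ) ≤ d * (11 / 10 * (m * p)) :=
        mul_le_mul_of_nonneg_left (by linarith) hd0.le
      nlinarith
    exact le_of_mul_le_mul_right h1 hmp
  have hqp : q ≤ 11 / 10 * p := by
    have h1 : 0 < d * (m * (p - q) + 2 * κ) := h.gap_pos.trans_le hgap
    have h2 : 0 < m * (p - q) + 2 * κ := (mul_pos_iff_of_pos_left hd0).1 h1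
    have h3 : m * q ≤ m * (11 / 10 * p) := by nlinarith
    exact le_of_mul_le_mul_left h3 hm0
  have hs2 : 0 < Real.sqrt 2 := by positivity
  -- The radius `√m / ρ` at the smallest admissible value `2 √2 d / χ` of `ρ`; the inequality is
  -- strict because an infimum needs to be attained only up to some slack.
  set e : ℝ := Real.sqrt m * (χ / (2 * Real.sqrt 2 * d)) with he_def
  have hρ0 : 0 < ρ := lt_trans (by positivity) hρ
  have hlt : estError .orthogonal (assemble C R) V₀ < e := by
    refine he.trans_lt ?_
    rw [he_def, div_eq_mul_inv]
    refine mul_lt_mul_of_pos_left ?_ (Real.sqrt_pos.2 hm0)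
    rw [inv_lt_comm₀ hρ0 (by positivity)]
    refine lt_of_eq_of_lt ?_ hρ
    field_simp
  have hesq : e ^ 2 = m * χ ^ 2 / (8 * d ^ 2) := by
    rw [he_def, mul_pow, div_pow, mul_pow, mul_pow, Real.sq_sqrt hm0.le,
      Real.sq_sqrt (by norm_num)]
    ring
  have hem : e ≤ Real.sqrt m := by
    rw [he_def]
    refine mul_le_of_le_one_right (Real.sqrt_nonneg _) ?_
    rw [div_le_one (by positivity)]
    have : 1 ≤ Real.sqrt 2 := Real.one_le_sqrt.2 (by norm_num)
    nlinarith
  obtain ⟨s, U, hU, hf⟩ := exists_target_of_estError_lt hlt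
  obtain ⟨V, rfl, hV, rfl⟩ := hW
  have hsmall : max p q / 2 * e ^ 2 ≤ χ * m * p / (4 * d) := by
    have h1 : max p q ≤ 11 / 10 * p := max_le (by linarith) hqp
    rw [hesq]
    calc max p q / 2 * (m * χ ^ 2 / (8 * d ^ 2)) ≤
          (11 / 10 * p) / 2 * (m * χ ^ 2 / (8 * d ^ 2)) := by gcongr
      _ = χ * m * p / (4 * d) * (11 / 40 * χ / d) := by field_simp; ring
      _ ≤ χ * m * p / (4 * d) := by
          refine mul_le_of_le_one_right (by positivity) ?_
          rw [div_le_one hd0]; linarith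
  obtain ⟨hVT, U', hU', hb⟩ := h.iterate hK hd hU hV₀ hV hf.le hsmall hκ1
  obtain ⟨h1, h2⟩ := finish_spec G hd hR (s := s) hU' hVT
  refine ⟨h1, h2.trans (mul_le_mul_of_nonneg_left (hb.trans ?_) (Real.sqrt_nonneg _))⟩
  gcongr

/-- The number of iterations gives `2 ^ T ≥ (n / τ)²`, while the initial factor is at most `√n √n =
n`; what remains is `τ · τ / n`. -/
theorem error_le_of_iterations {n m d T : ℕ} {τ : ℝ} (hmn : m ≤ n) (hdn : d ≤ n) (hn : 1 ≤ n)
    (hτ : 0 < τ) (hτn : τ ≤ Real.sqrt n) (hT : 2 / Real.log 2 * Real.log (n / τ) ≤ T) :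
    Real.sqrt d * (Real.sqrt m / 2 ^ T) ≤ τ := by
  have hn0 : (1 : ℝ) ≤ n := by exact_mod_cast hn
  have hl2 : 0 < Real.log 2 := Real.log_pos (by norm_num)
  have h2T : (n / τ) ^ 2 ≤ (2 : ℝ) ^ T := by
    have h1 : Real.log ((n / τ) ^ 2) ≤ Real.log ((2 : ℝ) ^ T) := by
      rw [Real.log_pow, Real.log_pow]
      rw [div_mul_eq_mul_div, div_le_iff₀ hl2] at hT
      exact_mod_cast hT
    exact (Real.log_le_log_iff (by positivity) (by positivity)).1 h1
  have hsd : Real.sqrt d ≤ Real.sqrt n := Real.sqrt_le_sqrt (by exact_mod_cast hdn)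
  have hsm : Real.sqrt m ≤ Real.sqrt n := Real.sqrt_le_sqrt (by exact_mod_cast hmn)
  have hss : Real.sqrt n * Real.sqrt n = n := Real.mul_self_sqrt (by linarith)
  have hs1 : Real.sqrt n ≤ n := by
    have : 1 ≤ Real.sqrt n := Real.one_le_sqrt.2 hn0
    nlinarith
  calc Real.sqrt d * (Real.sqrt m / 2 ^ T) ≤ Real.sqrt n * (Real.sqrt n / (n / τ) ^ 2) := by
        gcongr
    _ = τ * (τ / n) := by
        rw [mul_div_assoc', hss]; field_simp
    _ ≤ τ := by
        refine mul_le_of_le_one_right hτ.le ?_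
        rw [div_le_one (by linarith)]; linarith

/-- `x ≥ 1/2` absorbs the rounding of `T` and the extra round, by `c x + 2 ≤ (c + 4) x`. Similarly
`log n ≥ 1` absorbs the terms without logarithm into `4 hi + 11`. -/
theorem steps_le {n len T t B : ℕ} {hi c x : ℝ} (hn : 1 ≤ n)
    (hl1 : 1 ≤ Real.log n) (hc : 0 ≤ c) (hx : 1 / 2 ≤ x)
    (hlen : (len : ℝ) ≤ n + 2 * ((2 * hi + 2) * (n * Real.log n) + 1)) (hT : T = ⌈c * x⌉₊)
    (ht : t ≤ B * ((T + 1) * (n * (Nat.log 2 n + 1) + len + 1))) :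
    (t : ℝ) ≤ (B + 1) * ((c + 4) * (4 * hi + 11)) * (n * Real.log n * x) := by
  have hn0 : (1 : ℝ) ≤ n := by exact_mod_cast hn
  have hx0 : 0 ≤ c * x := mul_nonneg hc (by linarith)
  have hT1 : (T : ℝ) + 1 ≤ (c + 4) * x := by
    have h5 : (T : ℝ) < c * x + 1 := by
      rw [hT]; exact Nat.ceil_lt_add_one hx0
    linarith
  have hlog2 : (Nat.log 2 n : ℝ) ≤ 2 * Real.log n := by
    have h5 : (2 : ℝ) ^ Nat.log 2 n ≤ n := by
      exact_mod_cast Nat.pow_log_le_self 2 (by omega)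
    have h6 := Real.log_le_log (by positivity) h5
    rw [Real.log_pow] at h6
    have h7 := Real.log_two_gt_d9
    have h8 : (0 : ℝ) ≤ Nat.log 2 n := Nat.cast_nonneg _
    nlinarith
  have hsize : (n : ℝ) * (Nat.log 2 n + 1) + len + 1 ≤ (4 * hi + 11) * (n * Real.log n) := by
    have h5 : (n : ℝ) ≤ n * Real.log n := by nlinarith
    have h6 : (n : ℝ) * Nat.log 2 n ≤ n * (2 * Real.log n) := by gcongr
    nlinarith
  have h4' : (t : ℝ) ≤ B * ((T + 1) * (n * (Nat.log 2 n + 1) + len + 1)) := by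
    exact_mod_cast ht
  have hτ0 : 0 ≤ x := by linarith
  calc (t : ℝ) ≤ B * ((T + 1) * (n * (Nat.log 2 n + 1) + len + 1)) := h4'
    _ ≤ (B + 1) * (((c + 4) * x) * ((4 * hi + 11) * (n * Real.log n))) := by
        gcongr
        linarith
    _ = _ := by ring

end SGBM

end

/-! ### Choice of the constants and conclusion -/

open SGBM in
theorem theorem1 (K d : ℕ) (hK : 2 ≤ K) (hd : 1 ≤ d) (G : GroupKind) :
    ∃ c : Cmd, ImplementsGPM G K d c ∧
      ∀ lo hi : ℝ, 0 < lo → lo ≤ hi →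
      ∃ (γ C₁ C₂ : ℝ) (N : ℕ), 0 < γ ∧ 0 < C₁ ∧ 0 < C₂ ∧
      ∀ n m : ℕ, n = K * m → N ≤ n →
      ∀ α ∈ Set.Icc lo hi, ∀ β ∈ Set.Icc lo hi, ∀ χ ∈ Set.Icc lo hi,
      ∀ p q : ℝ, p = α * Real.log n / n → q = β * Real.log n / n →
      ∀ (Cstar : Fin n → Fin K) (Rstar : Fin n → Matrix (Fin d) (Fin d) ℝ),
        Balanced m Cstar → (∀ i, Rstar i ∈ G.carrier d) →
      ∀ Vstar : BlockMatrix n K d, Vstar = assemble Cstar Rstar →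
        sampleLaw G d Cstar p q {ω | ¬
          ∀ A : BlockMatrix n n d, A = observation Cstar Rstar ω →
            Separates A Vstar Cstar (χ * m * p) →
            (∀ i, Real.sqrt (2 * K * β) / α * m * p ≤
              blockNuclear (A * Vstar) i (Cstar i)) →
            ∀ V0 ∈ feasible .orthogonal n K d m,
            (∃ ρ : ℝ,
              2 * Real.sqrt 2 * Real.sqrt (d ^ 2 / χ ^ 2 + α ^ 2 / (2 * K * β)) < ρ ∧
              estError .orthogonal Vstar V0 ≤ Real.sqrt m / ρ) →
            ∀ τ : ℝ, 0 < τ → τ ≤ Real.sqrt n →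
            ∀ T : ℕ, T = ⌈C₁ * Real.log (n / τ)⌉₊ →
              (∀ W, IsGPMOutput G m A V0 T W →
                W ∈ feasible G n K d m ∧ estError G Vstar W ≤ τ) ∧
              (∀ (L : List (Fin n × Fin n)) (s : Memory), IsSupport A L →
                IsInput s m T A L V0 →
                ∃ (t : ℕ) (s' : Memory) (W : BlockMatrix n K d),
                  Exec c s t s' ∧ IsGPMOutput G m A V0 T W ∧ Holds s' W ∧
                  (t : ℝ) ≤ C₂ * (n * Real.log n * Real.log (n / τ)))}
          ≤ ENNReal.ofReal ((n : ℝ) ^ (-γ)) := by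
  obtain ⟨c, B, hc⟩ := exists_program K d G
  refine ⟨c, ?_, fun lo hi hlo hlohi => ?_⟩
  · intro n m hn _ A L hL V0 _ T s hs
    obtain ⟨t, s', W, h1, h2, h3, -⟩ := hc n m hn A L hL V0 T s hs
    exact ⟨t, s', W, h1, h2, h3⟩
  have hhi : 0 < hi := hlo.trans_le hlohi
  have hd0 : (0 : ℝ) < d := by exact_mod_cast hd
  have hK0 : (0 : ℝ) < K := by exact_mod_cast (show 0 < K by omega)
  have hl2 : 0 < Real.log 2 := Real.log_pos (by norm_num)
  -- Both noise conditions compare `η log n` with `m p = α log n / K`; the worst case is `α = χ =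
  -- lo`.
  set η : ℝ := min (lo ^ 2 / (8 * d * K)) (lo / (20 * K)) with hη
  have hη0 : 0 < η := lt_min (by positivity) (by positivity)
  obtain ⟨N, hN4, hN⟩ := exists_typical d G hhi hη0
  -- `N ≥ d` lets `√d` be absorbed into `√n`, so that `C₁` can be `2 / log 2`.
  refine ⟨1 / 2, 2 / Real.log 2, (B + 1) * ((2 / Real.log 2 + 4) * (4 * hi + 11)), max N d,
    by norm_num, by positivity, by positivity, ?_⟩
  intro n m hn hNn α hα β hβ χ hχ p q hp hq C R hC hR Vstar hV
  subst hV
  have hn4 : 4 ≤ n := hN4.trans ((le_max_left _ _).trans hNn)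
  have hdn : d ≤ n := (le_max_right _ _).trans hNn
  have hm : 0 < m := by
    rcases Nat.eq_zero_or_pos m with rfl | h
    · omega
    · exact h
  have hmn : m ≤ n := by rw [hn]; exact Nat.le_mul_of_pos_left m (by omega)
  have hn0 : (4 : ℝ) ≤ n := by exact_mod_cast hn4
  have hm0 : (0 : ℝ) < m := by exact_mod_cast hm
  have hnK : (n : ℝ) = K * m := by exact_mod_cast hn
  set l := Real.log n with hl
  have hl1 : 1 ≤ l := by
    have h1 : Real.log 4 ≤ l := Real.log_le_log (by norm_num) hn0
    have h2 : Real.log 4 = 2 * Real.log 2 := by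
      rw [show (4 : ℝ) = 2 ^ 2 by norm_num, Real.log_pow]; norm_num
    have h3 := Real.log_two_gt_d9
    linarith
  have hα0 : 0 < α := hlo.trans_le hα.1
  have hχ0 : 0 < χ := hlo.trans_le hχ.1
  have hp0 : 0 < p := by rw [hp]; positivity
  have hq0 : 0 ≤ q := by
    have : 0 < β := hlo.trans_le hβ.1
    rw [hq]; positivity
  obtain ⟨-, hprob⟩ := hN n ((le_max_left _ _).trans hNn)
  have hmeas := hprob K C R hR p q hp0.le hq0
    (by rw [hp]; gcongr; exact hα.2) (by rw [hq]; gcongr; exact hβ.2)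
  refine (MeasureTheory.measure_mono ?_).trans hmeas
  intro ω hω hgood
  refine hω ?_
  obtain ⟨hsmall, hedge⟩ := hgood
  intro A hA hsep _ V0 hV0 hρ τ hτ hτn T hT
  subst hA
  obtain ⟨ρ, hρ1, hρ2⟩ := hρ
  have hmp : m * p = α * l / K := by
    rw [hp, hnK]; field_simp
  have hobs := goodObservation hC hR hp0.le hq0 hsmall hsep
  have hκ1 : 8 * d * (η * l) ≤ χ * m * p := by
    have h1 : η ≤ lo ^ 2 / (8 * d * K) := min_le_left _ _
    rw [le_div_iff₀ (by positivity)] at h1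
    rw [mul_assoc χ, hmp, mul_div_assoc', le_div_iff₀ hK0]
    have h2 : lo ^ 2 ≤ χ * α := by
      rw [sq]; exact mul_le_mul hχ.1 hα.1 hlo.le hχ0.le
    nlinarith
  have hκ2 : 20 * (η * l) ≤ m * p := by
    have h1 : η ≤ lo / (20 * K) := min_le_right _ _
    rw [le_div_iff₀ (by positivity)] at h1
    rw [hmp, le_div_iff₀ hK0]
    have h2 := hα.1
    nlinarith
  -- The square root dominates the root of its first summand.
  have hρ' : 2 * Real.sqrt 2 * (d / χ) < ρ := by
    refine lt_of_le_of_lt (mul_le_mul_of_nonneg_left ?_ (by positivity)) hρ1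
    have hβ0 : 0 < β := hlo.trans_le hβ.1
    refine Real.le_sqrt_of_sq_le ?_
    rw [div_pow]
    have : 0 ≤ α ^ 2 / (2 * K * β) := by positivity
    linarith
  have hTl : 2 / Real.log 2 * Real.log (n / τ) ≤ T := hT ▸ Nat.le_ceil _
  -- `τ ≤ √n` gives `n / τ ≥ √n`.
  have hlτ : 1 / 2 ≤ Real.log (n / τ) := by
    have h1 : Real.log (Real.sqrt n) ≤ Real.log (n / τ) := by
      refine Real.log_le_log (by positivity) ?_
      rw [le_div_iff₀ hτ]
      have : Real.sqrt n * Real.sqrt n = n := Real.mul_self_sqrt (by linarith)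
      nlinarith [Real.sqrt_nonneg (n : ℝ)]
    rw [Real.log_sqrt (by linarith)] at h1
    linarith
  refine ⟨fun W hW => ?_, fun L s hL hs => ?_⟩
  · obtain ⟨h1, h2⟩ := hobs.output_spec hK hd (by omega) hm hR hχ0 hp0 hκ1 hκ2 hV0 hρ' hρ2 hW
    exact ⟨h1, h2.trans (error_le_of_iterations hmn hdn (by omega) hτ hτn hTl)⟩
  · obtain ⟨t, s', W, h1, h2, h3, h4⟩ := hc n m hn _ L hL V0 T s hs
    refine ⟨t, s', W, h1, h2, h3, ?_⟩
    have hlen : (L.length : ℝ) ≤ n + 2 * ((2 * hi + 2) * (n * l) + 1) := by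
      have h5 : (L.length : ℝ) ≤ n + 2 * edgeCount ω := by
        exact_mod_cast support_length_le hL
      linarith
    exact steps_le (by omega) hl1 (by positivity) hlτ hlen hT h4
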